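/- Let $d\ge 1$ and let $V$ be a real, even tempered distribution on $\mathbb{R}^d$ whose Fourier transform $\widehat V(\xi)=\int V(y)e^{-i\xi\cdot y}\,dy$ is smooth and bounded together with all its derivatives. For $\varepsilon\in(0,1]$ put $\widehat{V_\varepsilon}(\xi)=\widehat V(\varepsilon\xi)$, $\mathrm V_\rho=V_\varepsilon *_x\rho$ and $$a_\rho(t,x,\xi_v)=\mathrm V_\rho\big(t,x-\tfrac{\xi_v}{2}\big)-\mathrm V_\rho\big(t,x+\tfrac{\xi_v}{2}\big).$$ With $V_\pm=\varepsilon\nabla_x\pm 2iv$ and $X_\pm=\varepsilon\nabla_v\pm 2ix$, define for functions on $\mathbb{R}^{2d}$ and on $\mathbb{R}^d$ respectively $$\|f\|_{\mathcal H^m_r}=\sum_{|\alpha|\le m}\ \sum_{|\beta|+|\beta'|\le r,\ |\gamma|+|\gamma'|\le r}\|V_+^{\beta}X_-^{\beta'}V_-^{\gamma}X_+^{\gamma'}\partial^\alpha_{x,v}f\|_{L^2},\qquad \|\rho\|_{H^m_r}=\sum_{|\alpha|\le m,\ |\beta|\le r}\|(\varepsilon\partial_x)^\beta\partial_x^\alpha\rho\|_{L^2}.$$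 Let $m,r,p$ be integers with $r>d/2$, $p\ge 2$ and $m\ge\lfloor d/2\rfloor+p+2$. Then there are a function $M\mapsto T(M)>0$ on $(0,\infty)$ and a continuous function $\Lambda(T,M)$, nondecreasing in each argument, depending only on $d,V,m,r,p$ (in particular not on $\varepsilon$), such that the following holds. Let $M>0$, $\varepsilon\in(0,1]$, $T_\varepsilon>0$, and let $f\in\mathscr C([0,T_\varepsilon];\mathcal H^m_r)$ be a real-valued solution of the Wigner equation $$\partial_t f+v\cdot\nabla_x f+B[\rho_f,f]=0,\qquad B[\rho,f]=\tfrac{i}{\varepsilon}\,a_\rho(t,x,\varepsilon D_v)f,\qquad \rho_f(t,x)=\int f(t,x,v)\,dv,$$ such that $\|f\|_{L^\infty(0,T_\varepsilon;\mathcal H^{m-1}_r)}+\|\rho_f\|_{L^2(0,T_\varepsilon;H^m_r)}\le M$. Write $\rho=\rho_f$ and $T_0=\min(T(M),T_\varepsilon)$; below $z=(x,v)$ and $\xi=(\xi_x,\xi_v)$ range over $\mathbb{R}^{2d}$. 1. For every $s\in[0,T_0]$ there is a unique $\mathscr C^2$ solution $(t,z,\xi)\mapsto\varphi_{t,s}(z,\xi)$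 on $[0,T_0]\times\mathbb{R}^{2d}\times\mathbb{R}^{2d}$ of the eikonal equation $$\partial_t\varphi_{t,s}+v\cdot\nabla_x\varphi_{t,s}+a_\rho(t,x,\nabla_v\varphi_{t,s})=0,\qquad \varphi_{s,s}(z,\xi)=z\cdot\xi.$$ Moreover $\varphi$ is of class $\mathscr C^2$ jointly in $(t,s,z,\xi)\in[0,T_0]^2\times\mathbb{R}^{2d}\times\mathbb{R}^{2d}$, and $\varphi_{t,s}$ is of class $\mathscr C^p$ in $(z,\xi)$ for all $t,s\in[0,T_0]$. 2. Let $\widetilde\varphi_{t,s}(z,\xi)=\varphi_{t,s}(z,\xi)-(x-(t-s)v)\cdot\xi_x-v\cdot\xi_v$. For all $t,s\in[0,T_0]$ and all $z,\xi$, $$\sup_{|\alpha|+|\beta|\le p}|\partial_z^\alpha\partial_\xi^\beta\widetilde\varphi_{t,s}(z,\xi)|\le 1,\qquad \sup_{|\alpha|\le p}|\partial_z^\alpha\widetilde\varphi_{t,s}(z,\xi)|\le|\xi_v|+\tfrac12|t-s||\xi_x|,$$ and $\|\partial_z\partial_\xi\varphi_{t,s}(z,\xi)-\mathrm I\|\le\tfrac12$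 in the Euclidean operator norm. 3. For every $T\le T_0$, all $t,s\in[0,T]$ and all $z,\xi$, $$\sup_{|\alpha|+|\beta|\le p}|\partial_z^\alpha\partial_\xi^\beta\widetilde\varphi_{t,s}(z,\xi)|\le T^{1/2}\Lambda(T,M),\qquad \sup_{|\alpha|\le p}|\partial_z^\alpha\widetilde\varphi_{t,s}(z,\xi)|\le T^{1/2}\Lambda(T,M)\,\big(|\xi_v|+|t-s||\xi_x|\big).$$ -/

import Mathlib

open MeasureTheory Set Filter Topology SchwartzMap FourierTransform
open scoped ENNReal

noncomputable section

/-- Physical space `ℝ^d`. -/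
abbrev Space (d : ℕ) : Type := EuclideanSpace ℝ (Fin d)

/-- Phase space `ℝ^{2d}`, with points `z = (x, v)` or, for the dual variable, `ξ = (ξ_x, ξ_v)`. -/
abbrev Phase (d : ℕ) : Type := Space d × Space d

instance {d : ℕ} : (volume : Measure (Phase d)).IsAddHaarMeasure :=
  Measure.prod.instIsAddHaarMeasure _ _

/-- The Euclidean scalar product `z · ξ = x · ξ_x + v · ξ_v` on `ℝ^{2d}`. -/
def phaseDot {d : ℕ} (z ξ : Phase d) : ℝ := inner ℝ z.1 ξ.1 + inner ℝ z.2 ξ.2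

/-- The Euclidean norm on `ℝ^{2d}`. -/
def phaseNorm {d : ℕ} (z : Phase d) : ℝ := Real.sqrt (phaseDot z z)

/-- The canonical basis of `ℝ^{2d}`: first the directions of `x`, then those of `v`. -/
def phaseBasis {d : ℕ} : Fin d ⊕ Fin d → Phase d :=
  Sum.elim (fun j => (EuclideanSpace.single j 1, 0)) (fun j => (0, EuclideanSpace.single j 1))

/-- The canonical basis of `ℝ^{2d}_z × ℝ^{2d}_ξ`. -/
def fullBasis {d : ℕ} : (Fin d ⊕ Fin d) ⊕ (Fin d ⊕ Fin d) → Phase d × Phase d :=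
  Sum.elim (fun i => (phaseBasis i, 0)) (fun i => (0, phaseBasis i))

/-! ### Weighted Sobolev norms -/

/-- Multi-indices of length at most `n`. -/
def multiIndices (ι : Type) [Fintype ι] [DecidableEq ι] (n : ℕ) : Finset (ι → ℕ) :=
  (Fintype.piFinset fun _ : ι => Finset.range (n + 1)).filter fun α => ∑ i, α i ≤ n

/-- The `L²` norm of a tempered distribution; it is `∞` unless the distribution is an `L²`
function. -/
def distL2Norm {E : Type*} [NormedAddCommGroup E] [NormedSpace ℝ E] [FiniteDimensional ℝ E]
    [MeasureSpace E] [BorelSpace E] [(volume : Measure E).HasTemperateGrowth]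
    (u : 𝓢'(E, ℂ)) : ℝ≥0∞ :=
  ⨅ (g : Lp ℂ 2 (volume : Measure E)) (_ : (g : 𝓢'(E, ℂ)) = u), ‖g‖ₑ

/-- The product `A_1^{β_1} ⋯ A_d^{β_d}` of operators. -/
def opPow {A : Type*} [Monoid A] {d : ℕ} (D : Fin d → A) (β : Fin d → ℕ) : A :=
  (List.ofFn fun j => D j ^ β j).prod

/-- `∂_{x_j}` on distributions on `ℝ^d`. -/
def dSpace {d : ℕ} (j : Fin d) : 𝓢'(Space d, ℂ) →L[ℂ] 𝓢'(Space d, ℂ) :=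
  LineDeriv.lineDerivOpCLM ℂ 𝓢'(Space d, ℂ) (EuclideanSpace.single j 1 : Space d)

/-- `∂_{x_j}` on distributions on `ℝ^{2d}`. -/
def dX {d : ℕ} (j : Fin d) : 𝓢'(Phase d, ℂ) →L[ℂ] 𝓢'(Phase d, ℂ) :=
  LineDeriv.lineDerivOpCLM ℂ 𝓢'(Phase d, ℂ) ((EuclideanSpace.single j 1, 0) : Phase d)

/-- `∂_{v_j}` on distributions on `ℝ^{2d}`. -/
def dV {d : ℕ} (j : Fin d) : 𝓢'(Phase d, ℂ) →L[ℂ] 𝓢'(Phase d, ℂ) :=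
  LineDeriv.lineDerivOpCLM ℂ 𝓢'(Phase d, ℂ) ((0, EuclideanSpace.single j 1) : Phase d)

/-- `ε ∂_{x_j} + 2 i σ v_j`; this is the `j`-th component of `V_±` for `σ = ±1`. -/
def vecV {d : ℕ} (ε σ : ℝ) (j : Fin d) : 𝓢'(Phase d, ℂ) →L[ℂ] 𝓢'(Phase d, ℂ) :=
  (ε : ℂ) • dX j +
    (2 * Complex.I * σ) • TemperedDistribution.smulLeftCLM ℂ (fun z : Phase d => ((z.2 j : ℝ) : ℂ))

/-- `ε ∂_{v_j} + 2 i σ x_j`; this is the `j`-th component of `X_±` for `σ = ±1`. -/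
def vecX {d : ℕ} (ε σ : ℝ) (j : Fin d) : 𝓢'(Phase d, ℂ) →L[ℂ] 𝓢'(Phase d, ℂ) :=
  (ε : ℂ) • dV j +
    (2 * Complex.I * σ) • TemperedDistribution.smulLeftCLM ℂ (fun z : Phase d => ((z.1 j : ℝ) : ℂ))

/-- The norm of `𝓗^m_r` on `ℝ^{2d}`: the sum over `|α| ≤ m`, `|β| + |β'| ≤ r`, `|γ| + |γ'| ≤ r` of
`‖V_+^β X_-^{β'} V_-^γ X_+^{γ'} ∂^α_{x,v} g‖_{L²}`. -/
def phaseSobolevNorm {d : ℕ} (ε : ℝ) (m r : ℕ) (g : Lp ℂ 2 (volume : Measure (Phase d))) :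
    ℝ≥0∞ :=
  ∑ α ∈ multiIndices (Fin d ⊕ Fin d) m,
    ∑ β ∈ multiIndices (Fin d ⊕ Fin d) r, ∑ γ ∈ multiIndices (Fin d ⊕ Fin d) r,
      distL2Norm
        ((opPow (vecV ε 1) (fun j => β (Sum.inl j)) * opPow (vecX ε (-1)) (fun j => β (Sum.inr j)) *
          opPow (vecV ε (-1)) (fun j => γ (Sum.inl j)) * opPow (vecX ε 1) (fun j => γ (Sum.inr j)) *
          opPow dX (fun j => α (Sum.inl j)) * opPow dV (fun j => α (Sum.inr j)))
          (g : 𝓢'(Phase d, ℂ)))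

/-- The norm of `H^m_r` on `ℝ^d`: the sum over `|α| ≤ m`, `|β| ≤ r` of
`‖(ε∂_x)^β ∂_x^α ρ‖_{L²}`. -/
def spaceSobolevNorm {d : ℕ} (ε : ℝ) (m r : ℕ) (ρ : Lp ℂ 2 (volume : Measure (Space d))) :
    ℝ≥0∞ :=
  ∑ α ∈ multiIndices (Fin d) m, ∑ β ∈ multiIndices (Fin d) r,
    distL2Norm
      ((opPow (fun j => (ε : ℂ) • dSpace j) β * opPow dSpace α) (ρ : 𝓢'(Space d, ℂ)))

/-! ### The Wigner equation -/

/-- A real, even tempered distribution `V` on `ℝ^d` whose Fourier transform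
`V̂(ξ) = ∫ V(y) e^{-i ξ·y} dy` is smooth and bounded with all its derivatives. It is recorded
through `V̂`, which is real and even. -/
structure PairPotential (d : ℕ) where
  hat : Space d → ℝ
  even : ∀ ξ, hat (-ξ) = hat ξ
  smooth : ContDiff ℝ (⊤ : ℕ∞) hat
  bounded : ∀ k : ℕ, ∃ C : ℝ, ∀ ξ, ‖iteratedFDeriv ℝ k hat ξ‖ ≤ C

/-- The density `ρ_g(x) = ∫ g(x, v) dv`, as an element of `L²` (and `0` if it is not in `L²`). -/
def density {d : ℕ} (g : Lp ℂ 2 (volume : Measure (Phase d))) :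
    Lp ℂ 2 (volume : Measure (Space d)) :=
  open Classical in
  if h : MemLp (fun x : Space d => ∫ v : Space d, g (x, v)) 2 volume then h.toLp else 0

/-- The continuous representative of `V_ρ = V_ε * ρ`, where `V̂_ε(ξ) = V̂(ε ξ)`. With Mathlib's
normalization `∫ e^{-2πi ζ·y}` of the Fourier transform the multiplier is `V̂(2π ε ζ)`. -/
def potential {d : ℕ} (V : PairPotential d) (ε : ℝ) (ρ : Lp ℂ 2 (volume : Measure (Space d)))
    (x : Space d) : ℝ :=
  (𝓕⁻ (fun ζ : Space d =>
    ((V.hat ((2 * Real.pi * ε) • ζ) : ℝ) : ℂ) *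
      ((𝓕 ρ : Lp ℂ 2 (volume : Measure (Space d))) : Space d → ℂ) ζ) x).re

/-- The symbol `a(x, η) = U(x - η/2) - U(x + η/2)` associated with a potential `U`. -/
def symbolOf {d : ℕ} (U : Space d → ℝ) (x η : Space d) : ℝ :=
  U (x - (1 / 2 : ℝ) • η) - U (x + (1 / 2 : ℝ) • η)

/-- `B[ρ, g] = (i/ε) a_ρ(x, ε D_v) g`, where `U = V_ρ`. The variable dual to `v` is `ξ_v = 2π ζ`. -/
def wignerB {d : ℕ} (ε : ℝ) (U : Space d → ℝ) (g : Phase d → ℂ) (z : Phase d) : ℂ :=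
  (Complex.I / ε) *
    𝓕⁻ (fun ζ : Space d =>
      ((symbolOf U z.1 ((2 * Real.pi * ε) • ζ) : ℝ) : ℂ) *
        𝓕 (fun w : Space d => g (z.1, w)) ζ) z.2

/-- `f` is a real-valued solution in `C([0,T]; 𝓗^m_r)` of the Wigner equation
`∂_t f + v · ∇_x f + B[ρ_f, f] = 0`, in the sense of distributions. -/
structure IsWignerSolution {d : ℕ} (V : PairPotential d) (ε : ℝ) (m r : ℕ) (T : ℝ)
    (f : ℝ → Lp ℂ 2 (volume : Measure (Phase d))) : Prop where
  real : ∀ t ∈ Icc 0 T, ∀ᵐ z, (f t z).im = 0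
  finite : ∀ t ∈ Icc 0 T, phaseSobolevNorm ε m r (f t) < ∞
  continuous : ∀ t ∈ Icc 0 T,
    Tendsto (fun τ => phaseSobolevNorm ε m r (f τ - f t)) (𝓝[Icc 0 T] t) (𝓝 0)
  equation : ∀ χ : 𝓢(Phase d, ℂ), ∀ t ∈ Icc 0 T,
    HasDerivWithinAt (fun τ => ∫ z, f τ z * χ z)
      ((∫ z : Phase d, f t z * fderiv ℝ (χ : Phase d → ℂ) z (z.2, 0)) -
        ∫ z : Phase d, wignerB ε (potential V ε (density (f t))) (f t) z * χ z)
      (Icc 0 T) t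

/-- `𝓝_{m,r}(T, f) = ‖f‖_{L^∞(0,T; 𝓗^{m-1}_r)} + ‖ρ_f‖_{L²(0,T; H^m_r)}`. -/
def bootstrapNorm {d : ℕ} (ε : ℝ) (m r : ℕ) (T : ℝ)
    (f : ℝ → Lp ℂ 2 (volume : Measure (Phase d))) : ℝ≥0∞ :=
  essSup (fun t => phaseSobolevNorm ε (m - 1) r (f t)) (volume.restrict (Icc 0 T)) +
    (∫⁻ t in Icc 0 T, spaceSobolevNorm ε m r (density (f t)) ^ 2) ^ (1 / 2 : ℝ)

/-! ### The eikonal equation -/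

/-- `ψ = ψ(t, z, ξ)` is a solution of class `C²` on `[0,T] × ℝ^{2d} × ℝ^{2d}` of the eikonal equation
`∂_t ψ + v · ∇_x ψ + a(t, x, ∇_v ψ) = 0`, `ψ(s, z, ξ) = z · ξ`, with
`a(t, x, η) = U(t, x - η/2) - U(t, x + η/2)`. -/
structure IsEikonalSolution {d : ℕ} (U : ℝ → Space d → ℝ) (T s : ℝ)
    (ψ : ℝ → Phase d → Phase d → ℝ) : Prop where
  contDiffOn : ContDiffOn ℝ 2 (fun q : ℝ × Phase d × Phase d => ψ q.1 q.2.1 q.2.2)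
    (Icc 0 T ×ˢ univ)
  equation : ∀ t ∈ Icc 0 T, ∀ z ξ : Phase d,
    HasDerivWithinAt (fun τ => ψ τ z ξ)
      (-(inner ℝ z.2 (gradient (fun x => ψ t (x, z.2) ξ) z.1) +
        symbolOf (U t) z.1 (gradient (fun v => ψ t (z.1, v) ξ) z.2)))
      (Icc 0 T) t
  initial : ∀ z ξ : Phase d, ψ s z ξ = phaseDot z ξ

/-- The free phase `(x - (t-s) v) · ξ_x + v · ξ_v`. -/
def freePhase {d : ℕ} (t s : ℝ) (z ξ : Phase d) : ℝ :=
  inner ℝ (z.1 - (t - s) • z.2) ξ.1 + inner ℝ z.2 ξ.2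

end

/-! The phase comes from the method of characteristics, set up as a boundary value problem: position
and velocity are prescribed at time t, their dual variables at time s. The bicharacteristic system
is x' = v, v' = a_l, ξ' = -a_x, l' = -ξ. Integrated twice, it says that the pair of paths X = (x, l)
equals an explicit free motion, linear in the data, plus G(X), where G (`systemMap`) is a double
primitive of forces. Let S(t) bound the derivatives of order at most p + 1 of the potential at time
t. All derivatives of G of order at most p are bounded by 2^(p+2) ∫ S. When this is small, G is a
contraction, X ↦ X - G(X) is a C^p diffeomorphism of the path space, and X is C^p in (z, ξ) with
bounds uniform in z and ξ (`norm_iteratedFDeriv_fixedPoint_le`). No flow has to be inverted.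

The phase is the action φ = x(s)·ξ_x + v(s)·ξ_v + ∫_s^t (l·a_l - a). Its first variation
(`hasFDerivAt_eikonalPhase`) shows that its gradient consists of ξ(t), l(t), x(s), v(s). Moving one
of the two times along a fixed trajectory gives a Hamilton-Jacobi equation in t, which is the
eikonal equation, and a second one in s. Differentiating these in space gives the time derivatives
of the gradient, so φ is jointly C² once the potential is C¹ in (t, x). Uniqueness is a maximum
principle on a cone: in coordinates moving with free transport, the time derivative of the
difference of two solutions is controlled by its gradient (`nonpos_of_transport`).

For the estimates, the gradient of φ minus the free phase is made of single and double primitives of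
forces; those paired with v and ξ_x are double and gain a factor |t - s|. Hence every derivative of
order between 1 and p + 1 along basis vectors is at most F |∫_s^t S| with F = `forceConst p`. The
difference vanishes at ξ = 0, so integrating its ξ-derivative along a ray gives the bounds weighted
by |ξ_v| + |t - s||ξ_x|. The order 0 bound uses a rewriting of the action in which all terms growing
with ξ cancel (`phaseDefect_eq`).

It remains to study the potential. Since m - (p + 1) > d/2, the integral of (1 + |ζ|)^(p+1) |ρ̂| is
controlled by the H^m norm of ρ, and the multiplier V̂(ε·) is bounded. So S ≤ K ‖ρ‖ in H^m_r with K
independent of ε, and Cauchy-Schwarz in time gives ∫_0^T S ≤ K M √T. This produces T(M), the factor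
√T and Λ.

The C¹ regularity of the potential in time comes from the continuity equation ∂_t ρ + div J = 0
(`weak_continuity_equation`). The Wigner equation is tested against K(x) χ_n(v), where the Fourier
transform of χ_n concentrates at the origin; the symbol a vanishes at ξ_v = 0, so the term B
disappears in the limit. The momentum J keeps m - 1 derivatives in x, because multiplication by v_k
is a combination of V_+ or V_- with ε∂_x (`exists_momentNorm_le`). -/

open scoped BoundedContinuousFunction ContDiff

set_option linter.unusedSectionVars false

open scoped ENNReal BoundedContinuousFunction

/-! ### Superposition operators on spaces of continuous paths -/

noncomputable section Nemytskii

variable {I E F : Type} [TopologicalSpace I] [CompactSpace I]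
  [NormedAddCommGroup E] [NormedSpace ℝ E] [NormedAddCommGroup F] [NormedSpace ℝ F]

/-- The superposition operator `u ↦ (σ ↦ Γ (σ, u σ))` on continuous paths. -/
def nemytskii (Γ : C(I × E, F)) (u : I →ᵇ E) : I →ᵇ F :=
  BoundedContinuousFunction.mkOfCompact (Γ.comp ((ContinuousMap.id I).prodMk u.toContinuousMap))

@[simp] theorem nemytskii_apply (Γ : C(I × E, F)) (u : I →ᵇ E) (σ : I) :
    nemytskii Γ u σ = Γ (σ, u σ) := rfl

/-- On a compact interval of times the sup norm induces the compact-open topology, for which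
postcomposition is continuous. No uniform continuity of `Γ` in the noncompact variable is needed. -/
theorem continuous_nemytskii (Γ : C(I × E, F)) : Continuous (nemytskii Γ) := by
  refine (ContinuousMap.isometryEquivBoundedOfCompact I F).continuous.comp ?_
  refine (ContinuousMap.continuous_postcomp Γ).comp ?_
  refine (ContinuousMap.continuous_of_continuous_uncurry
    (fun u : C(I, E) => (ContinuousMap.id I).prodMk u) ?_).comp
      (ContinuousMap.isometryEquivBoundedOfCompact I E).symm.continuous
  exact continuous_snd.prodMk continuous_eval

/-- Pointwise application of a path of operators to a path. -/
def pathApply : (I →ᵇ (E →L[ℝ] F)) →L[ℝ] (I →ᵇ E) →L[ℝ] (I →ᵇ F) :=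
  LinearMap.mkContinuous₂
    (LinearMap.mk₂ ℝ (fun (A : (I →ᵇ (E →L[ℝ] F))) (h : I →ᵇ E) =>
        BoundedContinuousFunction.mkOfCompact ⟨fun σ => A σ (h σ), by fun_prop⟩)
      (fun _ _ _ => by ext; simp) (fun _ _ _ => by ext; simp)
      (fun _ _ _ => by ext; simp) (fun _ _ _ => by ext; simp)) 1
    (fun A h => by
      rw [BoundedContinuousFunction.norm_le (by positivity)]
      intro σ
      refine ((A σ).le_opNorm (h σ)).trans ?_
      rw [one_mul]
      gcongr
      · exact A.norm_coe_le_norm σ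
      · exact h.norm_coe_le_norm σ)

@[simp] theorem pathApply_apply (A : (I →ᵇ (E →L[ℝ] F))) (h : I →ᵇ E) (σ : I) :
    pathApply A h σ = A σ (h σ) := rfl

/-- The mean value inequality on the segment from `u σ` to `v σ` reduces the claim to the
oscillation of `Γ'` there, which is small uniformly in σ because `nemytskii Γ'` is continuous at `u`
in the sup norm. -/
theorem hasFDerivAt_nemytskii (Γ : C(I × E, F)) (Γ' : C(I × E, E →L[ℝ] F))
    (h : ∀ σ x, HasFDerivAt (fun y => Γ (σ, y)) (Γ' (σ, x)) x) (u : (I →ᵇ E)) :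
    HasFDerivAt (nemytskii Γ) (pathApply (nemytskii Γ' u)) u := by
  rw [hasFDerivAt_iff_isLittleO, Asymptotics.isLittleO_iff]
  intro c hc
  have := (continuous_nemytskii Γ').continuousAt (x := u)
  rw [Metric.continuousAt_iff] at this
  obtain ⟨δ, hδ, hd⟩ := this c hc
  filter_upwards [Metric.ball_mem_nhds u hδ] with v hv
  rw [BoundedContinuousFunction.norm_le (by positivity)]
  intro σ
  have key := (convex_segment (𝕜 := ℝ) (u σ) (v σ)).norm_image_sub_le_of_norm_hasFDerivWithin_le'
    (f := fun y => Γ (σ, y)) (f' := fun y => Γ' (σ, y)) (φ := Γ' (σ, u σ)) (C := c)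
    (fun y _ => (h σ y).hasFDerivWithinAt) ?_ (left_mem_segment ℝ _ _) (right_mem_segment ℝ _ _)
  · refine key.trans ?_
    gcongr
    exact (v - u).norm_coe_le_norm σ
  -- A point of the segment is the value at σ of the path `a • u + b • v`, which is as close to `u`
  -- as `v` is; this is what makes the estimate uniform in σ.
  · rintro y ⟨a, b, ha, hb, hab, rfl⟩
    have hw : dist (a • u + b • v) u < δ := by
      have : a • u + b • v - u = b • (v - u) := by
        have ha' : a = 1 - b := by linarith
        rw [ha']; module
      rw [dist_eq_norm, this, norm_smul, Real.norm_of_nonneg hb]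
      rw [Metric.mem_ball, dist_eq_norm] at hv
      have hb1 : b ≤ 1 := by linarith
      calc b * ‖v - u‖ ≤ 1 * ‖v - u‖ := by gcongr
        _ < δ := by simpa using hv
    have h1 := (nemytskii Γ' (a • u + b • v) - nemytskii Γ' u).norm_coe_le_norm σ
    rw [← dist_eq_norm] at h1
    exact h1.trans (hd hw).le

/-- `Γ` has `k` derivatives in the second variable, jointly continuous in both. -/
def SmoothFiber (k : ℕ) (f : I → E → F) : Prop :=
  (∀ σ, ContDiff ℝ k (f σ)) ∧
    ∀ j ≤ k, Continuous fun q : I × E => iteratedFDeriv ℝ j (f q.1) q.2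

omit [CompactSpace I] in
theorem SmoothFiber.continuous {k : ℕ} {f : I → E → F} (h : SmoothFiber k f) :
    Continuous fun q : I × E => f q.1 q.2 := by
  have := h.2 0 (Nat.zero_le _)
  simp only [iteratedFDeriv_zero_eq_comp] at this
  exact (continuousMultilinearCurryFin0 ℝ E F).continuous.comp this |>.congr fun q => by simp

omit [CompactSpace I] in
theorem SmoothFiber.fderiv {k : ℕ} {f : I → E → F} (h : SmoothFiber (k + 1) f) :
    SmoothFiber k (fun σ => fderiv ℝ (f σ)) := by
  refine ⟨fun σ => (h.1 σ).fderiv_right (by norm_cast), fun j hj => ?_⟩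
  have := h.2 (j + 1) (by omega)
  simp only [iteratedFDeriv_succ_eq_comp_right] at this
  exact ((continuousMultilinearCurryRightEquiv' ℝ j E F).continuous.comp this).congr fun q => by
    simp

/-- The derivative of a superposition operator is again one, for the fibre derivative, composed with
the bounded bilinear map `pathApply`; hence an induction on the order with varying target space. -/
theorem contDiff_nemytskii {k : ℕ} (Γ : C(I × E, F)) (h : SmoothFiber k fun σ y => Γ (σ, y)) :
    ContDiff ℝ k (nemytskii Γ) := by
  induction k generalizing F with
  | zero => exact_mod_cast contDiff_zero.2 (continuous_nemytskii Γ)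
  | succ k ih =>
    have h' := h.fderiv
    let Γ' : C(I × E, E →L[ℝ] F) := ⟨_, h'.continuous⟩
    have hd : ∀ u, HasFDerivAt (nemytskii Γ) (pathApply (nemytskii Γ' u)) u := fun u =>
      hasFDerivAt_nemytskii Γ Γ'
        (fun σ x => ((h.1 σ).differentiable (by norm_cast) x).hasFDerivAt) u
    push_cast
    rw [contDiff_succ_iff_hasFDerivAt]
    refine ⟨_, ?_, hd⟩
    exact (pathApply (I := I) (E := E) (F := F)).contDiff.comp (ih Γ' h')

end Nemytskii

/-! ### Smooth dependence and derivative bounds for contractive fixed points -/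

noncomputable section FixedPoint

variable {P W : Type} [NormedAddCommGroup P] [NormedSpace ℝ P] [CompleteSpace P]
  [NormedAddCommGroup W] [NormedSpace ℝ W]

theorem approximatesLinearOn_id_sub {G : P → P} (hG : LipschitzWith (1 / 2) G) :
    ApproximatesLinearOn (fun X => X - G X)
      ((ContinuousLinearEquiv.refl ℝ P : P ≃L[ℝ] P) : P →L[ℝ] P) univ (1 / 2) := by
  intro x _ y _
  have := hG.dist_le_mul x y
  rw [dist_eq_norm, dist_eq_norm] at this
  refine le_trans (le_of_eq ?_) this
  rw [← norm_neg]
  congr 1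
  simp only [ContinuousLinearEquiv.coe_refl, ContinuousLinearMap.coe_id', id]
  abel

/-- For a `1/2`-Lipschitz map `G`, the homeomorphism `X ↦ X - G X`. -/
def idSubHomeomorph {G : P → P} (hG : LipschitzWith (1 / 2) G) : P ≃ₜ P :=
  (approximatesLinearOn_id_sub hG).toHomeomorph _ (by
    rcases subsingleton_or_nontrivial P with h | h
    · exact Or.inl h
    · right
      have : ‖((ContinuousLinearEquiv.refl ℝ P).symm : P →L[ℝ] P)‖₊ = 1 := by
        have : ((ContinuousLinearEquiv.refl ℝ P).symm : P →L[ℝ] P) = ContinuousLinearMap.id ℝ P := rfl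
        rw [this]
        exact NNReal.eq ContinuousLinearMap.norm_id
      rw [this, inv_one]
      rw [← NNReal.coe_lt_coe]; norm_num)

theorem idSubHomeomorph_apply {G : P → P} (hG : LipschitzWith (1 / 2) G) (X : P) :
    idSubHomeomorph hG X = X - G X := rfl

theorem idSubHomeomorph_symm_eq {G : P → P} (hG : LipschitzWith (1 / 2) G) (y : P) :
    (idSubHomeomorph hG).symm y = y + G ((idSubHomeomorph hG).symm y) := by
  have := (idSubHomeomorph hG).apply_symm_apply y
  rw [idSubHomeomorph_apply] at this
  exact eq_add_of_sub_eq this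

theorem eq_idSubHomeomorph_symm {G : P → P} (hG : LipschitzWith (1 / 2) G) {X y : P}
    (h : X = y + G X) : X = (idSubHomeomorph hG).symm y := by
  rw [Homeomorph.eq_symm_apply, idSubHomeomorph_apply, sub_eq_iff_eq_add]
  exact h

/-- The derivative 1 - G'(X) is invertible by the Neumann series, since the Lipschitz bound gives
‖G'(X)‖ ≤ 1/2; the inverse function theorem then transfers the regularity of G. -/
theorem contDiff_idSubHomeomorph_symm {G : P → P} (hG : LipschitzWith (1 / 2) G) {n : ℕ}
    (hn : 1 ≤ n) (hd : ContDiff ℝ n G) : ContDiff ℝ n (idSubHomeomorph hG).symm := by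
  have hdiff : Differentiable ℝ G := hd.differentiable (by norm_cast; omega)
  have hlt : ∀ X, ‖fderiv ℝ G X‖ < 1 := fun X =>
    (norm_fderiv_le_of_lipschitz ℝ hG).trans_lt (by norm_num)
  refine (idSubHomeomorph hG).contDiff_symm
    (f₀' := fun X => ContinuousLinearEquiv.unitsEquiv ℝ P (Units.oneSub _ (hlt X))) ?_ ?_
  · intro X
    exact (hasFDerivAt_id X).sub (hdiff X).hasFDerivAt
  · exact contDiff_id.sub hd

theorem lipschitzWith_half_of_iteratedFDeriv_le {G : P → P} {n : ℕ} (hn : 1 ≤ n)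
    (hd : ContDiff ℝ n G) {κ : ℝ} (hκ : κ ≤ 1 / 2)
    (hb : ∀ i ≤ n, ∀ X, ‖iteratedFDeriv ℝ i G X‖ ≤ κ) : LipschitzWith (1 / 2) G := by
  refine lipschitzWith_of_nnnorm_fderiv_le (hd.differentiable (by norm_cast; omega)) fun X => ?_
  have := (hb 1 hn X).trans hκ
  rw [norm_iteratedFDeriv_one] at this
  rw [← NNReal.coe_le_coe]
  simpa using this

/-- Derivative bounds for the solution of `X = b w + G X`. -/
theorem norm_iteratedFDeriv_fixedPoint_le {G : P → P} {n : ℕ} (hd : ContDiff ℝ n G) {κ : ℝ}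
    (hκ : n.factorial * κ ≤ 1 / 2)
    (hb : ∀ i ≤ n, ∀ X, ‖iteratedFDeriv ℝ i G X‖ ≤ κ) {b : W →L[ℝ] P} {K : ℝ} (hK : 1 ≤ K)
    (hbK : ‖b‖ ≤ K) {X : W → P} (hX : ContDiff ℝ n X) (heq : ∀ w, X w = b w + G (X w)) (w : W) :
    ∀ j, 1 ≤ j → j ≤ n → ‖iteratedFDeriv ℝ j X w‖ ≤ (2 * K) ^ j := by
  have hκ0 : 0 ≤ κ := (norm_nonneg _).trans (hb 0 (Nat.zero_le _) (X w))
  intro j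
  induction j using Nat.strong_induction_on with
  | _ j ih =>
  intro hj1 hjn
  by_contra! hlt
  set A := ‖iteratedFDeriv ℝ j X w‖ with hA
  have hA0 : 0 ≤ A := norm_nonneg _
  have hj0 : (j : ℝ) ≠ 0 := by positivity
  -- The bound for derivatives of a composition wants a single D with ‖X^(i)‖ ≤ D^i for all i ≤ j.
  -- If the claim fails at order j, the choice D^j = A gives D ≥ 2K, so the lower orders are covered
  -- by induction. The composition bound then gives A ≤ K^j + j! κ A ≤ K^j + A/2, hence A ≤ 2K^j ≤
  -- (2K)^j, a contradiction.
  set D := A ^ (1 / (j : ℝ)) with hD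
  have hDj : D ^ j = A := by
    rw [hD, ← Real.rpow_natCast, ← Real.rpow_mul hA0, one_div_mul_cancel hj0, Real.rpow_one]
  have hKD : 2 * K ≤ D := by
    by_contra! h
    have : D ^ j ≤ (2 * K) ^ j := pow_le_pow_left₀ (by positivity) h.le j
    linarith
  have hcomp := norm_iteratedFDeriv_comp_le (g := G) (f := X) (n := j) (N := n) hd hX
    (by exact_mod_cast hjn) w (C := κ) (D := D) (fun i hi => hb i (hi.trans hjn) _) (by
      intro i hi1 hij
      rcases hij.lt_or_eq with h | rfl
      · exact (ih i h hi1 (hi1.trans (h.le.trans hjn) |> fun _ => h.le.trans hjn)).trans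
          (pow_le_pow_left₀ (by positivity) hKD i)
      · rw [hDj])
  rw [hDj] at hcomp
  have hXeq : X = fun w => b w + (G ∘ X) w := funext heq
  have hsum : iteratedFDeriv ℝ j X w = iteratedFDeriv ℝ j b w + iteratedFDeriv ℝ j (G ∘ X) w := by
    conv_lhs => rw [hXeq]
    exact iteratedFDeriv_add_apply (b.contDiff.of_le le_top).contDiffAt
      ((hd.comp hX).of_le (by exact_mod_cast hjn)).contDiffAt
  have hbj : ‖iteratedFDeriv ℝ j b w‖ ≤ K ^ j := by
    rcases hj1.lt_or_eq with h | rfl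
    · obtain ⟨i, rfl⟩ : ∃ i, j = i + 2 := ⟨j - 2, by omega⟩
      rw [← norm_iteratedFDeriv_fderiv]
      have : fderiv ℝ b = fun _ => b := funext fun _ => b.fderiv
      rw [this, iteratedFDeriv_succ_const]
      simp only [Pi.zero_apply, norm_zero]
      positivity
    · rw [norm_iteratedFDeriv_one, b.fderiv, pow_one]; exact hbK
  have hfac : (j.factorial : ℝ) * κ ≤ 1 / 2 := by
    refine le_trans ?_ hκ
    gcongr
  have h1 : A ≤ K ^ j + 1 / 2 * A := by
    rw [hA, hsum]
    refine (norm_add_le _ _).trans (add_le_add hbj (hcomp.trans ?_))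
    rw [← hsum]
    gcongr
  have h2 : 2 * K ^ j ≤ (2 * K) ^ j := by
    rw [mul_pow]
    gcongr
    calc (2 : ℝ) = 2 ^ 1 := by norm_num
      _ ≤ 2 ^ j := pow_le_pow_right₀ (by norm_num) hj1
  linarith

end FixedPoint

open scoped ENNReal BoundedContinuousFunction

/-! ### Primitives of continuous paths -/

noncomputable section Primitive

variable {E : Type} [NormedAddCommGroup E] [NormedSpace ℝ E] [CompleteSpace E]
  {a b : ℝ} (hab : a ≤ b)

theorem continuous_IccExtend_path (u : (Icc a b →ᵇ E)) : Continuous (IccExtend hab u) :=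
  u.continuous.Icc_extend'

theorem intervalIntegrable_IccExtend (u : (Icc a b →ᵇ E)) (t τ : ℝ) :
    IntervalIntegrable (IccExtend hab u) volume t τ :=
  (continuous_IccExtend_path hab u).intervalIntegrable _ _

theorem norm_integral_IccExtend_le {t τ : ℝ} (ht : t ∈ Icc a b) (hτ : τ ∈ Icc a b)
    (u : (Icc a b →ᵇ E)) {S : ℝ → ℝ} (hS : ContinuousOn S (Icc a b))
    (hu : ∀ σ : Icc a b, ‖u σ‖ ≤ S σ) :
    ‖∫ σ in t..τ, IccExtend hab u σ‖ ≤ |∫ σ in t..τ, S σ| := by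
  have hsub : uIcc t τ ⊆ Icc a b := uIcc_subset_Icc ht hτ
  refine intervalIntegral.norm_integral_le_abs_of_norm_le ?_ (hS.mono hsub).intervalIntegrable
  refine (ae_restrict_iff' measurableSet_uIoc).2 (Eventually.of_forall fun σ hσ => ?_)
  have hσ' := hsub (uIoc_subset_uIcc hσ)
  rw [IccExtend_of_mem hab _ hσ']
  exact hu ⟨σ, hσ'⟩

/-- The primitive `τ ↦ ∫ σ in t..τ, u σ` of a path. -/
def primitive (t : Icc a b) : (Icc a b →ᵇ E) →L[ℝ] (Icc a b →ᵇ E) :=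
  LinearMap.mkContinuous
    { toFun := fun u => BoundedContinuousFunction.mkOfCompact ⟨fun τ => ∫ σ in (t : ℝ)..τ, IccExtend hab u σ,
        (intervalIntegral.continuous_primitive (intervalIntegrable_IccExtend hab u) _).comp
          continuous_subtype_val⟩
      map_add' := fun u v => by
        ext τ
        simp only [BoundedContinuousFunction.mkOfCompact_apply, ContinuousMap.coe_mk, BoundedContinuousFunction.add_apply]
        rw [← intervalIntegral.integral_add (intervalIntegrable_IccExtend hab u _ _)
          (intervalIntegrable_IccExtend hab v _ _)]
        rfl
      map_smul' := fun c u => by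
        ext τ
        simp only [BoundedContinuousFunction.mkOfCompact_apply, ContinuousMap.coe_mk, BoundedContinuousFunction.smul_apply, RingHom.id_apply]
        rw [← intervalIntegral.integral_smul]
        rfl }
    (b - a)
    (fun u => by
      rw [BoundedContinuousFunction.norm_le (by have := sub_nonneg.2 hab; positivity)]
      intro τ
      refine (intervalIntegral.norm_integral_le_of_norm_le_const (C := ‖u‖) fun σ _ =>
        u.norm_coe_le_norm _).trans ?_
      rw [mul_comm]
      gcongr
      rw [abs_le]
      constructor <;> linarith [t.2.1, t.2.2, τ.2.1, τ.2.2])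

theorem primitive_apply (t : Icc a b) (u : (Icc a b →ᵇ E)) (τ : Icc a b) :
    primitive hab t u τ = ∫ σ in (t : ℝ)..τ, IccExtend hab u σ := rfl

@[simp] theorem primitive_self (t : Icc a b) (u : (Icc a b →ᵇ E)) : primitive hab t u t = 0 := by
  simp [primitive_apply]

theorem primitive_sub_primitive (t t' : Icc a b) (u : (Icc a b →ᵇ E)) (τ : Icc a b) :
    primitive hab t u τ - primitive hab t' u τ = primitive hab t u t' := by
  simp only [primitive_apply]
  exact sub_eq_of_eq_add (intervalIntegral.integral_add_adjacent_intervals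
    (intervalIntegrable_IccExtend hab u _ _) (intervalIntegrable_IccExtend hab u _ _)).symm

theorem primitive_swap (t τ : Icc a b) (u : (Icc a b →ᵇ E)) :
    primitive hab t u τ = - primitive hab τ u t := by
  simp only [primitive_apply]
  exact intervalIntegral.integral_symm _ _

theorem norm_primitive_sub_le (t t' : Icc a b) (u : (Icc a b →ᵇ E)) :
    ‖primitive hab t u - primitive hab t' u‖ ≤ |(t' : ℝ) - t| * ‖u‖ := by
  rw [BoundedContinuousFunction.norm_le (by positivity)]
  intro τ
  rw [BoundedContinuousFunction.sub_apply, primitive_sub_primitive, primitive_apply]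
  refine (intervalIntegral.norm_integral_le_of_norm_le_const (C := ‖u‖) fun σ _ =>
        u.norm_coe_le_norm _).trans ?_
  rw [mul_comm]

theorem norm_primitive_apply_le (t : Icc a b) (u : (Icc a b →ᵇ E)) :
    ‖primitive hab t u‖ ≤ (b - a) * ‖u‖ := by
  rw [BoundedContinuousFunction.norm_le (by have := sub_nonneg.2 hab; positivity)]
  intro τ
  refine (intervalIntegral.norm_integral_le_of_norm_le_const (C := ‖u‖) fun σ _ =>
    u.norm_coe_le_norm _).trans ?_
  rw [mul_comm]
  gcongr
  rw [abs_le]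
  constructor <;> linarith [t.2.1, t.2.2, τ.2.1, τ.2.2]

/-- The operator is Lipschitz in its base time on bounded sets of paths, and bounded by the length
of the interval, uniformly in the base time. -/
theorem continuous_primitive :
    Continuous fun q : Icc a b × (Icc a b →ᵇ E) => primitive hab q.1 q.2 := by
  rw [continuous_iff_continuousAt]
  rintro ⟨t, u⟩
  rw [ContinuousAt, tendsto_iff_norm_sub_tendsto_zero]
  have hc : Continuous fun q : Icc a b × (Icc a b →ᵇ E) =>
      (b - a) * ‖q.2 - u‖ + |(t : ℝ) - q.1| * ‖u‖ := by fun_prop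
  have h0 := hc.tendsto (t, u)
  simp only [sub_self, norm_zero, mul_zero, abs_zero, zero_mul, add_zero] at h0
  refine squeeze_zero (fun _ => norm_nonneg _) (fun q => ?_) h0
  have : primitive hab q.1 q.2 - primitive hab t u
      = primitive hab q.1 (q.2 - u) + (primitive hab q.1 u - primitive hab t u) := by
    rw [map_sub]; abel
  rw [this]
  exact (norm_add_le _ _).trans
    (add_le_add (norm_primitive_apply_le hab _ _) (norm_primitive_sub_le hab _ _ _))

theorem hasDerivAt_integral_IccExtend (t : ℝ) (u : (Icc a b →ᵇ E)) (τ : ℝ) :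
    HasDerivAt (fun τ => ∫ σ in t..τ, IccExtend hab u σ) (IccExtend hab u τ) τ :=
  intervalIntegral.integral_hasDerivAt_right (intervalIntegrable_IccExtend hab u _ _)
    ((continuous_IccExtend_path hab u).stronglyMeasurableAtFilter _ _)
    (continuous_IccExtend_path hab u).continuousAt

theorem hasDerivWithinAt_primitive (t : Icc a b) (u : (Icc a b →ᵇ E)) (τ : Icc a b) :
    HasDerivWithinAt (IccExtend hab (primitive hab t u)) (u τ) (Icc a b) τ := by
  have h := (hasDerivAt_integral_IccExtend hab t u τ).hasDerivWithinAt (s := Icc a b)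
  rw [IccExtend_val] at h
  refine h.congr (fun x hx => ?_) ?_
  · rw [IccExtend_of_mem hab _ hx]; rfl
  · rw [IccExtend_val]; rfl

theorem norm_primitive_le (t : Icc a b) (u : (Icc a b →ᵇ E)) {S : ℝ → ℝ}
    (hS : ContinuousOn S (Icc a b)) (hu : ∀ σ : Icc a b, ‖u σ‖ ≤ S σ) (τ : Icc a b) :
    ‖primitive hab t u τ‖ ≤ |∫ σ in (t : ℝ)..τ, S σ| :=
  norm_integral_IccExtend_le hab t.2 τ.2 u hS hu

end Primitive

/-! ### The integral form of the bicharacteristic system and its smallness -/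

noncomputable section System

variable {E : Type} [NormedAddCommGroup E] [NormedSpace ℝ E] [CompleteSpace E]
  {W Z : Type} [NormedAddCommGroup W] [NormedSpace ℝ W] [NormedAddCommGroup Z] [NormedSpace ℝ Z]
  {a b : ℝ}

theorem iteratedFDeriv_path_apply {f : W → (Icc a b →ᵇ E)} {n : ℕ} (hf : ContDiff ℝ n f) {i : ℕ}
    (hi : i ≤ n) (w : W) (h : Fin i → W) (σ : Icc a b) :
    iteratedFDeriv ℝ i f w h σ = iteratedFDeriv ℝ i (fun w => f w σ) w h := by
  have := (BoundedContinuousFunction.evalCLM ℝ σ : (Icc a b →ᵇ E) →L[ℝ] E).iteratedFDeriv_comp_left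
    (hf.contDiffAt (x := w)) (i := i) (by exact_mod_cast hi)
  have h2 := congrArg (fun A => A h) this
  exact h2.symm

/-- The derivative of a path-valued map is controlled at each time σ by the weight S(σ), which is
only small in L¹. A bound through the sup norm of the path would lose this, so the weighted estimate
for `L` is applied to each path obtained by evaluating the iterated derivative on a tuple `h`. -/
theorem norm_iteratedFDeriv_clm_path_le {f : W → (Icc a b →ᵇ E)} {n : ℕ} (hf : ContDiff ℝ n f)
    {i : ℕ} (hi : i ≤ n) (w : W) {S : ℝ → ℝ} {c κ : ℝ} (hc : 0 ≤ c) (hκ : 0 ≤ κ)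
    (hfb : ∀ σ : Icc a b, ‖iteratedFDeriv ℝ i (fun w => f w σ) w‖ ≤ c * S σ)
    (L : (Icc a b →ᵇ E) →L[ℝ] Z)
    (hL : ∀ (u : (Icc a b →ᵇ E)) (R : ℝ), 0 ≤ R → (∀ σ : Icc a b, ‖u σ‖ ≤ R * S σ) →
      ‖L u‖ ≤ R * κ) :
    ‖iteratedFDeriv ℝ i (fun w => L (f w)) w‖ ≤ c * κ := by
  refine ContinuousMultilinearMap.opNorm_le_bound (by positivity) fun h => ?_
  have h1 : iteratedFDeriv ℝ i (fun w => L (f w)) w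
      = L.compContinuousMultilinearMap (iteratedFDeriv ℝ i f w) :=
    L.iteratedFDeriv_comp_left (hf.contDiffAt (x := w)) (by exact_mod_cast hi)
  rw [h1, ContinuousLinearMap.compContinuousMultilinearMap_coe, Function.comp_apply]
  refine (hL _ (c * ∏ k, ‖h k‖) (by positivity) fun σ => ?_).trans (le_of_eq (by ring))
  rw [iteratedFDeriv_path_apply hf hi]
  refine (ContinuousMultilinearMap.le_opNorm _ _).trans ?_
  have : 0 ≤ ∏ k, ‖h k‖ := by positivity
  nlinarith [hfb σ]

/-- The operator `(x, l) ↦ x + c l` on pairs of paths. -/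
def shiftPath (c : ℝ) : (Icc a b →ᵇ E) × (Icc a b →ᵇ E) →L[ℝ] (Icc a b →ᵇ E) :=
  ContinuousLinearMap.fst ℝ _ _ + c • ContinuousLinearMap.snd ℝ _ _

/-- The path `c g(σ, x - l/2) + c' g(σ, x + l/2)`. -/
def force (g : C(Icc a b × E, E)) (c c' : ℝ) (X : (Icc a b →ᵇ E) × (Icc a b →ᵇ E)) : (Icc a b →ᵇ E) :=
  c • nemytskii g (shiftPath (-(1 / 2)) X) + c' • nemytskii g (shiftPath (1 / 2) X)

theorem force_apply (g : C(Icc a b × E, E)) (c c' : ℝ) (X : (Icc a b →ᵇ E) × (Icc a b →ᵇ E))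
    (σ : Icc a b) : force g c c' X σ = c • g (σ, X.1 σ - (1 / 2 : ℝ) • X.2 σ)
      + c' • g (σ, X.1 σ + (1 / 2 : ℝ) • X.2 σ) := by
  simp [force, shiftPath, sub_eq_add_neg]

theorem contDiff_force {p : ℕ} {g : C(Icc a b × E, E)} (hg : SmoothFiber p fun σ y => g (σ, y))
    (c c' : ℝ) : ContDiff ℝ p (force g c c') := by
  have h : ∀ e : ℝ, ContDiff ℝ p fun X : (Icc a b →ᵇ E) × (Icc a b →ᵇ E) =>
      nemytskii g (shiftPath e X) := fun e => by
    have h0 : ContDiff ℝ p (shiftPath e : (Icc a b →ᵇ E) × (Icc a b →ᵇ E) →L[ℝ] (Icc a b →ᵇ E)) :=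
      ContinuousLinearMap.contDiff _
    exact (contDiff_nemytskii g hg).comp h0
  have h1 := (h (-(1 / 2))).const_smul c
  have h2 := (h (1 / 2)).const_smul c'
  exact h1.add h2

theorem norm_iteratedFDeriv_comp_clm_le {f : E → Z} {n : ℕ} (hf : ContDiff ℝ n f) {i : ℕ}
    (hi : i ≤ n) (L : W →L[ℝ] E) {K : ℝ} (hL : ‖L‖ ≤ K) (w : W) {c : ℝ}
    (hc : ‖iteratedFDeriv ℝ i f (L w)‖ ≤ c) :
    ‖iteratedFDeriv ℝ i (fun w => f (L w)) w‖ ≤ K ^ i * c := by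
  have : iteratedFDeriv ℝ i (fun w => f (L w)) w
      = (iteratedFDeriv ℝ i f (L w)).compContinuousLinearMap fun _ => L :=
    L.iteratedFDeriv_comp_right hf w (by exact_mod_cast hi)
  rw [this]
  refine (ContinuousMultilinearMap.norm_compContinuousLinearMap_le _ _).trans ?_
  rw [Finset.prod_const, Finset.card_univ, Fintype.card_fin, mul_comm]
  have := (norm_nonneg L).trans hL
  gcongr

/-- Each of the two terms is g composed with the linear map X ↦ x(σ) ± l(σ)/2, of norm at most 2,
which costs 2^i ≤ 2^p; two terms give 2^(p+1). -/
theorem norm_iteratedFDeriv_force_le {p : ℕ} {g : C(Icc a b × E, E)}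
    (hg : SmoothFiber p fun σ y => g (σ, y)) {S : ℝ → ℝ}
    (hS : ∀ j ≤ p, ∀ (σ : Icc a b) (y : E), ‖iteratedFDeriv ℝ j (fun y => g (σ, y)) y‖ ≤ S σ)
    {c c' : ℝ} (hc : |c| ≤ 1) (hc' : |c'| ≤ 1) {i : ℕ} (hi : i ≤ p)
    (X : (Icc a b →ᵇ E) × (Icc a b →ᵇ E)) (σ : Icc a b) :
    ‖iteratedFDeriv ℝ i (fun X => force g c c' X σ) X‖ ≤ 2 ^ (p + 1) * S σ := by
  have hS0 : 0 ≤ S σ := (norm_nonneg _).trans (hS 0 (Nat.zero_le _) σ 0)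
  have hL : ∀ e : ℝ, |e| ≤ 1 / 2 →
      ‖(BoundedContinuousFunction.evalCLM ℝ σ : (Icc a b →ᵇ E) →L[ℝ] E).comp (shiftPath e)‖ ≤ 2 := by
    intro e he
    refine ContinuousLinearMap.opNorm_le_bound _ (by norm_num) fun Y => ?_
    have h1 : ‖Y.1 σ‖ ≤ ‖Y‖ := (Y.1.norm_coe_le_norm σ).trans (norm_fst_le Y)
    have h2 : ‖Y.2 σ‖ ≤ ‖Y‖ := (Y.2.norm_coe_le_norm σ).trans (norm_snd_le Y)
    calc ‖Y.1 σ + e • Y.2 σ‖ ≤ ‖Y.1 σ‖ + |e| * ‖Y.2 σ‖ := by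
          refine (norm_add_le _ _).trans ?_
          rw [norm_smul, Real.norm_eq_abs]
      _ ≤ ‖Y‖ + 1 / 2 * ‖Y‖ := by gcongr
      _ ≤ 2 * ‖Y‖ := by linarith [norm_nonneg Y]
  have hterm : ∀ e : ℝ, |e| ≤ 1 / 2 → ∀ k : ℝ, |k| ≤ 1 →
      ‖iteratedFDeriv ℝ i (fun X => k • g (σ, shiftPath e X σ)) X‖ ≤ 2 ^ p * S σ := by
    intro e he k hk
    have h1 := norm_iteratedFDeriv_comp_clm_le (hg.1 σ) hi
      ((BoundedContinuousFunction.evalCLM ℝ σ : (Icc a b →ᵇ E) →L[ℝ] E).comp (shiftPath e)) (hL e he) X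
      (hS i hi σ _)
    have hcd : ContDiff ℝ p fun X : (Icc a b →ᵇ E) × (Icc a b →ᵇ E) => g (σ, shiftPath e X σ) :=
      (hg.1 σ).comp ((BoundedContinuousFunction.evalCLM ℝ σ : (Icc a b →ᵇ E) →L[ℝ] E).comp
        (shiftPath e)).contDiff
    have h2 : iteratedFDeriv ℝ i (fun X => k • g (σ, shiftPath e X σ)) X
        = k • iteratedFDeriv ℝ i (fun X => g (σ, shiftPath e X σ)) X :=
      iteratedFDeriv_const_smul_apply ((hcd.of_le (by exact_mod_cast hi)).contDiffAt)
    rw [h2, norm_smul, Real.norm_eq_abs]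
    have h3 : (2 : ℝ) ^ i * S σ ≤ 2 ^ p * S σ := by
      gcongr
      norm_num
    calc |k| * _ ≤ 1 * _ := by gcongr
      _ ≤ 2 ^ p * S σ := by rw [one_mul]; exact h1.trans h3
  have hcd : ∀ e k : ℝ, ContDiff ℝ i fun X : (Icc a b →ᵇ E) × (Icc a b →ᵇ E) =>
      k • g (σ, shiftPath e X σ) := fun e k =>
    (((hg.1 σ).of_le (by exact_mod_cast hi)).comp
      ((BoundedContinuousFunction.evalCLM ℝ σ : (Icc a b →ᵇ E) →L[ℝ] E).comp (shiftPath e)).contDiff).const_smul k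
  have hsum : iteratedFDeriv ℝ i (fun X => force g c c' X σ) X
      = iteratedFDeriv ℝ i (fun X => c • g (σ, shiftPath (-(1 / 2)) X σ)) X
        + iteratedFDeriv ℝ i (fun X => c' • g (σ, shiftPath (1 / 2) X σ)) X :=
    iteratedFDeriv_add_apply (hcd _ _).contDiffAt (hcd _ _).contDiffAt
  rw [hsum]
  refine (norm_add_le _ _).trans ?_
  have h1 := hterm (-(1 / 2)) (by norm_num [abs_of_pos]) c hc
  have h2 := hterm (1 / 2) (by norm_num [abs_of_pos]) c' hc'
  rw [pow_succ]
  linarith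

variable (hab : a ≤ b)

theorem norm_primitive_le_of_le {S : ℝ → ℝ} (hS : ContinuousOn S (Icc a b))
    (hS0 : ∀ σ ∈ Icc a b, 0 ≤ S σ) (t : Icc a b) (u : (Icc a b →ᵇ E)) {R : ℝ} (hR : 0 ≤ R)
    (hu : ∀ σ : Icc a b, ‖u σ‖ ≤ R * S σ) :
    ‖primitive hab t u‖ ≤ R * ∫ σ in a..b, S σ := by
  have hI : 0 ≤ ∫ σ in a..b, S σ := intervalIntegral.integral_nonneg hab hS0
  rw [BoundedContinuousFunction.norm_le (by positivity)]
  intro τ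
  refine (norm_primitive_le hab t u (S := fun σ => R * S σ) (by fun_prop) hu τ).trans ?_
  rw [intervalIntegral.integral_const_mul, abs_mul, abs_of_nonneg hR]
  gcongr
  have := intervalIntegral.abs_integral_mono_interval (μ := volume) (f := S) (a := t) (b := τ)
    (c := a) (d := b)
    (by
      rw [uIoc_of_le hab]
      exact Ioc_subset_Ioc (le_min t.2.1 τ.2.1) (max_le t.2.2 τ.2.2)) ?_ ?_
  · rwa [abs_of_nonneg hI] at this
  · rw [uIoc_of_le hab]
    exact (ae_restrict_iff' measurableSet_Ioc).2 (Eventually.of_forall fun σ hσ =>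
      hS0 σ (Ioc_subset_Icc_self hσ))
  · rw [intervalIntegrable_iff, uIoc_of_le hab, ← intervalIntegrable_iff_integrableOn_Ioc_of_le hab]
    exact (hS.mono (by rw [uIcc_of_le hab])).intervalIntegrable

/-- The right-hand side of the integral form of the bicharacteristic system, for data given at the
times `t` and `s`. -/
def systemMap (g : C(Icc a b × E, E)) (t s : Icc a b) (X : (Icc a b →ᵇ E) × (Icc a b →ᵇ E)) :
    (Icc a b →ᵇ E) × (Icc a b →ᵇ E) :=
  (primitive hab t (primitive hab t (force g (-(1 / 2)) (-(1 / 2)) X)),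
    primitive hab s (primitive hab s (force g 1 (-1) X)))

theorem contDiff_systemMap {p : ℕ} {g : C(Icc a b × E, E)}
    (hg : SmoothFiber p fun σ y => g (σ, y)) (t s : Icc a b) :
    ContDiff ℝ p (systemMap hab g t s) := by
  have h1 := ((primitive hab t).comp (primitive hab t)).contDiff.comp
    (contDiff_force hg (-(1 / 2)) (-(1 / 2)))
  have h2 := ((primitive hab s).comp (primitive hab s)).contDiff.comp (contDiff_force hg 1 (-1))
  exact h1.prodMk h2

/-- Of the two primitives, the inner one integrates the weight S and the outer one costs at most the
length of the interval, hence 1. The two components are estimated separately and added, which turns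
2^(p+1) into 2^(p+2). -/
theorem norm_iteratedFDeriv_systemMap_le {p : ℕ} {g : C(Icc a b × E, E)}
    (hg : SmoothFiber p fun σ y => g (σ, y)) (hb1 : b - a ≤ 1) {S : ℝ → ℝ}
    (hSc : ContinuousOn S (Icc a b))
    (hS : ∀ j ≤ p, ∀ (σ : Icc a b) (y : E), ‖iteratedFDeriv ℝ j (fun y => g (σ, y)) y‖ ≤ S σ)
    (t s : Icc a b) {i : ℕ} (hi : i ≤ p) (X : (Icc a b →ᵇ E) × (Icc a b →ᵇ E)) :
    ‖iteratedFDeriv ℝ i (systemMap hab g t s) X‖ ≤ 2 ^ (p + 2) * ∫ σ in a..b, S σ := by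
  have hS0 : ∀ σ ∈ Icc a b, 0 ≤ S σ := fun σ hσ =>
    (norm_nonneg _).trans (hS 0 (Nat.zero_le _) ⟨σ, hσ⟩ 0)
  have hI : 0 ≤ ∫ σ in a..b, S σ := intervalIntegral.integral_nonneg hab hS0
  have hdom : ∀ (t : Icc a b) (u : (Icc a b →ᵇ E)) (R : ℝ), 0 ≤ R →
      (∀ σ : Icc a b, ‖u σ‖ ≤ R * S σ) →
      ‖primitive hab t (primitive hab t u)‖ ≤ R * ∫ σ in a..b, S σ := by
    intro t u R hR hu
    refine (norm_primitive_apply_le hab t _).trans ?_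
    calc (b - a) * ‖primitive hab t u‖ ≤ 1 * ‖primitive hab t u‖ := by gcongr
      _ ≤ _ := by rw [one_mul]; exact norm_primitive_le_of_le hab hSc hS0 t u hR hu
  have h1 := norm_iteratedFDeriv_clm_path_le (contDiff_force hg (-(1 / 2)) (-(1 / 2))) hi X
    (c := 2 ^ (p + 1)) (κ := ∫ σ in a..b, S σ) (by positivity) hI
    (fun σ => norm_iteratedFDeriv_force_le hg hS (by norm_num [abs_of_pos])
      (by norm_num [abs_of_pos]) hi X σ)
    ((ContinuousLinearMap.inl ℝ ((Icc a b →ᵇ E)) ((Icc a b →ᵇ E))).comp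
      ((primitive hab t).comp (primitive hab t))) (fun u R hR hu => by
        refine le_trans (le_of_eq ?_) (hdom t u R hR hu)
        simp)
  have h2 := norm_iteratedFDeriv_clm_path_le (contDiff_force hg 1 (-1)) hi X
    (c := 2 ^ (p + 1)) (κ := ∫ σ in a..b, S σ) (by positivity) hI
    (fun σ => norm_iteratedFDeriv_force_le hg hS (by norm_num) (by norm_num) hi X σ)
    ((ContinuousLinearMap.inr ℝ ((Icc a b →ᵇ E)) ((Icc a b →ᵇ E))).comp
      ((primitive hab s).comp (primitive hab s))) (fun u R hR hu => by
        refine le_trans (le_of_eq ?_) (hdom s u R hR hu)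
        simp)
  have hi' : (i : WithTop ℕ∞) ≤ p := by exact_mod_cast hi
  have hsum : iteratedFDeriv ℝ i (systemMap hab g t s) X
      = iteratedFDeriv ℝ i (fun X => ((ContinuousLinearMap.inl ℝ ((Icc a b →ᵇ E))
          ((Icc a b →ᵇ E))).comp ((primitive hab t).comp (primitive hab t)))
            (force g (-(1 / 2)) (-(1 / 2)) X)) X
        + iteratedFDeriv ℝ i (fun X => ((ContinuousLinearMap.inr ℝ ((Icc a b →ᵇ E))
          ((Icc a b →ᵇ E))).comp ((primitive hab s).comp (primitive hab s)))
            (force g 1 (-1) X)) X := by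
    rw [← iteratedFDeriv_add_apply]
    · congr 1
      funext X
      simp [systemMap]
    · exact ((ContinuousLinearMap.contDiff _).comp
        ((contDiff_force hg _ _).of_le hi')).contDiffAt
    · exact ((ContinuousLinearMap.contDiff _).comp
        ((contDiff_force hg _ _).of_le hi')).contDiffAt
  rw [hsum]
  refine (norm_add_le _ _).trans ((add_le_add h1 h2).trans (le_of_eq ?_))
  ring

end System

/-! ### Bicharacteristics with position data at time t and dual data at time s -/

noncomputable section Bicharacteristics

/-- Uniform contraction gives ‖X r - X q‖ ≤ 2 (‖y r - y q‖ + ‖G r (X q) - G q (X q)‖), so continuity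
of `G` in the parameter is only needed at a frozen point. -/
theorem continuous_of_fixedPoint {Q P : Type} [TopologicalSpace Q] [NormedAddCommGroup P]
    {G : Q → P → P} {y X : Q → P} (hG : ∀ q, LipschitzWith (1 / 2) (G q))
    (hy : Continuous y) (hc : ∀ Y, Continuous fun q => G q Y)
    (hX : ∀ q, X q = y q + G q (X q)) : Continuous X := by
  rw [continuous_iff_continuousAt]
  intro q
  rw [ContinuousAt, tendsto_iff_norm_sub_tendsto_zero]
  have h0 : Tendsto (fun r => 2 * (‖y r - y q‖ + ‖G r (X q) - G q (X q)‖)) (𝓝 q) (𝓝 0) := by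
    have h : Continuous fun r => 2 * (‖y r - y q‖ + ‖G r (X q) - G q (X q)‖) := by
      have := hc (X q)
      fun_prop
    simpa using h.tendsto q
  refine squeeze_zero (fun _ => norm_nonneg _) (fun r => ?_) h0
  have h1 : X r - X q = (y r - y q) + (G r (X r) - G r (X q)) + (G r (X q) - G q (X q)) := by
    conv_lhs => rw [hX r, hX q]
    abel
  have h2 := (hG r).dist_le_mul (X r) (X q)
  rw [dist_eq_norm, dist_eq_norm] at h2
  have h3 : ‖X r - X q‖ ≤ ‖y r - y q‖ + ‖G r (X r) - G r (X q)‖ + ‖G r (X q) - G q (X q)‖ := by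
    conv_lhs => rw [h1]
    exact norm_add₃_le
  have h4 : ((1 / 2 : NNReal) : ℝ) = 1 / 2 := by norm_num
  rw [h4] at h2
  linarith

variable {E : Type} [NormedAddCommGroup E] [NormedSpace ℝ E] [CompleteSpace E] {a b : ℝ}

/-- The path `τ ↦ f τ • y`. -/
def mulPath : (Icc a b →ᵇ ℝ) →L[ℝ] E →L[ℝ] (Icc a b →ᵇ E) :=
  LinearMap.mkContinuous₂
    (LinearMap.mk₂ ℝ (fun (f : Icc a b →ᵇ ℝ) (y : E) =>
        (BoundedContinuousFunction.mkOfCompact ⟨fun σ => f σ • y, by fun_prop⟩ : Icc a b →ᵇ E))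
      (fun _ _ _ => by ext; simp [add_smul]) (fun _ _ _ => by ext; simp [mul_smul])
      (fun _ _ _ => by ext; simp) (fun c _ _ => by ext; simp [smul_comm _ c])) 1
    (fun f y => by
      refine (BoundedContinuousFunction.norm_le (by positivity)).2 fun σ => ?_
      refine (norm_smul_le (f σ) y).trans ?_
      rw [one_mul]
      gcongr
      exact f.norm_coe_le_norm σ)

@[simp] theorem mulPath_apply (f : Icc a b →ᵇ ℝ) (y : E) (σ : Icc a b) :
    mulPath f y σ = f σ • y := rfl

/-- The path `τ ↦ c (τ - t)`. -/
def timePath (a b : ℝ) (c t : ℝ) : Icc a b →ᵇ ℝ :=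
  BoundedContinuousFunction.mkOfCompact ⟨fun σ => c * ((σ : ℝ) - t), by fun_prop⟩

@[simp] theorem timePath_apply (c t : ℝ) (σ : Icc a b) : timePath a b c t σ = c * (σ - t) := rfl

theorem continuous_timePath (c : ℝ) : Continuous fun t => timePath a b c t := by
  refine (LipschitzWith.of_dist_le_mul (K := Real.nnabs c) fun t t' => ?_).continuous
  refine (BoundedContinuousFunction.dist_le (by positivity)).2 fun σ => ?_
  rw [Real.dist_eq, Real.dist_eq, timePath_apply, timePath_apply, Real.coe_nnabs, ← abs_mul,
    ← abs_neg]
  exact le_of_eq (by ring_nf)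

/-- The free motion `(x + (τ - t) v, η - f(τ) ξ)`. -/
def freePath (f₁ f₂ : Icc a b →ᵇ ℝ) :
    ((E × E) × (E × E)) →L[ℝ] (Icc a b →ᵇ E) × (Icc a b →ᵇ E) :=
  ((mulPath (BoundedContinuousFunction.const _ 1)).comp
        ((ContinuousLinearMap.fst ℝ E E).comp (ContinuousLinearMap.fst ℝ (E × E) (E × E))) +
      (mulPath f₁).comp
        ((ContinuousLinearMap.snd ℝ E E).comp (ContinuousLinearMap.fst ℝ (E × E) (E × E)))).prod
    ((mulPath (BoundedContinuousFunction.const _ 1)).comp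
        ((ContinuousLinearMap.snd ℝ E E).comp (ContinuousLinearMap.snd ℝ (E × E) (E × E))) -
      (mulPath f₂).comp
        ((ContinuousLinearMap.fst ℝ E E).comp (ContinuousLinearMap.snd ℝ (E × E) (E × E))))

theorem freePath_apply (f₁ f₂ : Icc a b →ᵇ ℝ) (w : (E × E) × (E × E)) :
    freePath f₁ f₂ w = (mulPath (BoundedContinuousFunction.const _ 1) w.1.1 + mulPath f₁ w.1.2,
      mulPath (BoundedContinuousFunction.const _ 1) w.2.2 - mulPath f₂ w.2.1) := rfl

theorem freePath_apply_fst (f₁ f₂ : Icc a b →ᵇ ℝ) (w : (E × E) × (E × E)) (σ : Icc a b) :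
    (freePath f₁ f₂ w).1 σ = w.1.1 + f₁ σ • w.1.2 := by
  simp [freePath_apply]

theorem freePath_apply_snd (f₁ f₂ : Icc a b →ᵇ ℝ) (w : (E × E) × (E × E)) (σ : Icc a b) :
    (freePath f₁ f₂ w).2 σ = w.2.2 - f₂ σ • w.2.1 := by
  simp [freePath_apply]

theorem norm_freePath_le {f₁ f₂ : Icc a b →ᵇ ℝ} (h₁ : ‖f₁‖ ≤ 1) (h₂ : ‖f₂‖ ≤ 1) :
    ‖(freePath f₁ f₂ : ((E × E) × (E × E)) →L[ℝ] _)‖ ≤ 2 := by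
  refine ContinuousLinearMap.opNorm_le_bound _ (by norm_num) fun w => ?_
  have hx : ‖w.1.1‖ ≤ ‖w‖ := (norm_fst_le w.1).trans (norm_fst_le w)
  have hv : ‖w.1.2‖ ≤ ‖w‖ := (norm_snd_le w.1).trans (norm_fst_le w)
  have hξ : ‖w.2.1‖ ≤ ‖w‖ := (norm_fst_le w.2).trans (norm_snd_le w)
  have hη : ‖w.2.2‖ ≤ ‖w‖ := (norm_snd_le w.2).trans (norm_snd_le w)
  have hf₁ : ∀ σ, |f₁ σ| ≤ 1 := fun σ => (f₁.norm_coe_le_norm σ).trans h₁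
  have hf₂ : ∀ σ, |f₂ σ| ≤ 1 := fun σ => (f₂.norm_coe_le_norm σ).trans h₂
  refine norm_prod_le_iff.2 ⟨?_, ?_⟩
  · refine (BoundedContinuousFunction.norm_le (by positivity)).2 fun σ => ?_
    rw [freePath_apply_fst]
    refine (norm_add_le _ _).trans ?_
    rw [norm_smul, Real.norm_eq_abs]
    nlinarith [hf₁ σ, norm_nonneg w.1.2, norm_nonneg w]
  · refine (BoundedContinuousFunction.norm_le (by positivity)).2 fun σ => ?_
    rw [freePath_apply_snd]
    refine (norm_sub_le _ _).trans ?_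
    rw [norm_smul, Real.norm_eq_abs]
    nlinarith [hf₂ σ, norm_nonneg w.2.1, norm_nonneg w]

variable (hab : a ≤ b)

theorem continuous_systemMap {g : C(Icc a b × E, E)} :
    Continuous fun q : (Icc a b × Icc a b) × ((Icc a b →ᵇ E) × (Icc a b →ᵇ E)) =>
      systemMap hab g q.1.1 q.1.2 q.2 := by
  have hf : ∀ c c' : ℝ, Continuous (force g c c') := fun c c' => by
    have h : ∀ e : ℝ, Continuous fun X : (Icc a b →ᵇ E) × (Icc a b →ᵇ E) =>
        nemytskii g (shiftPath e X) := fun e =>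
      (continuous_nemytskii g).comp (ContinuousLinearMap.continuous _)
    exact ((h _).const_smul c).add ((h _).const_smul c')
  have hp := continuous_primitive (E := E) hab
  refine Continuous.prodMk ?_ ?_
  · exact hp.comp ((by fun_prop : Continuous fun q : (Icc a b × Icc a b) ×
      ((Icc a b →ᵇ E) × (Icc a b →ᵇ E)) => q.1.1).prodMk (hp.comp
        ((by fun_prop : Continuous fun q : (Icc a b × Icc a b) ×
          ((Icc a b →ᵇ E) × (Icc a b →ᵇ E)) => q.1.1).prodMk ((hf _ _).comp continuous_snd))))
  · exact hp.comp ((by fun_prop : Continuous fun q : (Icc a b × Icc a b) ×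
      ((Icc a b →ᵇ E) × (Icc a b →ᵇ E)) => q.1.2).prodMk (hp.comp
        ((by fun_prop : Continuous fun q : (Icc a b × Icc a b) ×
          ((Icc a b →ᵇ E) × (Icc a b →ᵇ E)) => q.1.2).prodMk ((hf _ _).comp continuous_snd))))

theorem fderiv_systemMap_apply {g : C(Icc a b × E, E)}
    (hg : SmoothFiber 1 fun σ y => g (σ, y)) (t s : Icc a b)
    (X Y : (Icc a b →ᵇ E) × (Icc a b →ᵇ E)) :
    fderiv ℝ (systemMap hab g t s) X Y =
      (primitive hab t (primitive hab t (fderiv ℝ (force g (-(1 / 2)) (-(1 / 2))) X Y)),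
        primitive hab s (primitive hab s (fderiv ℝ (force g 1 (-1)) X Y))) := by
  have hd : ∀ c c' : ℝ, HasFDerivAt (force g c c') (fderiv ℝ (force g c c') X) X := fun c c' =>
    (((contDiff_force hg c c').differentiable (by norm_num)) X).hasFDerivAt
  have h1 := ((primitive hab t).comp (primitive hab t)).hasFDerivAt.comp X
    (hd (-(1 / 2)) (-(1 / 2)))
  have h2 := ((primitive hab s).comp (primitive hab s)).hasFDerivAt.comp X (hd 1 (-1))
  have h3 : HasFDerivAt (systemMap hab g t s) _ X := h1.prodMk h2
  rw [h3.fderiv]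
  rfl

theorem continuous_fderiv_systemMap {g : C(Icc a b × E, E)}
    (hg : SmoothFiber 1 fun σ y => g (σ, y)) (Y : (Icc a b →ᵇ E) × (Icc a b →ᵇ E)) :
    Continuous fun q : (Icc a b × Icc a b) × ((Icc a b →ᵇ E) × (Icc a b →ᵇ E)) =>
      fderiv ℝ (systemMap hab g q.1.1 q.1.2) q.2 Y := by
  simp only [fderiv_systemMap_apply hab hg]
  have hf : ∀ c c' : ℝ, Continuous fun X => fderiv ℝ (force g c c') X Y := fun c c' =>
    ((contDiff_force hg c c').continuous_fderiv (by norm_num)).clm_apply continuous_const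
  have hp := continuous_primitive (E := E) hab
  refine Continuous.prodMk ?_ ?_
  · exact hp.comp ((by fun_prop : Continuous fun q : (Icc a b × Icc a b) ×
      ((Icc a b →ᵇ E) × (Icc a b →ᵇ E)) => q.1.1).prodMk (hp.comp
        ((by fun_prop : Continuous fun q : (Icc a b × Icc a b) ×
          ((Icc a b →ᵇ E) × (Icc a b →ᵇ E)) => q.1.1).prodMk ((hf _ _).comp continuous_snd))))
  · exact hp.comp ((by fun_prop : Continuous fun q : (Icc a b × Icc a b) ×
      ((Icc a b →ᵇ E) × (Icc a b →ᵇ E)) => q.1.2).prodMk (hp.comp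
        ((by fun_prop : Continuous fun q : (Icc a b × Icc a b) ×
          ((Icc a b →ᵇ E) × (Icc a b →ᵇ E)) => q.1.2).prodMk ((hf _ _).comp continuous_snd))))

/-- The bicharacteristic `(x, l)` with data `w = ((x, v), (ξ, l))`: position and velocity at time
`t`, dual variables at time `s`. -/
def bichar {g : C(Icc a b × E, E)} (hG : ∀ t s, LipschitzWith (1 / 2) (systemMap hab g t s))
    (t s : Icc a b) (w : (E × E) × (E × E)) : (Icc a b →ᵇ E) × (Icc a b →ᵇ E) :=
  (idSubHomeomorph (hG t s)).symm (freePath (timePath a b 1 t) (timePath a b 1 s) w)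

variable {g : C(Icc a b × E, E)} (hG : ∀ t s, LipschitzWith (1 / 2) (systemMap hab g t s))

theorem bichar_eq (t s : Icc a b) (w : (E × E) × (E × E)) :
    bichar hab hG t s w = freePath (timePath a b 1 t) (timePath a b 1 s) w
      + systemMap hab g t s (bichar hab hG t s w) :=
  idSubHomeomorph_symm_eq (hG t s) _

theorem eq_bichar {t s : Icc a b} {w : (E × E) × (E × E)} {X : (Icc a b →ᵇ E) × (Icc a b →ᵇ E)}
    (hX : X = freePath (timePath a b 1 t) (timePath a b 1 s) w + systemMap hab g t s X) :
    X = bichar hab hG t s w :=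
  eq_idSubHomeomorph_symm (hG t s) hX

theorem contDiff_bichar {p : ℕ} (hp : 1 ≤ p) (hg : SmoothFiber p fun σ y => g (σ, y))
    (t s : Icc a b) : ContDiff ℝ p (bichar hab hG t s) := by
  have h0 : ContDiff ℝ p (freePath (timePath a b 1 t) (timePath a b 1 s) :
      ((E × E) × (E × E)) →L[ℝ] (Icc a b →ᵇ E) × (Icc a b →ᵇ E)) := ContinuousLinearMap.contDiff _
  have h1 := (contDiff_idSubHomeomorph_symm (hG t s) hp (contDiff_systemMap hab hg t s)).comp h0
  exact h1

theorem continuous_freePath :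
    Continuous fun q : (Icc a b × Icc a b) × ((E × E) × (E × E)) =>
      freePath (timePath a b 1 q.1.1) (timePath a b 1 q.1.2) q.2 := by
  simp only [freePath_apply]
  have h := continuous_timePath (a := a) (b := b) 1
  fun_prop

theorem continuous_bichar :
    Continuous fun q : (Icc a b × Icc a b) × ((E × E) × (E × E)) =>
      bichar hab hG q.1.1 q.1.2 q.2 := by
  have hc : ∀ Y, Continuous fun q : (Icc a b × Icc a b) × ((E × E) × (E × E)) =>
      systemMap hab g q.1.1 q.1.2 Y := fun Y => by
    have h2 : Continuous fun q : (Icc a b × Icc a b) × ((E × E) × (E × E)) => (q.1, Y) := by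
      fun_prop
    have h3 := (continuous_systemMap hab (g := g)).comp h2
    exact h3
  exact continuous_of_fixedPoint (fun q => hG q.1.1 q.1.2) continuous_freePath hc
    (fun q => bichar_eq hab hG q.1.1 q.1.2 q.2)

/-- In a fixed direction the derivative solves the linearized fixed point equation, which is again a
contraction with constant 1/2, so the continuity of parametrized fixed points applies. Finite
dimension upgrades this to continuity in operator norm. -/
theorem continuous_fderiv_bichar [FiniteDimensional ℝ E]
    (hg : SmoothFiber 1 fun σ y => g (σ, y)) :
    Continuous fun q : (Icc a b × Icc a b) × ((E × E) × (E × E)) =>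
      fderiv ℝ (bichar hab hG q.1.1 q.1.2) q.2 := by
  rw [continuous_clm_apply]
  intro h
  have hy : Continuous fun q : (Icc a b × Icc a b) × ((E × E) × (E × E)) =>
      freePath (timePath a b 1 q.1.1) (timePath a b 1 q.1.2) h := by
    have h2 : Continuous fun q : (Icc a b × Icc a b) × ((E × E) × (E × E)) => (q.1, h) := by
      fun_prop
    have h3 := (continuous_freePath (a := a) (b := b) (E := E)).comp h2
    exact h3
  have hc : ∀ Y, Continuous fun q : (Icc a b × Icc a b) × ((E × E) × (E × E)) =>
      fderiv ℝ (systemMap hab g q.1.1 q.1.2) (bichar hab hG q.1.1 q.1.2 q.2) Y := fun Y => by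
    have h3 := (continuous_fderiv_systemMap hab hg Y).comp
      (continuous_fst.prodMk (continuous_bichar hab hG))
    exact h3
  have hL : ∀ q : (Icc a b × Icc a b) × ((E × E) × (E × E)), LipschitzWith (1 / 2)
      (fun Y => fderiv ℝ (systemMap hab g q.1.1 q.1.2) (bichar hab hG q.1.1 q.1.2 q.2) Y) :=
    fun q => LipschitzWith.weaken
      (fderiv ℝ (systemMap hab g q.1.1 q.1.2) (bichar hab hG q.1.1 q.1.2 q.2)).lipschitz
      (norm_fderiv_le_of_lipschitz ℝ (hG q.1.1 q.1.2))
  have hX : ∀ q : (Icc a b × Icc a b) × ((E × E) × (E × E)),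
      fderiv ℝ (bichar hab hG q.1.1 q.1.2) q.2 h
        = freePath (timePath a b 1 q.1.1) (timePath a b 1 q.1.2) h
          + fderiv ℝ (systemMap hab g q.1.1 q.1.2) (bichar hab hG q.1.1 q.1.2 q.2)
            (fderiv ℝ (bichar hab hG q.1.1 q.1.2) q.2 h) := by
    intro q
    have hd := (((contDiff_systemMap hab hg q.1.1 q.1.2).differentiable (by norm_num))
      (bichar hab hG q.1.1 q.1.2 q.2)).hasFDerivAt
    have hb0 : Differentiable ℝ (bichar hab hG q.1.1 q.1.2) :=
      (contDiff_bichar hab hG le_rfl hg q.1.1 q.1.2).differentiable (by norm_num)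
    have hb := (hb0 q.2).hasFDerivAt
    have h1 := HasFDerivAt.comp q.2 hd hb
    have h0 : HasFDerivAt (freePath (E := E) (timePath a b 1 q.1.1) (timePath a b 1 q.1.2))
      (freePath (E := E) (timePath a b 1 q.1.1) (timePath a b 1 q.1.2)) q.2 :=
      ContinuousLinearMap.hasFDerivAt _
    have h2 := h0.add h1
    have h3 : bichar hab hG q.1.1 q.1.2 = ⇑(freePath (E := E) (timePath a b 1 q.1.1)
        (timePath a b 1 q.1.2)) + systemMap hab g q.1.1 q.1.2 ∘ bichar hab hG q.1.1 q.1.2 :=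
      funext fun w => bichar_eq hab hG q.1.1 q.1.2 w
    rw [← h3] at h2
    exact congrArg (fun A => A h) h2.fderiv
  exact continuous_of_fixedPoint hL hy hc hX

end Bicharacteristics

/-! ### The bicharacteristic system as a differential system -/

noncomputable section BicharacteristicODE

variable {E : Type} [NormedAddCommGroup E] [NormedSpace ℝ E] [CompleteSpace E] {a b : ℝ}
  (hab : a ≤ b)

theorem eq_add_primitive {u U : Icc a b →ᵇ E}
    (h : ∀ τ : Icc a b, HasDerivWithinAt (IccExtend hab u) (U τ) (Icc a b) τ) (t τ : Icc a b) :
    u τ = u t + primitive hab t U τ := by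
  have hd : ∀ x ∈ Icc a b, HasDerivWithinAt
      (fun τ => IccExtend hab u τ - IccExtend hab (primitive hab t U) τ) 0 (Icc a b) x := by
    intro x hx
    have := (h ⟨x, hx⟩).sub (hasDerivWithinAt_primitive hab t U ⟨x, hx⟩)
    rwa [sub_self] at this
  have := (convex_Icc a b).norm_image_sub_le_of_norm_hasDerivWithin_le (C := 0) hd
    (by simp) t.2 τ.2
  rw [zero_mul, norm_le_zero_iff] at this
  simp only [IccExtend_val, primitive_self, sub_zero] at this
  rw [sub_eq_zero, sub_eq_iff_eq_add] at this
  exact this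

theorem primitive_mulPath_one (t : Icc a b) (y : E) :
    primitive hab t (mulPath (BoundedContinuousFunction.const _ 1) y)
      = mulPath (timePath a b 1 t) y := by
  ext τ
  rw [primitive_apply]
  have : ∀ σ, IccExtend hab (mulPath (BoundedContinuousFunction.const (Icc a b) (1 : ℝ)) y) σ = y :=
    fun σ => by simp [IccExtend]
  simp [this]

/-- The bicharacteristic system `x' = v`, `v' = a_l`, `ξ' = - a_x`, `l' = - ξ`. -/
structure IsBichar (g : C(Icc a b × E, E)) (x v ξ l : Icc a b →ᵇ E) : Prop where
  pos : ∀ τ : Icc a b, HasDerivWithinAt (IccExtend hab x) (v τ) (Icc a b) τ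
  vel : ∀ τ : Icc a b, HasDerivWithinAt (IccExtend hab v)
    (force g (-(1 / 2)) (-(1 / 2)) (x, l) τ) (Icc a b) τ
  mom : ∀ τ : Icc a b, HasDerivWithinAt (IccExtend hab ξ) (-force g 1 (-1) (x, l) τ) (Icc a b) τ
  dual : ∀ τ : Icc a b, HasDerivWithinAt (IccExtend hab l) (-ξ τ) (Icc a b) τ

variable {g : C(Icc a b × E, E)} (hG : ∀ t s, LipschitzWith (1 / 2) (systemMap hab g t s))

/-- The velocity along the bicharacteristic `bichar`. -/
def bicharVel (t s : Icc a b) (w : (E × E) × (E × E)) : Icc a b →ᵇ E :=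
  mulPath (BoundedContinuousFunction.const _ 1) w.1.2
    + primitive hab t (force g (-(1 / 2)) (-(1 / 2)) (bichar hab hG t s w))

/-- The dual variable of the position along the bicharacteristic `bichar`. -/
def bicharMom (t s : Icc a b) (w : (E × E) × (E × E)) : Icc a b →ᵇ E :=
  mulPath (BoundedContinuousFunction.const _ 1) w.2.1
    - primitive hab s (force g 1 (-1) (bichar hab hG t s w))

theorem bicharVel_apply (t s : Icc a b) (w : (E × E) × (E × E)) (τ : Icc a b) :
    bicharVel hab hG t s w τ = w.1.2
      + primitive hab t (force g (-(1 / 2)) (-(1 / 2)) (bichar hab hG t s w)) τ := by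
  simp [bicharVel]

theorem bicharMom_apply (t s : Icc a b) (w : (E × E) × (E × E)) (τ : Icc a b) :
    bicharMom hab hG t s w τ = w.2.1
      - primitive hab s (force g 1 (-1) (bichar hab hG t s w)) τ := by
  simp [bicharMom]

theorem bichar_fst_apply (t s : Icc a b) (w : (E × E) × (E × E)) (τ : Icc a b) :
    (bichar hab hG t s w).1 τ = w.1.1 + ((τ : ℝ) - t) • w.1.2
      + primitive hab t (primitive hab t
          (force g (-(1 / 2)) (-(1 / 2)) (bichar hab hG t s w))) τ := by
  conv_lhs => rw [bichar_eq]
  rw [Prod.fst_add, BoundedContinuousFunction.add_apply, freePath_apply_fst, timePath_apply, one_mul]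
  rfl

theorem bichar_snd_apply (t s : Icc a b) (w : (E × E) × (E × E)) (τ : Icc a b) :
    (bichar hab hG t s w).2 τ = w.2.2 - ((τ : ℝ) - s) • w.2.1
      + primitive hab s (primitive hab s (force g 1 (-1) (bichar hab hG t s w))) τ := by
  conv_lhs => rw [bichar_eq]
  rw [Prod.snd_add, BoundedContinuousFunction.add_apply, freePath_apply_snd, timePath_apply, one_mul]
  rfl

theorem bichar_fst_eq (t s : Icc a b) (w : (E × E) × (E × E)) :
    (bichar hab hG t s w).1 = mulPath (BoundedContinuousFunction.const _ 1) w.1.1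
      + primitive hab t (bicharVel hab hG t s w) := by
  ext τ
  rw [bicharVel, map_add, primitive_mulPath_one, bichar_fst_apply]
  simp [add_assoc]

theorem bichar_snd_eq (t s : Icc a b) (w : (E × E) × (E × E)) :
    (bichar hab hG t s w).2 = mulPath (BoundedContinuousFunction.const _ 1) w.2.2
      - primitive hab s (bicharMom hab hG t s w) := by
  ext τ
  rw [bicharMom, map_sub, primitive_mulPath_one, bichar_snd_apply]
  simp
  abel

theorem hasDerivWithinAt_const_add_primitive (y : E) (t : Icc a b) (u : Icc a b →ᵇ E)
    (τ : Icc a b) :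
    HasDerivWithinAt (IccExtend hab (mulPath (BoundedContinuousFunction.const _ 1) y
      + primitive hab t u : Icc a b →ᵇ E)) (u τ) (Icc a b) τ := by
  have h := (hasDerivWithinAt_primitive hab t u τ).const_add y
  refine h.congr (fun σ _ => ?_) ?_ <;> simp [IccExtend]

theorem isBichar_bichar (t s : Icc a b) (w : (E × E) × (E × E)) :
    IsBichar hab g (bichar hab hG t s w).1 (bicharVel hab hG t s w) (bicharMom hab hG t s w)
      (bichar hab hG t s w).2 where
  pos τ := by
    rw [bichar_fst_eq]
    exact hasDerivWithinAt_const_add_primitive hab _ t _ τ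
  vel τ := hasDerivWithinAt_const_add_primitive hab _ t _ τ
  mom τ := by
    have := hasDerivWithinAt_const_add_primitive hab w.2.1 s
      (-force g 1 (-1) (bichar hab hG t s w)) τ
    rwa [map_neg, ← sub_eq_add_neg] at this
  dual τ := by
    have := hasDerivWithinAt_const_add_primitive hab w.2.2 s (-bicharMom hab hG t s w) τ
    rwa [map_neg, ← sub_eq_add_neg, ← bichar_snd_eq] at this

variable {hab}

theorem IsBichar.vel_eq {x v ξ l : Icc a b →ᵇ E} (h : IsBichar hab g x v ξ l) (t : Icc a b) :
    v = mulPath (BoundedContinuousFunction.const _ 1) (v t)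
      + primitive hab t (force g (-(1 / 2)) (-(1 / 2)) (x, l)) := by
  ext τ
  rw [eq_add_primitive hab h.vel t τ]
  simp

theorem IsBichar.mom_eq {x v ξ l : Icc a b →ᵇ E} (h : IsBichar hab g x v ξ l) (s : Icc a b) :
    ξ = mulPath (BoundedContinuousFunction.const _ 1) (ξ s)
      - primitive hab s (force g 1 (-1) (x, l)) := by
  ext τ
  rw [eq_add_primitive hab (U := -force g 1 (-1) (x, l)) h.mom s τ]
  simp [sub_eq_add_neg]

/-- A trajectory is the fixed point attached to its own data at any pair of times. This allows the
base times to slide along a given trajectory, which is how the time derivatives of the phase are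
computed. -/
theorem IsBichar.eq_bichar {x v ξ l : Icc a b →ᵇ E} (h : IsBichar hab g x v ξ l)
    (t s : Icc a b) : (x, l) = bichar hab hG t s ((x t, v t), (ξ s, l s)) := by
  apply _root_.eq_bichar
  ext τ
  · rw [Prod.fst_add, BoundedContinuousFunction.add_apply, freePath_apply_fst]
    have h1 := eq_add_primitive hab h.pos t τ
    rw [h.vel_eq t, map_add, primitive_mulPath_one] at h1
    simpa [systemMap, add_assoc] using h1
  · rw [Prod.snd_add, BoundedContinuousFunction.add_apply, freePath_apply_snd]
    have h1 := eq_add_primitive hab (U := -ξ) h.dual s τ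
    rw [map_neg, h.mom_eq s, map_sub, primitive_mulPath_one] at h1
    simp only [BoundedContinuousFunction.neg_apply, BoundedContinuousFunction.sub_apply,
      mulPath_apply] at h1
    simp only [systemMap]
    rw [h1]
    abel

theorem IsBichar.eq_bicharVel {x v ξ l : Icc a b →ᵇ E} (h : IsBichar hab g x v ξ l)
    (t s : Icc a b) : v = bicharVel hab hG t s ((x t, v t), (ξ s, l s)) := by
  rw [bicharVel, ← h.eq_bichar hG t s]
  exact h.vel_eq t

end BicharacteristicODE

/-! ### Differentiability from partial derivatives, and a maximum principle for transport -/

noncomputable section CalculusOnProducts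

variable {E₁ E₂ F : Type} [NormedAddCommGroup E₁] [NormedSpace ℝ E₁]
  [NormedAddCommGroup E₂] [NormedSpace ℝ E₂] [NormedAddCommGroup F] [NormedSpace ℝ F]

/-- A function on a product of sets, the first one convex, is differentiable at a point if it has
partial derivatives and the first one is continuous. -/
theorem hasFDerivWithinAt_of_partial {f : E₁ × E₂ → F} {s₁ : Set E₁} {s₂ : Set E₂}
    (hs₁ : Convex ℝ s₁) {f₁ : E₁ × E₂ → E₁ →L[ℝ] F} {f₂ : E₂ →L[ℝ] F} {x : E₁} {y : E₂}
    (hx : x ∈ s₁)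
    (h₁ : ∀ x ∈ s₁, ∀ y ∈ s₂, HasFDerivWithinAt (fun x => f (x, y)) (f₁ (x, y)) s₁ x)
    (hc : ContinuousWithinAt f₁ (s₁ ×ˢ s₂) (x, y))
    (h₂ : HasFDerivWithinAt (fun y => f (x, y)) f₂ s₂ y) :
    HasFDerivWithinAt f ((f₁ (x, y)).coprod f₂) (s₁ ×ˢ s₂) (x, y) := by
  rw [hasFDerivWithinAt_iff_isLittleO] at h₂ ⊢
  rw [Asymptotics.isLittleO_iff] at h₂ ⊢
  intro c hc0
  have e₂ := h₂ (half_pos hc0)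
  have e₂' : ∀ᶠ q : E₁ × E₂ in 𝓝[s₁ ×ˢ s₂] (x, y),
      ‖f (x, q.2) - f (x, y) - f₂ (q.2 - y)‖ ≤ c / 2 * ‖q.2 - y‖ := by
    rw [nhdsWithin_prod_eq]
    exact tendsto_snd.eventually e₂
  obtain ⟨δ, hδ, hball⟩ := Metric.continuousWithinAt_iff.1 hc (c / 2) (half_pos hc0)
  have e₁ : ∀ᶠ q : E₁ × E₂ in 𝓝[s₁ ×ˢ s₂] (x, y), q ∈ Metric.ball (x, y) δ :=
    nhdsWithin_le_nhds (Metric.ball_mem_nhds _ hδ)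
  filter_upwards [e₁, e₂', self_mem_nhdsWithin] with q hq1 hq2 hqs
  have hqx : dist q.1 x < δ := (le_max_left _ _).trans_lt (Metric.mem_ball.1 hq1)
  have hqy : dist q.2 y < δ := (le_max_right _ _).trans_lt (Metric.mem_ball.1 hq1)
  have key := ((hs₁.inter (convex_ball x δ))).norm_image_sub_le_of_norm_hasFDerivWithin_le'
    (f := fun x => f (x, q.2)) (f' := fun x => f₁ (x, q.2)) (φ := f₁ (x, y)) (C := c / 2)
    (fun z hz => (h₁ z hz.1 q.2 hqs.2).mono inter_subset_left) (fun z hz => by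
      have := hball (x := (z, q.2)) ⟨hz.1, hqs.2⟩ (max_lt (Metric.mem_ball.1 hz.2) hqy)
      rw [dist_eq_norm] at this
      exact this.le) ⟨hx, Metric.mem_ball_self hδ⟩ ⟨hqs.1, Metric.mem_ball.2 hqx⟩
  have hsplit : f q - f (x, y) - ((f₁ (x, y)).coprod f₂) (q - (x, y))
      = (f (q.1, q.2) - f (x, q.2) - f₁ (x, y) (q.1 - x))
        + (f (x, q.2) - f (x, y) - f₂ (q.2 - y)) := by
    simp only [ContinuousLinearMap.coprod_apply, Prod.fst_sub, Prod.snd_sub]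
    abel
  rw [hsplit]
  have n1 : ‖q.1 - x‖ ≤ ‖q - (x, y)‖ := norm_fst_le (q - (x, y))
  have n2 : ‖q.2 - y‖ ≤ ‖q - (x, y)‖ := norm_snd_le (q - (x, y))
  calc _ ≤ c / 2 * ‖q.1 - x‖ + c / 2 * ‖q.2 - y‖ := (norm_add_le _ _).trans (add_le_add key hq2)
    _ ≤ c / 2 * ‖q - (x, y)‖ + c / 2 * ‖q - (x, y)‖ := by gcongr
    _ = c * ‖q - (x, y)‖ := by ring

theorem contDiffOn_succ_of_hasFDerivWithinAt {n : ℕ} {f : E₁ → F} {f' : E₁ → E₁ →L[ℝ] F}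
    {s : Set E₁} (hs : UniqueDiffOn ℝ s) (h : ∀ x ∈ s, HasFDerivWithinAt f (f' x) s x)
    (h' : ContDiffOn ℝ n f' s) : ContDiffOn ℝ (n + 1) f s := by
  rw [contDiffOn_succ_iff_fderivWithin hs]
  refine ⟨fun x hx => (h x hx).differentiableWithinAt, by simp, ?_⟩
  exact h'.congr fun x hx => (h x hx).fderivWithin (hs x hx)

/-- A function vanishing at the initial time whose time derivative is controlled by its spatial
derivative is nonpositive. -/
theorem nonpos_of_transport [ProperSpace F] {u : ℝ × F → ℝ} {u' : ℝ × F → ℝ × F →L[ℝ] ℝ}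
    {a b C : ℝ} (hC : 0 ≤ C)
    (hu : ∀ q ∈ Icc a b ×ˢ (univ : Set F), HasFDerivWithinAt u (u' q) (Icc a b ×ˢ univ) q)
    (hu' : ∀ q ∈ Icc a b ×ˢ (univ : Set F),
      |u' q (1, 0)| ≤ C * ‖(u' q).comp (ContinuousLinearMap.inr ℝ ℝ F)‖)
    (h0 : ∀ y, u (a, y) = 0) : ∀ t ∈ Icc a b, ∀ y, u (t, y) ≤ 0 := by
  intro t₁ ht₁ y₀
  have key : ∀ δ > 0, u (t₁, y₀) ≤ δ * (t₁ - a) := by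
    intro δ hδ
    -- A compact cone narrowing at speed 2C up to its vertex (t₁, y₀). The function u - δ(t - a) is
    -- maximized on it.
    set K : Set (ℝ × F) := {q | q.1 ∈ Icc a t₁ ∧ ‖q.2 - y₀‖ ≤ 2 * C * (t₁ - q.1)} with hK
    have hKsub : K ⊆ Icc a b ×ˢ univ := fun q hq =>
      ⟨⟨hq.1.1, hq.1.2.trans ht₁.2⟩, mem_univ _⟩
    have hKc : IsCompact K := by
      refine (isCompact_Icc.prod (isCompact_closedBall y₀ (2 * C * (t₁ - a)))).of_isClosed_subset
        ?_ ?_ (s := Icc a t₁ ×ˢ Metric.closedBall y₀ (2 * C * (t₁ - a)))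
      · exact (isClosed_Icc.preimage continuous_fst).inter
          (isClosed_le (f := fun q : ℝ × F => ‖q.2 - y₀‖)
            (g := fun q : ℝ × F => 2 * C * (t₁ - q.1)) (by fun_prop) (by fun_prop))
      · intro q hq
        refine ⟨hq.1, ?_⟩
        rw [Metric.mem_closedBall, dist_eq_norm]
        refine hq.2.trans ?_
        gcongr
        exact hq.1.1
    have hf : ∀ q ∈ K, HasFDerivWithinAt (fun q => u q - δ * (q.1 - a))
        (u' q - δ • ContinuousLinearMap.fst ℝ ℝ F) K q := fun q hq => by
      refine ((hu q (hKsub hq)).mono hKsub).sub ?_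
      exact (((ContinuousLinearMap.fst ℝ ℝ F).hasFDerivWithinAt).sub_const a).const_mul δ
    have hmem : (t₁, y₀) ∈ K := ⟨⟨ht₁.1, le_rfl⟩, by simp⟩
    obtain ⟨q, hq, hmax⟩ := hKc.exists_isMaxOn ⟨_, hmem⟩
      (fun q hq => (hf q hq).continuousWithinAt)
    have hle := hmax hmem
    simp only [mem_ofPred_eq] at hle
    rcases hq.1.1.eq_or_lt with h | h
    · have hq0 : u q = 0 := by
        have := h0 q.2
        rw [h] at this
        exact this
      rw [hq0, ← h] at hle
      linarith
    · exfalso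
      set A := (u' q).comp (ContinuousLinearMap.inr ℝ ℝ F) with hA
      -- The operator norm need not be attained, so w only norms A up to a factor 2; this is why the
      -- cone has speed 2C and not C.
      obtain ⟨w, hw1, hw2⟩ : ∃ w : F, ‖w‖ ≤ 1 ∧ ‖A‖ / 2 ≤ A w := by
        rcases eq_or_ne ‖A‖ 0 with h' | h'
        · exact ⟨0, by simp, by simp [h']⟩
        · have hpos : 0 < ‖A‖ := lt_of_le_of_ne (norm_nonneg _) h'.symm
          obtain ⟨w, hw1, hw2⟩ := A.exists_lt_apply_of_lt_opNorm (half_lt_self hpos)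
          rcases le_total 0 (A w) with h'' | h''
          · rw [Real.norm_of_nonneg h''] at hw2
            exact ⟨w, hw1.le, hw2.le⟩
          · rw [Real.norm_of_nonpos h''] at hw2
            exact ⟨-w, by rw [norm_neg]; exact hw1.le, by rw [map_neg]; exact hw2.le⟩
      -- The vector e goes backward in time and outward at the speed of the cone, so the segment
      -- from q to q + e stays in the cone. At a maximum after the initial time the derivative along
      -- e is nonpositive, whereas it is a positive multiple of -∂_t u + 2C A w + δ ≥ δ.
      set e : ℝ × F := (q.1 - a) • ((-1 : ℝ), (2 * C) • w) with he
      have hseg : segment ℝ q (q + e) ⊆ K := by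
        rintro _ ⟨α, β, hα, hβ, hαβ, rfl⟩
        have hα' : α = 1 - β := by linarith
        have h1 : (α • q + β • (q + e)).1 = q.1 - β * (q.1 - a) := by
          simp [he, hα']; ring
        have h2 : (α • q + β • (q + e)).2 - y₀
            = (q.2 - y₀) + (β * (q.1 - a) * (2 * C)) • w := by
          simp only [he, hα', Prod.snd_add, Prod.smul_snd]; module
        have hqa : 0 ≤ q.1 - a := by linarith
        refine ⟨⟨?_, ?_⟩, ?_⟩
        · rw [h1]; nlinarith
        · rw [h1]; nlinarith [hq.1.2, mul_nonneg hβ hqa]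
        · rw [h1, h2]
          refine (norm_add_le _ _).trans ?_
          rw [norm_smul, Real.norm_of_nonneg (by positivity)]
          have : β * (q.1 - a) * (2 * C) * ‖w‖ ≤ β * (q.1 - a) * (2 * C) :=
            mul_le_of_le_one_right (by positivity) hw1
          nlinarith [hq.2]
      have hnp := hmax.localize.hasFDerivWithinAt_nonpos (hf q hq)
        (mem_posTangentConeAt_of_segment_subset hseg)
      have hval : (u' q - δ • ContinuousLinearMap.fst ℝ ℝ F) e
          = (q.1 - a) * (-(u' q (1, 0)) + 2 * C * A w + δ) := by
        have h1 : u' q ((-1 : ℝ), (2 * C) • w) = -(u' q (1, 0)) + 2 * C * A w := by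
          have : ((-1 : ℝ), (2 * C) • w) = -((1 : ℝ), (0 : F)) + (2 * C) • ((0 : ℝ), w) := by
            simp
          rw [this, map_add, map_neg, map_smul]
          rfl
        simp only [he, map_smul, sub_apply, smul_apply, h1,
          ContinuousLinearMap.coe_fst', smul_eq_mul]
        ring
      rw [hval] at hnp
      have h3 := (abs_le.1 (hu' q (hKsub hq))).2
      have h4 : 0 < q.1 - a := by linarith
      have h5 : 0 < -(u' q (1, 0)) + 2 * C * A w + δ := by nlinarith
      have := mul_pos h4 h5
      linarith
  refine le_of_forall_pos_le_add fun ε hε => ?_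
  have h1 := key (ε / (t₁ - a + 1)) (by have := ht₁.1; apply div_pos hε; linarith)
  refine h1.trans ?_
  have hp : 0 < t₁ - a + 1 := by linarith [ht₁.1]
  rw [zero_add, div_mul_eq_mul_div, div_le_iff₀ hp]
  nlinarith [ht₁.1]

theorem hasDerivWithinAt_integral_diag [CompleteSpace F] {u : ℝ × ℝ → F} {a b : ℝ}
    (hu : ContinuousOn u (Icc a b ×ˢ Icc a b)) {t : ℝ} (ht : t ∈ Icc a b) :
    HasDerivWithinAt (fun t' => ∫ σ in t..t', u (t', σ)) (u (t, t)) (Icc a b) t := by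
  rw [hasDerivWithinAt_iff_isLittleO, Asymptotics.isLittleO_iff]
  intro c hc
  obtain ⟨δ, hδ, hball⟩ := Metric.continuousWithinAt_iff.1 (hu (t, t) ⟨ht, ht⟩) c hc
  filter_upwards [self_mem_nhdsWithin,
    nhdsWithin_le_nhds (Metric.ball_mem_nhds t hδ)] with t' ht' hd
  rw [intervalIntegral.integral_same, sub_zero]
  have hsub : uIcc t t' ⊆ Icc a b := uIcc_subset_Icc ht ht'
  have hint : IntervalIntegrable (fun σ => u (t', σ)) volume t t' :=
    (hu.comp (by fun_prop : ContinuousOn (fun σ : ℝ => (t', σ)) (uIcc t t'))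
      fun σ hσ => ⟨ht', hsub hσ⟩).intervalIntegrable
  rw [← intervalIntegral.integral_const, ← intervalIntegral.integral_sub hint (by simp)]
  refine intervalIntegral.norm_integral_le_of_norm_le_const fun σ hσ => ?_
  have hσ' : σ ∈ uIcc t t' := uIoc_subset_uIcc hσ
  have := hball (x := (t', σ)) ⟨ht', hsub hσ'⟩ (max_lt (Metric.mem_ball.1 hd) (by
    rw [Real.dist_eq]
    have h1 := abs_sub_left_of_mem_uIcc hσ'
    rw [Metric.mem_ball, Real.dist_eq] at hd
    exact h1.trans_lt hd))
  rw [dist_eq_norm] at this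
  exact this.le

end CalculusOnProducts

/-! ### The action and the gradient of the phase -/

noncomputable section Action

variable {E : Type} [NormedAddCommGroup E] [InnerProductSpace ℝ E] [CompleteSpace E] {a b : ℝ}

/-- The path of the scalar products of two paths. -/
def innerPath : (Icc a b →ᵇ E) →L[ℝ] (Icc a b →ᵇ E) →L[ℝ] (Icc a b →ᵇ ℝ) :=
  LinearMap.mkContinuous₂
    (LinearMap.mk₂ ℝ (fun (u v : Icc a b →ᵇ E) =>
        (BoundedContinuousFunction.mkOfCompact ⟨fun σ => inner ℝ (u σ) (v σ), by fun_prop⟩ :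
          Icc a b →ᵇ ℝ))
      (fun _ _ _ => by ext; simp [inner_add_left]) (fun _ _ _ => by ext; simp [inner_smul_left])
      (fun _ _ _ => by ext; simp [inner_add_right])
      (fun c _ _ => by ext; simp [inner_smul_right])) 1
    (fun u v => by
      refine (BoundedContinuousFunction.norm_le (by positivity)).2 fun σ => ?_
      refine (norm_inner_le_norm (u σ) (v σ)).trans ?_
      rw [one_mul]
      gcongr
      · exact u.norm_coe_le_norm σ
      · exact v.norm_coe_le_norm σ)

@[simp] theorem innerPath_apply (u v : Icc a b →ᵇ E) (σ : Icc a b) :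
    innerPath u v σ = inner ℝ (u σ) (v σ) := rfl

theorem hasDerivWithinAt_innerPath (hab : a ≤ b) {u v u' v' : Icc a b →ᵇ E} {τ : Icc a b}
    (hu : HasDerivWithinAt (IccExtend hab u) (u' τ) (Icc a b) τ)
    (hv : HasDerivWithinAt (IccExtend hab v) (v' τ) (Icc a b) τ) :
    HasDerivWithinAt (IccExtend hab (innerPath u v)) ((innerPath u v' + innerPath u' v) τ)
      (Icc a b) τ := by
  have h := hu.inner ℝ hv
  rw [IccExtend_val, IccExtend_val] at h
  exact h

/-- The symbol `U(x - l/2) - U(x + l/2)` along a pair of paths. -/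
def symbolPath (U : C(Icc a b × E, ℝ)) (X : (Icc a b →ᵇ E) × (Icc a b →ᵇ E)) : Icc a b →ᵇ ℝ :=
  nemytskii U (shiftPath (-(1 / 2)) X) - nemytskii U (shiftPath (1 / 2) X)

theorem symbolPath_apply (U : C(Icc a b × E, ℝ)) (X : (Icc a b →ᵇ E) × (Icc a b →ᵇ E))
    (σ : Icc a b) : symbolPath U X σ = U (σ, X.1 σ - (1 / 2 : ℝ) • X.2 σ)
      - U (σ, X.1 σ + (1 / 2 : ℝ) • X.2 σ) := by
  simp [symbolPath, shiftPath, sub_eq_add_neg]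

/-- With g the gradient of U, the coefficients (1, -1) of `force` give a_x and the coefficients
(-1/2, -1/2) give a_l for a(x, l) = U(x - l/2) - U(x + l/2). -/
theorem hasFDerivAt_symbolPath {U : C(Icc a b × E, ℝ)} {g : C(Icc a b × E, E)}
    (hU : ∀ σ x, HasFDerivAt (fun y => U (σ, y)) (innerSL ℝ (g (σ, x))) x)
    (X : (Icc a b →ᵇ E) × (Icc a b →ᵇ E)) :
    HasFDerivAt (symbolPath U)
      ((innerPath (force g 1 (-1) X)).comp (ContinuousLinearMap.fst ℝ _ _)
        + (innerPath (force g (-(1 / 2)) (-(1 / 2)) X)).comp (ContinuousLinearMap.snd ℝ _ _)) X := by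
  have h := fun e : ℝ => HasFDerivAt.comp X
    (hasFDerivAt_nemytskii U ⟨fun q => innerSL ℝ (g q), by fun_prop⟩ hU (shiftPath e X))
    (shiftPath e).hasFDerivAt
  have h2 := (h (-(1 / 2))).sub (h (1 / 2))
  refine h2.congr_fderiv ?_
  refine ContinuousLinearMap.ext fun Y => ?_
  ext σ
  simp only [shiftPath, force, innerPath_apply, add_apply, sub_apply, smul_apply,
    ContinuousLinearMap.comp_apply, pathApply_apply, nemytskii_apply, ContinuousMap.coe_mk,
    innerSL_apply_apply, ContinuousLinearMap.coe_fst', ContinuousLinearMap.coe_snd',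
    BoundedContinuousFunction.add_apply, BoundedContinuousFunction.sub_apply,
    BoundedContinuousFunction.smul_apply, inner_add_left, inner_add_right, inner_smul_left,
    inner_smul_right, conj_trivial]
  ring

/-- The Lagrangian `⟨l, a_l⟩ - a` along a pair of paths. -/
def lagrangianPath (U : C(Icc a b × E, ℝ)) (g : C(Icc a b × E, E))
    (X : (Icc a b →ᵇ E) × (Icc a b →ᵇ E)) : Icc a b →ᵇ ℝ :=
  innerPath X.2 (force g (-(1 / 2)) (-(1 / 2)) X) - symbolPath U X

variable (hab : a ≤ b) {g : C(Icc a b × E, E)}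
  (hG : ∀ t s, LipschitzWith (1 / 2) (systemMap hab g t s)) (U : C(Icc a b × E, ℝ))

/-- The phase: solution of the eikonal equation constructed from the action. -/
def eikonalPhase (t s : Icc a b) (w : (E × E) × (E × E)) : ℝ :=
  inner ℝ ((bichar hab hG t s w).1 s) w.2.1 + inner ℝ (bicharVel hab hG t s w s) w.2.2
    + primitive hab s (lagrangianPath U g (bichar hab hG t s w)) t

/-- The linear form with coefficients `y`. -/
def dotForm : ((E × E) × (E × E)) →L[ℝ] ((E × E) × (E × E)) →L[ℝ] ℝ :=
  LinearMap.mkContinuous₂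
    (LinearMap.mk₂ ℝ (fun y h : (E × E) × (E × E) =>
      inner ℝ y.1.1 h.1.1 + inner ℝ y.1.2 h.1.2 + inner ℝ y.2.1 h.2.1 + inner ℝ y.2.2 h.2.2)
      (fun _ _ _ => by simp [inner_add_left]; ring)
      (fun _ _ _ => by simp [inner_smul_left]; ring)
      (fun _ _ _ => by simp [inner_add_right]; ring)
      (fun _ _ _ => by simp [inner_smul_right]; ring)) 4
    (fun y h => by
      have key : ∀ u v : E, ‖u‖ ≤ ‖y‖ → ‖v‖ ≤ ‖h‖ → |inner ℝ u v| ≤ ‖y‖ * ‖h‖ :=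
        fun u v hu hv => (abs_real_inner_le_norm u v).trans (by gcongr)
      have h1 := key y.1.1 h.1.1 ((norm_fst_le _).trans (norm_fst_le _))
        ((norm_fst_le _).trans (norm_fst_le _))
      have h2 := key y.1.2 h.1.2 ((norm_snd_le _).trans (norm_fst_le _))
        ((norm_snd_le _).trans (norm_fst_le _))
      have h3 := key y.2.1 h.2.1 ((norm_fst_le _).trans (norm_snd_le _))
        ((norm_fst_le _).trans (norm_snd_le _))
      have h4 := key y.2.2 h.2.2 ((norm_snd_le _).trans (norm_snd_le _))
        ((norm_snd_le _).trans (norm_snd_le _))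
      rw [abs_le] at h1 h2 h3 h4
      simp only [LinearMap.mk₂_apply, Real.norm_eq_abs]
      rw [abs_le]
      constructor <;> linarith)

@[simp] theorem dotForm_apply (y h : (E × E) × (E × E)) : dotForm y h =
    inner ℝ y.1.1 h.1.1 + inner ℝ y.1.2 h.1.2 + inner ℝ y.2.1 h.2.1 + inner ℝ y.2.2 h.2.2 := rfl

/-- The coefficients of the gradient of the phase: dual variables at time `t`, position and
velocity at time `s`. -/
def phaseGradient (t s : Icc a b) (w : (E × E) × (E × E)) : (E × E) × (E × E) :=
  ((bicharMom hab hG t s w t, (bichar hab hG t s w).2 t),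
    ((bichar hab hG t s w).1 s, bicharVel hab hG t s w s))

variable {U}

-- This is the first variation of the action. The variation of the Lagrangian l·a_l - a is l·δ(a_l)
-- - a_x·δx, since the terms in δl cancel; it is also the time derivative of l·δv + ξ·δx along the
-- trajectory. Integrating from s to t, the boundary terms at s cancel the variation of x(s) and
-- v(s) in the first two terms of the phase. What remains is the pairing of ξ(t), l(t) with the
-- variation of z and of x(s), v(s) with the variation of ξ.
set_option maxHeartbeats 1000000 in
theorem hasFDerivAt_eikonalPhase (hg : SmoothFiber 1 fun σ y => g (σ, y))
    (hU : ∀ σ x, HasFDerivAt (fun y => U (σ, y)) (innerSL ℝ (g (σ, x))) x)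
    (t s : Icc a b) (w : (E × E) × (E × E)) :
    HasFDerivAt (eikonalPhase hab hG U t s) (dotForm (phaseGradient hab hG t s w)) w := by
  set B := bichar hab hG t s with hB
  obtain ⟨B', hB'⟩ : ∃ B', HasFDerivAt B B' w :=
    ⟨_, (((contDiff_bichar hab hG le_rfl hg t s).differentiable (by norm_num)) w).hasFDerivAt⟩
  obtain ⟨A', hA'⟩ : ∃ A', HasFDerivAt (fun w => force g (-(1 / 2)) (-(1 / 2)) (B w)) A' w :=
    ⟨_, HasFDerivAt.comp w (((contDiff_force hg (-(1 / 2)) (-(1 / 2))).differentiable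
      (by norm_num)) (B w)).hasFDerivAt hB'⟩
  have hB1 : HasFDerivAt (fun w => (B w).1) ((ContinuousLinearMap.fst ℝ _ _).comp B') w :=
    HasFDerivAt.comp w (ContinuousLinearMap.fst ℝ (Icc a b →ᵇ E) (Icc a b →ᵇ E)).hasFDerivAt hB'
  have hB2 : HasFDerivAt (fun w => (B w).2) ((ContinuousLinearMap.snd ℝ _ _).comp B') w :=
    HasFDerivAt.comp w (ContinuousLinearMap.snd ℝ (Icc a b →ᵇ E) (Icc a b →ᵇ E)).hasFDerivAt hB'
  set one := BoundedContinuousFunction.const (Icc a b) (1 : ℝ)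
  obtain ⟨V', hV'1, hV'⟩ : ∃ V' : ((E × E) × (E × E)) →L[ℝ] (Icc a b →ᵇ E),
      (∀ h, V' h = mulPath one h.1.2 + primitive hab t (A' h)) ∧
      HasFDerivAt (bicharVel hab hG t s) V' w := by
    have h1 := (((mulPath (E := E) one).comp (ContinuousLinearMap.snd ℝ E E)).comp
      (ContinuousLinearMap.fst ℝ (E × E) (E × E))).hasFDerivAt (x := w)
    have h2 := HasFDerivAt.comp w (primitive hab t).hasFDerivAt hA'
    exact ⟨_, fun h => rfl, h1.add h2⟩
  have hX' : ∀ h, (B' h).1 = mulPath one h.1.1 + primitive hab t (V' h) := by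
    have h1 := (((mulPath (E := E) one).comp (ContinuousLinearMap.fst ℝ E E)).comp
      (ContinuousLinearMap.fst ℝ (E × E) (E × E))).hasFDerivAt (x := w)
    have h2 := HasFDerivAt.comp w (primitive hab t).hasFDerivAt hV'
    have h3 := h1.add h2
    have h4 : (fun w => (B w).1) = fun w => mulPath one w.1.1
      + primitive hab t (bicharVel hab hG t s w) := funext fun w => bichar_fst_eq hab hG t s w
    rw [h4] at hB1
    have h5 := hB1.unique h3
    intro h
    exact congrArg (fun L => L h) h5
  obtain ⟨L', hL'1, hL⟩ : ∃ L' : ((E × E) × (E × E)) →L[ℝ] (Icc a b →ᵇ ℝ),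
      (∀ h, L' h = (innerPath (B w).2 (A' h)
          + innerPath (B' h).2 (force g (-(1 / 2)) (-(1 / 2)) (B w)))
        - (innerPath (force g 1 (-1) (B w)) (B' h).1
          + innerPath (force g (-(1 / 2)) (-(1 / 2)) (B w)) (B' h).2)) ∧
      HasFDerivAt (fun w => lagrangianPath U g (B w)) L' w := by
    have hS := HasFDerivAt.comp w (hasFDerivAt_symbolPath hU (B w)) hB'
    have hI := (innerPath (E := E) (a := a) (b := b)).hasFDerivAt_of_bilinear hB2 hA'
    have hL := hI.sub hS
    exact ⟨_, fun h => rfl, hL⟩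
  have hP := HasFDerivAt.comp w ((BoundedContinuousFunction.evalCLM ℝ t :
    (Icc a b →ᵇ ℝ) →L[ℝ] ℝ).comp (primitive hab s)).hasFDerivAt hL
  have hx : HasFDerivAt (fun w => (B w).1 s) _ w :=
    HasFDerivAt.comp w (BoundedContinuousFunction.evalCLM ℝ s :
      (Icc a b →ᵇ E) →L[ℝ] E).hasFDerivAt hB1
  have hv : HasFDerivAt (fun w => bicharVel hab hG t s w s) _ w :=
    HasFDerivAt.comp w (BoundedContinuousFunction.evalCLM ℝ s :
      (Icc a b →ᵇ E) →L[ℝ] E).hasFDerivAt hV'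
  have hk1 := ((ContinuousLinearMap.fst ℝ E E).comp
    (ContinuousLinearMap.snd ℝ (E × E) (E × E))).hasFDerivAt (x := w)
  have hk2 := ((ContinuousLinearMap.snd ℝ E E).comp
    (ContinuousLinearMap.snd ℝ (E × E) (E × E))).hasFDerivAt (x := w)
  have hfin := ((hx.inner ℝ hk1).add (hv.inner ℝ hk2)).add hP
  refine HasFDerivAt.congr_fderiv (f := eikonalPhase hab hG U t s) hfin ?_
  refine ContinuousLinearMap.ext fun h => ?_
  have hb := isBichar_bichar hab hG t s w
  have hdx : ∀ τ : Icc a b, HasDerivWithinAt (IccExtend hab (B' h).1) (V' h τ) (Icc a b) τ := by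
    intro τ
    rw [hX']
    exact hasDerivWithinAt_const_add_primitive hab _ t _ τ
  have hdv : ∀ τ : Icc a b, HasDerivWithinAt (IccExtend hab (V' h)) (A' h τ) (Icc a b) τ := by
    intro τ
    rw [hV'1]
    exact hasDerivWithinAt_const_add_primitive hab _ t _ τ
  -- The identity d/dτ (l·δv + ξ·δx) = l·δ(a_l) - a_x·δx, integrated from s to t; the two products
  -- of the momentum with δv cancel in `e5`.
  have key := eq_add_primitive hab
    (u := innerPath (B w).2 (V' h) + innerPath (bicharMom hab hG t s w) (B' h).1)
    (U := (innerPath (B w).2 (A' h) + innerPath (-bicharMom hab hG t s w) (V' h))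
      + (innerPath (bicharMom hab hG t s w) (V' h)
        + innerPath (-force g 1 (-1) (B w)) (B' h).1))
    (fun τ => (hasDerivWithinAt_innerPath hab (u' := -bicharMom hab hG t s w)
      (hb.dual τ) (hdv τ)).add (hasDerivWithinAt_innerPath hab
        (u' := -force g 1 (-1) (B w)) (hb.mom τ) (hdx τ))) s t
  have e1 : (B' h).1 t = h.1.1 := by rw [hX']; simp [one]
  have e2 : V' h t = h.1.2 := by rw [hV'1]; simp [one]
  have e3 : (B w).2 s = w.2.2 := by rw [hB, bichar_snd_apply]; simp
  have e4 : bicharMom hab hG t s w s = w.2.1 := by rw [bicharMom_apply]; simp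
  have e5 : (innerPath (B w).2 (A' h) + innerPath (-bicharMom hab hG t s w) (V' h))
      + (innerPath (bicharMom hab hG t s w) (V' h)
        + innerPath (-force g 1 (-1) (B w)) (B' h).1)
      = innerPath (B w).2 (A' h) - innerPath (force g 1 (-1) (B w)) (B' h).1 := by
    simp only [map_neg, neg_apply]
    abel
  rw [e5] at key
  simp only [BoundedContinuousFunction.add_apply, innerPath_apply, e1, e2, e3, e4] at key
  have e6 : L' h = innerPath (B w).2 (A' h) - innerPath (force g 1 (-1) (B w)) (B' h).1 := by
    have : innerPath (force g (-(1 / 2)) (-(1 / 2)) (B w)) (B' h).2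
        = innerPath (B' h).2 (force g (-(1 / 2)) (-(1 / 2)) (B w)) := by
      ext σ
      simp [real_inner_comm]
    rw [hL'1, this]
    abel
  have e7 : ∀ L : (Icc a b →ᵇ ℝ), ((BoundedContinuousFunction.evalCLM ℝ t :
    (Icc a b →ᵇ ℝ) →L[ℝ] ℝ).comp (primitive hab s)) L = primitive hab s L t := fun _ => rfl
  rw [add_apply, ContinuousLinearMap.comp_apply _ _ h, e7, e6]
  simp only [dotForm_apply, phaseGradient, ← hB]
  simp only [add_apply, ContinuousLinearMap.comp_apply, ContinuousLinearMap.prod_apply,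
    fderivInnerCLM_apply, ContinuousLinearMap.coe_fst', ContinuousLinearMap.coe_snd',
    BoundedContinuousFunction.evalCLM_apply]
  rw [real_inner_comm (V' h s), real_inner_comm ((B' h).1 s)] at key
  linarith [key]

end Action

/-! ### Exchange of derivatives, and joint regularity in two times and a space variable -/

noncomputable section PartialDerivatives

variable {W F : Type} [NormedAddCommGroup W] [NormedSpace ℝ W] [NormedAddCommGroup F]
  [NormedSpace ℝ F]

/-- Exchange of a time derivative and a spatial derivative. -/
theorem hasDerivWithinAt_of_hasFDerivAt {f A : ℝ → W → F} {P : ℝ → W →L[ℝ] F}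
    {A' : ℝ × W → W →L[ℝ] F} {s : Set ℝ} (hs : Convex ℝ s) {t : ℝ} (ht : t ∈ s) {w : W}
    (hA : ∀ τ ∈ s, ∀ y, HasDerivWithinAt (fun τ => f τ y) (A τ y) s τ)
    (hP : ∀ τ ∈ s, HasFDerivAt (f τ) (P τ) w)
    (hA' : ∀ τ ∈ s, ∀ y, HasFDerivAt (A τ) (A' (τ, y)) y)
    (hc : ContinuousWithinAt A' (s ×ˢ univ) (t, w)) : HasDerivWithinAt P (A' (t, w)) s t := by
  rw [hasDerivWithinAt_iff_isLittleO, Asymptotics.isLittleO_iff]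
  intro c hc0
  obtain ⟨δ, hδ, hball⟩ := Metric.continuousWithinAt_iff.1 hc c hc0
  filter_upwards [self_mem_nhdsWithin,
    nhdsWithin_le_nhds (Metric.ball_mem_nhds t hδ)] with t' ht' hd
  have hder : HasFDerivAt (fun y => f t' y - f t y - (t' - t) • A' (t, w) y)
      (P t' - P t - (t' - t) • A' (t, w)) w :=
    ((hP t' ht').sub (hP t ht)).sub ((A' (t, w)).hasFDerivAt.const_smul (t' - t))
  refine hder.le_of_lip' (by positivity) ?_
  filter_upwards [Metric.ball_mem_nhds w hδ] with y hy
  have hconv : Convex ℝ (s ∩ Metric.ball t δ) := hs.inter (convex_ball t δ)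
  have hsp : ∀ τ ∈ s ∩ Metric.ball t δ, ‖A τ y - A τ w - A' (t, w) (y - w)‖ ≤ c * ‖y - w‖ := by
    intro τ hτ
    refine (convex_ball w δ).norm_image_sub_le_of_norm_hasFDerivWithin_le'
      (fun z _ => (hA' τ hτ.1 z).hasFDerivWithinAt) (fun z hz => ?_) (Metric.mem_ball_self hδ) hy
    have := hball (x := (τ, z)) ⟨hτ.1, mem_univ _⟩ (max_lt hτ.2 hz)
    rw [dist_eq_norm] at this
    exact this.le
  have hD : ∀ τ ∈ s ∩ Metric.ball t δ, HasDerivWithinAt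
      (fun τ => f τ y - f τ w - τ • A' (t, w) (y - w))
      (A τ y - A τ w - A' (t, w) (y - w)) (s ∩ Metric.ball t δ) τ := by
    intro τ hτ
    have h1 := ((hA τ hτ.1 y).sub (hA τ hτ.1 w)).sub
      ((hasDerivWithinAt_id τ s).smul_const (A' (t, w) (y - w)))
    rw [one_smul] at h1
    exact h1.mono inter_subset_left
  have key := hconv.norm_image_sub_le_of_norm_hasDerivWithin_le hD hsp
    ⟨ht, Metric.mem_ball_self hδ⟩ ⟨ht', hd⟩
  refine le_trans (le_of_eq ?_) (key.trans (le_of_eq (by ring)))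
  congr 1
  rw [map_sub]
  module

variable {f A B : ℝ × ℝ × W → F} {P : ℝ × ℝ × W → W →L[ℝ] F} {I : Set ℝ}

/-- The linear map with partial components `A`, `B`, `P`. -/
def partialsMap (A B : F) (P : W →L[ℝ] F) : ℝ × ℝ × W →L[ℝ] F :=
  (ContinuousLinearMap.toSpanSingleton ℝ A).coprod
    ((ContinuousLinearMap.toSpanSingleton ℝ B).coprod P)

theorem partialsMap_eq (A B : F) (P : W →L[ℝ] F) : partialsMap A B P =
    (ContinuousLinearMap.fst ℝ ℝ (ℝ × W)).smulRight A
      + ((ContinuousLinearMap.fst ℝ ℝ W).comp (ContinuousLinearMap.snd ℝ ℝ (ℝ × W))).smulRight B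
      + P.comp ((ContinuousLinearMap.snd ℝ ℝ W).comp (ContinuousLinearMap.snd ℝ ℝ (ℝ × W))) := by
  refine ContinuousLinearMap.ext fun h => ?_
  simp [partialsMap, add_assoc]

theorem contDiffOn_partialsMap {n : WithTop ℕ∞} {s : Set (ℝ × ℝ × W)} (hA : ContDiffOn ℝ n A s)
    (hB : ContDiffOn ℝ n B s) (hP : ContDiffOn ℝ n P s) :
    ContDiffOn ℝ n (fun q => partialsMap (A q) (B q) (P q)) s := by
  simp only [partialsMap_eq]
  exact ((contDiffOn_const.smulRight hA).add (contDiffOn_const.smulRight hB)).add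
    (hP.clm_comp contDiffOn_const)

/-- The two times are peeled off one after the other. Only the time derivatives have to be
continuous; the spatial derivative enters at the point itself. -/
theorem hasFDerivWithinAt_of_partials (hI : Convex ℝ I)
    (hA : ∀ q ∈ I ×ˢ I ×ˢ univ, HasDerivWithinAt (fun τ => f (τ, q.2)) (A q) I q.1)
    (hAc : ContinuousOn A (I ×ˢ I ×ˢ univ))
    (hB : ∀ q ∈ I ×ˢ I ×ˢ univ, HasDerivWithinAt (fun τ => f (q.1, τ, q.2.2)) (B q) I q.2.1)
    (hBc : ContinuousOn B (I ×ˢ I ×ˢ univ))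
    (hP : ∀ q ∈ I ×ˢ I ×ˢ univ, HasFDerivAt (fun w => f (q.1, q.2.1, w)) (P q) q.2.2)
    {q : ℝ × ℝ × W} (hq : q ∈ I ×ˢ I ×ˢ univ) :
    HasFDerivWithinAt f (partialsMap (A q) (B q) (P q)) (I ×ˢ I ×ˢ univ) q := by
  have hts : Continuous fun v : F => ContinuousLinearMap.toSpanSingleton ℝ v :=
    (ContinuousLinearMap.toSpanSingletonCLE (𝕜 := ℝ) (E := F)).continuous
  obtain ⟨t, s, w⟩ := q
  have h1 := hasFDerivWithinAt_of_partial (f := fun q : ℝ × W => f (t, q.1, q.2)) (s₁ := I)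
    (s₂ := univ) hI (f₁ := fun q => ContinuousLinearMap.toSpanSingleton ℝ (B (t, q)))
    (f₂ := P (t, s, w)) (x := s) (y := w) hq.2.1
    (fun σ hσ y _ => (hB (t, σ, y) ⟨hq.1, hσ, mem_univ _⟩).hasFDerivWithinAt)
    (hts.continuousAt.comp_continuousWithinAt ((hBc (t, s, w) hq).comp
      (by fun_prop : ContinuousWithinAt (fun q : ℝ × W => (t, q)) (I ×ˢ univ) (s, w))
      fun r hr => ⟨hq.1, hr⟩))
    (hP (t, s, w) hq).hasFDerivWithinAt
  exact hasFDerivWithinAt_of_partial (f := f) (s₁ := I) (s₂ := I ×ˢ univ) hI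
    (f₁ := fun q => ContinuousLinearMap.toSpanSingleton ℝ (A q)) (x := t) (y := (s, w)) hq.1
    (fun τ hτ y hy => (hA (τ, y) ⟨hτ, hy⟩).hasFDerivWithinAt)
    (hts.continuousAt.comp_continuousWithinAt (hAc (t, s, w) hq)) h1

theorem contDiffOn_one_of_partials {a b : ℝ} (hab : a < b)
    (hA : ∀ q ∈ Icc a b ×ˢ Icc a b ×ˢ univ, HasDerivWithinAt (fun τ => f (τ, q.2)) (A q) (Icc a b) q.1)
    (hAc : ContinuousOn A (Icc a b ×ˢ Icc a b ×ˢ univ))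
    (hB : ∀ q ∈ Icc a b ×ˢ Icc a b ×ˢ univ,
      HasDerivWithinAt (fun τ => f (q.1, τ, q.2.2)) (B q) (Icc a b) q.2.1)
    (hBc : ContinuousOn B (Icc a b ×ˢ Icc a b ×ˢ univ))
    (hP : ∀ q ∈ Icc a b ×ˢ Icc a b ×ˢ univ,
      HasFDerivAt (fun w => f (q.1, q.2.1, w)) (P q) q.2.2)
    (hPc : ContinuousOn P (Icc a b ×ˢ Icc a b ×ˢ univ)) :
    ContDiffOn ℝ 1 f (Icc a b ×ˢ Icc a b ×ˢ univ) := by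
  have hu : UniqueDiffOn ℝ (Icc a b ×ˢ Icc a b ×ˢ (univ : Set W)) :=
    (uniqueDiffOn_Icc hab).prod ((uniqueDiffOn_Icc hab).prod uniqueDiffOn_univ)
  have := contDiffOn_succ_of_hasFDerivWithinAt (n := 0) hu
    (fun q hq => hasFDerivWithinAt_of_partials (convex_Icc a b) hA hAc hB hBc hP hq)
    (contDiffOn_partialsMap (contDiffOn_zero.2 hAc) (contDiffOn_zero.2 hBc)
      (contDiffOn_zero.2 hPc))
  simpa using this

theorem contDiffOn_two_of_partials {a b : ℝ} (hab : a < b)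
    (hA : ∀ q ∈ Icc a b ×ˢ Icc a b ×ˢ univ, HasDerivWithinAt (fun τ => f (τ, q.2)) (A q) (Icc a b) q.1)
    (hAc : ContDiffOn ℝ 1 A (Icc a b ×ˢ Icc a b ×ˢ univ))
    (hB : ∀ q ∈ Icc a b ×ˢ Icc a b ×ˢ univ,
      HasDerivWithinAt (fun τ => f (q.1, τ, q.2.2)) (B q) (Icc a b) q.2.1)
    (hBc : ContDiffOn ℝ 1 B (Icc a b ×ˢ Icc a b ×ˢ univ))
    (hP : ∀ q ∈ Icc a b ×ˢ Icc a b ×ˢ univ,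
      HasFDerivAt (fun w => f (q.1, q.2.1, w)) (P q) q.2.2)
    (hPc : ContDiffOn ℝ 1 P (Icc a b ×ˢ Icc a b ×ˢ univ)) :
    ContDiffOn ℝ 2 f (Icc a b ×ˢ Icc a b ×ˢ univ) := by
  have hu : UniqueDiffOn ℝ (Icc a b ×ˢ Icc a b ×ˢ (univ : Set W)) :=
    (uniqueDiffOn_Icc hab).prod ((uniqueDiffOn_Icc hab).prod uniqueDiffOn_univ)
  have := contDiffOn_succ_of_hasFDerivWithinAt (n := 1) hu
    (fun q hq => hasFDerivWithinAt_of_partials (convex_Icc a b) hA hAc.continuousOn hB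
      hBc.continuousOn hP hq) (contDiffOn_partialsMap hAc hBc hPc)
  have h2 : ((1 : ℕ) : WithTop ℕ∞) + 1 = 2 := by norm_num
  rwa [h2] at this

end PartialDerivatives

/-! ### Regularity of the gradient of the phase, and sliding of the base times -/

noncomputable section PhaseRegularity

variable {E : Type} [NormedAddCommGroup E] [InnerProductSpace ℝ E] [CompleteSpace E] {a b : ℝ}

theorem continuous_force (g : C(Icc a b × E, E)) (c c' : ℝ) : Continuous (force g c c') := by
  have h : ∀ e : ℝ, Continuous fun X : (Icc a b →ᵇ E) × (Icc a b →ᵇ E) =>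
      nemytskii g (shiftPath e X) := fun e =>
    (continuous_nemytskii g).comp (ContinuousLinearMap.continuous _)
  exact ((h _).const_smul c).add ((h _).const_smul c')

variable (hab : a ≤ b) {g : C(Icc a b × E, E)}
  (hG : ∀ t s, LipschitzWith (1 / 2) (systemMap hab g t s)) {U : C(Icc a b × E, ℝ)}

theorem continuous_primitive_force_bichar (c c' : ℝ) {f : (Icc a b × Icc a b) ×
    ((E × E) × (E × E)) → Icc a b} (hf : Continuous f) :
    Continuous fun q : (Icc a b × Icc a b) × ((E × E) × (E × E)) =>
      primitive hab (f q) (force g c c' (bichar hab hG q.1.1 q.1.2 q.2)) := by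
  have h1 : Continuous fun q : (Icc a b × Icc a b) × ((E × E) × (E × E)) =>
      force g c c' (bichar hab hG q.1.1 q.1.2 q.2) := by
    have := (continuous_force g c c').comp (continuous_bichar hab hG)
    exact this
  have := (continuous_primitive (E := E) hab).comp (hf.prodMk h1)
  exact this

theorem continuous_bicharVel :
    Continuous fun q : (Icc a b × Icc a b) × ((E × E) × (E × E)) =>
      bicharVel hab hG q.1.1 q.1.2 q.2 := by
  have h1 := continuous_primitive_force_bichar hab hG (-(1 / 2)) (-(1 / 2))
    (f := fun q => q.1.1) (by fun_prop)
  have h2 : Continuous fun q : (Icc a b × Icc a b) × ((E × E) × (E × E)) =>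
      mulPath (BoundedContinuousFunction.const (Icc a b) (1 : ℝ)) q.2.1.2 := by fun_prop
  exact h2.add h1

theorem continuous_bicharMom :
    Continuous fun q : (Icc a b × Icc a b) × ((E × E) × (E × E)) =>
      bicharMom hab hG q.1.1 q.1.2 q.2 := by
  have h1 := continuous_primitive_force_bichar hab hG 1 (-1)
    (f := fun q => q.1.2) (by fun_prop)
  have h2 : Continuous fun q : (Icc a b × Icc a b) × ((E × E) × (E × E)) =>
      mulPath (BoundedContinuousFunction.const (Icc a b) (1 : ℝ)) q.2.2.1 := by fun_prop
  exact h2.sub h1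

theorem continuous_path_apply {Q : Type} [TopologicalSpace Q] {F : Type} [NormedAddCommGroup F]
    {u : Q → (Icc a b →ᵇ F)} {σ : Q → Icc a b} (hu : Continuous u) (hσ : Continuous σ) :
    Continuous fun q => u q (σ q) := by
  have h1 : Continuous fun p : (Icc a b →ᵇ F) × Icc a b => p.1 p.2 :=
    continuous_eval
  have h2 := h1.comp (hu.prodMk hσ)
  exact h2

theorem continuous_phaseGradient :
    Continuous fun q : (Icc a b × Icc a b) × ((E × E) × (E × E)) =>
      phaseGradient hab hG q.1.1 q.1.2 q.2 := by
  have hB := continuous_bichar hab hG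
  have h1 := continuous_path_apply (continuous_bicharMom hab hG) (σ := fun q => q.1.1)
    (by fun_prop)
  have h2 := continuous_path_apply hB.snd (σ := fun q => q.1.1) (by fun_prop)
  have h3 := continuous_path_apply hB.fst (σ := fun q => q.1.2) (by fun_prop)
  have h4 := continuous_path_apply (continuous_bicharVel hab hG) (σ := fun q => q.1.2)
    (by fun_prop)
  exact (h1.prodMk h2).prodMk (h3.prodMk h4)

theorem contDiff_force_bichar {p : ℕ} (hp : 1 ≤ p) (hg : SmoothFiber p fun σ y => g (σ, y))
    (c c' : ℝ) (t s : Icc a b) : ContDiff ℝ p fun w => force g c c' (bichar hab hG t s w) := by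
  have := (contDiff_force hg c c').comp (contDiff_bichar hab hG hp hg t s)
  exact this

theorem contDiff_phaseGradient {p : ℕ} (hp : 1 ≤ p) (hg : SmoothFiber p fun σ y => g (σ, y))
    (t s : Icc a b) : ContDiff ℝ p (phaseGradient hab hG t s) := by
  have hB := contDiff_bichar hab hG hp hg t s
  have hev : ∀ (u : (E × E) × (E × E) → (Icc a b →ᵇ E)) (σ : Icc a b), ContDiff ℝ p u →
      ContDiff ℝ p fun w => u w σ := fun u σ hu => by
    have h0 : ContDiff ℝ p (BoundedContinuousFunction.evalCLM ℝ σ : (Icc a b →ᵇ E) →L[ℝ] E) :=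
      ContinuousLinearMap.contDiff _
    have := h0.comp hu
    exact this
  have hJ : ∀ (c c' : ℝ) (r : Icc a b), ContDiff ℝ p fun w =>
      primitive hab r (force g c c' (bichar hab hG t s w)) := fun c c' r => by
    have h0 : ContDiff ℝ p (primitive hab r : (Icc a b →ᵇ E) →L[ℝ] (Icc a b →ᵇ E)) :=
      ContinuousLinearMap.contDiff _
    have := h0.comp (contDiff_force_bichar hab hG hp hg c c' t s)
    exact this
  have hm : ContDiff ℝ p
      (mulPath (E := E) (BoundedContinuousFunction.const (Icc a b) (1 : ℝ))) :=
    ContinuousLinearMap.contDiff _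
  have hV : ContDiff ℝ p (bicharVel hab hG t s) :=
    (hm.comp (contDiff_snd.comp contDiff_fst)).add (hJ _ _ t)
  have hM : ContDiff ℝ p (bicharMom hab hG t s) :=
    (hm.comp (contDiff_fst.comp contDiff_snd)).sub (hJ _ _ s)
  exact ((hev _ t hM).prodMk (hev _ t hB.snd)).prodMk ((hev _ s hB.fst).prodMk (hev _ s hV))

theorem fderiv_phaseGradient_apply (hg : SmoothFiber 1 fun σ y => g (σ, y)) (t s : Icc a b)
    (w h : (E × E) × (E × E)) :
    fderiv ℝ (phaseGradient hab hG t s) w h =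
      ((h.2.1 - primitive hab s (fderiv ℝ (force g 1 (-1)) (bichar hab hG t s w)
          (fderiv ℝ (bichar hab hG t s) w h)) t, (fderiv ℝ (bichar hab hG t s) w h).2 t),
        ((fderiv ℝ (bichar hab hG t s) w h).1 s,
          h.1.2 + primitive hab t (fderiv ℝ (force g (-(1 / 2)) (-(1 / 2))) (bichar hab hG t s w)
            (fderiv ℝ (bichar hab hG t s) w h)) s)) := by
  have hB := (((contDiff_bichar hab hG le_rfl hg t s).differentiable (by norm_num)) w).hasFDerivAt
  have hF : ∀ c c', HasFDerivAt (fun w => force g c c' (bichar hab hG t s w))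
      ((fderiv ℝ (force g c c') (bichar hab hG t s w)).comp
        (fderiv ℝ (bichar hab hG t s) w)) w := fun c c' =>
    HasFDerivAt.comp w (((contDiff_force hg c c').differentiable
      (by norm_num)) (bichar hab hG t s w)).hasFDerivAt hB
  have hev : ∀ (u : (E × E) × (E × E) → (Icc a b →ᵇ E)) u' (σ : Icc a b), HasFDerivAt u u' w →
      HasFDerivAt (fun w => u w σ) ((BoundedContinuousFunction.evalCLM ℝ σ).comp u') w :=
    fun u u' σ hu => HasFDerivAt.comp w (BoundedContinuousFunction.evalCLM ℝ σ :
      (Icc a b →ᵇ E) →L[ℝ] E).hasFDerivAt hu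
  set one := BoundedContinuousFunction.const (Icc a b) (1 : ℝ)
  have hm : ∀ L : (E × E) × (E × E) →L[ℝ] E, HasFDerivAt (fun w => mulPath one (L w))
      ((mulPath one).comp L) w := fun L => ((mulPath one).comp L).hasFDerivAt
  have hV : HasFDerivAt (bicharVel hab hG t s) _ w :=
    (hm ((ContinuousLinearMap.snd ℝ E E).comp (ContinuousLinearMap.fst ℝ (E × E) (E × E)))).add
      (HasFDerivAt.comp w (primitive hab t).hasFDerivAt (hF (-(1 / 2)) (-(1 / 2))))
  have hM : HasFDerivAt (bicharMom hab hG t s) _ w :=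
    (hm ((ContinuousLinearMap.fst ℝ E E).comp (ContinuousLinearMap.snd ℝ (E × E) (E × E)))).sub
      (HasFDerivAt.comp w (primitive hab s).hasFDerivAt (hF 1 (-1)))
  have hB1 := HasFDerivAt.comp w
    (ContinuousLinearMap.fst ℝ (Icc a b →ᵇ E) (Icc a b →ᵇ E)).hasFDerivAt hB
  have hB2 := HasFDerivAt.comp w
    (ContinuousLinearMap.snd ℝ (Icc a b →ᵇ E) (Icc a b →ᵇ E)).hasFDerivAt hB
  have hP : HasFDerivAt (phaseGradient hab hG t s) _ w :=
    ((hev _ _ t hM).prodMk (hev _ _ t hB2)).prodMk ((hev _ _ s hB1).prodMk (hev _ _ s hV))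
  rw [hP.fderiv]
  have h1 : ∀ (y : E) (σ : Icc a b), (1 : ℝ) • y = y := fun y _ => one_smul _ _
  simp [one]

/-- In a fixed direction the derivative is explicit in terms of that of the bicharacteristic and its
primitives, all continuous in the two times; testing on directions is enough in finite dimension. -/
theorem continuous_fderiv_phaseGradient [FiniteDimensional ℝ E]
    (hg : SmoothFiber 1 fun σ y => g (σ, y)) :
    Continuous fun q : (Icc a b × Icc a b) × ((E × E) × (E × E)) =>
      fderiv ℝ (phaseGradient hab hG q.1.1 q.1.2) q.2 := by
  rw [continuous_clm_apply]
  intro h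
  simp only [fderiv_phaseGradient_apply hab hG hg]
  have hB' : Continuous fun q : (Icc a b × Icc a b) × ((E × E) × (E × E)) =>
      fderiv ℝ (bichar hab hG q.1.1 q.1.2) q.2 h :=
    (continuous_fderiv_bichar hab hG hg).clm_apply continuous_const
  have hF : ∀ c c' : ℝ, Continuous fun q : (Icc a b × Icc a b) × ((E × E) × (E × E)) =>
      fderiv ℝ (force g c c') (bichar hab hG q.1.1 q.1.2 q.2)
        (fderiv ℝ (bichar hab hG q.1.1 q.1.2) q.2 h) := fun c c' => by
    have h1 := ((contDiff_force hg c c').continuous_fderiv (by norm_num)).comp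
      (continuous_bichar hab hG)
    exact h1.clm_apply hB'
  have hJ : ∀ (c c' : ℝ) (f : (Icc a b × Icc a b) × ((E × E) × (E × E)) → Icc a b),
      Continuous f → Continuous fun q => primitive hab (f q)
        (fderiv ℝ (force g c c') (bichar hab hG q.1.1 q.1.2 q.2)
          (fderiv ℝ (bichar hab hG q.1.1 q.1.2) q.2 h)) := fun c c' f hf => by
    have := (continuous_primitive (E := E) hab).comp (hf.prodMk (hF c c'))
    exact this
  have c1 : Continuous fun q : (Icc a b × Icc a b) × ((E × E) × (E × E)) => q.1.1 := by fun_prop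
  have c2 : Continuous fun q : (Icc a b × Icc a b) × ((E × E) × (E × E)) => q.1.2 := by fun_prop
  have h1 := continuous_path_apply (hJ 1 (-1) _ c2) c1
  have h2 := continuous_path_apply hB'.snd c1
  have h3 := continuous_path_apply hB'.fst c2
  have h4 := continuous_path_apply (hJ (-(1 / 2)) (-(1 / 2)) _ c1) c2
  exact ((continuous_const.sub h1).prodMk h2).prodMk (h3.prodMk (continuous_const.add h4))

/-! ### Change of base times -/

/-- Along the trajectory of w the dual data at time s do not change, so every point of it yields the
same trajectory. The phase at the moving point is then the action of one fixed path, whose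
dependence on t is an integral. -/
theorem eikonalPhase_flow (t₀ t s : Icc a b) (w : (E × E) × (E × E)) :
    eikonalPhase hab hG U t s
        (((bichar hab hG t₀ s w).1 t, bicharVel hab hG t₀ s w t), w.2) =
      inner ℝ ((bichar hab hG t₀ s w).1 s) w.2.1 + inner ℝ (bicharVel hab hG t₀ s w s) w.2.2
        + primitive hab s (lagrangianPath U g (bichar hab hG t₀ s w)) t := by
  have hb := isBichar_bichar hab hG t₀ s w
  have e3 : (bichar hab hG t₀ s w).2 s = w.2.2 := by rw [bichar_snd_apply]; simp
  have e4 : bicharMom hab hG t₀ s w s = w.2.1 := by rw [bicharMom_apply]; simp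
  have h1 := hb.eq_bichar hG t s
  have h2 := hb.eq_bicharVel hG t s
  rw [e3, e4] at h1 h2
  rw [eikonalPhase]
  rw [Prod.mk.eta] at h1
  erw [← h1, ← h2]

/-- The counterpart with the position data at time t kept and the dual data read off the same
trajectory at a moving time s. -/
theorem eikonalPhase_dual (t s₀ s : Icc a b) (w : (E × E) × (E × E)) :
    eikonalPhase hab hG U t s
        (w.1, (bicharMom hab hG t s₀ w s, (bichar hab hG t s₀ w).2 s)) =
      inner ℝ ((bichar hab hG t s₀ w).1 s) (bicharMom hab hG t s₀ w s)
        + inner ℝ (bicharVel hab hG t s₀ w s) ((bichar hab hG t s₀ w).2 s)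
        + primitive hab s (lagrangianPath U g (bichar hab hG t s₀ w)) t := by
  have hb := isBichar_bichar hab hG t s₀ w
  have e1 : (bichar hab hG t s₀ w).1 t = w.1.1 := by rw [bichar_fst_apply]; simp
  have e2 : bicharVel hab hG t s₀ w t = w.1.2 := by rw [bicharVel_apply]; simp
  have h1 := hb.eq_bichar hG t s
  have h2 := hb.eq_bicharVel hG t s
  rw [e1, e2] at h1 h2
  rw [eikonalPhase]
  rw [Prod.mk.eta] at h1
  erw [← h1, ← h2]

end PhaseRegularity

/-! ### The Hamilton-Jacobi equations in the two times -/

noncomputable section PhaseTimeDerivatives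

variable {E : Type} [NormedAddCommGroup E] [InnerProductSpace ℝ E] [CompleteSpace E] {a b : ℝ}

/-- The Hamiltonian `v · η_x + a(x, η_v)`. -/
def hamiltonian (U : E → ℝ) (z η : E × E) : ℝ :=
  inner ℝ z.2 η.1 + (U (z.1 - (1 / 2 : ℝ) • η.2) - U (z.1 + (1 / 2 : ℝ) • η.2))

variable (hab : a ≤ b) {g : C(Icc a b × E, E)}
  (hG : ∀ t s, LipschitzWith (1 / 2) (systemMap hab g t s)) {U : C(Icc a b × E, ℝ)}

/-- If `u` is differentiable along a curve and has a continuous gradient, it is differentiable in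
time at a fixed point. -/
theorem hasDerivWithinAt_of_curve {W : Type} [NormedAddCommGroup W] [NormedSpace ℝ W] {I : Set ℝ}
    {f : W → ℝ → ℝ} {P : W → ℝ → W →L[ℝ] ℝ} (hP : ∀ y, ∀ τ ∈ I, HasFDerivAt (fun y => f y τ) (P y τ) y)
    (hPc : ContinuousOn (fun q : W × ℝ => P q.1 q.2) (univ ×ˢ I)) {t : ℝ} (ht : t ∈ I)
    {c : ℝ → W} {c' : W} (hc : ContinuousOn c I) (hc' : HasDerivWithinAt c c' I t) {m : ℝ}
    (hm : HasDerivWithinAt (fun τ => f (c τ) τ) m I t) :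
    HasDerivWithinAt (fun τ => f (c t) τ) (m - P (c t) t c') I t := by
  have hshift : ContinuousOn (fun q : W × ℝ => (c q.2 + q.1, q.2)) (univ ×ˢ I) := by
    refine ContinuousOn.prodMk (ContinuousOn.add (hc.comp continuousOn_snd fun q hq => hq.2)
      continuousOn_fst) continuousOn_snd
  have h := hasFDerivWithinAt_of_partial (f := fun q : W × ℝ => f (c q.2 + q.1) q.2)
    (s₁ := univ) (s₂ := I) convex_univ (f₁ := fun q => P (c q.2 + q.1) q.2)
    (f₂ := ContinuousLinearMap.toSpanSingleton ℝ m) (x := 0) (y := t) (mem_univ _)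
    (fun x _ τ hτ => (((hP (c τ + x) τ hτ).comp x ((hasFDerivAt_id x).const_add (c τ))).congr_fderiv
      (by simp)).hasFDerivWithinAt)
    ((hPc.comp hshift fun q hq => ⟨mem_univ _, hq.2⟩) (0, t) ⟨mem_univ _, ht⟩)
    (by simpa using hm.hasFDerivWithinAt)
  have hcurve : HasDerivWithinAt (fun τ => (c t - c τ, τ)) (-c', (1 : ℝ)) I t :=
    (hc'.const_sub (c t)).prodMk (hasDerivWithinAt_id t I)
  have h0 : (fun τ => (c t - c τ, τ)) t = ((0 : W), t) := by simp
  have h2 := h.comp_hasDerivWithinAt_of_eq t hcurve (fun τ hτ => ⟨mem_univ _, hτ⟩) h0.symm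
  simp only [Function.comp_def, add_sub_cancel, add_zero] at h2
  refine h2.congr_deriv ?_
  simp
  ring

/-- Along the trajectory the phase grows at the rate l·a_l - a. Subtracting the gradient paired with
the velocity, v·ξ + a_l·l, leaves -(v·ξ + a), the eikonal equation. -/
theorem hasDerivWithinAt_eikonalPhase_fst (hg : SmoothFiber 1 fun σ y => g (σ, y))
    (hU : ∀ σ x, HasFDerivAt (fun y => U (σ, y)) (innerSL ℝ (g (σ, x))) x)
    (t s : Icc a b) (w : (E × E) × (E × E)) :
    HasDerivWithinAt (fun τ => eikonalPhase hab hG U (projIcc a b hab τ) s w)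
      (-hamiltonian (fun x => U (t, x)) w.1 (phaseGradient hab hG t s w).1) (Icc a b) t := by
  have hb := isBichar_bichar hab hG t s w
  set X := bichar hab hG t s w with hX
  set V := bicharVel hab hG t s w with hV
  set c : ℝ → E × E := fun τ => (IccExtend hab X.1 τ, IccExtend hab V τ) with hc
  have hct : c t = w.1 := by
    simp only [hc, IccExtend_val, hX, hV, bichar_fst_apply, bicharVel_apply, primitive_self]
    simp
  have hinl : Continuous fun q : (E × E) × ℝ =>
      ((projIcc a b hab q.2, s), ((q.1, w.2) : (E × E) × (E × E))) := by fun_prop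
  have key := hasDerivWithinAt_of_curve (I := Icc a b)
    (f := fun y τ => eikonalPhase hab hG U (projIcc a b hab τ) s (y, w.2))
    (P := fun y τ => (dotForm (phaseGradient hab hG (projIcc a b hab τ) s (y, w.2))).comp
      (ContinuousLinearMap.inl ℝ (E × E) (E × E)))
    (fun y τ _ => by
      have h1 := HasFDerivAt.comp y
        (hasFDerivAt_eikonalPhase hab hG hg hU (projIcc a b hab τ) s (y, w.2))
        (hasFDerivAt_prodMk_left (𝕜 := ℝ) y w.2)
      exact h1)
    (by
      have h1 := (continuous_phaseGradient hab hG).comp hinl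
      have h2 := (dotForm (E := E)).continuous.comp h1
      exact (h2.clm_comp continuous_const).continuousOn)
    (t := t) t.2 (c := c)
    (by
      have h1 := continuous_IccExtend_path hab X.1
      have h2 := continuous_IccExtend_path hab V
      exact (h1.prodMk h2).continuousOn)
    ((hb.pos t).prodMk (hb.vel t))
    (m := lagrangianPath U g X t)
    (by
      have h1 := (hasDerivWithinAt_primitive hab s (lagrangianPath U g X) t).const_add
        (inner ℝ (X.1 s) w.2.1 + inner ℝ (V s) w.2.2)
      refine h1.congr (fun τ _ => ?_) ?_
      · exact eikonalPhase_flow hab hG t (projIcc a b hab τ) s w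
      · exact eikonalPhase_flow hab hG t (projIcc a b hab t) s w)
  rw [hct] at key
  refine key.congr_deriv ?_
  have e1 : X.1 t = w.1.1 := by simp [hX, bichar_fst_apply]
  have e2 : V t = w.1.2 := by simp [hV, bicharVel_apply]
  simp only [projIcc_val, ContinuousLinearMap.comp_apply, ContinuousLinearMap.inl_apply,
    dotForm_apply, lagrangianPath, hamiltonian, BoundedContinuousFunction.sub_apply,
    innerPath_apply, symbolPath_apply, phaseGradient, Prod.mk.eta, ← hX, Prod.fst_zero,
    Prod.snd_zero, inner_zero_right, e1, e2]
  rw [real_inner_comm w.1.2]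
  ring

/-- Along the moving dual data the phase is x(s)·ξ(s) + v(s)·l(s) plus the action from s to t, with
derivative a - x·a_x. The part due to the motion of the data is the pairing of (x, v) with (-a_x,
-ξ); removing it leaves v·ξ + a. -/
theorem hasDerivWithinAt_eikonalPhase_snd (hg : SmoothFiber 1 fun σ y => g (σ, y))
    (hU : ∀ σ x, HasFDerivAt (fun y => U (σ, y)) (innerSL ℝ (g (σ, x))) x)
    (t s : Icc a b) (w : (E × E) × (E × E)) :
    HasDerivWithinAt (fun τ => eikonalPhase hab hG U t (projIcc a b hab τ) w)
      (hamiltonian (fun x => U (s, x)) (phaseGradient hab hG t s w).2 w.2) (Icc a b) s := by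
  have hb := isBichar_bichar hab hG t s w
  set X := bichar hab hG t s w with hX
  set V := bicharVel hab hG t s w with hV
  set M := bicharMom hab hG t s w with hM
  set c : ℝ → E × E := fun τ => (IccExtend hab M τ, IccExtend hab X.2 τ) with hc
  have hct : c s = w.2 := by
    simp only [hc, IccExtend_val, hX, hM, bichar_snd_apply, bicharMom_apply, primitive_self]
    simp
  have hinr : Continuous fun q : (E × E) × ℝ =>
      ((t, projIcc a b hab q.2), ((w.1, q.1) : (E × E) × (E × E))) := by fun_prop
  have key := hasDerivWithinAt_of_curve (I := Icc a b)
    (f := fun y τ => eikonalPhase hab hG U t (projIcc a b hab τ) (w.1, y))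
    (P := fun y τ => (dotForm (phaseGradient hab hG t (projIcc a b hab τ) (w.1, y))).comp
      (ContinuousLinearMap.inr ℝ (E × E) (E × E)))
    (fun y τ _ => by
      have h1 := HasFDerivAt.comp y
        (hasFDerivAt_eikonalPhase hab hG hg hU t (projIcc a b hab τ) (w.1, y))
        (hasFDerivAt_prodMk_right (𝕜 := ℝ) w.1 y)
      exact h1)
    (by
      have h1 := (continuous_phaseGradient hab hG).comp hinr
      have h2 := (dotForm (E := E)).continuous.comp h1
      exact (h2.clm_comp continuous_const).continuousOn)
    (t := s) s.2 (c := c)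
    (by
      have h1 := continuous_IccExtend_path hab X.2
      have h2 := continuous_IccExtend_path hab M
      exact (h2.prodMk h1).continuousOn)
    ((hb.mom s).prodMk (hb.dual s))
    (by
      have h1 := (((hb.pos s).inner ℝ (hb.mom s)).add ((hb.vel s).inner ℝ (hb.dual s))).sub
        (hasDerivWithinAt_primitive hab t (lagrangianPath U g X) s)
      refine h1.congr (fun τ hτ => ?_) ?_
      · refine (eikonalPhase_dual hab hG t s (projIcc a b hab τ) w).trans ?_
        rw [primitive_swap, ← sub_eq_add_neg]
        rfl
      · refine (eikonalPhase_dual hab hG t s (projIcc a b hab s) w).trans ?_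
        rw [primitive_swap, ← sub_eq_add_neg]
        rfl)
  rw [hct] at key
  refine key.congr_deriv ?_
  have e1 : X.2 s = w.2.2 := by simp [hX, bichar_snd_apply]
  have e2 : M s = w.2.1 := by simp [hM, bicharMom_apply]
  simp only [projIcc_val, ContinuousLinearMap.comp_apply, ContinuousLinearMap.inr_apply,
    dotForm_apply, lagrangianPath, hamiltonian, BoundedContinuousFunction.sub_apply,
    innerPath_apply, symbolPath_apply, phaseGradient, Prod.mk.eta, ← hX, ← hV, ← hM, Prod.fst_zero,
    Prod.snd_zero, inner_zero_right, e1, e2, IccExtend_val]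
  rw [real_inner_comm (force g (-(1 / 2)) (-(1 / 2)) (X.1, X.2) s)]
  ring

end PhaseTimeDerivatives

/-! ### Joint C² regularity of the phase in (t, s, z, ξ) -/

noncomputable section PhaseJointRegularity

variable {E : Type} [NormedAddCommGroup E] [InnerProductSpace ℝ E] {a b : ℝ}

/-- The derivative of the phase is handled as a linear form, its gradient as a vector of
coefficients. A continuous left inverse brings regularity back from the form to the coefficients. -/
theorem exists_dotForm_leftInverse [FiniteDimensional ℝ E] :
    ∃ R : (((E × E) × (E × E)) →L[ℝ] ℝ) →L[ℝ] ((E × E) × (E × E)), ∀ y, R (dotForm y) = y := by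
  have hinj : Function.Injective (dotForm (E := E)).toLinearMap := by
    rw [← LinearMap.ker_eq_bot, LinearMap.ker_eq_bot']
    intro y hy
    have h1 : dotForm y y = 0 := by
      have := congrArg (fun L : ((E × E) × (E × E)) →L[ℝ] ℝ => L y) hy
      exact this
    simp only [dotForm_apply, real_inner_self_eq_norm_sq] at h1
    have e1 : ‖y.1.1‖ ^ 2 = 0 := by nlinarith [sq_nonneg ‖y.1.1‖, sq_nonneg ‖y.1.2‖, sq_nonneg ‖y.2.1‖, sq_nonneg ‖y.2.2‖]
    have e2 : ‖y.1.2‖ ^ 2 = 0 := by nlinarith [sq_nonneg ‖y.1.1‖, sq_nonneg ‖y.1.2‖, sq_nonneg ‖y.2.1‖, sq_nonneg ‖y.2.2‖]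
    have e3 : ‖y.2.1‖ ^ 2 = 0 := by nlinarith [sq_nonneg ‖y.1.1‖, sq_nonneg ‖y.1.2‖, sq_nonneg ‖y.2.1‖, sq_nonneg ‖y.2.2‖]
    have e4 : ‖y.2.2‖ ^ 2 = 0 := by nlinarith [sq_nonneg ‖y.1.1‖, sq_nonneg ‖y.1.2‖, sq_nonneg ‖y.2.1‖, sq_nonneg ‖y.2.2‖]
    simp only [ne_eq, OfNat.ofNat_ne_zero, not_false_eq_true, pow_eq_zero_iff, norm_eq_zero]
      at e1 e2 e3 e4
    exact Prod.ext (Prod.ext e1 e2) (Prod.ext e3 e4)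
  obtain ⟨R, hR⟩ := LinearMap.exists_leftInverse_of_injective _ (LinearMap.ker_eq_bot.2 hinj)
  exact ⟨LinearMap.toContinuousLinearMap R, fun y => congrArg (fun L => L y) hR⟩

/-- The gradient of the Hamiltonian. -/
def hamiltonianGradient (g : E → E) (y : (E × E) × (E × E)) : (E × E) × (E × E) :=
  ((g (y.1.1 - (1 / 2 : ℝ) • y.2.2) - g (y.1.1 + (1 / 2 : ℝ) • y.2.2), y.2.1),
    (y.1.2, -(1 / 2 : ℝ) • (g (y.1.1 - (1 / 2 : ℝ) • y.2.2) + g (y.1.1 + (1 / 2 : ℝ) • y.2.2))))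

variable [CompleteSpace E]

theorem hasFDerivAt_hamiltonian {U : E → ℝ} {g : E → E}
    (hU : ∀ x, HasFDerivAt U (innerSL ℝ (g x)) x) (y : (E × E) × (E × E)) :
    HasFDerivAt (fun y : (E × E) × (E × E) => hamiltonian U y.1 y.2)
      (dotForm (hamiltonianGradient g y)) y := by
  have hx := ((ContinuousLinearMap.fst ℝ E E).comp
    (ContinuousLinearMap.fst ℝ (E × E) (E × E))).hasFDerivAt (x := y)
  have hv := ((ContinuousLinearMap.snd ℝ E E).comp
    (ContinuousLinearMap.fst ℝ (E × E) (E × E))).hasFDerivAt (x := y)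
  have hξ := ((ContinuousLinearMap.fst ℝ E E).comp
    (ContinuousLinearMap.snd ℝ (E × E) (E × E))).hasFDerivAt (x := y)
  have hη := ((ContinuousLinearMap.snd ℝ E E).comp
    (ContinuousLinearMap.snd ℝ (E × E) (E × E))).hasFDerivAt (x := y)
  have h1 := HasFDerivAt.comp y (hU (y.1.1 - (1 / 2 : ℝ) • y.2.2))
    (hx.sub (hη.const_smul (1 / 2 : ℝ)))
  have h2 := HasFDerivAt.comp y (hU (y.1.1 + (1 / 2 : ℝ) • y.2.2))
    (hx.add (hη.const_smul (1 / 2 : ℝ)))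
  have h3 := (hv.inner ℝ hξ).add (h1.sub h2)
  refine HasFDerivAt.congr_fderiv (f := fun y : (E × E) × (E × E) => hamiltonian U y.1 y.2) h3 ?_
  refine ContinuousLinearMap.ext fun h => ?_
  simp only [dotForm_apply, hamiltonianGradient, add_apply, sub_apply, smul_apply,
    ContinuousLinearMap.comp_apply, ContinuousLinearMap.prod_apply, fderivInnerCLM_apply,
    ContinuousLinearMap.coe_fst', ContinuousLinearMap.coe_snd', innerSL_apply_apply,
    inner_add_left, inner_sub_left, inner_sub_right, inner_add_right, inner_smul_left,
    inner_smul_right, conj_trivial]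
  rw [real_inner_comm h.1.2]
  ring

variable (hab : a ≤ b) {g : C(Icc a b × E, E)}
  (hG : ∀ t s, LipschitzWith (1 / 2) (systemMap hab g t s)) {U : C(Icc a b × E, ℝ)}

theorem contDiffOn_hamiltonian {F : Type} [NormedAddCommGroup F] [NormedSpace ℝ F] {S : Set F}
    (hU : ContDiffOn ℝ 1 (fun q : ℝ × E => U (projIcc a b hab q.1, q.2)) (Icc a b ×ˢ univ))
    {τ : F → ℝ} {y : F → (E × E) × (E × E)} (hτ : ContDiffOn ℝ 1 τ S)
    (hτI : ∀ q ∈ S, τ q ∈ Icc a b) (hy : ContDiffOn ℝ 1 y S) :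
    ContDiffOn ℝ 1 (fun q => hamiltonian (fun x => U (projIcc a b hab (τ q), x)) (y q).1 (y q).2)
      S := by
  have hx : ContDiffOn ℝ 1 (fun q => (y q).1.1) S := hy.fst.fst
  have hv : ContDiffOn ℝ 1 (fun q => (y q).1.2) S := hy.fst.snd
  have hξ : ContDiffOn ℝ 1 (fun q => (y q).2.1) S := hy.snd.fst
  have hη : ContDiffOn ℝ 1 (fun q => (y q).2.2) S := hy.snd.snd
  have h1 := hU.comp (hτ.prodMk (hx.sub (hη.const_smul (1 / 2 : ℝ))))
    fun q hq => ⟨hτI q hq, mem_univ _⟩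
  have h2 := hU.comp (hτ.prodMk (hx.add (hη.const_smul (1 / 2 : ℝ))))
    fun q hq => ⟨hτI q hq, mem_univ _⟩
  exact (hv.inner ℝ hξ).add (h1.sub h2)

variable (U) in
/-- The phase as a function of real times. -/
def phaseExt (q : ℝ × ℝ × ((E × E) × (E × E))) : ℝ :=
  eikonalPhase hab hG U (projIcc a b hab q.1) (projIcc a b hab q.2.1) q.2.2

/-- The gradient of the phase as a function of real times. -/
def gradExt (q : ℝ × ℝ × ((E × E) × (E × E))) : (E × E) × (E × E) :=
  phaseGradient hab hG (projIcc a b hab q.1) (projIcc a b hab q.2.1) q.2.2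

/-- The derivative of `gradExt` in the spatial variables. -/
def gradExtDeriv (q : ℝ × ℝ × ((E × E) × (E × E))) :
    ((E × E) × (E × E)) →L[ℝ] ((E × E) × (E × E)) :=
  fderiv ℝ (phaseGradient hab hG (projIcc a b hab q.1) (projIcc a b hab q.2.1)) q.2.2

variable (U) in
/-- The derivative of the phase in the first time. -/
def phaseDerivFst (q : ℝ × ℝ × ((E × E) × (E × E))) : ℝ :=
  -hamiltonian (fun x => U (projIcc a b hab q.1, x)) q.2.2.1 (gradExt hab hG q).1

variable (U) in
/-- The derivative of the phase in the second time. -/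
def phaseDerivSnd (q : ℝ × ℝ × ((E × E) × (E × E))) : ℝ :=
  hamiltonian (fun x => U (projIcc a b hab q.2.1, x)) (gradExt hab hG q).2 q.2.2.2

/-- The spatial derivative of `phaseDerivFst`. -/
def mixedDerivFst (q : ℝ × ℝ × ((E × E) × (E × E))) : ((E × E) × (E × E)) →L[ℝ] ℝ :=
  -(dotForm (hamiltonianGradient (fun x => g (projIcc a b hab q.1, x))
      (q.2.2.1, (gradExt hab hG q).1))).comp
    ((ContinuousLinearMap.fst ℝ (E × E) (E × E)).prod
      ((ContinuousLinearMap.fst ℝ (E × E) (E × E)).comp (gradExtDeriv hab hG q)))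

/-- The spatial derivative of `phaseDerivSnd`. -/
def mixedDerivSnd (q : ℝ × ℝ × ((E × E) × (E × E))) : ((E × E) × (E × E)) →L[ℝ] ℝ :=
  (dotForm (hamiltonianGradient (fun x => g (projIcc a b hab q.2.1, x))
      ((gradExt hab hG q).2, q.2.2.2))).comp
    (((ContinuousLinearMap.snd ℝ (E × E) (E × E)).comp (gradExtDeriv hab hG q)).prod
      (ContinuousLinearMap.snd ℝ (E × E) (E × E)))

theorem continuous_timeProj : Continuous fun q : ℝ × ℝ × ((E × E) × (E × E)) =>
    ((projIcc a b hab q.1, projIcc a b hab q.2.1), q.2.2) := by fun_prop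

theorem continuous_gradExt : Continuous (gradExt hab hG) := by
  have h1 := (continuous_phaseGradient hab hG).comp (continuous_timeProj hab)
  exact h1

theorem continuous_gradExtDeriv [FiniteDimensional ℝ E]
    (hg : SmoothFiber 1 fun σ y => g (σ, y)) : Continuous (gradExtDeriv hab hG) := by
  have h1 := (continuous_fderiv_phaseGradient hab hG hg).comp (continuous_timeProj hab)
  exact h1

theorem hasFDerivAt_gradExt (hg : SmoothFiber 1 fun σ y => g (σ, y))
    (q : ℝ × ℝ × ((E × E) × (E × E))) :
    HasFDerivAt (fun w => gradExt hab hG (q.1, q.2.1, w)) (gradExtDeriv hab hG q) q.2.2 := by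
  have h1 := (contDiff_phaseGradient hab hG le_rfl hg (projIcc a b hab q.1)
    (projIcc a b hab q.2.1)).differentiable (by norm_num)
  have h2 := (h1 q.2.2).hasFDerivAt
  exact h2

theorem hasDerivWithinAt_phaseExt_fst (hg : SmoothFiber 1 fun σ y => g (σ, y))
    (hU : ∀ σ x, HasFDerivAt (fun y => U (σ, y)) (innerSL ℝ (g (σ, x))) x)
    (q : ℝ × ℝ × ((E × E) × (E × E))) (hq : q.1 ∈ Icc a b) :
    HasDerivWithinAt (fun τ => phaseExt hab hG U (τ, q.2)) (phaseDerivFst hab hG U q)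
      (Icc a b) q.1 := by
  have := hasDerivWithinAt_eikonalPhase_fst hab hG hg hU ⟨q.1, hq⟩ (projIcc a b hab q.2.1) q.2.2
  simp only [phaseDerivFst, gradExt, projIcc_of_mem hab hq]
  exact this

theorem hasDerivWithinAt_phaseExt_snd (hg : SmoothFiber 1 fun σ y => g (σ, y))
    (hU : ∀ σ x, HasFDerivAt (fun y => U (σ, y)) (innerSL ℝ (g (σ, x))) x)
    (q : ℝ × ℝ × ((E × E) × (E × E))) (hq : q.2.1 ∈ Icc a b) :
    HasDerivWithinAt (fun τ => phaseExt hab hG U (q.1, τ, q.2.2)) (phaseDerivSnd hab hG U q)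
      (Icc a b) q.2.1 := by
  have := hasDerivWithinAt_eikonalPhase_snd hab hG hg hU (projIcc a b hab q.1) ⟨q.2.1, hq⟩ q.2.2
  simp only [phaseDerivSnd, gradExt, projIcc_of_mem hab hq]
  exact this

theorem hasFDerivAt_phaseExt (hg : SmoothFiber 1 fun σ y => g (σ, y))
    (hU : ∀ σ x, HasFDerivAt (fun y => U (σ, y)) (innerSL ℝ (g (σ, x))) x)
    (q : ℝ × ℝ × ((E × E) × (E × E))) :
    HasFDerivAt (fun w => phaseExt hab hG U (q.1, q.2.1, w)) (dotForm (gradExt hab hG q)) q.2.2 := by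
  have h := hasFDerivAt_eikonalPhase hab hG hg hU (projIcc a b hab q.1) (projIcc a b hab q.2.1) q.2.2
  exact h

theorem hasFDerivAt_phaseDerivFst (hg : SmoothFiber 1 fun σ y => g (σ, y))
    (hU : ∀ σ x, HasFDerivAt (fun y => U (σ, y)) (innerSL ℝ (g (σ, x))) x)
    (q : ℝ × ℝ × ((E × E) × (E × E))) :
    HasFDerivAt (fun w => phaseDerivFst hab hG U (q.1, q.2.1, w)) (mixedDerivFst hab hG q)
      q.2.2 := by
  have h1 : HasFDerivAt (fun w : (E × E) × (E × E) => (w.1, (gradExt hab hG (q.1, q.2.1, w)).1))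
      ((ContinuousLinearMap.fst ℝ (E × E) (E × E)).prod
        ((ContinuousLinearMap.fst ℝ (E × E) (E × E)).comp (gradExtDeriv hab hG q))) q.2.2 :=
    hasFDerivAt_fst.prodMk (hasFDerivAt_fst.comp q.2.2 (hasFDerivAt_gradExt hab hG hg q))
  have h2 := HasFDerivAt.comp q.2.2
    (hasFDerivAt_hamiltonian (hU (projIcc a b hab q.1)) (q.2.2.1, (gradExt hab hG q).1)) h1
  have h3 := h2.neg
  exact h3

theorem hasFDerivAt_phaseDerivSnd (hg : SmoothFiber 1 fun σ y => g (σ, y))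
    (hU : ∀ σ x, HasFDerivAt (fun y => U (σ, y)) (innerSL ℝ (g (σ, x))) x)
    (q : ℝ × ℝ × ((E × E) × (E × E))) :
    HasFDerivAt (fun w => phaseDerivSnd hab hG U (q.1, q.2.1, w)) (mixedDerivSnd hab hG q)
      q.2.2 := by
  have h1 : HasFDerivAt (fun w : (E × E) × (E × E) => ((gradExt hab hG (q.1, q.2.1, w)).2, w.2))
      (((ContinuousLinearMap.snd ℝ (E × E) (E × E)).comp (gradExtDeriv hab hG q)).prod
        (ContinuousLinearMap.snd ℝ (E × E) (E × E))) q.2.2 :=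
    (hasFDerivAt_snd.comp q.2.2 (hasFDerivAt_gradExt hab hG hg q)).prodMk hasFDerivAt_snd
  have h2 := HasFDerivAt.comp q.2.2
    (hasFDerivAt_hamiltonian (hU (projIcc a b hab q.2.1)) ((gradExt hab hG q).2, q.2.2.2)) h1
  exact h2

theorem continuous_dotForm_hamiltonianGradient {Q : Type} [TopologicalSpace Q] {τ : Q → Icc a b}
    {y : Q → (E × E) × (E × E)} (hτ : Continuous τ) (hy : Continuous y) :
    Continuous fun q => dotForm (hamiltonianGradient (fun x => g (τ q, x)) (y q)) := by
  have h1 : Continuous fun q => hamiltonianGradient (fun x => g (τ q, x)) (y q) := by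
    unfold hamiltonianGradient
    fun_prop
  have h2 := (dotForm (E := E)).continuous.comp h1
  exact h2

theorem continuous_mixedDerivFst [FiniteDimensional ℝ E]
    (hg : SmoothFiber 1 fun σ y => g (σ, y)) : Continuous (mixedDerivFst hab hG) := by
  have hG0 := continuous_gradExt hab hG
  have h1 := continuous_dotForm_hamiltonianGradient (g := g) (τ := fun q => projIcc a b hab q.1)
    (y := fun q : ℝ × ℝ × ((E × E) × (E × E)) => (q.2.2.1, (gradExt hab hG q).1)) (by fun_prop)
    (continuous_snd.snd.fst.prodMk hG0.fst)
  have h2 : Continuous fun q => (ContinuousLinearMap.fst ℝ (E × E) (E × E)).prod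
      ((ContinuousLinearMap.fst ℝ (E × E) (E × E)).comp (gradExtDeriv hab hG q)) := by
    rw [continuous_clm_apply]
    intro h
    have := (continuous_gradExtDeriv hab hG hg).clm_apply (continuous_const (y := h))
    exact continuous_const.prodMk this.fst
  have h3 := (h1.clm_comp h2).neg
  exact h3

theorem continuous_mixedDerivSnd [FiniteDimensional ℝ E]
    (hg : SmoothFiber 1 fun σ y => g (σ, y)) : Continuous (mixedDerivSnd hab hG) := by
  have hG0 := continuous_gradExt hab hG
  have h1 := continuous_dotForm_hamiltonianGradient (g := g) (τ := fun q => projIcc a b hab q.2.1)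
    (y := fun q : ℝ × ℝ × ((E × E) × (E × E)) => ((gradExt hab hG q).2, q.2.2.2)) (by fun_prop)
    (hG0.snd.prodMk continuous_snd.snd.snd)
  have h2 : Continuous fun q =>
      ((ContinuousLinearMap.snd ℝ (E × E) (E × E)).comp (gradExtDeriv hab hG q)).prod
        (ContinuousLinearMap.snd ℝ (E × E) (E × E)) := by
    rw [continuous_clm_apply]
    intro h
    have := (continuous_gradExtDeriv hab hG hg).clm_apply (continuous_const (y := h))
    exact this.snd.prodMk continuous_const
  have h3 := h1.clm_comp h2
  exact h3

theorem hasDerivWithinAt_dotForm_gradExt_fst [FiniteDimensional ℝ E]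
    (hg : SmoothFiber 1 fun σ y => g (σ, y))
    (hU : ∀ σ x, HasFDerivAt (fun y => U (σ, y)) (innerSL ℝ (g (σ, x))) x)
    (q : ℝ × ℝ × ((E × E) × (E × E))) (hq : q.1 ∈ Icc a b) :
    HasDerivWithinAt (fun τ => dotForm (gradExt hab hG (τ, q.2))) (mixedDerivFst hab hG q)
      (Icc a b) q.1 := by
  have hc : Continuous fun r : ℝ × ((E × E) × (E × E)) =>
      mixedDerivFst hab hG (r.1, q.2.1, r.2) := by
    have h0 : Continuous fun r : ℝ × ((E × E) × (E × E)) => (r.1, q.2.1, r.2) := by fun_prop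
    have h1 := (continuous_mixedDerivFst hab hG hg).comp h0
    exact h1
  exact hasDerivWithinAt_of_hasFDerivAt (f := fun τ w => phaseExt hab hG U (τ, q.2.1, w))
    (A := fun τ w => phaseDerivFst hab hG U (τ, q.2.1, w))
    (A' := fun r => mixedDerivFst hab hG (r.1, q.2.1, r.2)) (w := q.2.2)
    (convex_Icc a b) hq
    (fun τ hτ y => hasDerivWithinAt_phaseExt_fst hab hG hg hU (τ, q.2.1, y) hτ)
    (fun τ _ => hasFDerivAt_phaseExt hab hG hg hU (τ, q.2))
    (fun τ _ y => hasFDerivAt_phaseDerivFst hab hG hg hU (τ, q.2.1, y)) hc.continuousWithinAt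

theorem hasDerivWithinAt_dotForm_gradExt_snd [FiniteDimensional ℝ E]
    (hg : SmoothFiber 1 fun σ y => g (σ, y))
    (hU : ∀ σ x, HasFDerivAt (fun y => U (σ, y)) (innerSL ℝ (g (σ, x))) x)
    (q : ℝ × ℝ × ((E × E) × (E × E))) (hq : q.2.1 ∈ Icc a b) :
    HasDerivWithinAt (fun τ => dotForm (gradExt hab hG (q.1, τ, q.2.2)))
      (mixedDerivSnd hab hG q) (Icc a b) q.2.1 := by
  have hc : Continuous fun r : ℝ × ((E × E) × (E × E)) =>
      mixedDerivSnd hab hG (q.1, r.1, r.2) := by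
    have h0 : Continuous fun r : ℝ × ((E × E) × (E × E)) => (q.1, r.1, r.2) := by fun_prop
    have h1 := (continuous_mixedDerivSnd hab hG hg).comp h0
    exact h1
  exact hasDerivWithinAt_of_hasFDerivAt (f := fun τ w => phaseExt hab hG U (q.1, τ, w))
    (A := fun τ w => phaseDerivSnd hab hG U (q.1, τ, w))
    (A' := fun r => mixedDerivSnd hab hG (q.1, r.1, r.2)) (w := q.2.2)
    (convex_Icc a b) hq
    (fun τ hτ y => hasDerivWithinAt_phaseExt_snd hab hG hg hU (q.1, τ, y) hτ)
    (fun τ _ => hasFDerivAt_phaseExt hab hG hg hU (q.1, τ, q.2.2))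
    (fun τ _ y => hasFDerivAt_phaseDerivSnd hab hG hg hU (q.1, τ, y)) hc.continuousWithinAt

theorem hasFDerivAt_clm_comp {W V G : Type} [NormedAddCommGroup W] [NormedSpace ℝ W]
    [NormedAddCommGroup V] [NormedSpace ℝ V] [NormedAddCommGroup G] [NormedSpace ℝ G]
    (L : V →L[ℝ] G) {u : W → V} {u' : W →L[ℝ] V} {w : W} (hu : HasFDerivAt u u' w) :
    HasFDerivAt (fun w => L (u w)) (L.comp u') w :=
  L.hasFDerivAt.comp w hu

theorem continuous_clm_comp {Q W V G : Type} [TopologicalSpace Q] [NormedAddCommGroup W]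
    [NormedSpace ℝ W] [NormedAddCommGroup V] [NormedSpace ℝ V] [NormedAddCommGroup G]
    [NormedSpace ℝ G] (L : V →L[ℝ] G) {u : Q → W →L[ℝ] V} (hu : Continuous u) :
    Continuous fun q => L.comp (u q) :=
  continuous_const.clm_comp hu

/-- The time derivatives of the gradient are the spatial derivatives of the two Hamilton-Jacobi
equations. These involve only U and its first spatial derivative and the already known derivative of
the gradient in space, so no differentiability of U in time enters. -/
theorem contDiffOn_gradExt [FiniteDimensional ℝ E] (hab' : a < b)
    (hg : SmoothFiber 1 fun σ y => g (σ, y))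
    (hU : ∀ σ x, HasFDerivAt (fun y => U (σ, y)) (innerSL ℝ (g (σ, x))) x) :
    ContDiffOn ℝ 1 (gradExt hab hG) (Icc a b ×ˢ Icc a b ×ˢ univ) := by
  have hPw : ∀ q, HasFDerivAt (fun w => dotForm (gradExt hab hG (q.1, q.2.1, w)))
      ((dotForm (E := E)).comp (gradExtDeriv hab hG q)) q.2.2 := fun q => by
    have h0 := hasFDerivAt_gradExt hab hG hg q
    have h1 := hasFDerivAt_clm_comp (W := (E × E) × (E × E)) (V := (E × E) × (E × E))
      (G := ((E × E) × (E × E)) →L[ℝ] ℝ) (dotForm (E := E)) h0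
    exact h1
  have hc : Continuous fun q => (dotForm (E := E)).comp (gradExtDeriv hab hG q) :=
    continuous_clm_comp (W := (E × E) × (E × E)) (V := (E × E) × (E × E))
      (G := ((E × E) × (E × E)) →L[ℝ] ℝ) (dotForm (E := E)) (continuous_gradExtDeriv hab hG hg)
  have hP1 := contDiffOn_one_of_partials (f := fun q => dotForm (gradExt hab hG q)) hab'
    (fun q hq => hasDerivWithinAt_dotForm_gradExt_fst hab hG hg hU q hq.1)
    (continuous_mixedDerivFst hab hG hg).continuousOn
    (fun q hq => hasDerivWithinAt_dotForm_gradExt_snd hab hG hg hU q hq.2.1)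
    (continuous_mixedDerivSnd hab hG hg).continuousOn (fun q _ => hPw q) hc.continuousOn
  obtain ⟨R, hR⟩ := exists_dotForm_leftInverse (E := E)
  have h2 := R.contDiff.comp_contDiffOn hP1
  exact h2.congr fun q _ => (hR _).symm

/-- The time derivatives of the phase are Hamiltonians evaluated at its gradient, and the gradient
is C¹. Differentiability of U in time is needed exactly here, for these Hamiltonians to be C¹ as
well. -/
theorem contDiffOn_phaseExt [FiniteDimensional ℝ E] (hab' : a < b)
    (hg : SmoothFiber 1 fun σ y => g (σ, y))
    (hU : ∀ σ x, HasFDerivAt (fun y => U (σ, y)) (innerSL ℝ (g (σ, x))) x)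
    (hUt : ContDiffOn ℝ 1 (fun q : ℝ × E => U (projIcc a b hab q.1, q.2)) (Icc a b ×ˢ univ)) :
    ContDiffOn ℝ 2 (phaseExt hab hG U) (Icc a b ×ˢ Icc a b ×ˢ univ) := by
  have hG1 := contDiffOn_gradExt hab hG hab' hg hU
  have hP : ContDiffOn ℝ 1 (fun q => dotForm (gradExt hab hG q)) (Icc a b ×ˢ Icc a b ×ˢ univ) := by
    have h0 : ContDiff ℝ 1 (dotForm (E := E)) := ContinuousLinearMap.contDiff _
    have := h0.comp_contDiffOn hG1
    exact this
  have cs : ContDiffOn ℝ 1 (fun q : ℝ × ℝ × ((E × E) × (E × E)) => q.2.1)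
    (Icc a b ×ˢ Icc a b ×ˢ univ) := contDiffOn_snd.fst
  have cw : ContDiffOn ℝ 1 (fun q : ℝ × ℝ × ((E × E) × (E × E)) => q.2.2)
    (Icc a b ×ˢ Icc a b ×ˢ univ) := contDiffOn_snd.snd
  have h1 := (contDiffOn_hamiltonian hab hUt
    (τ := fun q : ℝ × ℝ × ((E × E) × (E × E)) => q.1)
    (y := fun q => (q.2.2.1, (gradExt hab hG q).1)) contDiffOn_fst (fun q hq => hq.1)
    (cw.fst.prodMk hG1.fst)).neg
  have h2 := contDiffOn_hamiltonian hab hUt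
    (τ := fun q : ℝ × ℝ × ((E × E) × (E × E)) => q.2.1)
    (y := fun q => ((gradExt hab hG q).2, q.2.2.2)) cs (fun q hq => hq.2.1)
    (hG1.snd.prodMk cw.snd)
  exact contDiffOn_two_of_partials hab'
    (fun q hq => hasDerivWithinAt_phaseExt_fst hab hG hg hU q hq.1) h1
    (fun q hq => hasDerivWithinAt_phaseExt_snd hab hG hg hU q hq.2.1) h2
    (fun q _ => hasFDerivAt_phaseExt hab hG hg hU q) hP

end PhaseJointRegularity

/-! ### Iterated derivatives in prescribed directions -/

noncomputable section IteratedDerivatives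

variable {W F : Type} [NormedAddCommGroup W] [NormedSpace ℝ W] [NormedAddCommGroup F]
  [NormedSpace ℝ F]

theorem iteratedFDeriv_succ_apply_fderiv {f : W → F} {j : ℕ} (hf : ContDiff ℝ (j + 1 : ℕ) f) (w : W)
    (h : Fin (j + 1) → W) : iteratedFDeriv ℝ (j + 1) f w h
      = fderiv ℝ (fun y => iteratedFDeriv ℝ j f y (Fin.tail h)) w (h 0) := by
  rw [iteratedFDeriv_succ_apply_left]
  have hd : DifferentiableAt ℝ (iteratedFDeriv ℝ j f) w :=
    (hf.differentiable_iteratedFDeriv (by exact_mod_cast Nat.lt_succ_self j)) w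
  have h1 := HasFDerivAt.continuousMultilinear_apply_const hd.hasFDerivAt (Fin.tail h)
  rw [h1.fderiv]
  rfl

/-- A directional derivative commutes with iterated derivatives. -/
theorem iteratedFDeriv_fderiv_apply_comm {f : W → F} {j : ℕ} (hf : ContDiff ℝ (j + 1 : ℕ) f) (k w : W)
    (h : Fin j → W) : iteratedFDeriv ℝ j (fun y => fderiv ℝ f y k) w h
      = fderiv ℝ (fun y => iteratedFDeriv ℝ j f y h) w k := by
  induction j generalizing w with
  | zero => simp
  | succ j ih =>
    have hk : ContDiff ℝ (j + 1 : ℕ) fun y => fderiv ℝ f y k :=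
      (hf.fderiv_right (by norm_cast)).clm_apply contDiff_const
    have hf' : ContDiff ℝ (j + 1 : ℕ) f := hf.of_le (by norm_cast; omega)
    rw [iteratedFDeriv_succ_apply_fderiv hk]
    have e1 : (fun y => iteratedFDeriv ℝ j (fun y => fderiv ℝ f y k) y (Fin.tail h))
        = fun y => fderiv ℝ (fun x => iteratedFDeriv ℝ j f x (Fin.tail h)) y k :=
      funext fun y => ih hf' y (Fin.tail h)
    have e2 : (fun y => iteratedFDeriv ℝ (j + 1) f y h)
        = fun y => fderiv ℝ (fun x => iteratedFDeriv ℝ j f x (Fin.tail h)) y (h 0) :=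
      funext fun y => iteratedFDeriv_succ_apply_fderiv hf' y h
    rw [e1, e2]
    set G := fun x => iteratedFDeriv ℝ j f x (Fin.tail h) with hG
    have hG2 : ContDiff ℝ 2 G := by
      have h0 : ContDiff ℝ 2 (iteratedFDeriv ℝ j f) := by
        refine hf.iteratedFDeriv_right ?_
        norm_cast
        omega
      exact (ContinuousMultilinearMap.apply ℝ (fun _ : Fin j => W) F (Fin.tail h)).contDiff.comp h0
    have hd : Differentiable ℝ (fderiv ℝ G) :=
      (hG2.fderiv_right (m := 1) (by norm_num)).differentiable (by norm_num)
    have h2 : ∀ u v : W, fderiv ℝ (fun y => fderiv ℝ G y u) w v = fderiv ℝ (fderiv ℝ G) w v u := by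
      intro u v
      have := (hd w).hasFDerivAt.clm_apply (hasFDerivAt_const u w)
      rw [this.fderiv]
      simp
    rw [h2, h2]
    exact (hG2.contDiffAt.isSymmSndFDerivAt (by simp)) _ _

theorem iteratedFDeriv_succ_apply_snoc {f : W → F} {j : ℕ} (hf : ContDiff ℝ (j + 1 : ℕ) f) (w : W)
    (h : Fin (j + 1) → W) : iteratedFDeriv ℝ (j + 1) f w h
      = iteratedFDeriv ℝ j (fun y => fderiv ℝ f y (h (Fin.last j))) w (Fin.init h) := by
  have h1 : ContDiff ℝ (j : ℕ) (fderiv ℝ f) := hf.fderiv_right (by norm_cast)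
  rw [iteratedFDeriv_succ_apply_right, iteratedFDeriv_clm_apply_const_apply h1 le_rfl]

theorem iteratedFDeriv_comp_prodMk_left {W₁ W₂ : Type} [NormedAddCommGroup W₁] [NormedSpace ℝ W₁]
    [NormedAddCommGroup W₂] [NormedSpace ℝ W₂] {f : W₁ × W₂ → F} {n : ℕ} (hf : ContDiff ℝ n f)
    {j : ℕ} (hj : j ≤ n) (z : W₁) (ξ : W₂) (h : Fin j → W₁) :
    iteratedFDeriv ℝ j (fun y => f (y, ξ)) z h = iteratedFDeriv ℝ j f (z, ξ) fun i => (h i, 0) := by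
  have e1 : (fun y => f (y, ξ)) = fun y =>
      (fun q => f ((0, ξ) + q)) (ContinuousLinearMap.inl ℝ W₁ W₂ y) := by
    funext y
    simp
  have hs : ContDiff ℝ n fun q => f ((0, ξ) + q) := hf.comp (contDiff_const.add contDiff_id)
  have e2 := (ContinuousLinearMap.inl ℝ W₁ W₂).iteratedFDeriv_comp_right hs z (i := j)
    (by exact_mod_cast hj)
  rw [e1]
  have e3 := congrArg (fun A => A h) e2
  refine e3.trans ?_
  rw [ContinuousMultilinearMap.compContinuousLinearMap_apply, iteratedFDeriv_comp_add_left]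
  simp

/-- If the directional derivatives of `f` in the second variable are controlled and `f` vanishes
when the second variable does, then so are the derivatives of `f` in the first variable. -/
theorem abs_iteratedFDeriv_le_of_fderiv_snd {W₁ W₂ : Type} [NormedAddCommGroup W₁]
    [NormedSpace ℝ W₁] [NormedAddCommGroup W₂] [NormedSpace ℝ W₂] {f : W₁ × W₂ → ℝ} {j : ℕ}
    (hf : ContDiff ℝ (j + 1 : ℕ) f) (h0 : ∀ z, f (z, 0) = 0) {z : W₁} {ξ : W₂} {h : Fin j → W₁}
    {c : ℝ} (hc : ∀ θ ∈ Icc (0 : ℝ) 1, |iteratedFDeriv ℝ j (fun y => fderiv ℝ f y (0, ξ)) (z, θ • ξ)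
      fun i => (h i, 0)| ≤ c) :
    |iteratedFDeriv ℝ j (fun y => f (y, ξ)) z h| ≤ c := by
  have hf' : ContDiff ℝ j f := hf.of_le (by norm_cast; omega)
  rw [iteratedFDeriv_comp_prodMk_left hf' le_rfl]
  set G : W₁ × W₂ → ℝ := fun y => iteratedFDeriv ℝ j f y fun i => (h i, 0) with hG
  have hGd : Differentiable ℝ G := by
    have h1 : ContDiff ℝ 1 (iteratedFDeriv ℝ j f) := by
      refine hf.iteratedFDeriv_right ?_
      norm_cast
      omega
    exact ((ContinuousMultilinearMap.apply ℝ (fun _ : Fin j => W₁ × W₂) ℝ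
      fun i => (h i, 0)).contDiff.comp h1).differentiable (by norm_num)
  have hG0 : G (z, 0) = 0 := by
    have h1 := iteratedFDeriv_comp_prodMk_left hf' le_rfl z 0 h
    simp only [h0] at h1
    simp only [hG]
    rw [← h1, iteratedFDeriv_fun_zero]
    rfl
  have hd : ∀ θ : ℝ, HasDerivAt (fun θ : ℝ => G (z, θ • ξ)) (fderiv ℝ G (z, θ • ξ) (0, ξ)) θ := by
    intro θ
    have h1 : HasDerivAt (fun θ : ℝ => ((z, θ • ξ) : W₁ × W₂)) (0, ξ) θ := by
      have := (hasDerivAt_const θ z).prodMk ((hasDerivAt_id θ).smul_const ξ)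
      simpa using this
    exact (hGd (z, θ • ξ)).hasFDerivAt.comp_hasDerivAt θ h1
  have key := (convex_Icc (0 : ℝ) 1).norm_image_sub_le_of_norm_hasDerivWithin_le (C := c)
    (fun θ _ => (hd θ).hasDerivWithinAt) (fun θ hθ => by
      rw [← iteratedFDeriv_fderiv_apply_comm hf]
      exact hc θ hθ) (left_mem_Icc.2 zero_le_one) (right_mem_Icc.2 zero_le_one)
  simpa [hG0] using key

end IteratedDerivatives

/-! ### Bounds for the difference between the phase and the free phase -/

noncomputable section PhaseBounds

variable {E : Type} [NormedAddCommGroup E] [InnerProductSpace ℝ E] [CompleteSpace E] {a b : ℝ}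
variable (hab : a ≤ b) {g : C(Icc a b × E, E)}
  (hG : ∀ t s, LipschitzWith (1 / 2) (systemMap hab g t s)) {U : C(Icc a b × E, ℝ)}

theorem norm_timePath_le (hb1 : b - a ≤ 1) (t : Icc a b) : ‖timePath a b 1 t‖ ≤ 1 := by
  refine (BoundedContinuousFunction.norm_le zero_le_one).2 fun σ => ?_
  rw [timePath_apply, one_mul, Real.norm_eq_abs, abs_le]
  constructor <;> linarith [t.2.1, t.2.2, σ.2.1, σ.2.2]

/-- On an interval of length at most 1 the free motion has norm at most K = 2 as a function of the
data, whence (2K)^j = 4^j. -/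
theorem norm_iteratedFDeriv_bichar_le {p : ℕ} (hp : 1 ≤ p) (hb1 : b - a ≤ 1)
    (hg : SmoothFiber p fun σ y => g (σ, y)) {S : ℝ → ℝ} (hSc : ContinuousOn S (Icc a b))
    (hS : ∀ j ≤ p, ∀ (σ : Icc a b) (y : E), ‖iteratedFDeriv ℝ j (fun y => g (σ, y)) y‖ ≤ S σ)
    (hκ : p.factorial * (2 ^ (p + 2) * ∫ σ in a..b, S σ) ≤ 1 / 2) (t s : Icc a b)
    (w : (E × E) × (E × E)) {j : ℕ} (hj1 : 1 ≤ j) (hj : j ≤ p) :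
    ‖iteratedFDeriv ℝ j (bichar hab hG t s) w‖ ≤ 4 ^ j := by
  have h := norm_iteratedFDeriv_fixedPoint_le (contDiff_systemMap hab hg t s) hκ
    (fun i hi X => norm_iteratedFDeriv_systemMap_le hab hg hb1 hSc hS t s hi X)
    (b := freePath (timePath a b 1 t) (timePath a b 1 s)) (K := 2) (by norm_num)
    (norm_freePath_le (norm_timePath_le hb1 t) (norm_timePath_le hb1 s))
    (contDiff_bichar hab hG hp hg t s) (bichar_eq hab hG t s) w j hj1 hj
  norm_num at h
  exact h

/-- The constant in the bounds of the forces along the bicharacteristics. -/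
def forceConst (p : ℕ) : ℝ := p.factorial * 2 ^ (p + 1) * 4 ^ p

theorem forceConst_pos (p : ℕ) : 0 < forceConst p := by
  unfold forceConst
  positivity

/-- The bound for derivatives of a composition, with 2^(p+1) S for the force and 4^j for the
bicharacteristic, explains the three factors of `forceConst`. -/
theorem norm_iteratedFDeriv_force_bichar_le {p : ℕ} (hp : 1 ≤ p) (hb1 : b - a ≤ 1)
    (hg : SmoothFiber p fun σ y => g (σ, y)) {S : ℝ → ℝ} (hSc : ContinuousOn S (Icc a b))
    (hS : ∀ j ≤ p, ∀ (σ : Icc a b) (y : E), ‖iteratedFDeriv ℝ j (fun y => g (σ, y)) y‖ ≤ S σ)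
    (hκ : p.factorial * (2 ^ (p + 2) * ∫ σ in a..b, S σ) ≤ 1 / 2) (t s : Icc a b)
    (w : (E × E) × (E × E)) {c c' : ℝ} (hc : |c| ≤ 1) (hc' : |c'| ≤ 1) {j : ℕ} (hj : j ≤ p)
    (σ : Icc a b) :
    ‖iteratedFDeriv ℝ j (fun w => force g c c' (bichar hab hG t s w) σ) w‖
      ≤ forceConst p * S σ := by
  have hS0 : 0 ≤ S σ := (norm_nonneg _).trans (hS 0 (Nat.zero_le _) σ 0)
  have h0 : ContDiff ℝ p (BoundedContinuousFunction.evalCLM ℝ σ : (Icc a b →ᵇ E) →L[ℝ] E) :=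
    ContinuousLinearMap.contDiff _
  have h1 : ContDiff ℝ p fun X => force g c c' X σ := by
    have := h0.comp (contDiff_force hg c c')
    exact this
  have h2 := norm_iteratedFDeriv_comp_le h1 (contDiff_bichar hab hG hp hg t s) (n := j)
    (by exact_mod_cast hj) w
    (fun i hi => norm_iteratedFDeriv_force_le hg hS hc hc' (hi.trans hj) _ σ)
    (fun i hi1 hi => norm_iteratedFDeriv_bichar_le hab hG hp hb1 hg hSc hS hκ t s w hi1
      (hi.trans hj))
  refine h2.trans ?_
  have e1 : (j.factorial : ℝ) ≤ p.factorial := by exact_mod_cast Nat.factorial_le hj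
  have e2 : (4 : ℝ) ^ j ≤ 4 ^ p := pow_le_pow_right₀ (by norm_num) hj
  calc (j.factorial : ℝ) * (2 ^ (p + 1) * S σ) * 4 ^ j
      ≤ p.factorial * (2 ^ (p + 1) * S σ) * 4 ^ p := by gcongr
    _ = forceConst p * S σ := by unfold forceConst; ring

theorem norm_primitive_apply_le_of_le {S : ℝ → ℝ} (hSc : ContinuousOn S (Icc a b))
    {u : Icc a b →ᵇ E} {R : ℝ} (hR : 0 ≤ R) (hu : ∀ σ : Icc a b, ‖u σ‖ ≤ R * S σ)
    (t τ : Icc a b) : ‖primitive hab t u τ‖ ≤ R * |∫ σ in (t : ℝ)..τ, S σ| := by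
  refine (norm_primitive_le hab t u (S := fun σ => R * S σ) (by fun_prop) hu τ).trans ?_
  rw [intervalIntegral.integral_const_mul, abs_mul, abs_of_nonneg hR]

theorem abs_integral_le_of_mem_uIcc {S : ℝ → ℝ} (hSc : ContinuousOn S (Icc a b))
    (hS0 : ∀ σ ∈ Icc a b, 0 ≤ S σ) {t τ r : ℝ} (ht : t ∈ Icc a b) (hr : r ∈ Icc a b)
    (hτ : τ ∈ uIcc t r) : |∫ σ in t..τ, S σ| ≤ |∫ σ in t..r, S σ| := by
  have hsub : uIcc t r ⊆ Icc a b := uIcc_subset_Icc ht hr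
  refine intervalIntegral.abs_integral_mono_interval (μ := volume) (f := S) ?_ ?_ ?_
  · rw [uIoc_comm t τ, uIoc_comm t r]
    rcases le_total t r with h | h
    · rw [uIcc_of_le h] at hτ
      rw [uIoc_comm, uIoc_of_le hτ.1, uIoc_comm, uIoc_of_le h]
      exact Ioc_subset_Ioc_right hτ.2
    · rw [uIcc_of_ge h] at hτ
      rw [uIoc_of_le hτ.2, uIoc_of_le h]
      exact Ioc_subset_Ioc_left hτ.1
  · exact (ae_restrict_iff' measurableSet_uIoc).2 (Eventually.of_forall fun σ hσ =>
      hS0 σ (hsub (uIoc_subset_uIcc hσ)))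
  · exact (hSc.mono hsub).intervalIntegrable

/-- The inner primitive is bounded between t and r by its value over the full range, so the second
integration gains the factor |r - t|. This is the origin of the weights |t - s| in the estimates. -/
theorem norm_primitive_primitive_apply_le {S : ℝ → ℝ} (hSc : ContinuousOn S (Icc a b))
    (hS0 : ∀ σ ∈ Icc a b, 0 ≤ S σ) {u : Icc a b →ᵇ E} {R : ℝ} (hR : 0 ≤ R)
    (hu : ∀ σ : Icc a b, ‖u σ‖ ≤ R * S σ) (t r : Icc a b) :
    ‖primitive hab t (primitive hab t u) r‖ ≤ R * (|(r : ℝ) - t| * |∫ σ in (t : ℝ)..r, S σ|) := by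
  rw [primitive_apply]
  refine (intervalIntegral.norm_integral_le_of_norm_le_const
    (C := R * |∫ σ in (t : ℝ)..r, S σ|) fun σ hσ => ?_).trans (le_of_eq (by ring))
  have hσ' : σ ∈ uIcc (t : ℝ) r := uIoc_subset_uIcc hσ
  have hσI : σ ∈ Icc a b := uIcc_subset_Icc t.2 r.2 hσ'
  rw [IccExtend_of_mem hab _ hσI]
  refine (norm_primitive_apply_le_of_le hab hSc hR hu t ⟨σ, hσI⟩).trans ?_
  exact mul_le_mul_of_nonneg_left (abs_integral_le_of_mem_uIcc hSc hS0 t.2 r.2 hσ') hR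

/-! ### The difference with the free phase -/

/-- The gradient of the free phase with time lag `δ`. -/
def freeGradient (δ : ℝ) : ((E × E) × (E × E)) →L[ℝ] ((E × E) × (E × E)) :=
  let x := (ContinuousLinearMap.fst ℝ E E).comp (ContinuousLinearMap.fst ℝ (E × E) (E × E))
  let v := (ContinuousLinearMap.snd ℝ E E).comp (ContinuousLinearMap.fst ℝ (E × E) (E × E))
  let ξ := (ContinuousLinearMap.fst ℝ E E).comp (ContinuousLinearMap.snd ℝ (E × E) (E × E))
  let η := (ContinuousLinearMap.snd ℝ E E).comp (ContinuousLinearMap.snd ℝ (E × E) (E × E))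
  (ξ.prod (η - δ • ξ)).prod ((x - δ • v).prod v)

theorem freeGradient_apply (δ : ℝ) (w : (E × E) × (E × E)) :
    freeGradient δ w = ((w.2.1, w.2.2 - δ • w.2.1), (w.1.1 - δ • w.1.2, w.1.2)) := rfl

/-- The free phase with time lag `δ`. -/
def freeForm (δ : ℝ) (w : (E × E) × (E × E)) : ℝ :=
  inner ℝ (w.1.1 - δ • w.1.2) w.2.1 + inner ℝ w.1.2 w.2.2

theorem hasFDerivAt_freeForm (δ : ℝ) (w : (E × E) × (E × E)) :
    HasFDerivAt (freeForm δ) (dotForm (freeGradient δ w)) w := by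
  have hx := ((ContinuousLinearMap.fst ℝ E E).comp
    (ContinuousLinearMap.fst ℝ (E × E) (E × E))).hasFDerivAt (x := w)
  have hv := ((ContinuousLinearMap.snd ℝ E E).comp
    (ContinuousLinearMap.fst ℝ (E × E) (E × E))).hasFDerivAt (x := w)
  have hξ := ((ContinuousLinearMap.fst ℝ E E).comp
    (ContinuousLinearMap.snd ℝ (E × E) (E × E))).hasFDerivAt (x := w)
  have hη := ((ContinuousLinearMap.snd ℝ E E).comp
    (ContinuousLinearMap.snd ℝ (E × E) (E × E))).hasFDerivAt (x := w)
  have h3 := ((hx.sub (hv.const_smul δ)).inner ℝ hξ).add (hv.inner ℝ hη)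
  refine HasFDerivAt.congr_fderiv (f := freeForm δ) h3 ?_
  refine ContinuousLinearMap.ext fun h => ?_
  simp only [dotForm_apply, freeGradient_apply, add_apply, sub_apply, smul_apply,
    ContinuousLinearMap.comp_apply, ContinuousLinearMap.prod_apply, fderivInnerCLM_apply,
    ContinuousLinearMap.coe_fst', ContinuousLinearMap.coe_snd',
    inner_sub_left, inner_smul_left, conj_trivial, Pi.sub_apply, Pi.smul_apply]
  rw [real_inner_comm w.2.1 h.1.1, real_inner_comm w.2.1 h.1.2, real_inner_comm w.2.2 h.1.2]
  ring

variable (U) in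
/-- The difference between the phase and the free phase. -/
def phaseDefect (t s : Icc a b) (w : (E × E) × (E × E)) : ℝ :=
  eikonalPhase hab hG U t s w - freeForm ((t : ℝ) - s) w

/-- The gradient of `phaseDefect`. -/
def defectGradient (t s : Icc a b) (w : (E × E) × (E × E)) : (E × E) × (E × E) :=
  ((-primitive hab s (force g 1 (-1) (bichar hab hG t s w)) t,
      primitive hab s (primitive hab s (force g 1 (-1) (bichar hab hG t s w))) t),
    (primitive hab t (primitive hab t (force g (-(1 / 2)) (-(1 / 2)) (bichar hab hG t s w))) s,
      primitive hab t (force g (-(1 / 2)) (-(1 / 2)) (bichar hab hG t s w)) s))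

/-- The free parts of the bicharacteristic cancel against the gradient of the free phase. Only
single and double primitives of forces survive, which is what makes the difference small. -/
theorem phaseGradient_sub_freeGradient (t s : Icc a b) (w : (E × E) × (E × E)) :
    phaseGradient hab hG t s w - freeGradient ((t : ℝ) - s) w = defectGradient hab hG t s w := by
  rw [phaseGradient, freeGradient_apply, defectGradient, bicharMom_apply, bichar_fst_apply,
    bichar_snd_apply, bicharVel_apply]
  refine Prod.ext (Prod.ext ?_ ?_) (Prod.ext ?_ ?_)
  · simp only [Prod.fst_sub]; abel
  · simp only [Prod.fst_sub, Prod.snd_sub]; abel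
  · simp only [Prod.fst_sub, Prod.snd_sub]; module
  · simp only [Prod.snd_sub]; abel

theorem hasFDerivAt_phaseDefect (hg : SmoothFiber 1 fun σ y => g (σ, y))
    (hU : ∀ σ x, HasFDerivAt (fun y => U (σ, y)) (innerSL ℝ (g (σ, x))) x)
    (t s : Icc a b) (w : (E × E) × (E × E)) :
    HasFDerivAt (phaseDefect hab hG U t s) (dotForm (defectGradient hab hG t s w)) w := by
  have h1 := (hasFDerivAt_eikonalPhase hab hG hg hU t s w).sub
    (hasFDerivAt_freeForm ((t : ℝ) - s) w)
  rw [← phaseGradient_sub_freeGradient, map_sub]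
  exact h1

/-- The gradient is C^p in (z, ξ), so the phase itself has one more derivative than the
bicharacteristics; the estimates at order p + 1 rest on this gain. -/
theorem contDiff_phaseDefect {p : ℕ} (hp : 1 ≤ p) (hg : SmoothFiber p fun σ y => g (σ, y))
    (hg1 : SmoothFiber 1 fun σ y => g (σ, y))
    (hU : ∀ σ x, HasFDerivAt (fun y => U (σ, y)) (innerSL ℝ (g (σ, x))) x)
    (t s : Icc a b) : ContDiff ℝ (p + 1 : ℕ) (phaseDefect hab hG U t s) := by
  have h0 : ContDiff ℝ p (dotForm (E := E)) := ContinuousLinearMap.contDiff _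
  have hd : ContDiff ℝ p (defectGradient hab hG t s) := by
    have h1 : ContDiff ℝ p (freeGradient (E := E) ((t : ℝ) - s)) := ContinuousLinearMap.contDiff _
    have h2 := (contDiff_phaseGradient hab hG hp hg t s).sub h1
    rw [funext fun w => (phaseGradient_sub_freeGradient hab hG t s w).symm]
    exact h2
  have h2 := h0.comp hd
  push_cast
  rw [contDiff_succ_iff_hasFDerivAt]
  exact ⟨_, h2, hasFDerivAt_phaseDefect hab hG hg1 hU t s⟩

theorem contDiff_freeForm {n : WithTop ℕ∞} (δ : ℝ) : ContDiff ℝ n (freeForm (E := E) δ) := by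
  have hx : ContDiff ℝ n fun w : (E × E) × (E × E) => w.1.1 := contDiff_fst.fst
  have hv : ContDiff ℝ n fun w : (E × E) × (E × E) => w.1.2 := contDiff_fst.snd
  have hξ : ContDiff ℝ n fun w : (E × E) × (E × E) => w.2.1 := contDiff_snd.fst
  have hη : ContDiff ℝ n fun w : (E × E) × (E × E) => w.2.2 := contDiff_snd.snd
  exact ((hx.sub (hv.const_smul δ)).inner ℝ hξ).add (hv.inner ℝ hη)

/-- The component of the gradient paired with each block of k is a primitive of a force. It is
double, with a gain |t - s|, for the v and ξ_x blocks, and single for the x and ξ_v blocks. Each is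
a fixed linear functional of the force path, so the pointwise bound by S integrates. -/
theorem abs_iteratedFDeriv_fderiv_phaseDefect_le {p : ℕ} (hp : 1 ≤ p) (hb1 : b - a ≤ 1)
    (hg : SmoothFiber p fun σ y => g (σ, y)) (hg1 : SmoothFiber 1 fun σ y => g (σ, y))
    (hU : ∀ σ x, HasFDerivAt (fun y => U (σ, y)) (innerSL ℝ (g (σ, x))) x)
    {S : ℝ → ℝ} (hSc : ContinuousOn S (Icc a b))
    (hS : ∀ j ≤ p, ∀ (σ : Icc a b) (y : E), ‖iteratedFDeriv ℝ j (fun y => g (σ, y)) y‖ ≤ S σ)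
    (hκ : p.factorial * (2 ^ (p + 2) * ∫ σ in a..b, S σ) ≤ 1 / 2) (t s : Icc a b)
    (w k : (E × E) × (E × E)) {j : ℕ} (hj : j ≤ p) (h : Fin j → (E × E) × (E × E)) :
    |iteratedFDeriv ℝ j (fun y => fderiv ℝ (phaseDefect hab hG U t s) y k) w h|
      ≤ forceConst p * |∫ σ in (s : ℝ)..t, S σ| * (‖k.1.1‖ + |(t : ℝ) - s| * ‖k.1.2‖
        + |(t : ℝ) - s| * ‖k.2.1‖ + ‖k.2.2‖) * ∏ i, ‖h i‖ := by
  have hS0 : ∀ σ ∈ Icc a b, 0 ≤ S σ := fun σ hσ =>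
    (norm_nonneg _).trans (hS 0 (Nat.zero_le _) ⟨σ, hσ⟩ 0)
  set β := |∫ σ in (s : ℝ)..t, S σ| with hβ
  have hβ' : |∫ σ in (t : ℝ)..s, S σ| = β := by
    rw [intervalIntegral.integral_symm, abs_neg]
  have hβ0 : 0 ≤ β := abs_nonneg _
  have hF := fun c c' => contDiff_force_bichar hab hG hp hg c c' t s
  -- The four blocks are treated at once: n + 1 primitives from r, evaluated at q and paired with y,
  -- where {r, q} = {s, t} and n is 0 or 1.
  have main : ∀ (c c' : ℝ), |c| ≤ 1 → |c'| ≤ 1 → ∀ (r q : Icc a b) (n : ℕ) (y : E),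
      |∫ σ in (r : ℝ)..q, S σ| = β → n = 0 ∨ n = 1 →
      ∃ T : ((E × E) × (E × E)) → ℝ, ContDiff ℝ p T ∧
        ‖iteratedFDeriv ℝ j T w‖ ≤ forceConst p * (|(q : ℝ) - r| ^ n * ‖y‖ * β) ∧
        ∀ w, T w = inner ℝ (((primitive hab r) ^ (n + 1))
          (force g c c' (bichar hab hG t s w)) q) y := by
    intro c c' hc hc' r q n y hrq hn
    set L : (Icc a b →ᵇ E) →L[ℝ] ℝ := (innerSL ℝ y).comp
      ((BoundedContinuousFunction.evalCLM ℝ q : (Icc a b →ᵇ E) →L[ℝ] E).comp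
        (primitive hab r ^ (n + 1))) with hL
    have hLu : ∀ u, L u = inner ℝ y ((primitive hab r ^ (n + 1)) u q) := fun u => rfl
    refine ⟨fun w => L (force g c c' (bichar hab hG t s w)), ?_, ?_, fun w => ?_⟩
    · have h0 : ContDiff ℝ p L := ContinuousLinearMap.contDiff _
      have := h0.comp (hF c c')
      exact this
    · refine norm_iteratedFDeriv_clm_path_le (hF c c') hj w (S := S) (forceConst_pos p).le
        (by positivity) (fun σ => norm_iteratedFDeriv_force_bichar_le hab hG hp hb1 hg hSc hS hκ
          t s w hc hc' hj σ) L fun u R hR hu => ?_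
      rw [hLu]
      refine (norm_inner_le_norm _ _).trans ?_
      rcases hn with rfl | rfl
      · have h1 := norm_primitive_apply_le_of_le hab hSc hR hu r q
        rw [hrq] at h1
        rw [zero_add, pow_one, pow_zero, one_mul]
        calc ‖y‖ * _ ≤ ‖y‖ * (R * β) := by gcongr
          _ = _ := by ring
      · have h1 := norm_primitive_primitive_apply_le hab hSc hS0 hR hu r q
        rw [hrq] at h1
        have e1 : (primitive hab r ^ (1 + 1)) u q = primitive hab r (primitive hab r u) q := by
          rw [pow_succ, pow_one]
          rfl
        rw [e1, pow_one]
        calc ‖y‖ * _ ≤ ‖y‖ * (R * (|(q : ℝ) - r| * β)) := by gcongr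
          _ = _ := by ring
    · exact (hLu _).trans (real_inner_comm _ _)
  obtain ⟨T₁, hT₁, hb₁, e₁⟩ := main 1 (-1) (by simp) (by simp) s t 0 (-k.1.1) rfl (Or.inl rfl)
  obtain ⟨T₂, hT₂, hb₂, e₂⟩ := main 1 (-1) (by simp) (by simp) s t 1 k.1.2 rfl (Or.inr rfl)
  obtain ⟨T₃, hT₃, hb₃, e₃⟩ := main (-(1 / 2)) (-(1 / 2)) (by norm_num [abs_of_pos])
    (by norm_num [abs_of_pos]) t s 1 k.2.1 hβ' (Or.inr rfl)
  obtain ⟨T₄, hT₄, hb₄, e₄⟩ := main (-(1 / 2)) (-(1 / 2)) (by norm_num [abs_of_pos])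
    (by norm_num [abs_of_pos]) t s 0 k.2.2 hβ' (Or.inl rfl)
  have hfun : (fun y => fderiv ℝ (phaseDefect hab hG U t s) y k) = T₁ + T₂ + T₃ + T₄ := by
    funext y
    rw [(hasFDerivAt_phaseDefect hab hG hg1 hU t s y).fderiv]
    simp only [Pi.add_apply, e₁, e₂, e₃, e₄, dotForm_apply, defectGradient, zero_add, pow_one,
      inner_neg_left, inner_neg_right]
    have hsq : ∀ (r : Icc a b) (u : Icc a b →ᵇ E), (primitive hab r ^ (1 + 1)) u
        = primitive hab r (primitive hab r u) := fun r u => by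
      rw [pow_succ, pow_one]
      rfl
    rw [hsq, hsq]
  have hj' : (j : WithTop ℕ∞) ≤ p := by exact_mod_cast hj
  rw [hfun, ← Real.norm_eq_abs]
  refine (ContinuousMultilinearMap.le_opNorm _ _).trans ?_
  gcongr
  have c₁ := hT₁.of_le hj'
  have c₂ := hT₂.of_le hj'
  have c₃ := hT₃.of_le hj'
  have c₄ := hT₄.of_le hj'
  have c₁₂ : ContDiff ℝ j (T₁ + T₂) := c₁.add c₂
  have c₁₃ : ContDiff ℝ j (T₁ + T₂ + T₃) := c₁₂.add c₃
  rw [iteratedFDeriv_add_apply c₁₃.contDiffAt c₄.contDiffAt,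
    iteratedFDeriv_add_apply c₁₂.contDiffAt c₃.contDiffAt,
    iteratedFDeriv_add_apply c₁.contDiffAt c₂.contDiffAt]
  refine (norm_add_le _ _).trans ?_
  have h3 := norm_add₃_le (a := iteratedFDeriv ℝ j T₁ w) (b := iteratedFDeriv ℝ j T₂ w)
    (c := iteratedFDeriv ℝ j T₃ w)
  rw [abs_sub_comm (s : ℝ) t] at hb₃
  simp only [pow_zero, pow_one, one_mul, norm_neg] at hb₁ hb₂ hb₃ hb₄
  have h4 := add_le_add h3 hb₄
  linarith [hb₁, hb₂, hb₃]

/-- For ξ = 0 the dual component l vanishes: the force a_x is zero at l = 0, so comparing the fixed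
point (x, l) with (x, 0) gives ‖l‖ ≤ ‖l‖/2. The Lagrangian is then identically zero. -/
theorem phaseDefect_zero (t s : Icc a b) (z : E × E) : phaseDefect hab hG U t s (z, 0) = 0 := by
  set X := bichar hab hG t s (z, 0) with hX
  have hl : X.2 = 0 := by
    have h1 := (hG t s).dist_le_mul X (X.1, 0)
    have h2 : force g 1 (-1) (X.1, 0) = 0 := by
      ext σ
      simp [force_apply]
    have h3 : X.2 = (systemMap hab g t s X).2 - (systemMap hab g t s (X.1, 0)).2 := by
      have h4 : (systemMap hab g t s (X.1, 0)).2 = 0 := by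
        simp [systemMap, h2]
      rw [h4, sub_zero]
      have h5 := congrArg Prod.snd (bichar_eq hab hG t s (z, 0))
      rw [← hX] at h5
      rw [h5]
      ext σ
      rw [Prod.snd_add, BoundedContinuousFunction.add_apply, freePath_apply_snd]
      simp
    rw [dist_eq_norm, dist_eq_norm] at h1
    have h4 : ‖X.2‖ ≤ ‖systemMap hab g t s X - systemMap hab g t s (X.1, 0)‖ := by
      conv_lhs => rw [h3]
      exact norm_snd_le (systemMap hab g t s X - systemMap hab g t s (X.1, 0))
    have h5 : ‖X - (X.1, 0)‖ = ‖X.2‖ := by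
      rw [Prod.norm_def]
      simp
    rw [h5] at h1
    have h6 : ((1 / 2 : NNReal) : ℝ) = 1 / 2 := by norm_num
    rw [h6] at h1
    have h7 : ‖X.2‖ = 0 := by linarith [norm_nonneg X.2]
    exact norm_eq_zero.1 h7
  have hLag : lagrangianPath U g X = 0 := by
    ext σ
    simp [lagrangianPath, symbolPath_apply, hl]
  simp [phaseDefect, eikonalPhase, freeForm, ← hX, hLag]

/-- With l₀ the free dual variable, d/dτ (l₀·v + ξ·x) = l₀·a_l for the constant free momentum ξ.
Integrating this removes from the action all terms growing with ξ. The integrand left, (l - l₀)·a_l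
- a, is bounded uniformly in (z, ξ), which the order 0 estimate requires. -/
theorem phaseDefect_eq (t s : Icc a b) (w : (E × E) × (E × E)) :
    phaseDefect hab hG U t s w = primitive hab s
      (innerPath (primitive hab s (primitive hab s (force g 1 (-1) (bichar hab hG t s w))))
        (force g (-(1 / 2)) (-(1 / 2)) (bichar hab hG t s w))
        - symbolPath U (bichar hab hG t s w)) t := by
  set X := bichar hab hG t s w with hX
  have hb := isBichar_bichar hab hG t s w
  set one := BoundedContinuousFunction.const (Icc a b) (1 : ℝ)
  set A := force g (-(1 / 2)) (-(1 / 2)) X with hA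
  set l₀ : Icc a b →ᵇ E := mulPath one w.2.2 - primitive hab s (mulPath one w.2.1) with hl₀
  have hd₀ : ∀ τ : Icc a b, HasDerivWithinAt (IccExtend hab l₀) ((-mulPath one w.2.1) τ)
      (Icc a b) τ := fun τ => by
    have := hasDerivWithinAt_const_add_primitive hab w.2.2 s (-mulPath one w.2.1) τ
    rwa [map_neg, ← sub_eq_add_neg] at this
  have hc₀ : ∀ τ : Icc a b, HasDerivWithinAt (IccExtend hab (mulPath one w.2.1))
      ((0 : Icc a b →ᵇ E) τ) (Icc a b) τ := fun τ => by
    have : IccExtend hab (mulPath one w.2.1) = fun _ => w.2.1 := by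
      funext σ
      simp [IccExtend, one]
    rw [this]
    exact hasDerivWithinAt_const _ _ _
  have key := eq_add_primitive hab
    (u := innerPath l₀ (bicharVel hab hG t s w) + innerPath (mulPath one w.2.1) X.1)
    (U := (innerPath l₀ A + innerPath (-mulPath one w.2.1) (bicharVel hab hG t s w))
      + (innerPath (mulPath one w.2.1) (bicharVel hab hG t s w) + innerPath 0 X.1))
    (fun τ => (hasDerivWithinAt_innerPath hab (hd₀ τ) (hb.vel τ)).add
      (hasDerivWithinAt_innerPath hab (hc₀ τ) (hb.pos τ))) s t
  have e5 : (innerPath l₀ A + innerPath (-mulPath one w.2.1) (bicharVel hab hG t s w))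
      + (innerPath (mulPath one w.2.1) (bicharVel hab hG t s w) + innerPath 0 X.1)
      = innerPath l₀ A := by
    simp only [map_neg, neg_apply, map_zero, zero_apply]
    abel
  have el : X.2 = l₀ + primitive hab s (primitive hab s (force g 1 (-1) X)) := by
    rw [hX, bichar_snd_eq, bicharMom, map_sub, ← hX]
    simp only [hl₀]
    abel
  rw [e5] at key
  have hpm : primitive hab s (mulPath one w.2.1) t = ((t : ℝ) - s) • w.2.1 := by
    rw [primitive_mulPath_one]
    simp
  have x1 : X.1 t = w.1.1 := by simp [hX, bichar_fst_apply]
  have x2 : bicharVel hab hG t s w t = w.1.2 := by simp [bicharVel_apply]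
  simp only [BoundedContinuousFunction.add_apply, innerPath_apply, hl₀,
    BoundedContinuousFunction.sub_apply, hpm, x1, x2, primitive_self, mulPath_apply, one,
    BoundedContinuousFunction.const_apply, one_smul, sub_zero] at key
  have hsplit : lagrangianPath U g X = innerPath l₀ A
      + (innerPath (primitive hab s (primitive hab s (force g 1 (-1) X))) A - symbolPath U X) := by
    rw [lagrangianPath]
    conv_lhs => rw [el]
    rw [map_add, add_apply, ← hA]
    abel
  rw [phaseDefect, eikonalPhase, ← hX, hsplit, map_add, BoundedContinuousFunction.add_apply,
    freeForm]
  simp only [inner_sub_left, inner_smul_left, conj_trivial] at key ⊢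
  rw [real_inner_comm w.2.1 (X.1 s), real_inner_comm w.2.2 (bicharVel hab hG t s w s),
    real_inner_comm w.2.1 w.1.1, real_inner_comm w.2.1 w.1.2, real_inner_comm w.2.2 w.1.2]
  simp only [hl₀, one] at key ⊢
  linarith [key]

theorem norm_force_le {S : ℝ → ℝ} (hS : ∀ (σ : Icc a b) (y : E), ‖g (σ, y)‖ ≤ S σ)
    {c c' : ℝ} (hc : |c| ≤ 1) (hc' : |c'| ≤ 1) (X : (Icc a b →ᵇ E) × (Icc a b →ᵇ E))
    (σ : Icc a b) : ‖force g c c' X σ‖ ≤ 2 * S σ := by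
  rw [force_apply]
  refine (norm_add_le _ _).trans ?_
  rw [norm_smul, norm_smul, Real.norm_eq_abs, Real.norm_eq_abs]
  have h1 := hS σ (X.1 σ - (1 / 2 : ℝ) • X.2 σ)
  have h2 := hS σ (X.1 σ + (1 / 2 : ℝ) • X.2 σ)
  have h3 := mul_le_mul hc h1 (norm_nonneg _) zero_le_one
  have h4 := mul_le_mul hc' h2 (norm_nonneg _) zero_le_one
  linarith

/-- In the reduced action |l - l₀| ≤ 1 and |a_l| ≤ 2S, and the symbol is a difference of two values
of U, hence at most 2S; this accounts for the constant 4. -/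
theorem abs_phaseDefect_le (hb1 : b - a ≤ 1) {S : ℝ → ℝ} (hSc : ContinuousOn S (Icc a b))
    (hS : ∀ (σ : Icc a b) (y : E), ‖g (σ, y)‖ ≤ S σ)
    (hSU : ∀ (σ : Icc a b) (y : E), |U (σ, y)| ≤ S σ)
    (hκ : ∫ σ in a..b, S σ ≤ 1 / 2) (t s : Icc a b) (w : (E × E) × (E × E)) :
    |phaseDefect hab hG U t s w| ≤ 4 * |∫ σ in (s : ℝ)..t, S σ| := by
  have hS0 : ∀ σ ∈ Icc a b, 0 ≤ S σ := fun σ hσ =>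
    (norm_nonneg _).trans (hS ⟨σ, hσ⟩ 0)
  rw [phaseDefect_eq, ← Real.norm_eq_abs]
  set X := bichar hab hG t s w
  refine norm_primitive_apply_le_of_le hab hSc (by norm_num) (fun σ => ?_) s t
  have hm : ‖primitive hab s (primitive hab s (force g 1 (-1) X)) σ‖ ≤ 1 := by
    refine (BoundedContinuousFunction.norm_coe_le_norm _ σ).trans ?_
    refine (norm_primitive_apply_le hab s _).trans ?_
    have h1 := norm_primitive_le_of_le hab hSc hS0 s (force g 1 (-1) X) zero_le_two
      (norm_force_le hS (by simp) (by simp) X)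
    have h2 : 0 ≤ b - a := sub_nonneg.2 hab
    calc (b - a) * ‖primitive hab s (force g 1 (-1) X)‖ ≤ 1 * (2 * ∫ σ in a..b, S σ) := by gcongr
      _ ≤ 1 := by linarith
  have hA := norm_force_le hS (c := -(1 / 2)) (c' := -(1 / 2)) (by norm_num [abs_of_pos])
    (by norm_num [abs_of_pos]) X σ
  rw [BoundedContinuousFunction.sub_apply, innerPath_apply, symbolPath_apply]
  have h1 := abs_real_inner_le_norm (primitive hab s (primitive hab s (force g 1 (-1) X)) σ)
    (force g (-(1 / 2)) (-(1 / 2)) X σ)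
  have h2 := hSU σ (X.1 σ - (1 / 2 : ℝ) • X.2 σ)
  have h3 := hSU σ (X.1 σ + (1 / 2 : ℝ) • X.2 σ)
  have h4 : ‖primitive hab s (primitive hab s (force g 1 (-1) X)) σ‖
      * ‖force g (-(1 / 2)) (-(1 / 2)) X σ‖ ≤ 1 * (2 * S σ) := by gcongr
  rw [Real.norm_eq_abs, abs_le]
  rw [abs_le] at h1 h2 h3
  constructor <;> linarith

end PhaseBounds

/-! ### Uniqueness for the eikonal equation -/

noncomputable section EikonalUniqueness

variable {d : ℕ} {U : ℝ → Space d → ℝ} {T s : ℝ} {ψ ψ₁ ψ₂ : ℝ → Phase d → Phase d → ℝ}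

theorem IsEikonalSolution.hasFDerivWithinAt (h : IsEikonalSolution U T s ψ) {t : ℝ}
    (ht : t ∈ Icc 0 T) (z ξ : Phase d) :
    HasFDerivWithinAt (fun q : ℝ × Phase d × Phase d => ψ q.1 q.2.1 q.2.2)
      (fderivWithin ℝ (fun q : ℝ × Phase d × Phase d => ψ q.1 q.2.1 q.2.2) (Icc 0 T ×ˢ univ)
        (t, z, ξ)) (Icc 0 T ×ˢ univ) (t, z, ξ) :=
  ((h.contDiffOn.differentiableOn (by norm_num)) (t, z, ξ) ⟨ht, mem_univ _⟩).hasFDerivWithinAt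

/-- The derivative of a solution of the eikonal equation. -/
def eikonalDeriv (ψ : ℝ → Phase d → Phase d → ℝ) (T t : ℝ) (z ξ : Phase d) :
    ℝ × Phase d × Phase d →L[ℝ] ℝ :=
  fderivWithin ℝ (fun q : ℝ × Phase d × Phase d => ψ q.1 q.2.1 q.2.2) (Icc 0 T ×ˢ univ) (t, z, ξ)

theorem IsEikonalSolution.hasFDerivAt_space (h : IsEikonalSolution U T s ψ) {t : ℝ}
    (ht : t ∈ Icc 0 T) (z ξ : Phase d) : HasFDerivAt (fun z => ψ t z ξ)
      ((eikonalDeriv ψ T t z ξ).comp ((ContinuousLinearMap.inr ℝ ℝ (Phase d × Phase d)).comp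
        (ContinuousLinearMap.inl ℝ (Phase d) (Phase d)))) z := by
  have h1 : HasFDerivAt (fun z : Phase d => ((t, z, ξ) : ℝ × Phase d × Phase d))
      ((ContinuousLinearMap.inr ℝ ℝ (Phase d × Phase d)).comp
        (ContinuousLinearMap.inl ℝ (Phase d) (Phase d))) z :=
    (hasFDerivAt_prodMk_right t (z, ξ)).comp z (hasFDerivAt_prodMk_left z ξ)
  have hm : MapsTo (fun z : Phase d => ((t, z, ξ) : ℝ × Phase d × Phase d)) univ
      (Icc 0 T ×ˢ univ) := fun y _ => ⟨ht, mem_univ _⟩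
  have h2 := (h.hasFDerivWithinAt ht z ξ).comp z (h1.hasFDerivWithinAt (s := univ)) hm
  exact hasFDerivWithinAt_univ.1 h2

theorem inner_gradient_of_hasFDerivAt {E : Type} [NormedAddCommGroup E] [InnerProductSpace ℝ E]
    [CompleteSpace E] {f : E → ℝ} {f' : E →L[ℝ] ℝ} {x : E} (h : HasFDerivAt f f' x) (k : E) :
    inner ℝ (gradient f x) k = f' k := by
  rw [gradient, h.fderiv, InnerProductSpace.toDual_symm_apply]

theorem IsEikonalSolution.inner_gradient_fst (h : IsEikonalSolution U T s ψ) {t : ℝ}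
    (ht : t ∈ Icc 0 T) (z ξ : Phase d) (k : Space d) :
    inner ℝ (gradient (fun x => ψ t (x, z.2) ξ) z.1) k
      = eikonalDeriv ψ T t z ξ (0, ((k, 0), 0)) := by
  have h1 := (h.hasFDerivAt_space ht z ξ).comp z.1
    (hasFDerivAt_prodMk_left (𝕜 := ℝ) z.1 z.2)
  exact inner_gradient_of_hasFDerivAt h1 k

theorem IsEikonalSolution.inner_gradient_snd (h : IsEikonalSolution U T s ψ) {t : ℝ}
    (ht : t ∈ Icc 0 T) (z ξ : Phase d) (k : Space d) :
    inner ℝ (gradient (fun v => ψ t (z.1, v) ξ) z.2) k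
      = eikonalDeriv ψ T t z ξ (0, ((0, k), 0)) := by
  have h1 := (h.hasFDerivAt_space ht z ξ).comp z.2
    (hasFDerivAt_prodMk_right (𝕜 := ℝ) z.1 z.2)
  exact inner_gradient_of_hasFDerivAt h1 k

theorem IsEikonalSolution.eikonalDeriv_time (h : IsEikonalSolution U T s ψ) (hT : 0 < T) {t : ℝ}
    (ht : t ∈ Icc 0 T) (z ξ : Phase d) : eikonalDeriv ψ T t z ξ (1, 0) =
      -(inner ℝ z.2 (gradient (fun x => ψ t (x, z.2) ξ) z.1) +
        symbolOf (U t) z.1 (gradient (fun v => ψ t (z.1, v) ξ) z.2)) := by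
  have h1 : HasDerivWithinAt (fun τ : ℝ => ((τ, z, ξ) : ℝ × Phase d × Phase d)) (1, 0)
      (Icc 0 T) t := (hasDerivWithinAt_id t _).prodMk (hasDerivWithinAt_const t _ (z, ξ))
  have hm : MapsTo (fun τ : ℝ => ((τ, z, ξ) : ℝ × Phase d × Phase d)) (Icc 0 T)
      (Icc 0 T ×ˢ univ) := fun τ hτ => ⟨hτ, mem_univ _⟩
  have h2 := (h.hasFDerivWithinAt ht z ξ).comp_hasDerivWithinAt t h1 hm
  exact (uniqueDiffOn_Icc hT t ht).eq_deriv _ h2 (h.equation t ht z ξ)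

theorem abs_symbolOf_sub_le {u : Space d → ℝ} {L : NNReal} (hu : LipschitzWith L u)
    (x η η' : Space d) : |symbolOf u x η - symbolOf u x η'| ≤ L * ‖η - η'‖ := by
  have h1 := hu.dist_le_mul (x - (1 / 2 : ℝ) • η) (x - (1 / 2 : ℝ) • η')
  have h2 := hu.dist_le_mul (x + (1 / 2 : ℝ) • η) (x + (1 / 2 : ℝ) • η')
  rw [Real.dist_eq, dist_eq_norm] at h1 h2
  have e1 : ‖x - (1 / 2 : ℝ) • η - (x - (1 / 2 : ℝ) • η')‖ = 1 / 2 * ‖η - η'‖ := by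
    rw [show x - (1 / 2 : ℝ) • η - (x - (1 / 2 : ℝ) • η') = -((1 / 2 : ℝ) • (η - η')) by module,
      norm_neg, norm_smul]
    norm_num
  have e2 : ‖x + (1 / 2 : ℝ) • η - (x + (1 / 2 : ℝ) • η')‖ = 1 / 2 * ‖η - η'‖ := by
    rw [show x + (1 / 2 : ℝ) • η - (x + (1 / 2 : ℝ) • η') = (1 / 2 : ℝ) • (η - η') by module,
      norm_smul]
    norm_num
  rw [e1] at h1
  rw [e2] at h2
  unfold symbolOf
  rw [abs_le] at h1 h2 ⊢
  constructor <;> linarith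

/-- In coordinates moving with free transport the term v·∇_x disappears. The difference of two
solutions then has a time derivative bounded by the Lipschitz constant of the symbol times the
difference of the v-gradients, and the maximum principle on cones applies. The sign κ = ±1 treats
times after and before s together. -/
theorem IsEikonalSolution.le_of_direction (h₁ : IsEikonalSolution U T s ψ₁)
    (h₂ : IsEikonalSolution U T s ψ₂) (hT : 0 < T) {L : NNReal}
    (hU : ∀ t ∈ Icc 0 T, LipschitzWith L (U t)) {κ b : ℝ} (hκ : |κ| = 1) (hb1 : b ≤ 1)
    (hb : ∀ τ ∈ Icc 0 b, s + κ * τ ∈ Icc 0 T) (ξ : Phase d) :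
    ∀ τ ∈ Icc 0 b, ∀ z : Phase d, ψ₁ (s + κ * τ) z ξ ≤ ψ₂ (s + κ * τ) z ξ := by
  set m : ℝ × Phase d → ℝ × Phase d × Phase d := fun q =>
    (s + κ * q.1, ((q.2.1 + (κ * q.1) • q.2.2, q.2.2), ξ)) with hm
  set m' : ℝ × Phase d → ℝ × Phase d →L[ℝ] ℝ × Phase d × Phase d := fun q =>
    (κ • ContinuousLinearMap.fst ℝ ℝ (Phase d)).prod
      ((((ContinuousLinearMap.fst ℝ _ _).comp (ContinuousLinearMap.snd ℝ ℝ (Phase d)) +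
        ((κ * q.1) • (ContinuousLinearMap.snd ℝ _ _).comp (ContinuousLinearMap.snd ℝ ℝ (Phase d))
          + (κ • ContinuousLinearMap.fst ℝ ℝ (Phase d)).smulRight q.2.2)).prod
        ((ContinuousLinearMap.snd ℝ _ _).comp (ContinuousLinearMap.snd ℝ ℝ (Phase d)))).prod 0)
    with hm'
  have hmd : ∀ q, HasFDerivAt m (m' q) q := by
    intro q
    have c1 := (ContinuousLinearMap.fst ℝ ℝ (Phase d)).hasFDerivAt (x := q)
    have c2 := ((ContinuousLinearMap.fst ℝ (Space d) (Space d)).comp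
      (ContinuousLinearMap.snd ℝ ℝ (Phase d))).hasFDerivAt (x := q)
    have c3 := ((ContinuousLinearMap.snd ℝ (Space d) (Space d)).comp
      (ContinuousLinearMap.snd ℝ ℝ (Phase d))).hasFDerivAt (x := q)
    have e1 := (c1.const_mul κ).const_add s
    have e2 := c2.add ((c1.const_mul κ).smul c3)
    exact e1.prodMk ((e2.prodMk c3).prodMk (hasFDerivAt_const ξ q))
  have hmI : ∀ q ∈ Icc 0 b ×ˢ (univ : Set (Phase d)), m q ∈ Icc 0 T ×ˢ univ := fun q hq =>
    ⟨hb q.1 hq.1, mem_univ _⟩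
  set D : ℝ × Phase d → ℝ × Phase d × Phase d →L[ℝ] ℝ := fun q =>
    eikonalDeriv ψ₁ T (m q).1 (m q).2.1 (m q).2.2 - eikonalDeriv ψ₂ T (m q).1 (m q).2.1 (m q).2.2
    with hD
  have hu : ∀ q ∈ Icc 0 b ×ˢ (univ : Set (Phase d)), HasFDerivWithinAt
      (fun q => ψ₁ (m q).1 (m q).2.1 (m q).2.2 - ψ₂ (m q).1 (m q).2.1 (m q).2.2)
      ((D q).comp (m' q)) (Icc 0 b ×ˢ univ) q := by
    intro q hq
    have e1 := (h₁.hasFDerivWithinAt (hmI q hq).1 (m q).2.1 (m q).2.2).comp q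
      (hmd q).hasFDerivWithinAt hmI
    have e2 := (h₂.hasFDerivWithinAt (hmI q hq).1 (m q).2.1 (m q).2.2).comp q
      (hmd q).hasFDerivWithinAt hmI
    have e3 := e1.sub e2
    rw [← ContinuousLinearMap.sub_comp] at e3
    exact e3
  have hu' : ∀ q ∈ Icc 0 b ×ˢ (univ : Set (Phase d)), |((D q).comp (m' q)) (1, 0)|
      ≤ (2 * L) * ‖((D q).comp (m' q)).comp (ContinuousLinearMap.inr ℝ ℝ (Phase d))‖ := by
    intro q hq
    have hq1 : |q.1| ≤ 1 := abs_le.2 ⟨by linarith [hq.1.1], hq.1.2.trans hb1⟩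
    have ht := (hmI q hq).1
    set z := (m q).2.1 with hz
    set A := ((D q).comp (m' q)).comp (ContinuousLinearMap.inr ℝ ℝ (Phase d)) with hA
    set η₁ := gradient (fun v => ψ₁ (m q).1 (z.1, v) ξ) z.2 with hη₁
    set η₂ := gradient (fun v => ψ₂ (m q).1 (z.1, v) ξ) z.2 with hη₂
    have hval : ((D q).comp (m' q)) (1, 0)
        = -κ * (symbolOf (U (m q).1) z.1 η₁ - symbolOf (U (m q).1) z.1 η₂) := by
      have e0 : m' q (1, 0) = κ • (((1 : ℝ), (0 : Phase d × Phase d))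
          + ((0 : ℝ), (((z.2, 0), 0) : Phase d × Phase d))) := by
        simp [hm', hz, hm]
      have f1 := h₁.eikonalDeriv_time hT ht z ξ
      have f2 := h₂.eikonalDeriv_time hT ht z ξ
      have g1 := h₁.inner_gradient_fst ht z ξ z.2
      have g2 := h₂.inner_gradient_fst ht z ξ z.2
      rw [real_inner_comm] at g1 g2
      rw [ContinuousLinearMap.comp_apply, e0, map_smul, map_add]
      simp only [hD, sub_apply, smul_eq_mul]
      change κ * (eikonalDeriv ψ₁ T (m q).1 z ξ (1, 0) - eikonalDeriv ψ₂ T (m q).1 z ξ (1, 0)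
        + (eikonalDeriv ψ₁ T (m q).1 z ξ (0, ((z.2, 0), 0))
          - eikonalDeriv ψ₂ T (m q).1 z ξ (0, ((z.2, 0), 0)))) = _
      rw [f1, f2, ← g1, ← g2]
      ring
    have hη : ‖η₁ - η₂‖ ≤ 2 * ‖A‖ := by
      set k := η₁ - η₂ with hk
      have g1 := h₁.inner_gradient_snd ht z ξ k
      have g2 := h₂.inner_gradient_snd ht z ξ k
      -- In the moving coordinates a pure v direction k becomes (-κτ k, k); for |τ| ≤ 1 its sup norm
      -- is that of k, so the v-gradient is controlled by the full spatial derivative A.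
      have e1 : inner ℝ k k = A (-(κ * q.1) • k, k) := by
        have e0 : m' q (0, (-(κ * q.1) • k, k)) = ((0 : ℝ), (((0, k), 0) : Phase d × Phase d)) := by
          simp [hm']
        have e2 : A (-(κ * q.1) • k, k) = D q (m' q (0, (-(κ * q.1) • k, k))) := rfl
        rw [e2, e0]
        conv_lhs => rw [hk]
        rw [inner_sub_left, g1, g2]
        rfl
      have e3 : ‖((-(κ * q.1) • k, k) : Phase d)‖ ≤ ‖k‖ := by
        refine norm_prod_le_iff.2 ⟨?_, le_rfl⟩
        rw [norm_smul, Real.norm_eq_abs, abs_neg, abs_mul, hκ, one_mul]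
        exact mul_le_of_le_one_left (norm_nonneg _) hq1
      have e4 := (le_abs_self _).trans (A.le_opNorm (-(κ * q.1) • k, k))
      rw [← e1, real_inner_self_eq_norm_sq] at e4
      have e5 : ‖k‖ ^ 2 ≤ ‖A‖ * ‖k‖ := e4.trans (by gcongr)
      rcases (norm_nonneg k).eq_or_lt with h0 | h0
      · rw [← h0]; positivity
      · have : ‖k‖ ≤ ‖A‖ := by
          have : ‖k‖ * ‖k‖ ≤ ‖A‖ * ‖k‖ := by rwa [← pow_two]
          exact le_of_mul_le_mul_right this h0
        linarith [norm_nonneg A]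
    rw [hval, abs_mul, abs_neg, hκ, one_mul]
    calc _ ≤ (L : ℝ) * ‖η₁ - η₂‖ := abs_symbolOf_sub_le (hU _ ht) _ _ _
      _ ≤ L * (2 * ‖A‖) := by gcongr
      _ = 2 * L * ‖A‖ := by ring
  have key := nonpos_of_transport (a := 0) (b := b) (C := 2 * L) (by positivity) hu hu' fun y => by
    simp only [hm, mul_zero, add_zero]
    rw [h₁.initial, h₂.initial, sub_self]
  intro τ hτ z
  have := key τ hτ (z.1 - (κ * τ) • z.2, z.2)
  simp only [hm, sub_add_cancel] at this
  linarith

theorem IsEikonalSolution.unique (h₁ : IsEikonalSolution U T s ψ₁)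
    (h₂ : IsEikonalSolution U T s ψ₂) (hT : 0 < T) (hT1 : T ≤ 1) (hs : s ∈ Icc 0 T) {L : NNReal}
    (hU : ∀ t ∈ Icc 0 T, LipschitzWith L (U t)) {t : ℝ} (ht : t ∈ Icc 0 T) (z ξ : Phase d) :
    ψ₁ t z ξ = ψ₂ t z ξ := by
  rcases le_total s t with h | h
  · have hb : ∀ τ ∈ Icc 0 (T - s), s + 1 * τ ∈ Icc 0 T := fun τ hτ =>
      ⟨by linarith [hs.1, hτ.1], by linarith [hτ.2]⟩
    have hmem : t - s ∈ Icc 0 (T - s) := ⟨by linarith, by linarith [ht.2]⟩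
    have e : s + 1 * (t - s) = t := by ring
    have a1 := h₁.le_of_direction h₂ hT hU (κ := 1) (by simp) (by linarith [hs.1]) hb ξ _ hmem z
    have a2 := h₂.le_of_direction h₁ hT hU (κ := 1) (by simp) (by linarith [hs.1]) hb ξ _ hmem z
    rw [e] at a1 a2
    exact le_antisymm a1 a2
  · have hb : ∀ τ ∈ Icc 0 s, s + (-1) * τ ∈ Icc 0 T := fun τ hτ =>
      ⟨by linarith [hτ.2], by linarith [hs.2, hτ.1]⟩
    have hmem : s - t ∈ Icc 0 s := ⟨by linarith, by linarith [ht.1]⟩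
    have e : s + (-1) * (s - t) = t := by ring
    have a1 := h₁.le_of_direction h₂ hT hU (κ := -1) (by simp) (by linarith [hs.2]) hb ξ _ hmem z
    have a2 := h₂.le_of_direction h₁ hT hU (κ := -1) (by simp) (by linarith [hs.2]) hb ξ _ hmem z
    rw [e] at a1 a2
    exact le_antisymm a1 a2

end EikonalUniqueness

/-! ### Estimates in the directions of the canonical basis -/

noncomputable section EikonalTheorem

theorem SmoothFiber.clm_comp {I E F G : Type} [TopologicalSpace I] [NormedAddCommGroup E]
    [NormedSpace ℝ E] [NormedAddCommGroup F] [NormedSpace ℝ F] [NormedAddCommGroup G]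
    [NormedSpace ℝ G] {k : ℕ} {f : I → E → F} (h : SmoothFiber k f) (L : F →L[ℝ] G) :
    SmoothFiber k fun σ y => L (f σ y) := by
  refine ⟨fun σ => L.contDiff.comp (h.1 σ), fun j hj => ?_⟩
  have e : ∀ q : I × E, iteratedFDeriv ℝ j (fun y => L (f q.1 y)) q.2
      = L.compContinuousMultilinearMap (iteratedFDeriv ℝ j (f q.1) q.2) := fun q =>
    L.iteratedFDeriv_comp_left (h.1 q.1).contDiffAt (by exact_mod_cast hj)
  simp only [e]
  exact (ContinuousLinearMap.compContinuousMultilinearMapL ℝ (fun _ : Fin j => E) F G L).continuous.comp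
    (h.2 j hj)

/-- The Riesz representation. -/
def rieszCLM (E : Type) [NormedAddCommGroup E] [InnerProductSpace ℝ E] [CompleteSpace E] :
    (E →L[ℝ] ℝ) →L[ℝ] E :=
  LinearMap.mkContinuous
    { toFun := fun ℓ => (InnerProductSpace.toDual ℝ E).symm ℓ
      map_add' := fun x y => map_add _ x y
      map_smul' := fun c x => by simp }
    1 fun ℓ => by simp

theorem inner_rieszCLM {E : Type} [NormedAddCommGroup E] [InnerProductSpace ℝ E]
    [CompleteSpace E] (ℓ : E →L[ℝ] ℝ) (y : E) : inner ℝ (rieszCLM E ℓ) y = ℓ y :=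
  InnerProductSpace.toDual_symm_apply

theorem norm_rieszCLM_le {E : Type} [NormedAddCommGroup E] [InnerProductSpace ℝ E]
    [CompleteSpace E] : ‖rieszCLM E‖ ≤ 1 :=
  LinearMap.mkContinuous_norm_le _ zero_le_one _

theorem norm_iteratedFDeriv_gradient_le {E : Type} [NormedAddCommGroup E] [InnerProductSpace ℝ E]
    [CompleteSpace E] {u : E → ℝ} {j : ℕ} (hu : ContDiff ℝ (j + 1 : ℕ) u) (x : E) :
    ‖iteratedFDeriv ℝ j (fun y => rieszCLM E (fderiv ℝ u y)) x‖ ≤ ‖iteratedFDeriv ℝ (j + 1) u x‖ := by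
  have e : iteratedFDeriv ℝ j (fun y => rieszCLM E (fderiv ℝ u y)) x
      = (rieszCLM E).compContinuousMultilinearMap (iteratedFDeriv ℝ j (fderiv ℝ u) x) :=
    (rieszCLM E).iteratedFDeriv_comp_left
      (hu.fderiv_right (m := j) (by norm_cast)).contDiffAt le_rfl
  rw [e, ← norm_iteratedFDeriv_fderiv]
  refine (ContinuousLinearMap.norm_compContinuousMultilinearMap_le _ _).trans ?_
  exact mul_le_of_le_one_left (norm_nonneg _) norm_rieszCLM_le

variable {d : ℕ}

theorem norm_fst_le_phaseNorm (z : Phase d) : ‖z.1‖ ≤ phaseNorm z := by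
  rw [phaseNorm, phaseDot]
  refine Real.le_sqrt_of_sq_le ?_
  rw [real_inner_self_eq_norm_sq, real_inner_self_eq_norm_sq]
  nlinarith [sq_nonneg ‖z.2‖]

theorem norm_snd_le_phaseNorm (z : Phase d) : ‖z.2‖ ≤ phaseNorm z := by
  rw [phaseNorm, phaseDot]
  refine Real.le_sqrt_of_sq_le ?_
  rw [real_inner_self_eq_norm_sq, real_inner_self_eq_norm_sq]
  nlinarith [sq_nonneg ‖z.1‖]

theorem norm_phaseBasis_le (i : Fin d ⊕ Fin d) : ‖phaseBasis i‖ ≤ 1 := by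
  rcases i with i | i <;> simp [phaseBasis, Prod.norm_def]

/-- A basis vector has a single nonzero block, so the weighted sum of blocks costs no dimensional
constant. -/
theorem weight_fullBasis_le {δ : ℝ} (hδ : |δ| ≤ 1) (i : (Fin d ⊕ Fin d) ⊕ (Fin d ⊕ Fin d)) :
    ‖(fullBasis i).1.1‖ + |δ| * ‖(fullBasis i).1.2‖ + |δ| * ‖(fullBasis i).2.1‖
      + ‖(fullBasis i).2.2‖ ≤ 1 := by
  rcases i with (i | i) | (i | i) <;> simp [fullBasis, phaseBasis, hδ]

theorem norm_fullBasis_le (i : (Fin d ⊕ Fin d) ⊕ (Fin d ⊕ Fin d)) : ‖fullBasis i‖ ≤ 1 := by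
  rcases i with i | i <;> simp [fullBasis, Prod.norm_mk, norm_phaseBasis_le]

/-- The mixed Hessian of the free phase is the identity up to the block -(t - s) pairing v with ξ_x;
this is the term |t - s| in the distance of the mixed Hessian of the phase to the identity. -/
theorem iteratedFDeriv_two_freeForm {E : Type} [NormedAddCommGroup E] [InnerProductSpace ℝ E]
    [CompleteSpace E] (δ : ℝ) (w : (E × E) × (E × E)) (h k : E × E) :
    iteratedFDeriv ℝ 2 (freeForm δ) w ![(h, 0), (0, k)]
      = inner ℝ h.1 k.1 + inner ℝ h.2 k.2 - δ * inner ℝ h.2 k.1 := by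
  have e : (fderiv ℝ (freeForm (E := E) δ)) = fun w => dotForm (freeGradient δ w) :=
    funext fun w => (hasFDerivAt_freeForm δ w).fderiv
  have h1 : HasFDerivAt (fun w : (E × E) × (E × E) => dotForm (freeGradient δ w))
      (dotForm.comp (freeGradient δ)) w :=
    (dotForm.comp (freeGradient (E := E) δ)).hasFDerivAt
  rw [iteratedFDeriv_two_apply, e, h1.fderiv]
  simp [freeGradient_apply, inner_sub_left, inner_smul_left]
  ring

section Defect

variable {E : Type} [NormedAddCommGroup E] [InnerProductSpace ℝ E] [CompleteSpace E] {a b : ℝ}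
  (hab : a ≤ b) {g : C(Icc a b × E, E)}
  (hG : ∀ t s, LipschitzWith (1 / 2) (systemMap hab g t s)) {U : C(Icc a b × E, ℝ)}

/-- One direction is spent on the explicit gradient, the others on the bounds of order j ≤ p for its
components. -/
theorem abs_iteratedFDeriv_phaseDefect_le {p : ℕ} (hp : 1 ≤ p) (hb1 : b - a ≤ 1)
    (hg : SmoothFiber p fun σ y => g (σ, y)) (hg1 : SmoothFiber 1 fun σ y => g (σ, y))
    (hU : ∀ σ x, HasFDerivAt (fun y => U (σ, y)) (innerSL ℝ (g (σ, x))) x)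
    {S : ℝ → ℝ} (hSc : ContinuousOn S (Icc a b))
    (hS : ∀ j ≤ p, ∀ (σ : Icc a b) (y : E), ‖iteratedFDeriv ℝ j (fun y => g (σ, y)) y‖ ≤ S σ)
    (hκ : p.factorial * (2 ^ (p + 2) * ∫ σ in a..b, S σ) ≤ 1 / 2) (t s : Icc a b)
    (w : (E × E) × (E × E)) {j : ℕ} (hj : j ≤ p) (h : Fin (j + 1) → (E × E) × (E × E))
    (hn : ∀ i, ‖h i‖ ≤ 1)
    (hl : ‖(h (Fin.last j)).1.1‖ + |(t : ℝ) - s| * ‖(h (Fin.last j)).1.2‖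
      + |(t : ℝ) - s| * ‖(h (Fin.last j)).2.1‖ + ‖(h (Fin.last j)).2.2‖ ≤ 1) :
    |iteratedFDeriv ℝ (j + 1) (phaseDefect hab hG U t s) w h|
      ≤ forceConst p * |∫ σ in (s : ℝ)..t, S σ| := by
  have hc := contDiff_phaseDefect hab hG hp hg hg1 hU t s
  rw [iteratedFDeriv_succ_apply_snoc (hc.of_le (by exact_mod_cast Nat.succ_le_succ hj))]
  have key := abs_iteratedFDeriv_fderiv_phaseDefect_le hab hG hp hb1 hg hg1 hU hSc hS hκ t s w
    (h (Fin.last j)) hj (Fin.init h)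
  refine key.trans ?_
  have hF := (forceConst_pos p).le
  have h1 : ∏ i, ‖Fin.init h i‖ ≤ 1 := Finset.prod_le_one (fun _ _ => norm_nonneg _)
    fun i _ => hn _
  have h2 : 0 ≤ ∏ i, ‖Fin.init h i‖ := Finset.prod_nonneg fun _ _ => norm_nonneg _
  have h3 : 0 ≤ forceConst p * |∫ σ in (s : ℝ)..t, S σ| := mul_nonneg hF (abs_nonneg _)
  exact mul_le_of_le_one_right (mul_nonneg h3 (by positivity)) h1 |>.trans
    (mul_le_of_le_one_right h3 hl)

/-- The difference vanishes at ξ = 0, so its z-derivatives are recovered from the derivative in the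
direction (0, ξ) along the segment from 0 to ξ. The weights of the blocks ξ_v and ξ_x appear in this
way. -/
theorem abs_iteratedFDeriv_phaseDefect_left_le {p : ℕ} (hp : 1 ≤ p) (hb1 : b - a ≤ 1)
    (hg : SmoothFiber p fun σ y => g (σ, y)) (hg1 : SmoothFiber 1 fun σ y => g (σ, y))
    (hU : ∀ σ x, HasFDerivAt (fun y => U (σ, y)) (innerSL ℝ (g (σ, x))) x)
    {S : ℝ → ℝ} (hSc : ContinuousOn S (Icc a b))
    (hS : ∀ j ≤ p, ∀ (σ : Icc a b) (y : E), ‖iteratedFDeriv ℝ j (fun y => g (σ, y)) y‖ ≤ S σ)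
    (hκ : p.factorial * (2 ^ (p + 2) * ∫ σ in a..b, S σ) ≤ 1 / 2) (t s : Icc a b)
    (z ξ : E × E) {j : ℕ} (hj : j ≤ p) (h : Fin j → E × E) (hn : ∀ i, ‖h i‖ ≤ 1) :
    |iteratedFDeriv ℝ j (fun y => phaseDefect hab hG U t s (y, ξ)) z h|
      ≤ forceConst p * |∫ σ in (s : ℝ)..t, S σ| * (‖ξ.2‖ + |(t : ℝ) - s| * ‖ξ.1‖) := by
  have hc := contDiff_phaseDefect hab hG hp hg hg1 hU t s
  refine abs_iteratedFDeriv_le_of_fderiv_snd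
    (hc.of_le (by exact_mod_cast Nat.succ_le_succ hj)) (phaseDefect_zero hab hG t s)
    fun θ _ => ?_
  have key := abs_iteratedFDeriv_fderiv_phaseDefect_le hab hG hp hb1 hg hg1 hU hSc hS hκ t s
    (z, θ • ξ) (0, ξ) hj fun i => (h i, 0)
  refine key.trans ?_
  have hF := (forceConst_pos p).le
  have h1 : ∏ i, ‖((h i, 0) : (E × E) × (E × E))‖ ≤ 1 :=
    Finset.prod_le_one (fun _ _ => norm_nonneg _) fun i _ => by
      rw [Prod.norm_mk, norm_zero, max_eq_left (norm_nonneg _)]; exact hn i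
  have h3 : 0 ≤ forceConst p * |∫ σ in (s : ℝ)..t, S σ| := mul_nonneg hF (abs_nonneg _)
  refine (mul_le_of_le_one_right (mul_nonneg h3 (by positivity)) h1).trans ?_
  simp only [Prod.fst_zero, Prod.snd_zero, norm_zero, mul_zero, add_zero, zero_add]
  rw [add_comm]

theorem abs_mixed_phaseDefect_le {p : ℕ} (hp : 1 ≤ p) (hb1 : b - a ≤ 1)
    (hg : SmoothFiber p fun σ y => g (σ, y)) (hg1 : SmoothFiber 1 fun σ y => g (σ, y))
    (hU : ∀ σ x, HasFDerivAt (fun y => U (σ, y)) (innerSL ℝ (g (σ, x))) x)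
    {S : ℝ → ℝ} (hSc : ContinuousOn S (Icc a b))
    (hS : ∀ j ≤ p, ∀ (σ : Icc a b) (y : E), ‖iteratedFDeriv ℝ j (fun y => g (σ, y)) y‖ ≤ S σ)
    (hκ : p.factorial * (2 ^ (p + 2) * ∫ σ in a..b, S σ) ≤ 1 / 2) (t s : Icc a b)
    (w : (E × E) × (E × E)) (h k : E × E) {H K : ℝ} (hH1 : ‖h.1‖ ≤ H) (hH2 : ‖h.2‖ ≤ H)
    (hK1 : ‖k.1‖ ≤ K) (hK2 : ‖k.2‖ ≤ K) :
    |iteratedFDeriv ℝ 2 (phaseDefect hab hG U t s) w ![(h, 0), (0, k)]|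
      ≤ forceConst p * |∫ σ in (s : ℝ)..t, S σ| * (2 * K) * H := by
  have hc := contDiff_phaseDefect hab hG hp hg hg1 hU t s
  rw [iteratedFDeriv_succ_apply_snoc (j := 1) (hc.of_le (by exact_mod_cast Nat.succ_le_succ hp))]
  have key := abs_iteratedFDeriv_fderiv_phaseDefect_le hab hG hp hb1 hg hg1 hU hSc hS hκ t s w
    (0, k) hp (Fin.init ![(h, 0), (0, k)])
  refine key.trans ?_
  have hF := (forceConst_pos p).le
  have h3 : 0 ≤ forceConst p * |∫ σ in (s : ℝ)..t, S σ| := mul_nonneg hF (abs_nonneg _)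
  have hts : |(t : ℝ) - s| ≤ 1 := abs_le.2
    ⟨by linarith [t.2.1, s.2.2], by linarith [t.2.2, s.2.1]⟩
  have h4 : ∏ i, ‖Fin.init (α := fun _ => (E × E) × (E × E)) ![(h, 0), (0, k)] i‖ ≤ H := by
    simp [Fin.init, Prod.norm_def, hH1, hH2]
  simp only [Prod.fst_zero, Prod.snd_zero, norm_zero, mul_zero, add_zero, zero_add]
  have h5 : |(t : ℝ) - s| * ‖k.1‖ + ‖k.2‖ ≤ 2 * K := by
    have := mul_le_of_le_one_left (norm_nonneg k.1) hts
    linarith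
  have h6 : 0 ≤ K := (norm_nonneg _).trans hK1
  gcongr

end Defect

end EikonalTheorem

/-! ### The eikonal equation for a potential small in L¹ in time -/

noncomputable section EikonalExistence

variable {d : ℕ}

theorem gradient_eq_of_hasFDerivAt {E : Type} [NormedAddCommGroup E] [InnerProductSpace ℝ E]
    [CompleteSpace E] {f : E → ℝ} {f' : E →L[ℝ] ℝ} {x y : E} (h : HasFDerivAt f f' x)
    (hy : ∀ k, f' k = inner ℝ y k) : gradient f x = y :=
  ext_inner_right ℝ fun k => by rw [inner_gradient_of_hasFDerivAt h, hy]

/-- Existence, uniqueness and bounds for the eikonal equation of a smooth potential which is small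
in `L¹` in time. -/
theorem exists_eikonal {p : ℕ} (hp : 2 ≤ p) {T : ℝ} (hT : 0 < T) (hT1 : T ≤ 1 / 4)
    {U : ℝ → Space d → ℝ} {S : ℝ → ℝ} (hSc : ContinuousOn S (Icc 0 T))
    (hU : ∀ t ∈ Icc 0 T, ContDiff ℝ (p + 1 : ℕ) (U t))
    (hUc : ∀ j ≤ p + 1, ContinuousOn (fun q : ℝ × Space d => iteratedFDeriv ℝ j (U q.1) q.2)
      (Icc 0 T ×ˢ univ))
    (hUS : ∀ j ≤ p + 1, ∀ t ∈ Icc 0 T, ∀ x, ‖iteratedFDeriv ℝ j (U t) x‖ ≤ S t)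
    (hUt : ContDiffOn ℝ 1 (fun q : ℝ × Space d => U q.1 q.2) (Icc 0 T ×ˢ univ))
    (hκ : 8 * (forceConst p * ∫ σ in 0..T, S σ) ≤ 1) :
    ∃ φ : ℝ → ℝ → Phase d → Phase d → ℝ,
      ContDiffOn ℝ 2 (fun q : ℝ × ℝ × Phase d × Phase d => φ q.1 q.2.1 q.2.2.1 q.2.2.2)
        (Icc 0 T ×ˢ Icc 0 T ×ˢ univ) ∧
      (∀ s ∈ Icc 0 T, IsEikonalSolution U T s (fun t => φ t s) ∧
        ∀ ψ, IsEikonalSolution U T s ψ → ∀ t ∈ Icc 0 T, ∀ z ξ, ψ t z ξ = φ t s z ξ) ∧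
      (∀ t ∈ Icc 0 T, ∀ s ∈ Icc 0 T,
        ContDiff ℝ p (fun w : Phase d × Phase d => φ t s w.1 w.2)) ∧
      ∀ t ∈ Icc 0 T, ∀ s ∈ Icc 0 T, ∀ z ξ : Phase d,
        (∀ k ≤ p, ∀ e : Fin k → (Fin d ⊕ Fin d) ⊕ (Fin d ⊕ Fin d),
          |iteratedFDeriv ℝ k
            (fun w : Phase d × Phase d => φ t s w.1 w.2 - freePhase t s w.1 w.2) (z, ξ)
            (fun i => fullBasis (e i))| ≤ forceConst p * |∫ σ in s..t, S σ|) ∧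
        (∀ k ≤ p, ∀ e : Fin k → Fin d ⊕ Fin d,
          |iteratedFDeriv ℝ k (fun y : Phase d => φ t s y ξ - freePhase t s y ξ) z
            (fun i => phaseBasis (e i))|
              ≤ forceConst p * |∫ σ in s..t, S σ| * (‖ξ.2‖ + |t - s| * ‖ξ.1‖)) ∧
        (∀ h k : Phase d,
          |iteratedFDeriv ℝ 2 (fun w : Phase d × Phase d => φ t s w.1 w.2) (z, ξ)
              ![(h, 0), (0, k)] - phaseDot h k|
            ≤ (|t - s| + 2 * (forceConst p * |∫ σ in s..t, S σ|)) * phaseNorm h * phaseNorm k) := by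
  have hab : (0 : ℝ) ≤ T := hT.le
  have hp1 : 1 ≤ p := by omega
  have hS0 : ∀ σ ∈ Icc 0 T, 0 ≤ S σ := fun σ hσ =>
    (norm_nonneg _).trans (hUS 0 (Nat.zero_le _) σ hσ 0)
  have hI0 : 0 ≤ ∫ σ in 0..T, S σ := intervalIntegral.integral_nonneg hab hS0
  -- `forceConst` exceeds p! 2^(p+1), so smallness of F ∫ S also yields the contraction property and
  -- the derivative bounds of the fixed point.
  have hκ' : p.factorial * (2 ^ (p + 2) * ∫ σ in 0..T, S σ) ≤ 1 / 2 := by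
    have h1 : (p.factorial : ℝ) * 2 ^ (p + 2) ≤ 2 * forceConst p := by
      have : (1 : ℝ) ≤ 4 ^ p := one_le_pow₀ (by norm_num)
      have h0 : (0 : ℝ) ≤ p.factorial * 2 ^ (p + 2) := by positivity
      calc (p.factorial : ℝ) * 2 ^ (p + 2) ≤ p.factorial * 2 ^ (p + 2) * 4 ^ p :=
            le_mul_of_one_le_right h0 this
        _ = 2 * forceConst p := by rw [forceConst]; ring
    have h2 := mul_le_mul_of_nonneg_right h1 hI0
    linarith
  -- The order 0 bound has constant 4, which is thereby absorbed in F.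
  have hF4 : 4 ≤ forceConst p := by
    have h1 : (1 : ℝ) ≤ p.factorial := by exact_mod_cast Nat.factorial_pos p
    have h2 : (1 : ℝ) ≤ 2 ^ (p + 1) := one_le_pow₀ (by norm_num)
    have h3 : (4 : ℝ) ≤ 4 ^ p := le_self_pow₀ (by norm_num) (by omega)
    rw [forceConst]
    nlinarith [mul_le_mul h1 h2 zero_le_one (by positivity)]
  have hI2 : ∫ σ in 0..T, S σ ≤ 1 / 2 := by nlinarith
  have hfib : SmoothFiber (p + 1) fun (σ : Icc 0 T) (y : Space d) => U σ y :=
    ⟨fun σ => hU σ σ.2, fun j hj => by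
      have h1 : Continuous fun q : Icc 0 T × Space d => ((q.1 : ℝ), q.2) := by fun_prop
      exact (hUc j hj).comp_continuous h1 fun q => ⟨q.1.2, mem_univ _⟩⟩
  set U' : C(Icc 0 T × Space d, ℝ) := ⟨fun q => U q.1 q.2, hfib.continuous⟩ with hU'
  have hgf : SmoothFiber p fun (σ : Icc 0 T) (y : Space d) =>
      rieszCLM (Space d) (fderiv ℝ (U σ) y) := hfib.fderiv.clm_comp _
  set g : C(Icc 0 T × Space d, Space d) := ⟨fun q => rieszCLM _ (fderiv ℝ (U q.1) q.2),
    hgf.continuous⟩ with hgdef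
  have hg : SmoothFiber p fun σ y => g (σ, y) := hgf
  have hg1 : SmoothFiber 1 fun σ y => g (σ, y) :=
    ⟨fun σ => (hg.1 σ).of_le (by exact_mod_cast hp1), fun j hj => hg.2 j (hj.trans hp1)⟩
  have hUg : ∀ σ x, HasFDerivAt (fun y => U' (σ, y)) (innerSL ℝ (g (σ, x))) x := by
    intro σ x
    have h1 : innerSL ℝ (g (σ, x)) = fderiv ℝ (U σ) x :=
      ContinuousLinearMap.ext fun k =>
        inner_rieszCLM (fderiv ℝ (U σ) x) k
    rw [h1]
    exact ((hU σ σ.2).differentiable (by norm_cast) x).hasFDerivAt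
  have hgS : ∀ j ≤ p, ∀ (σ : Icc 0 T) (y : Space d),
      ‖iteratedFDeriv ℝ j (fun y => g (σ, y)) y‖ ≤ S σ := fun j hj σ y =>
    (norm_iteratedFDeriv_gradient_le ((hU σ σ.2).of_le (by exact_mod_cast Nat.succ_le_succ hj))
      y).trans (hUS (j + 1) (by omega) σ σ.2 y)
  have hb1 : T - 0 ≤ 1 := by linarith
  have hG : ∀ t s, LipschitzWith (1 / 2) (systemMap hab g t s) := fun t s =>
    lipschitzWith_half_of_iteratedFDeriv_le hp1 (contDiff_systemMap hab hg t s)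
      (κ := 2 ^ (p + 2) * ∫ σ in 0..T, S σ)
      ((le_mul_of_one_le_left (by positivity)
        (by exact_mod_cast Nat.factorial_pos p)).trans hκ')
      fun i hi X => norm_iteratedFDeriv_systemMap_le hab hg hb1 hSc hgS t s hi X
  have hgS0 : ∀ (σ : Icc 0 T) (y : Space d), ‖g (σ, y)‖ ≤ S σ := fun σ y => by
    simpa using hgS 0 (Nat.zero_le _) σ y
  have hUS0 : ∀ (σ : Icc 0 T) (y : Space d), |U' (σ, y)| ≤ S σ := fun σ y => by
    have h := hUS 0 (Nat.zero_le _) σ σ.2 y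
    rw [norm_iteratedFDeriv_zero] at h
    exact h
  have hUt' : ContDiffOn ℝ 1 (fun q : ℝ × Space d => U' (projIcc 0 T hab q.1, q.2))
      (Icc 0 T ×ˢ univ) := hUt.congr fun q hq => by
    simp only [hU', ContinuousMap.coe_mk, projIcc_of_mem hab hq.1]
  -- A Lipschitz constant of the potential uniform in time, only for uniqueness; its size does not
  -- enter the estimates.
  obtain ⟨C0, hC0⟩ := isCompact_Icc.exists_bound_of_continuousOn hSc
  have hLip : ∀ t ∈ Icc 0 T, LipschitzWith C0.toNNReal (U t) := fun t ht =>
    lipschitzWith_of_nnnorm_fderiv_le ((hU t ht).differentiable (by norm_cast)) fun x => by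
      rw [← NNReal.coe_le_coe, coe_nnnorm, ← norm_iteratedFDeriv_one]
      exact (hUS 1 (by omega) t ht x).trans (((le_abs_self _).trans (hC0 t ht)).trans
        (Real.le_coe_toNNReal _))
  set φ : ℝ → ℝ → Phase d → Phase d → ℝ := fun t s z ξ => phaseExt hab hG U' (t, s, (z, ξ))
    with hφ
  have hφeq : ∀ (t s : Icc 0 T) (z ξ : Phase d),
      φ t s z ξ = eikonalPhase hab hG U' t s (z, ξ) := fun t s z ξ => by
    simp only [hφ, phaseExt, projIcc_val]
  have hφd : ∀ (t s : Icc 0 T) (z ξ : Phase d),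
      φ t s z ξ - freePhase t s z ξ = phaseDefect hab hG U' t s (z, ξ) := fun t s z ξ => by
    rw [hφeq]; rfl
  have hC2 := contDiffOn_phaseExt hab hG hT hg1 hUg hUt'
  have hsol : ∀ s ∈ Icc 0 T, IsEikonalSolution U T s (fun t => φ t s) := by
    intro s hs
    refine ⟨?_, ?_, ?_⟩
    · have h1 : ContDiff ℝ 2 (fun q : ℝ × Phase d × Phase d => (q.1, s, q.2)) := by fun_prop
      have h2 := hC2.comp h1.contDiffOn (s := Icc 0 T ×ˢ univ) fun q hq =>
        ⟨hq.1, hs, mem_univ _⟩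
      exact h2
    · intro t ht z ξ
      have h1 := hasDerivWithinAt_phaseExt_fst hab hG hg1 hUg (t, s, (z, ξ)) ht
      have hgr := hasFDerivAt_phaseExt hab hG hg1 hUg (t, s, (z, ξ))
      have e1 : gradient (fun x => φ t s (x, z.2) ξ) z.1
          = (gradExt hab hG (t, s, (z, ξ))).1.1 := by
        have h3 : HasFDerivAt (fun x : Space d => (((x, z.2), ξ) : Phase d × Phase d)) _ z.1 :=
          (hasFDerivAt_prodMk_left z ξ).comp z.1 (hasFDerivAt_prodMk_left (𝕜 := ℝ) z.1 z.2)
        have h4 := hgr.comp z.1 h3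
        exact gradient_eq_of_hasFDerivAt h4 fun k => by simp
      have e2 : gradient (fun v => φ t s (z.1, v) ξ) z.2
          = (gradExt hab hG (t, s, (z, ξ))).1.2 := by
        have h3 : HasFDerivAt (fun v : Space d => (((z.1, v), ξ) : Phase d × Phase d)) _ z.2 :=
          (hasFDerivAt_prodMk_left z ξ).comp z.2 (hasFDerivAt_prodMk_right (𝕜 := ℝ) z.1 z.2)
        have h4 := hgr.comp z.2 h3
        exact gradient_eq_of_hasFDerivAt h4 fun k => by simp
      rw [e1, e2]
      have e3 : phaseDerivFst hab hG U' (t, s, (z, ξ)) = -(inner ℝ z.2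
          (gradExt hab hG (t, s, (z, ξ))).1.1
            + symbolOf (U t) z.1 (gradExt hab hG (t, s, (z, ξ))).1.2) := by
        simp only [phaseDerivFst, hamiltonian, symbolOf, hU', ContinuousMap.coe_mk,
          projIcc_of_mem hab ht]
      rw [← e3]
      exact h1
    · intro z ξ
      -- At t = s the integral of S is over a point, so the order 0 bound forces the difference with
      -- the free phase to vanish.
      have h1 := abs_phaseDefect_le hab hG hb1 hSc hgS0 hUS0 hI2 ⟨s, hs⟩ ⟨s, hs⟩ (z, ξ)
      rw [intervalIntegral.integral_same, abs_zero, mul_zero, ← hφd] at h1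
      have h2 := sub_eq_zero.1 (abs_nonpos_iff.1 h1)
      rw [show φ s s z ξ = _ from h2]
      simp [freePhase, phaseDot]
  refine ⟨φ, hC2, fun s hs => ⟨hsol s hs, fun ψ hψ t ht z ξ =>
    hψ.unique (hsol s hs) hT (by linarith) hs hLip ht z ξ⟩, ?_, ?_⟩
  · intro t ht s hs
    have e : (fun w : Phase d × Phase d => φ t s w.1 w.2) = fun w =>
        phaseDefect hab hG U' ⟨t, ht⟩ ⟨s, hs⟩ w + freeForm (t - s) w := funext fun w => by
      rw [← hφd ⟨t, ht⟩ ⟨s, hs⟩ w.1 w.2]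
      exact (sub_add_cancel _ _).symm
    rw [e]
    exact ((contDiff_phaseDefect hab hG hp1 hg hg1 hUg _ _).of_le
      (by exact_mod_cast Nat.le_succ p)).add (contDiff_freeForm _)
  · intro t ht s hs z ξ
    have e : (fun w : Phase d × Phase d => φ t s w.1 w.2 - freePhase t s w.1 w.2) =
        phaseDefect hab hG U' ⟨t, ht⟩ ⟨s, hs⟩ := funext fun w => hφd ⟨t, ht⟩ ⟨s, hs⟩ w.1 w.2
    have e' : (fun y : Phase d => φ t s y ξ - freePhase t s y ξ) =
        fun y => phaseDefect hab hG U' ⟨t, ht⟩ ⟨s, hs⟩ (y, ξ) :=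
      funext fun y => hφd ⟨t, ht⟩ ⟨s, hs⟩ y ξ
    have hts : |t - s| ≤ 1 := abs_le.2 ⟨by linarith [ht.1, hs.2], by linarith [ht.2, hs.1]⟩
    refine ⟨fun k hk b => ?_, fun k hk b => ?_, fun h k => ?_⟩
    · rw [e]
      rcases k with _ | j
      · rw [iteratedFDeriv_zero_apply]
        exact (abs_phaseDefect_le hab hG hb1 hSc hgS0 hUS0 hI2 _ _ _).trans (by gcongr)
      · exact abs_iteratedFDeriv_phaseDefect_le hab hG hp1 hb1 hg hg1 hUg hSc hgS hκ' ⟨t, ht⟩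
          ⟨s, hs⟩ (z, ξ) (by omega) _ (fun i => norm_fullBasis_le _)
          (weight_fullBasis_le hts _)
    · rw [e']
      exact abs_iteratedFDeriv_phaseDefect_left_le hab hG hp1 hb1 hg hg1 hUg hSc hgS hκ' ⟨t, ht⟩
          ⟨s, hs⟩ z ξ hk _ (fun i => norm_phaseBasis_le _)
    · have e2 : (fun w : Phase d × Phase d => φ t s w.1 w.2) =
          phaseDefect hab hG U' ⟨t, ht⟩ ⟨s, hs⟩ + freeForm (t - s) := funext fun w => by
        rw [← e]
        exact (sub_add_cancel _ _).symm
      have h1 := abs_mixed_phaseDefect_le hab hG hp1 hb1 hg hg1 hUg hSc hgS hκ' ⟨t, ht⟩ ⟨s, hs⟩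
        (z, ξ) h k (norm_fst_le_phaseNorm h) (norm_snd_le_phaseNorm h) (norm_fst_le_phaseNorm k)
        (norm_snd_le_phaseNorm k)
      have h2 : |(t - s) * inner ℝ h.2 k.1| ≤ |t - s| * (phaseNorm h * phaseNorm k) := by
        rw [abs_mul]
        have := (abs_real_inner_le_norm h.2 k.1).trans (mul_le_mul (norm_snd_le_phaseNorm h)
          (norm_fst_le_phaseNorm k) (norm_nonneg _) (Real.sqrt_nonneg _))
        gcongr
      rw [e2, iteratedFDeriv_add_apply
        ((contDiff_phaseDefect hab hG hp1 hg hg1 hUg _ _).of_le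
          (by exact_mod_cast (show 2 ≤ p + 1 by omega))).contDiffAt
        (contDiff_freeForm _).contDiffAt, add_apply,
        iteratedFDeriv_two_freeForm, phaseDot]
      rw [abs_le] at h1 h2 ⊢
      constructor <;> linarith

end EikonalExistence

/-! ### The L² norm of distributions and weighted L² norms -/

noncomputable section DistributionNorm

section General

variable {E : Type} [NormedAddCommGroup E] [NormedSpace ℝ E] [FiniteDimensional ℝ E]
  [MeasureSpace E] [BorelSpace E] [(volume : Measure E).HasTemperateGrowth]
  [IsLocallyFiniteMeasure (volume : Measure E)]

theorem coe_distribution_injective :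
    Function.Injective fun g : Lp ℂ 2 (volume : Measure E) => (g : 𝓢'(E, ℂ)) :=
  LinearMap.ker_eq_bot.1 (Lp.ker_toTemperedDistributionCLM_eq_bot (F := ℂ)
    (μ := (volume : Measure E)) (p := 2))

theorem coe_distribution_add (g h : Lp ℂ 2 (volume : Measure E)) :
    ((g + h : Lp ℂ 2 (volume : Measure E)) : 𝓢'(E, ℂ)) = (g : 𝓢'(E, ℂ)) + (h : 𝓢'(E, ℂ)) :=
  map_add (Lp.toTemperedDistributionCLM ℂ (volume : Measure E) 2) g h

theorem coe_distribution_sub (g h : Lp ℂ 2 (volume : Measure E)) :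
    ((g - h : Lp ℂ 2 (volume : Measure E)) : 𝓢'(E, ℂ)) = (g : 𝓢'(E, ℂ)) - (h : 𝓢'(E, ℂ)) :=
  map_sub (Lp.toTemperedDistributionCLM ℂ (volume : Measure E) 2) g h

theorem coe_distribution_smul (c : ℂ) (g : Lp ℂ 2 (volume : Measure E)) :
    ((c • g : Lp ℂ 2 (volume : Measure E)) : 𝓢'(E, ℂ)) = c • (g : 𝓢'(E, ℂ)) :=
  map_smul (Lp.toTemperedDistributionCLM ℂ (volume : Measure E) 2) c g

/-- L² embeds injectively in the tempered distributions, so the infimum runs over a single function.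
-/
theorem distL2Norm_coe (g : Lp ℂ 2 (volume : Measure E)) :
    distL2Norm (g : 𝓢'(E, ℂ)) = ‖g‖ₑ := by
  refine le_antisymm (iInf₂_le (f := fun (h : Lp ℂ 2 (volume : Measure E)) (_ : (h : 𝓢'(E, ℂ)) = g) => ‖h‖ₑ) g rfl) (le_iInf₂ fun h hh => ?_)
  rw [coe_distribution_injective hh]

theorem exists_of_distL2Norm_lt_top {u : 𝓢'(E, ℂ)} (h : distL2Norm u < ⊤) :
    ∃ g : Lp ℂ 2 (volume : Measure E), (g : 𝓢'(E, ℂ)) = u := by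
  obtain ⟨g, hg⟩ := iInf_lt_iff.1 h
  obtain ⟨hg, -⟩ := iInf_lt_iff.1 hg
  exact ⟨g, hg⟩

theorem distL2Norm_zero : distL2Norm (0 : 𝓢'(E, ℂ)) = 0 := by
  have h := distL2Norm_coe (0 : Lp ℂ 2 (volume : Measure E))
  have e : ((0 : Lp ℂ 2 (volume : Measure E)) : 𝓢'(E, ℂ)) = 0 :=
    map_zero (Lp.toTemperedDistributionCLM ℂ (volume : Measure E) 2)
  rwa [e, enorm_zero] at h

theorem distL2Norm_add_le (u v : 𝓢'(E, ℂ)) :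
    distL2Norm (u + v) ≤ distL2Norm u + distL2Norm v := by
  rcases eq_top_or_lt_top (distL2Norm u) with hu | hu
  · simp [hu]
  rcases eq_top_or_lt_top (distL2Norm v) with hv | hv
  · simp [hv]
  obtain ⟨g, rfl⟩ := exists_of_distL2Norm_lt_top hu
  obtain ⟨h, rfl⟩ := exists_of_distL2Norm_lt_top hv
  rw [← coe_distribution_add, distL2Norm_coe, distL2Norm_coe, distL2Norm_coe]
  exact enorm_add_le g h

theorem distL2Norm_smul_le (c : ℂ) (u : 𝓢'(E, ℂ)) :
    distL2Norm (c • u) ≤ ‖c‖ₑ * distL2Norm u := by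
  rcases eq_or_ne c 0 with rfl | hc
  · have e : (0 : ℂ) • u = 0 := zero_smul ℂ u
    rw [e, distL2Norm_zero]
    exact zero_le
  rcases eq_top_or_lt_top (distL2Norm u) with hu | hu
  · rw [hu, ENNReal.mul_top (by simpa using hc)]
    exact le_top
  obtain ⟨g, rfl⟩ := exists_of_distL2Norm_lt_top hu
  rw [← coe_distribution_smul, distL2Norm_coe, distL2Norm_coe, enorm_smul]

theorem distL2Norm_sum_le {ι : Type} (s : Finset ι) (u : ι → 𝓢'(E, ℂ)) :
    distL2Norm (∑ i ∈ s, u i) ≤ ∑ i ∈ s, distL2Norm (u i) := by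
  classical
  induction s using Finset.induction_on with
  | empty => simp [distL2Norm_zero]
  | insert i s hi ih =>
    rw [Finset.sum_insert hi, Finset.sum_insert hi]
    exact (distL2Norm_add_le _ _).trans (by gcongr)

theorem enorm_Lp_two_sq {α : Type} [MeasurableSpace α] {μ : Measure α} (g : Lp ℂ 2 μ) :
    ‖g‖ₑ ^ 2 = ∫⁻ x, ‖g x‖ₑ ^ 2 ∂μ := by
  rw [Lp.enorm_def, eLpNorm_eq_lintegral_rpow_enorm_toReal (by norm_num) (by norm_num)]
  simp only [ENNReal.toReal_ofNat, one_div]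
  rw [← ENNReal.rpow_natCast, ← ENNReal.rpow_mul]
  norm_num

/-- A distribution which is both an `L²` function and the product of an `L²` function with a
function of temperate growth is the pointwise product. -/
theorem coeFn_ae_eq_of_smulLeftCLM {a : E → ℂ} (ha : a.HasTemperateGrowth)
    {g G : Lp ℂ 2 (volume : Measure E)}
    (h : (G : 𝓢'(E, ℂ)) = TemperedDistribution.smulLeftCLM ℂ a (g : 𝓢'(E, ℂ))) :
    G =ᵐ[volume] fun x => a x * g x := by
  have hac : Continuous a := ha.1.continuous
  have hg : LocallyIntegrable (fun x => a x * g x) (volume : Measure E) := by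
    have := ((Lp.memLp g).locallyIntegrable (by norm_num : (1 : ℝ≥0∞) ≤ 2)).continuous_mul hac
    exact this
  refine ae_eq_of_integral_contDiff_smul_eq
    ((Lp.memLp G).locallyIntegrable (by norm_num)) hg fun φ hφ hφc => ?_
  have hg₁ : HasCompactSupport (Complex.ofRealCLM ∘ φ) := hφc.comp_left rfl
  have hg₂ : ContDiff ℝ ∞ (Complex.ofRealCLM ∘ φ) := by fun_prop
  have e := congrArg (fun u : 𝓢'(E, ℂ) => u (hg₁.toSchwartzMap hg₂)) h
  simp only [TemperedDistribution.smulLeftCLM_apply_apply, Lp.toTemperedDistribution_apply,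
    SchwartzMap.smulLeftCLM_apply_apply ha] at e
  refine e.trans (integral_congr_ae (Eventually.of_forall fun x => ?_))
  change (a x • ((φ x : ℝ) : ℂ)) • g x = (φ x : ℝ) • (a x * g x)
  rw [Complex.real_smul, smul_eq_mul, smul_eq_mul]
  ring

end General

section Weights

variable {d : ℕ}

/-- The power mean inequality for the d + 1 numbers 1, |ζ_1|, ..., |ζ_d|. It reduces a full weight
to pure powers of the coordinates, hence Sobolev norms to pure derivatives. -/
theorem one_add_norm_pow_le (n : ℕ) (ζ : Space d) :
    (1 + ‖ζ‖) ^ (n + 1) ≤ (d + 1) ^ n * (1 + ∑ l, |ζ l| ^ (n + 1)) := by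
  have h1 : ‖ζ‖ ≤ ∑ l, |ζ l| := by
    have h2 : ζ = ∑ l, ζ l • EuclideanSpace.single l (1 : ℝ) := by
      ext i; simp [Pi.single_apply]
    calc ‖ζ‖ = ‖∑ l, ζ l • EuclideanSpace.single l (1 : ℝ)‖ := by rw [← h2]
      _ ≤ ∑ l, |ζ l| := (norm_sum_le _ _).trans (by simp [norm_smul])
  have h3 := pow_sum_div_card_le_sum_pow (s := (Finset.univ : Finset (Option (Fin d))))
    (f := fun o => o.elim 1 fun l => |ζ l|) (fun o _ => by cases o <;> simp) n
  simp only [Fintype.sum_option, Option.elim, one_pow, Finset.card_univ, Fintype.card_option,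
    Fintype.card_fin] at h3
  rw [div_le_iff₀' (by positivity)] at h3
  push_cast at h3
  exact (pow_le_pow_left₀ (by positivity) (by linarith) _).trans h3

theorem lintegral_mul_sq_le {α : Type} [MeasurableSpace α] {μ : Measure α} {A B : α → ℝ≥0∞}
    (hA : AEMeasurable A μ) (hB : AEMeasurable B μ) :
    (∫⁻ x, A x * B x ∂μ) ^ 2 ≤ (∫⁻ x, A x ^ 2 ∂μ) * ∫⁻ x, B x ^ 2 ∂μ := by
  have h := ENNReal.lintegral_mul_le_Lp_mul_Lq μ
    (Real.holderConjugate_iff.2 ⟨one_lt_two, by norm_num⟩ : (2 : ℝ).HolderConjugate 2) hA hB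
  have h2 := pow_le_pow_left₀ (zero_le) h 2
  simp only [Pi.mul_apply, ENNReal.rpow_two] at h2
  rw [mul_pow, ← ENNReal.rpow_two, ← ENNReal.rpow_two, ← ENNReal.rpow_two, ← ENNReal.rpow_mul,
    ← ENNReal.rpow_mul] at h2
  norm_num at h2
  exact h2

/-- Weighted `L¹` norms are controlled by weighted `L²` norms. -/
theorem exists_lintegral_weight_sq_le {q n : ℕ} (hq : q ≤ n) (hn : d < 2 * (n - q)) :
    ∃ C : ℝ≥0∞, C < ⊤ ∧ ∀ F : Space d → ℂ, AEMeasurable F →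
      (∫⁻ ζ, ENNReal.ofReal ((1 + ‖ζ‖) ^ q) * ‖F ζ‖ₑ) ^ 2 ≤
        C * ((∫⁻ ζ, ‖F ζ‖ₑ ^ 2) + ∑ l, ∫⁻ ζ, ‖((ζ l : ℝ) : ℂ) ^ n * F ζ‖ₑ ^ 2) := by
  -- Cauchy-Schwarz with (1+|ζ|)^q = (1+|ζ|)^(-(n-q)) (1+|ζ|)^n; the square of the first factor is
  -- integrable because 2(n - q) > d.
  set K : ℝ≥0∞ := ∫⁻ ζ : Space d, ENNReal.ofReal (((1 + ‖ζ‖) ^ (n - q))⁻¹) ^ 2 with hK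
  have hKf : K < ⊤ := by
    have h := finite_integral_one_add_norm (E := Space d) (μ := volume) (r := (2 * (n - q) : ℕ))
      (by rw [finrank_euclideanSpace_fin]; exact_mod_cast hn)
    refine lt_of_eq_of_lt (lintegral_congr fun ζ => ?_) h
    rw [← ENNReal.ofReal_pow (by positivity), Real.rpow_neg (by positivity), Real.rpow_natCast,
      inv_pow, ← pow_mul, mul_comm]
  obtain ⟨N, hN⟩ : ∃ N, 2 * n = N + 1 := ⟨2 * n - 1, by omega⟩
  refine ⟨K * ENNReal.ofReal ((d + 1) ^ N), ENNReal.mul_lt_top hKf ENNReal.ofReal_lt_top,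
    fun F hF => ?_⟩
  have h1 := lintegral_mul_sq_le (μ := (volume : Measure (Space d)))
    (A := fun ζ => ENNReal.ofReal (((1 + ‖ζ‖) ^ (n - q))⁻¹))
    (B := fun ζ => ENNReal.ofReal ((1 + ‖ζ‖) ^ n) * ‖F ζ‖ₑ) (by fun_prop)
    ((by fun_prop : AEMeasurable fun ζ : Space d => ENNReal.ofReal ((1 + ‖ζ‖) ^ n)).mul hF.enorm)
  have e1 : ∀ ζ : Space d, ENNReal.ofReal (((1 + ‖ζ‖) ^ (n - q))⁻¹)
      * (ENNReal.ofReal ((1 + ‖ζ‖) ^ n) * ‖F ζ‖ₑ) = ENNReal.ofReal ((1 + ‖ζ‖) ^ q) * ‖F ζ‖ₑ := by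
    intro ζ
    rw [← mul_assoc, ← ENNReal.ofReal_mul (by positivity)]
    congr 2
    rw [inv_mul_eq_div, div_eq_iff (by positivity), ← pow_add]
    congr 1
    omega
  simp only [e1] at h1
  refine h1.trans ?_
  rw [mul_assoc K]
  refine mul_le_mul_right ?_ K
  rw [← lintegral_finsetSum' _ fun l _ => by fun_prop, ← lintegral_add_left' (by fun_prop),
    ← lintegral_const_mul' _ _ ENNReal.ofReal_ne_top]
  refine lintegral_mono fun ζ => ?_
  have e2 : ∀ l, ‖((ζ l : ℝ) : ℂ) ^ n * F ζ‖ₑ ^ 2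
      = ENNReal.ofReal (|ζ l| ^ (N + 1)) * ‖F ζ‖ₑ ^ 2 := fun l => by
    rw [enorm_mul, mul_pow, ← ofReal_norm, ← ENNReal.ofReal_pow (norm_nonneg _), norm_pow,
      Complex.norm_real, Real.norm_eq_abs, ← pow_mul, mul_comm n, hN]
  simp only [e2]
  rw [mul_pow, ← ENNReal.ofReal_pow (by positivity), ← pow_mul, mul_comm n, hN,
    ← Finset.sum_mul, ← one_add_mul, ← mul_assoc, ← ENNReal.ofReal_sum_of_nonneg (by intros; positivity),
    ← ENNReal.ofReal_one, ← ENNReal.ofReal_add zero_le_one (Finset.sum_nonneg (by intros; positivity)),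
    ← ENNReal.ofReal_mul (by positivity)]
  gcongr
  exact one_add_norm_pow_le N ζ

end Weights

end DistributionNorm

/-! ### Commutation of the fields V_± with derivatives and multiplications -/

noncomputable section VectorFields

theorem fderiv_lineDerivOp {E : Type} [NormedAddCommGroup E] [NormedSpace ℝ E] (φ : 𝓢(E, ℂ))
    (v w z : E) :
    fderiv ℝ (LineDeriv.lineDerivOp v φ : 𝓢(E, ℂ)) z w = fderiv ℝ (fderiv ℝ φ) z w v := by
  have h : HasFDerivAt (fun y => fderiv ℝ φ y v)
      ((ContinuousLinearMap.apply ℝ ℂ v).comp (fderiv ℝ (fderiv ℝ φ) z)) z :=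
    (ContinuousLinearMap.apply ℝ ℂ v).hasFDerivAt.comp z
      ((((φ.smooth 2).fderiv_right (m := 1) (by norm_num)).differentiable (by norm_num))
        z).hasFDerivAt
  have e : (LineDeriv.lineDerivOp v φ : 𝓢(E, ℂ)) = (fun y => fderiv ℝ φ y v : E → ℂ) := rfl
  rw [e, h.fderiv]
  rfl

theorem lineDerivOp_lineDerivOp_comm {E : Type} [NormedAddCommGroup E] [NormedSpace ℝ E]
    (φ : 𝓢(E, ℂ)) (v w : E) : LineDeriv.lineDerivOp v (LineDeriv.lineDerivOp w φ : 𝓢(E, ℂ))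
      = (LineDeriv.lineDerivOp w (LineDeriv.lineDerivOp v φ : 𝓢(E, ℂ)) : 𝓢(E, ℂ)) := by
  ext z
  rw [lineDerivOp_apply_eq_fderiv, lineDerivOp_apply_eq_fderiv, fderiv_lineDerivOp,
    fderiv_lineDerivOp]
  exact ((φ.smooth 2).contDiffAt.isSymmSndFDerivAt (by simp)) v w

variable {d : ℕ}

/-- Multiplication of distributions by `v_j`. -/
def mulV (j : Fin d) : 𝓢'(Phase d, ℂ) →L[ℂ] 𝓢'(Phase d, ℂ) :=
  TemperedDistribution.smulLeftCLM ℂ (fun z : Phase d => ((z.2 j : ℝ) : ℂ))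

/-- The coordinate `v_j` as a linear form. -/
def coordV (j : Fin d) : Phase d →L[ℝ] ℂ :=
  Complex.ofRealCLM ∘L (EuclideanSpace.proj j ∘L ContinuousLinearMap.snd ℝ (Space d) (Space d))

theorem hasTemperateGrowth_coordV (j : Fin d) :
    (fun z : Phase d => ((z.2 j : ℝ) : ℂ)).HasTemperateGrowth :=
  (coordV j).hasTemperateGrowth

theorem commute_dX_dX (i j : Fin d) : Commute (dX i) (dX j) := by
  refine ContinuousLinearMap.ext fun u => ?_
  ext φ
  change u (- LineDeriv.lineDerivOpCLM ℂ 𝓢(Phase d, ℂ) _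
    (-(LineDeriv.lineDerivOpCLM ℂ 𝓢(Phase d, ℂ) _ φ)))
    = u (- LineDeriv.lineDerivOpCLM ℂ 𝓢(Phase d, ℂ) _
      (-(LineDeriv.lineDerivOpCLM ℂ 𝓢(Phase d, ℂ) _ φ)))
  congr 2
  simp only [map_neg, LineDeriv.lineDerivOpCLM_apply]
  rw [lineDerivOp_lineDerivOp_comm]

theorem commute_mulV_mulV (i j : Fin d) : Commute (mulV i) (mulV j) := by
  refine ContinuousLinearMap.ext fun u => ?_
  change mulV i (mulV j u) = mulV j (mulV i u)
  rw [mulV, mulV, TemperedDistribution.smulLeftCLM_smulLeftCLM_apply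
    (hasTemperateGrowth_coordV j) (hasTemperateGrowth_coordV i),
    TemperedDistribution.smulLeftCLM_smulLeftCLM_apply
    (hasTemperateGrowth_coordV i) (hasTemperateGrowth_coordV j), mul_comm]

theorem commute_dX_mulV (i j : Fin d) : Commute (dX i) (mulV j) := by
  refine ContinuousLinearMap.ext fun u => ?_
  ext φ
  change u (SchwartzMap.smulLeftCLM ℂ (fun z : Phase d => ((z.2 j : ℝ) : ℂ))
    (-(LineDeriv.lineDerivOpCLM ℂ 𝓢(Phase d, ℂ) _ φ)))
    = u (-(LineDeriv.lineDerivOpCLM ℂ 𝓢(Phase d, ℂ) _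
      (SchwartzMap.smulLeftCLM ℂ (fun z : Phase d => ((z.2 j : ℝ) : ℂ)) φ)))
  congr 1
  rw [map_neg]
  congr 1
  ext z
  rw [SchwartzMap.smulLeftCLM_apply_apply (hasTemperateGrowth_coordV j),
    LineDeriv.lineDerivOpCLM_apply, LineDeriv.lineDerivOpCLM_apply, lineDerivOp_apply_eq_fderiv,
    lineDerivOp_apply_eq_fderiv, SchwartzMap.smulLeftCLM_apply (hasTemperateGrowth_coordV j)]
  have h := ((coordV j).hasFDerivAt (x := z)).mul (φ.differentiableAt (x := z)).hasFDerivAt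
  have e : (fun x : Phase d => ((x.2 j : ℝ) : ℂ) • φ x) = (coordV j : Phase d → ℂ) * φ := rfl
  rw [e, h.fderiv]
  simp [coordV]

/-- The fields V_± combine ∂_x with multiplication by v, which concern different variables, so all
components commute whatever the signs and parameters. -/
theorem commute_vecV_vecV (ε ε' σ σ' : ℝ) (i j : Fin d) : Commute (vecV ε σ i) (vecV ε' σ' j) := by
  have h1 := commute_dX_dX i j
  have h2 := commute_mulV_mulV i j
  have h3 := commute_dX_mulV i j
  have h4 := (commute_dX_mulV j i).symm
  exact ((h1.smul_left _).smul_right _ |>.add_right ((h3.smul_left _).smul_right _)).add_left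
    ((h4.smul_left _).smul_right _ |>.add_right ((h2.smul_left _).smul_right _))

theorem commute_dX_vecV (ε σ : ℝ) (i j : Fin d) : Commute (dX i) (vecV ε σ j) :=
  ((commute_dX_dX i j).smul_right _).add_right ((commute_dX_mulV i j).smul_right _)

theorem commute_mulV_vecV (ε σ : ℝ) (i j : Fin d) : Commute (mulV i) (vecV ε σ j) :=
  (((commute_dX_mulV j i).symm).smul_right _).add_right ((commute_mulV_mulV i j).smul_right _)

theorem vecV_eq (ε σ : ℝ) (j : Fin d) :
    vecV ε σ j = (ε : ℂ) • dX j + (2 * Complex.I * σ) • mulV j := rfl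

/-- From V_+ - V_- = 4iv: the derivative cancels, so powers of v cost no derivative but spend one
field of either kind. -/
theorem mulV_eq_sub (ε : ℝ) (j : Fin d) :
    mulV j = (4 * Complex.I)⁻¹ • (vecV ε 1 j + -vecV ε (-1) j) := by
  have h : (4 * Complex.I : ℂ) ≠ 0 := by simp
  rw [eq_inv_smul_iff₀ h, vecV_eq, vecV_eq]
  push_cast
  module

/-- Multiplication by v through V_+ alone, at the price of one derivative ε∂_x; needed when the
number of fields available is exhausted. The next identity is the analogue with V_-. -/
theorem mulV_eq_pos (ε : ℝ) (j : Fin d) :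
    mulV j = (2 * Complex.I)⁻¹ • (vecV ε 1 j + (-ε : ℂ) • dX j) := by
  have h : (2 * Complex.I : ℂ) ≠ 0 := by simp
  rw [eq_inv_smul_iff₀ h, vecV_eq]
  push_cast
  module

theorem mulV_eq_neg (ε : ℝ) (j : Fin d) :
    mulV j = (-(2 * Complex.I))⁻¹ • (vecV ε (-1) j + (-ε : ℂ) • dX j) := by
  have h : (-(2 * Complex.I) : ℂ) ≠ 0 := by simp
  rw [eq_inv_smul_iff₀ h, vecV_eq]
  push_cast
  module

section OpPow

variable {A : Type} [Monoid A]

theorem opPow_zero (D : Fin d → A) : opPow D 0 = 1 := by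
  simp [opPow]

theorem opPow_succ (D : Fin (d + 1) → A) (β : Fin (d + 1) → ℕ) :
    opPow D β = D 0 ^ β 0 * opPow (fun j => D j.succ) fun j => β j.succ := by
  simp [opPow, List.ofFn_succ]

theorem commute_opPow {a : A} (D : Fin d → A) (h : ∀ j, Commute a (D j)) (β : Fin d → ℕ) :
    Commute a (opPow D β) := by
  induction d with
  | zero => simp [opPow]
  | succ d ih =>
    rw [opPow_succ]
    exact ((h 0).pow_right _).mul_right (ih _ (fun j => h j.succ) _)

theorem opPow_add (D : Fin d → A) (h : ∀ i j, Commute (D i) (D j)) (β γ : Fin d → ℕ) :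
    opPow D (β + γ) = opPow D β * opPow D γ := by
  induction d with
  | zero => simp [opPow]
  | succ d ih =>
    rw [opPow_succ, opPow_succ, opPow_succ]
    have h1 := ih (fun j => D j.succ) (fun i j => h i.succ j.succ) (fun j => β j.succ)
      fun j => γ j.succ
    have h2 : Commute (D 0 ^ γ 0) (opPow (fun j => D j.succ) fun j => β j.succ) :=
      (commute_opPow _ (fun j => h 0 j.succ) _).pow_left _
    simp only [Pi.add_apply] at h1 ⊢
    rw [show (fun j : Fin d => β j.succ + γ j.succ) = (fun j => β j.succ) + fun j => γ j.succ
      from rfl, h1, pow_add]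
    rw [mul_assoc, ← mul_assoc (D 0 ^ γ 0), h2.eq]
    simp only [mul_assoc]

theorem opPow_single (D : Fin d → A) (j : Fin d) (n : ℕ) : opPow D (Pi.single j n) = D j ^ n := by
  induction d with
  | zero => exact j.elim0
  | succ d ih =>
    rw [opPow_succ]
    induction j using Fin.cases with
    | zero =>
      have : (fun j : Fin d => (Pi.single 0 n : Fin (d + 1) → ℕ) j.succ) = 0 := by
        ext i; simp
      rw [this, opPow_zero]
      simp
    | succ j =>
      have : (fun i : Fin d => (Pi.single j.succ n : Fin (d + 1) → ℕ) i.succ) = Pi.single j n := by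
        ext i; simp [Pi.single_apply]
      rw [this, ih]
      simp

end OpPow

theorem mem_multiIndices {ι : Type} [Fintype ι] [DecidableEq ι] {n : ℕ} {α : ι → ℕ} :
    α ∈ multiIndices ι n ↔ ∑ i, α i ≤ n := by
  refine ⟨fun h => (Finset.mem_filter.1 h).2, fun h => Finset.mem_filter.2 ⟨?_, h⟩⟩
  refine Fintype.mem_piFinset.2 fun i => Finset.mem_range.2 ?_
  exact Nat.lt_succ_of_le ((Finset.single_le_sum (fun _ _ => Nat.zero_le _)
    (Finset.mem_univ i)).trans h)

/-- The terms of the norm of `𝓗^m_r` which only contain `V_±` and `∂_x`. -/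
theorem distL2Norm_opPow_le_phaseSobolevNorm (ε : ℝ) {m r : ℕ} {α β γ : Fin d → ℕ}
    (hα : ∑ i, α i ≤ m) (hβ : ∑ i, β i ≤ r) (hγ : ∑ i, γ i ≤ r)
    (g : Lp ℂ 2 (volume : Measure (Phase d))) :
    distL2Norm ((opPow (vecV ε 1) β * opPow (vecV ε (-1)) γ * opPow dX α) (g : 𝓢'(Phase d, ℂ)))
      ≤ phaseSobolevNorm ε m r g := by
  have hmem : ∀ {n : ℕ} {δ : Fin d → ℕ}, ∑ i, δ i ≤ n →
      (Sum.elim δ 0 : Fin d ⊕ Fin d → ℕ) ∈ multiIndices (Fin d ⊕ Fin d) n := fun h =>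
    mem_multiIndices.2 (by simpa using h)
  rw [phaseSobolevNorm]
  refine le_trans ?_ (Finset.single_le_sum (fun _ _ => zero_le) (hmem hα))
  refine le_trans ?_ (Finset.single_le_sum (fun _ _ => zero_le) (hmem hβ))
  refine le_trans (le_of_eq ?_) (Finset.single_le_sum (fun _ _ => zero_le) (hmem hγ))
  simp only [Sum.elim_inl, Sum.elim_inr]
  have e : (fun j : Fin d => (0 : Fin d → ℕ) j) = 0 := rfl
  rw [e, opPow_zero, opPow_zero, opPow_zero, mul_one, mul_one, mul_one]

end VectorFields

/-! ### Velocity moments controlled by the phase space norm -/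

noncomputable section MomentNorm

variable {d : ℕ}

/-- The `L²` norm with the weights `1` and `v_j^r`. -/
def weightNorm (r : ℕ) (u : 𝓢'(Phase d, ℂ)) : ℝ≥0∞ :=
  distL2Norm u + ∑ j, distL2Norm ((mulV j ^ r) u)

/-- The weighted `L²` norms of `u` and of its pure derivatives of order `n` in `x`. -/
def momentNorm (r n : ℕ) (u : 𝓢'(Phase d, ℂ)) : ℝ≥0∞ :=
  weightNorm r u + ∑ l, weightNorm r ((dX l ^ n) u)

/-- The binomial expansion of (V_+ - V_-)^w, legitimate because the two fields commute. The total
power is w, so at most w of each kind occur. -/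
theorem exists_mulV_pow_eq (ε : ℝ) (j : Fin d) (w : ℕ) :
    ∃ c : Fin (w + 1) → ℂ, mulV j ^ w
      = ∑ a : Fin (w + 1), c a • (vecV ε 1 j ^ (a : ℕ) * vecV ε (-1) j ^ (w - a)) := by
  have hc : Commute (vecV ε 1 j) (-vecV ε (-1) j) := (commute_vecV_vecV ε ε 1 (-1) j j).neg_right
  refine ⟨fun a => ((4 * Complex.I)⁻¹) ^ w * ((-1) ^ (w - a) * (w.choose a : ℂ)), ?_⟩
  rw [mulV_eq_sub ε j, smul_pow, hc.add_pow, Finset.sum_range, Finset.smul_sum]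
  refine Finset.sum_congr rfl fun a _ => ?_
  have e : (-vecV ε (-1) j) ^ (w - (a : ℕ)) = ((-1 : ℂ) ^ (w - (a : ℕ))) • vecV ε (-1) j ^ (w - (a : ℕ)) := by
    rw [← neg_one_smul ℂ (vecV ε (-1) j), smul_pow]
  rw [e, ← nsmul_eq_mul', mul_smul_comm, ← Nat.cast_smul_eq_nsmul ℂ, smul_smul, smul_smul]
  congr 1
  ring

/-- A bound for all products of `V_+` and `V_-` gives a bound for a power of `v_j`. -/
theorem exists_distL2Norm_mulV_pow_le (ε : ℝ) (j : Fin d) (w : ℕ) :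
    ∃ C : ℝ≥0∞, C < ⊤ ∧ ∀ (L : 𝓢'(Phase d, ℂ) →L[ℂ] 𝓢'(Phase d, ℂ)) (u : 𝓢'(Phase d, ℂ)) (N : ℝ≥0∞),
      (∀ a b : ℕ, a + b = w → distL2Norm (L ((vecV ε 1 j ^ a * vecV ε (-1) j ^ b) u)) ≤ N) →
      distL2Norm (L ((mulV j ^ w) u)) ≤ C * N := by
  obtain ⟨c, hc⟩ := exists_mulV_pow_eq ε j w
  refine ⟨∑ a, ‖c a‖ₑ, ENNReal.sum_lt_top.2 fun a _ => enorm_lt_top, fun L u N h => ?_⟩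
  have e : L ((mulV j ^ w) u)
      = ∑ a, c a • L ((vecV ε 1 j ^ (a : ℕ) * vecV ε (-1) j ^ (w - a)) u) := by
    rw [hc, sum_apply, map_sum]
    exact Finset.sum_congr rfl fun a _ => map_smul L (c a) _
  rw [e, Finset.sum_mul]
  refine (distL2Norm_sum_le _ _).trans (Finset.sum_le_sum fun a _ => ?_)
  refine (distL2Norm_smul_le _ _).trans ?_
  gcongr
  exact h _ _ (by omega)

theorem sum_single_add_single (j k : Fin d) (a b : ℕ) :
    ∑ i, (Pi.single j a + Pi.single k b : Fin d → ℕ) i = a + b := by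
  simp [Finset.sum_add_distrib]

theorem distL2Norm_vecV_pow_le (ε : ℝ) {m r : ℕ} (j l : Fin d) {a b n : ℕ} (ha : a ≤ r) (hb : b ≤ r)
    (hn : n ≤ m) (g : Lp ℂ 2 (volume : Measure (Phase d))) :
    distL2Norm ((vecV ε 1 j ^ a * vecV ε (-1) j ^ b * dX l ^ n) (g : 𝓢'(Phase d, ℂ)))
      ≤ phaseSobolevNorm ε m r g := by
  have h := distL2Norm_opPow_le_phaseSobolevNorm ε (m := m) (r := r) (α := Pi.single l n)
    (β := Pi.single j a) (γ := Pi.single j b) (by simpa using hn) (by simpa using ha)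
    (by simpa using hb) g
  rwa [opPow_single, opPow_single, opPow_single] at h

/-- One more power of `v_k` costs one derivative. -/
theorem distL2Norm_mulV_vecV_pow_le (ε : ℝ) {m r : ℕ} (hr : 0 < r) (j k l : Fin d) {a b n : ℕ}
    (hab : a + b ≤ r) (hn : n + 1 ≤ m) (g : Lp ℂ 2 (volume : Measure (Phase d))) :
    distL2Norm ((mulV k * (vecV ε 1 j ^ a * vecV ε (-1) j ^ b * dX l ^ n)) (g : 𝓢'(Phase d, ℂ)))
      ≤ (‖(2 * Complex.I)⁻¹‖ₑ * (1 + ‖(ε : ℂ)‖ₑ)) * phaseSobolevNorm ε m r g := by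
  have hV : ∀ i j : Fin d, Commute (vecV ε 1 i) (vecV ε 1 j) := commute_vecV_vecV ε ε 1 1
  have hV' : ∀ i j : Fin d, Commute (vecV ε (-1) i) (vecV ε (-1) j) :=
    commute_vecV_vecV ε ε (-1) (-1)
  have hdX := distL2Norm_opPow_le_phaseSobolevNorm ε (m := m) (r := r)
    (α := Pi.single k 1 + Pi.single l n) (β := Pi.single j a) (γ := Pi.single j b)
    (by rw [sum_single_add_single]; omega) (by simp; omega) (by simp; omega) g
  rw [opPow_add _ commute_dX_dX, opPow_single, opPow_single, opPow_single, opPow_single,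
    pow_one, ← mul_assoc] at hdX
  have hdX' : distL2Norm ((dX k * (vecV ε 1 j ^ a * vecV ε (-1) j ^ b * dX l ^ n))
      (g : 𝓢'(Phase d, ℂ))) ≤ phaseSobolevNorm ε m r g := by
    have hc : Commute (dX k) (vecV ε 1 j ^ a * vecV ε (-1) j ^ b) :=
      ((commute_dX_vecV ε 1 k j).pow_right a).mul_right ((commute_dX_vecV ε (-1) k j).pow_right b)
    rw [← mul_assoc, hc.eq]
    exact hdX
  have fin : ∀ (c : ℂ) (Y : 𝓢'(Phase d, ℂ) →L[ℂ] 𝓢'(Phase d, ℂ)), ‖c‖ₑ = ‖(2 * Complex.I)⁻¹‖ₑ →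
      mulV k = c • (Y + (-ε : ℂ) • dX k) →
      distL2Norm ((Y * (vecV ε 1 j ^ a * vecV ε (-1) j ^ b * dX l ^ n)) (g : 𝓢'(Phase d, ℂ)))
        ≤ phaseSobolevNorm ε m r g →
      distL2Norm ((mulV k * (vecV ε 1 j ^ a * vecV ε (-1) j ^ b * dX l ^ n)) (g : 𝓢'(Phase d, ℂ)))
      ≤ (‖(2 * Complex.I)⁻¹‖ₑ * (1 + ‖(ε : ℂ)‖ₑ)) * phaseSobolevNorm ε m r g := by
    intro c Y hc hY hb
    rw [hY, smul_mul_assoc, add_mul, smul_mul_assoc]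
    refine (distL2Norm_smul_le c ((Y * (vecV ε 1 j ^ a * vecV ε (-1) j ^ b * dX l ^ n)
      + (-ε : ℂ) • (dX k * (vecV ε 1 j ^ a * vecV ε (-1) j ^ b * dX l ^ n)))
      (g : 𝓢'(Phase d, ℂ)))).trans ?_
    rw [hc, mul_assoc ‖(2 * Complex.I)⁻¹‖ₑ]
    gcongr
    refine (distL2Norm_add_le ((Y * (vecV ε 1 j ^ a * vecV ε (-1) j ^ b * dX l ^ n))
      (g : 𝓢'(Phase d, ℂ))) (((-ε : ℂ) • (dX k * (vecV ε 1 j ^ a * vecV ε (-1) j ^ b * dX l ^ n)))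
      (g : 𝓢'(Phase d, ℂ)))).trans ?_
    rw [one_add_mul]
    gcongr
    refine (distL2Norm_smul_le (-ε : ℂ) ((dX k * (vecV ε 1 j ^ a * vecV ε (-1) j ^ b * dX l ^ n))
      (g : 𝓢'(Phase d, ℂ)))).trans ?_
    rw [enorm_neg]
    gcongr
  -- If fewer than r fields V_+ are present, one more of them fits; otherwise b = 0 and a V_- fits,
  -- since r > 0.
  rcases (show a < r ∨ (a = r ∧ b = 0) by omega) with ha | ⟨ha, hb⟩
  · refine fin _ _ rfl (mulV_eq_pos ε k) ?_
    have h := distL2Norm_opPow_le_phaseSobolevNorm ε (m := m) (r := r) (α := Pi.single l n)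
      (β := Pi.single k 1 + Pi.single j a) (γ := Pi.single j b)
      (by simp; omega) (by rw [sum_single_add_single]; omega) (by simp; omega) g
    rw [opPow_add _ hV, opPow_single, opPow_single, opPow_single, opPow_single,
      pow_one] at h
    simpa only [mul_assoc] using h
  · refine fin _ _ ?_ (mulV_eq_neg ε k) ?_
    · rw [enorm_inv (by simp), enorm_inv (by simp), enorm_neg]
    have h := distL2Norm_opPow_le_phaseSobolevNorm ε (m := m) (r := r) (α := Pi.single l n)
      (β := Pi.single j a) (γ := Pi.single k 1)
      (by simp; omega) (by simp; omega) (by simp; omega) g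
    rw [opPow_single, opPow_single, opPow_single, pow_one] at h
    have hc : Commute (vecV ε (-1) k) (vecV ε 1 j ^ a) :=
      (commute_vecV_vecV ε ε (-1) 1 k j).pow_right a
    rw [hb, pow_zero, mul_one, ← mul_assoc, hc.eq]
    exact h

/-- The norm of `𝓗^m_r` controls velocity moments of `g` and of `v_k g`. -/
theorem exists_momentNorm_le (ε : ℝ) {m r : ℕ} (hr : 0 < r) (hm : 0 < m) :
    ∃ C : ℝ≥0∞, C < ⊤ ∧ ∀ g : Lp ℂ 2 (volume : Measure (Phase d)),
      momentNorm r m (g : 𝓢'(Phase d, ℂ)) ≤ C * phaseSobolevNorm ε m r g ∧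
      ∀ k, momentNorm r (m - 1) (mulV k (g : 𝓢'(Phase d, ℂ))) ≤ C * phaseSobolevNorm ε m r g := by
  choose c hc hcb using fun (j : Fin d) => exists_distL2Norm_mulV_pow_le ε j r
  set A : ℝ≥0∞ := 1 + ∑ j, c j with hA
  have hA' : A < ⊤ := ENNReal.add_lt_top.2 ⟨ENNReal.one_lt_top, ENNReal.sum_lt_top.2 fun j _ => hc j⟩
  -- The constant is allowed to depend on ε: it serves finiteness and continuity in time only, while
  -- uniform bounds come from the norm of the density.
  set q : ℝ≥0∞ := 1 + ‖(2 * Complex.I : ℂ)⁻¹‖ₑ * (1 + ‖(ε : ℂ)‖ₑ) with hq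
  have hq1 : 1 ≤ q := le_self_add
  have hq2 : ‖(2 * Complex.I : ℂ)⁻¹‖ₑ * (1 + ‖(ε : ℂ)‖ₑ) ≤ q := le_add_self
  have hq' : q < ⊤ := ENNReal.add_lt_top.2 ⟨ENNReal.one_lt_top, ENNReal.mul_lt_top enorm_lt_top
    (ENNReal.add_lt_top.2 ⟨ENNReal.one_lt_top, enorm_lt_top⟩)⟩
  have hW : ∀ (u : 𝓢'(Phase d, ℂ)) (N : ℝ≥0∞), (∀ (j : Fin d) (a b : ℕ), a + b ≤ r →
      distL2Norm ((vecV ε 1 j ^ a * vecV ε (-1) j ^ b) u) ≤ N) → distL2Norm u ≤ N →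
      weightNorm r u ≤ A * N := by
    intro u N h h0
    rw [weightNorm, hA, one_add_mul, Finset.sum_mul]
    refine add_le_add h0 (Finset.sum_le_sum fun j _ => ?_)
    exact hcb j 1 u N fun a b hab => h j a b hab.le
  have hH : ∀ (n : ℕ) (u : 𝓢'(Phase d, ℂ)) (N : ℝ≥0∞),
      (∀ (j l : Fin d) (a b n' : ℕ), n' ≤ n → a + b ≤ r →
        distL2Norm ((vecV ε 1 j ^ a * vecV ε (-1) j ^ b * dX l ^ n') u) ≤ N) →
      distL2Norm u ≤ N → momentNorm r n u ≤ ((d + 1 : ℕ) * A) * N := by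
    intro n u N h h0
    have h1 : weightNorm r u ≤ A * N := hW u N (fun j a b hab => by
      simpa using h j j a b 0 (Nat.zero_le _) hab) h0
    have h2 : ∀ l, weightNorm r ((dX l ^ n) u) ≤ A * N := fun l => hW _ N
      (fun j a b hab => h j l a b n le_rfl hab) (by simpa using h l l 0 0 n le_rfl (Nat.zero_le _))
    calc momentNorm r n u ≤ A * N + ∑ _l : Fin d, A * N :=
          add_le_add h1 (Finset.sum_le_sum fun l _ => h2 l)
      _ = ((d + 1 : ℕ) * A) * N := by
          simp only [Finset.sum_const, Finset.card_univ, Fintype.card_fin, nsmul_eq_mul]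
          push_cast; ring
  refine ⟨((d + 1 : ℕ) * A) * q, ENNReal.mul_lt_top (ENNReal.mul_lt_top (by simp) hA') hq',
    fun g => ⟨?_, fun k => ?_⟩⟩
  · have hle : phaseSobolevNorm ε m r g ≤ q * phaseSobolevNorm ε m r g :=
      le_mul_of_one_le_left zero_le hq1
    rw [mul_assoc]
    refine hH m _ _ (fun j l a b n' hn hab => ?_) ?_
    · exact (distL2Norm_vecV_pow_le ε j l (by omega) (by omega) hn g).trans hle
    · have h := distL2Norm_opPow_le_phaseSobolevNorm ε (m := m) (r := r) (α := 0)
        (β := 0) (γ := 0) (by simp) (by simp) (by simp) g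
      rw [opPow_zero, opPow_zero, opPow_zero] at h
      exact h.trans hle
  · have hle : ‖(2 * Complex.I : ℂ)⁻¹‖ₑ * (1 + ‖(ε : ℂ)‖ₑ) * phaseSobolevNorm ε m r g
        ≤ q * phaseSobolevNorm ε m r g := by gcongr
    rw [mul_assoc]
    refine hH (m - 1) _ _ (fun j l a b n' hn hab => ?_) ?_
    · have hcm : Commute (mulV k) (vecV ε 1 j ^ a * vecV ε (-1) j ^ b * dX l ^ n') :=
        (((commute_mulV_vecV ε 1 k j).pow_right a).mul_right
          ((commute_mulV_vecV ε (-1) k j).pow_right b)).mul_right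
          ((commute_dX_mulV l k).symm.pow_right n')
      have h := distL2Norm_mulV_vecV_pow_le ε hr j k l hab (show n' + 1 ≤ m by omega) g
      rw [hcm.eq] at h
      exact h.trans hle
    · have h := distL2Norm_mulV_vecV_pow_le ε hr k k k (a := 0) (b := 0) (n := 0) (Nat.zero_le _)
        (show 0 + 1 ≤ m by omega) g
      simp only [pow_zero, mul_one] at h
      exact h.trans hle

end MomentNorm

/-! ### Tensor test functions and velocity cutoffs -/

noncomputable section TestFunctions

variable {d : ℕ}

/-- The test function `K(x) χ(v)`. -/
def tensorTest (K χ : 𝓢(Space d, ℂ)) : 𝓢(Phase d, ℂ) where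
  toFun z := K z.1 * χ z.2
  smooth' := (K.smooth'.comp contDiff_fst).mul (χ.smooth'.comp contDiff_snd)
  decay' k n := by
    choose A hA using fun k i => K.decay' k i
    choose B hB using fun k i => χ.decay' k i
    have hA0 : ∀ k i, 0 ≤ A k i := fun k i => (by positivity : (0 : ℝ) ≤ _).trans (hA k i 0)
    have hB0 : ∀ k i, 0 ≤ B k i := fun k i => (by positivity : (0 : ℝ) ≤ _).trans (hB k i 0)
    refine ⟨∑ i ∈ Finset.range (n + 1),
      (n.choose i : ℝ) * (A k i * B 0 (n - i) + A 0 i * B k (n - i)), fun z => ?_⟩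
    have h1 := norm_iteratedFDeriv_mul_le (𝕜 := ℝ) (K.smooth'.comp contDiff_fst)
      (χ.smooth'.comp contDiff_snd) z (n := n) (by exact_mod_cast le_top)
    refine (mul_le_mul_of_nonneg_left h1 (by positivity)).trans ?_
    rw [Finset.mul_sum]
    refine Finset.sum_le_sum fun i _ => ?_
    have hK : ‖iteratedFDeriv ℝ i (fun z : Phase d => K z.1) z‖ ≤ ‖iteratedFDeriv ℝ i K z.1‖ := by
      have h := norm_iteratedFDeriv_comp_clm_le (K.smooth i) le_rfl
        (ContinuousLinearMap.fst ℝ (Space d) (Space d))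
        (ContinuousLinearMap.norm_fst_le _ _ _) z le_rfl
      simpa using h
    have hχ : ‖iteratedFDeriv ℝ (n - i) (fun z : Phase d => χ z.2) z‖
        ≤ ‖iteratedFDeriv ℝ (n - i) χ z.2‖ := by
      have h := norm_iteratedFDeriv_comp_clm_le (χ.smooth (n - i : ℕ)) le_rfl
        (ContinuousLinearMap.snd ℝ (Space d) (Space d))
        (ContinuousLinearMap.norm_snd_le _ _ _) z le_rfl
      simpa using h
    have hz : ‖z‖ ^ k ≤ ‖z.1‖ ^ k + ‖z.2‖ ^ k := by
      rcases max_choice ‖z.1‖ ‖z.2‖ with h | h <;> rw [Prod.norm_def, h]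
      · exact le_add_of_nonneg_right (by positivity)
      · exact le_add_of_nonneg_left (by positivity)
    set a := ‖iteratedFDeriv ℝ i K z.1‖
    set b := ‖iteratedFDeriv ℝ (n - i) χ z.2‖
    have a1 : ‖z.1‖ ^ k * a ≤ A k i := hA k i z.1
    have a2 : a ≤ A 0 i := by
      have h := hA 0 i z.1
      rw [pow_zero, one_mul] at h
      exact h
    have b1 : ‖z.2‖ ^ k * b ≤ B k (n - i) := hB k (n - i) z.2
    have b2 : b ≤ B 0 (n - i) := by
      have h := hB 0 (n - i) z.2
      rw [pow_zero, one_mul] at h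
      exact h
    have a0 : 0 ≤ a := norm_nonneg _
    have b0 : 0 ≤ b := norm_nonneg _
    calc _ ≤ (‖z.1‖ ^ k + ‖z.2‖ ^ k) * ((n.choose i : ℝ) * a * b) := by
          have := mul_le_mul hK hχ (norm_nonneg _) a0
          have h3 : (n.choose i : ℝ) * ‖iteratedFDeriv ℝ i (fun z : Phase d => K z.1) z‖
              * ‖iteratedFDeriv ℝ (n - i) (fun z : Phase d => χ z.2) z‖ ≤ n.choose i * a * b := by
            rw [mul_assoc, mul_assoc]
            gcongr
          exact mul_le_mul hz h3 (by positivity) (by positivity)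
      _ = n.choose i * ((‖z.1‖ ^ k * a) * b + a * (‖z.2‖ ^ k * b)) := by ring
      _ ≤ _ := by
          gcongr
          exact hA0 k i
          exact hA0 0 i

@[simp] theorem tensorTest_apply (K χ : 𝓢(Space d, ℂ)) (z : Phase d) :
    tensorTest K χ z = K z.1 * χ z.2 := rfl

theorem fderiv_tensorTest_left (K χ : 𝓢(Space d, ℂ)) (z : Phase d) (w : Space d) :
    fderiv ℝ (tensorTest K χ : Phase d → ℂ) z (w, 0) = fderiv ℝ K z.1 w * χ z.2 := by
  have h1 : HasFDerivAt (fun z : Phase d => K z.1) _ z :=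
    (K.differentiableAt (x := z.1)).hasFDerivAt.comp z hasFDerivAt_fst
  have h2 : HasFDerivAt (fun z : Phase d => χ z.2) _ z :=
    (χ.differentiableAt (x := z.2)).hasFDerivAt.comp z hasFDerivAt_snd
  have h := h1.mul h2
  have e : (tensorTest K χ : Phase d → ℂ) = (fun z : Phase d => K z.1) * fun z => χ z.2 := rfl
  rw [e, h.fderiv]
  simp [mul_comm]

theorem lineDerivOp_tensorTest (K χ : 𝓢(Space d, ℂ)) (w : Space d) :
    LineDeriv.lineDerivOp ((w, 0) : Phase d) (tensorTest K χ)
      = tensorTest (LineDeriv.lineDerivOp w K) χ := by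
  ext z
  rw [lineDerivOp_apply_eq_fderiv, fderiv_tensorTest_left]
  rfl

variable (d) in
/-- A smooth bump supported near the origin. -/
def smallBump (n : ℕ) : ContDiffBump (0 : Space d) where
  rIn := 1 / (2 * (n + 1))
  rOut := 1 / (n + 1)
  rIn_pos := by positivity
  rIn_lt_rOut := by
    rw [div_lt_div_iff₀ (by positivity) (by positivity)]
    nlinarith [(Nat.cast_nonneg n : (0 : ℝ) ≤ n)]

variable (d) in
/-- An approximate identity. -/
def approxIdentity (n : ℕ) : 𝓢(Space d, ℂ) :=
  HasCompactSupport.toSchwartzMap (f := Complex.ofRealCLM ∘ (smallBump d n).normed volume)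
    ((smallBump d n).hasCompactSupport_normed.comp_left rfl)
    (Complex.ofRealCLM.contDiff.comp (smallBump d n).contDiff_normed)

theorem approxIdentity_apply (n : ℕ) (ζ : Space d) :
    approxIdentity d n ζ = (((smallBump d n).normed volume ζ : ℝ) : ℂ) := rfl

theorem integral_norm_approxIdentity (n : ℕ) : ∫ ζ, ‖approxIdentity d n ζ‖ = 1 := by
  simp only [approxIdentity_apply, Complex.norm_real, Real.norm_eq_abs,
    abs_of_nonneg ((smallBump d n).nonneg_normed _)]
  exact (smallBump d n).integral_normed

theorem approxIdentity_eq_zero {n : ℕ} {ζ : Space d} (h : 1 / ((n : ℝ) + 1) < ‖ζ‖) :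
    approxIdentity d n ζ = 0 := by
  rw [approxIdentity_apply]
  have : ζ ∉ Function.support ((smallBump d n).normed volume) := by
    rw [ContDiffBump.support_normed_eq]
    simp only [Metric.mem_ball, dist_zero_right, not_lt]
    exact h.le
  rw [Function.notMem_support.1 this, Complex.ofReal_zero]

/-- A bound for an integral against the approximate identity. -/
theorem integral_norm_mul_approxIdentity_le {n : ℕ} {F : Space d → ℂ} {c : ℝ} (hc : 0 ≤ c)
    (hF : ∀ ζ, ‖F ζ‖ ≤ c * ‖ζ‖) :
    ‖∫ ζ, F ζ * approxIdentity d n ζ‖ ≤ c / (n + 1) := by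
  have h : ∀ ζ, ‖F ζ * approxIdentity d n ζ‖ ≤ c / (n + 1) * ‖approxIdentity d n ζ‖ := by
    intro ζ
    rw [norm_mul]
    rcases le_or_gt ‖ζ‖ (1 / ((n : ℝ) + 1)) with h | h
    · gcongr
      calc ‖F ζ‖ ≤ c * ‖ζ‖ := hF ζ
        _ ≤ c * (1 / (n + 1)) := by gcongr
        _ = c / (n + 1) := by ring
    · rw [approxIdentity_eq_zero h]
      simp
  refine (norm_integral_le_of_norm_le
    ((approxIdentity d n).integrable.norm.const_mul _) (Eventually.of_forall h)).trans ?_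
  rw [integral_const_mul, integral_norm_approxIdentity, mul_one]

variable (d) in
/-- A cutoff with Fourier transform supported near the origin. -/
def velocityCutoff (n : ℕ) : 𝓢(Space d, ℂ) := 𝓕 (approxIdentity d n)

theorem velocityCutoff_apply (n : ℕ) (v : Space d) :
    velocityCutoff d n v = 𝓕 (approxIdentity d n : Space d → ℂ) v := rfl

theorem norm_velocityCutoff_le (n : ℕ) (v : Space d) : ‖velocityCutoff d n v‖ ≤ 1 := by
  rw [velocityCutoff_apply, ← integral_norm_approxIdentity (d := d) n]
  exact VectorFourier.norm_fourierIntegral_le_integral_norm _ _ _ _ _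

/-- The cutoff is the mean of the characters e^(-2πi ζ·v) over |ζ| ≤ 1/(n+1), and |e^(iθ) - 1| ≤
|θ|. -/
theorem norm_velocityCutoff_sub_one_le (n : ℕ) (v : Space d) :
    ‖velocityCutoff d n v - 1‖ ≤ 2 * Real.pi * ‖v‖ / (n + 1) := by
  have h1 : velocityCutoff d n v = ∫ ζ, Complex.exp (↑(-2 * Real.pi * inner ℝ ζ v) * Complex.I)
      * approxIdentity d n ζ := by
    rw [velocityCutoff_apply, Real.fourier_eq']
    rfl
  have h2 : (1 : ℂ) = ∫ ζ, approxIdentity d n ζ := by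
    simp only [approxIdentity_apply]
    rw [integral_complex_ofReal, ContDiffBump.integral_normed, Complex.ofReal_one]
  have hi := (approxIdentity d n).integrable (μ := volume)
  have hi' : Integrable fun ζ => Complex.exp (↑(-2 * Real.pi * inner ℝ ζ v) * Complex.I)
      * approxIdentity d n ζ := by
    refine hi.bdd_mul (c := 1) (by fun_prop) (Eventually.of_forall fun ζ => ?_)
    rw [Complex.norm_exp_ofReal_mul_I]
  rw [h1, h2, ← integral_sub hi' hi]
  have e : ∀ ζ, Complex.exp (↑(-2 * Real.pi * inner ℝ ζ v) * Complex.I) * approxIdentity d n ζ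
      - approxIdentity d n ζ
      = (Complex.exp (↑(-2 * Real.pi * inner ℝ ζ v) * Complex.I) - 1) * approxIdentity d n ζ :=
    fun ζ => by ring
  simp only [e]
  refine integral_norm_mul_approxIdentity_le (by positivity) fun ζ => ?_
  rw [mul_comm _ Complex.I]
  refine Real.norm_exp_I_mul_ofReal_sub_one_le.trans ?_
  rw [Real.norm_eq_abs, abs_mul, abs_mul, abs_neg, abs_two, abs_of_pos Real.pi_pos]
  have := mul_le_mul_of_nonneg_left (abs_real_inner_le_norm ζ v) Real.two_pi_pos.le
  linarith

theorem tendsto_velocityCutoff (v : Space d) :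
    Tendsto (fun n => velocityCutoff d n v) atTop (𝓝 1) := by
  rw [tendsto_iff_norm_sub_tendsto_zero]
  refine squeeze_zero (fun _ => norm_nonneg _) (fun n => norm_velocityCutoff_sub_one_le n v) ?_
  have := tendsto_one_div_add_atTop_nhds_zero_nat (𝕜 := ℝ)
  have h := this.const_mul (2 * Real.pi * ‖v‖)
  rw [mul_zero] at h
  refine h.congr fun n => ?_
  ring

end TestFunctions

/-! ### Velocity integrals and the density -/

noncomputable section Density

variable {d : ℕ}

theorem hasTemperateGrowth_coordV_pow (j : Fin d) (r : ℕ) :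
    (fun z : Phase d => ((z.2 j : ℝ) : ℂ) ^ r).HasTemperateGrowth :=
  (hasTemperateGrowth_coordV j).fun_pow r

theorem mulV_pow_eq (j : Fin d) (r : ℕ) : mulV j ^ r
    = TemperedDistribution.smulLeftCLM ℂ (fun z : Phase d => ((z.2 j : ℝ) : ℂ) ^ r) := by
  induction r with
  | zero =>
    refine ContinuousLinearMap.ext fun u => ?_
    simp only [pow_zero]
    rw [TemperedDistribution.smulLeftCLM_const, one_smul]
    rfl
  | succ r ih =>
    refine ContinuousLinearMap.ext fun u => ?_
    rw [pow_succ', ih]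
    change mulV j (TemperedDistribution.smulLeftCLM ℂ _ u) = _
    rw [mulV, TemperedDistribution.smulLeftCLM_smulLeftCLM_apply
      (hasTemperateGrowth_coordV_pow j r) (hasTemperateGrowth_coordV j)]
    rfl

theorem lintegral_mulV_pow_eq (j : Fin d) (r : ℕ) (g : Lp ℂ 2 (volume : Measure (Phase d)))
    (h : distL2Norm ((mulV j ^ r) (g : 𝓢'(Phase d, ℂ))) < ⊤) :
    ∫⁻ z : Phase d, ‖((z.2 j : ℝ) : ℂ) ^ r * g z‖ₑ ^ 2
      = distL2Norm ((mulV j ^ r) (g : 𝓢'(Phase d, ℂ))) ^ 2 := by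
  obtain ⟨G, hG⟩ := exists_of_distL2Norm_lt_top h
  rw [← hG, distL2Norm_coe, enorm_Lp_two_sq]
  rw [mulV_pow_eq] at hG
  have hae := coeFn_ae_eq_of_smulLeftCLM (hasTemperateGrowth_coordV_pow j r) hG
  exact lintegral_congr_ae (hae.mono fun z hz => by simp only [hz])

theorem add_sq_sum_le {ι : Type} (s : Finset ι) (a : ℝ≥0∞) (b : ι → ℝ≥0∞) :
    a ^ 2 + ∑ i ∈ s, b i ^ 2 ≤ (a + ∑ i ∈ s, b i) ^ 2 := by
  have h : ∑ i ∈ s, b i ^ 2 ≤ (∑ i ∈ s, b i) ^ 2 := by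
    rw [sq (∑ i ∈ s, b i), Finset.sum_mul]
    refine Finset.sum_le_sum fun i hi => ?_
    rw [sq]
    gcongr
    exact Finset.single_le_sum (fun _ _ => zero_le) hi
  calc a ^ 2 + ∑ i ∈ s, b i ^ 2 ≤ a ^ 2 + (∑ i ∈ s, b i) ^ 2 := by gcongr
    _ ≤ (a + ∑ i ∈ s, b i) ^ 2 := by
      rw [add_sq]
      exact add_le_add le_self_add le_rfl

/-- The constant C + 1 dominates the square root of C, because C ≤ (C + 1)². -/
theorem exists_le_mul_of_sq_le {C : ℝ≥0∞} (hC : C < ⊤) :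
    ∃ D : ℝ≥0∞, D < ⊤ ∧ ∀ a b : ℝ≥0∞, a ^ 2 ≤ C * b ^ 2 → a ≤ D * b := by
  refine ⟨C + 1, ENNReal.add_lt_top.2 ⟨hC, ENNReal.one_lt_top⟩, fun a b h => ?_⟩
  refine (ENNReal.pow_le_pow_left_iff two_ne_zero).1 (h.trans ?_)
  rw [mul_pow]
  gcongr
  calc C ≤ C + 1 := le_self_add
    _ ≤ (C + 1) ^ 2 := le_self_pow₀ le_add_self two_ne_zero

theorem measurable_Lp {α : Type} [MeasurableSpace α] {μ : Measure α} (g : Lp ℂ 2 μ) :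
    Measurable g := (Lp.stronglyMeasurable g).measurable

/-- The velocity integral of `|g|` is controlled in `L²`. -/
theorem exists_lintegral_velocity_sq_le {r : ℕ} (hr : d < 2 * r) :
    ∃ C : ℝ≥0∞, C < ⊤ ∧ ∀ g : Lp ℂ 2 (volume : Measure (Phase d)),
      weightNorm r (g : 𝓢'(Phase d, ℂ)) < ⊤ →
      ∫⁻ x : Space d, (∫⁻ v : Space d, ‖g (x, v)‖ₑ) ^ 2
        ≤ C * weightNorm r (g : 𝓢'(Phase d, ℂ)) ^ 2 := by
  obtain ⟨C, hC, h⟩ := exists_lintegral_weight_sq_le (d := d) (q := 0) (n := r) (Nat.zero_le _)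
    (by simpa using hr)
  refine ⟨C, hC, fun g hg => ?_⟩
  have hgm := measurable_Lp g
  have hlt : ∀ j, distL2Norm ((mulV j ^ r) (g : 𝓢'(Phase d, ℂ))) < ⊤ := fun j =>
    (ENNReal.sum_lt_top.1 (ENNReal.add_lt_top.1 hg).2) j (Finset.mem_univ j)
  have h1 : ∀ x : Space d, (∫⁻ v : Space d, ‖g (x, v)‖ₑ) ^ 2 ≤ C * ((∫⁻ v, ‖g (x, v)‖ₑ ^ 2)
      + ∑ l, ∫⁻ v : Space d, ‖((v l : ℝ) : ℂ) ^ r * g (x, v)‖ₑ ^ 2) := fun x => by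
    simpa using h (fun v => g (x, v)) (hgm.comp measurable_prodMk_left).aemeasurable
  refine (lintegral_mono h1).trans ?_
  have hm : ∀ l, Measurable fun z : Phase d => ‖((z.2 l : ℝ) : ℂ) ^ r * g z‖ₑ ^ 2 := fun l => by
    have : Measurable fun z : Phase d => ((z.2 l : ℝ) : ℂ) := (coordV l).measurable
    fun_prop
  rw [lintegral_const_mul' _ _ hC.ne, lintegral_add_left
    ((hgm.enorm.pow_const 2).lintegral_prod_right'),
    lintegral_finsetSum _ fun l _ => (hm l).lintegral_prod_right']
  gcongr
  have e0 : ∫⁻ x : Space d, ∫⁻ v : Space d, ‖g (x, v)‖ₑ ^ 2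
      = distL2Norm (g : 𝓢'(Phase d, ℂ)) ^ 2 := by
    rw [distL2Norm_coe, enorm_Lp_two_sq]
    exact (lintegral_prod _ (hgm.enorm.pow_const 2).aemeasurable).symm
  have e1 : ∀ l, ∫⁻ x : Space d, ∫⁻ v : Space d, ‖((v l : ℝ) : ℂ) ^ r * g (x, v)‖ₑ ^ 2
      = distL2Norm ((mulV l ^ r) (g : 𝓢'(Phase d, ℂ))) ^ 2 := fun l => by
    rw [← lintegral_mulV_pow_eq l r g (hlt l)]
    exact (lintegral_prod _ (hm l).aemeasurable).symm
  rw [e0]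
  simp only [e1]
  exact add_sq_sum_le _ _ _

/-- The velocity integral of `|g|`. -/
def absDensity (g : Lp ℂ 2 (volume : Measure (Phase d))) (x : Space d) : ℝ :=
  ∫ v : Space d, ‖g (x, v)‖

variable {r : ℕ} (hr : d < 2 * r) {g : Lp ℂ 2 (volume : Measure (Phase d))}
  (hg : weightNorm r (g : 𝓢'(Phase d, ℂ)) < ⊤)

include hr hg

theorem lintegral_velocity_sq_lt_top :
    ∫⁻ x : Space d, (∫⁻ v : Space d, ‖g (x, v)‖ₑ) ^ 2 < ⊤ := by
  obtain ⟨C, hC, h⟩ := exists_lintegral_velocity_sq_le hr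
  exact (h g hg).trans_lt (ENNReal.mul_lt_top hC (ENNReal.pow_lt_top hg))

theorem ae_integrable_velocity : ∀ᵐ x : Space d, Integrable fun v : Space d => g (x, v) := by
  have hm : Measurable fun x : Space d => ∫⁻ v : Space d, ‖g (x, v)‖ₑ :=
    (measurable_Lp g).enorm.lintegral_prod_right'
  filter_upwards [ae_lt_top (hm.pow_const 2) (lintegral_velocity_sq_lt_top hr hg).ne] with x hx
  refine ⟨((measurable_Lp g).comp measurable_prodMk_left).aestronglyMeasurable, ?_⟩
  exact (ENNReal.pow_lt_top_iff.1 hx).resolve_right two_ne_zero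

theorem memLp_of_enorm_le {F : Space d → ℂ} (hF : AEStronglyMeasurable F)
    (h : ∀ x, ‖F x‖ₑ ≤ ∫⁻ v : Space d, ‖g (x, v)‖ₑ) : MemLp F 2 := by
  refine ⟨hF, ?_⟩
  rw [eLpNorm_lt_top_iff_lintegral_rpow_enorm_lt_top (by norm_num) (by norm_num)]
  refine (lintegral_mono fun x => ?_).trans_lt (lintegral_velocity_sq_lt_top hr hg)
  simp only [ENNReal.toReal_ofNat, ENNReal.rpow_two]
  gcongr
  exact h x

theorem memLp_density : MemLp (fun x : Space d => ∫ v : Space d, g (x, v)) 2 :=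
  memLp_of_enorm_le hr hg
    (Lp.stronglyMeasurable g).integral_prod_right'.aestronglyMeasurable
    fun _ => enorm_integral_le_lintegral_enorm _

theorem density_eq_toLp : density g = (memLp_density hr hg).toLp := by
  rw [density, dif_pos (memLp_density hr hg)]

theorem density_ae_eq : density g =ᵐ[volume] fun x : Space d => ∫ v : Space d, g (x, v) := by
  rw [density_eq_toLp hr hg]
  exact MemLp.coeFn_toLp _

/-- Products of `g` with square-integrable functions of `x` are integrable. -/
theorem integrable_mul_fst {K : Space d → ℂ} (hK : MemLp K 2) (hKm : Measurable K) :
    Integrable fun z : Phase d => g z * K z.1 := by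
  have hgm := measurable_Lp g
  refine ⟨(hgm.mul (hKm.comp measurable_fst)).aestronglyMeasurable, ?_⟩
  have e : ∫⁻ z : Phase d, ‖g z * K z.1‖ₑ
      = ∫⁻ x : Space d, (∫⁻ v : Space d, ‖g (x, v)‖ₑ) * ‖K x‖ₑ := by
    refine (lintegral_prod _ (hgm.mul (hKm.comp measurable_fst)).enorm.aemeasurable).trans
      (lintegral_congr fun x => ?_)
    change ∫⁻ v : Space d, ‖g (x, v) * K x‖ₑ = _
    simp only [enorm_mul]
    exact lintegral_mul_const' _ _ enorm_ne_top
  rw [HasFiniteIntegral, e]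
  have h := lintegral_mul_sq_le (μ := (volume : Measure (Space d)))
    (A := fun x => ∫⁻ v : Space d, ‖g (x, v)‖ₑ) (B := fun x => ‖K x‖ₑ)
    hgm.enorm.lintegral_prod_right'.aemeasurable hKm.enorm.aemeasurable
  have hK2 : ∫⁻ x, ‖K x‖ₑ ^ 2 < ⊤ := by
    have := (eLpNorm_lt_top_iff_lintegral_rpow_enorm_lt_top (by norm_num) (by norm_num)).1 hK.2
    simpa using this
  exact (ENNReal.pow_lt_top_iff.1 (h.trans_lt
    (ENNReal.mul_lt_top (lintegral_velocity_sq_lt_top hr hg) hK2))).resolve_right two_ne_zero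

theorem integral_mul_fst {K : Space d → ℂ} (hK : MemLp K 2) (hKm : Measurable K) :
    ∫ z : Phase d, g z * K z.1 = ∫ x : Space d, density g x * K x := by
  refine (integral_prod _ (integrable_mul_fst hr hg hK hKm)).trans (integral_congr_ae ?_)
  filter_upwards [density_ae_eq hr hg] with x hx
  rw [hx]
  exact integral_mul_const _ _

/-- Removing the velocity cutoff. -/
theorem tendsto_integral_tensorTest (K : 𝓢(Space d, ℂ)) :
    Tendsto (fun n => ∫ z : Phase d, g z * tensorTest K (velocityCutoff d n) z) atTop
      (𝓝 (∫ x : Space d, density g x * K x)) := by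
  have hK := K.memLp 2 (volume : Measure (Space d))
  have hKm : Measurable K := K.continuous.measurable
  rw [← integral_mul_fst hr hg hK hKm]
  refine tendsto_integral_of_dominated_convergence (fun z : Phase d => ‖g z * K z.1‖)
    (fun n => ?_) (integrable_mul_fst hr hg hK hKm).norm
    (fun n => Eventually.of_forall fun z => ?_) (Eventually.of_forall fun z => ?_)
  · exact ((measurable_Lp g).mul
      (tensorTest K (velocityCutoff d n)).continuous.measurable).aestronglyMeasurable
  · rw [tensorTest_apply, ← mul_assoc, norm_mul _ (velocityCutoff d n z.2)]
    exact mul_le_of_le_one_right (norm_nonneg _) (norm_velocityCutoff_le n z.2)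
  · have h := (tendsto_velocityCutoff z.2).const_mul (g z * K z.1)
    rw [mul_one] at h
    simpa only [tensorTest_apply, mul_assoc] using h

end Density

/-! ### Sobolev regularity of the density and integrability of its Fourier transform -/

noncomputable section DensitySobolev

variable {d : ℕ} {r : ℕ}

theorem weightNorm_sub_le (u v : 𝓢'(Phase d, ℂ)) :
    weightNorm r (u - v) ≤ weightNorm r u + weightNorm r v := by
  have h : ∀ a b : 𝓢'(Phase d, ℂ), distL2Norm (a - b) ≤ distL2Norm a + distL2Norm b := by
    intro a b
    have h1 := distL2Norm_add_le a ((-1 : ℂ) • b)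
    have h2 := distL2Norm_smul_le (-1 : ℂ) b
    rw [enorm_neg, enorm_one, one_mul] at h2
    have e : a + (-1 : ℂ) • b = a - b := by module
    rw [e] at h1
    exact h1.trans (by gcongr)
  rw [weightNorm, weightNorm, weightNorm, add_add_add_comm, ← Finset.sum_add_distrib]
  refine add_le_add (h u v) (Finset.sum_le_sum fun j _ => ?_)
  rw [map_sub]
  exact h _ _

theorem weightNorm_le_momentNorm (n : ℕ) (u : 𝓢'(Phase d, ℂ)) :
    weightNorm r u ≤ momentNorm r n u := le_self_add

theorem weightNorm_dX_le_momentNorm (n : ℕ) (l : Fin d) (u : 𝓢'(Phase d, ℂ)) :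
    weightNorm r ((dX l ^ n) u) ≤ momentNorm r n u :=
  (Finset.single_le_sum (f := fun l => weightNorm r ((dX l ^ n) u)) (fun _ _ => zero_le)
    (Finset.mem_univ l)).trans le_add_self

theorem distL2Norm_le_weightNorm (u : 𝓢'(Phase d, ℂ)) : distL2Norm u ≤ weightNorm r u :=
  le_self_add

/-- `density` takes the value 0 when the velocity integral is not in L², so it is not linear as
such; the weighted norms exclude this and make the velocity integrals converge for almost every x.
-/
theorem density_sub (hr : d < 2 * r) {g h : Lp ℂ 2 (volume : Measure (Phase d))}
    (hg : weightNorm r (g : 𝓢'(Phase d, ℂ)) < ⊤) (hh : weightNorm r (h : 𝓢'(Phase d, ℂ)) < ⊤) :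
    density (g - h) = density g - density h := by
  have hgh : weightNorm r ((g - h : Lp ℂ 2 (volume : Measure (Phase d))) : 𝓢'(Phase d, ℂ)) < ⊤ := by
    rw [coe_distribution_sub]
    exact (weightNorm_sub_le _ _).trans_lt (ENNReal.add_lt_top.2 ⟨hg, hh⟩)
  refine Lp.ext ?_
  have hsub : ∀ᵐ x : Space d, ∀ᵐ v : Space d, (g - h) (x, v) = g (x, v) - h (x, v) :=
    Measure.ae_ae_of_ae_prod (Lp.coeFn_sub g h)
  filter_upwards [density_ae_eq hr hgh, density_ae_eq hr hg, density_ae_eq hr hh,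
    Lp.coeFn_sub (density g) (density h), ae_integrable_velocity hr hg,
    ae_integrable_velocity hr hh, hsub] with x h1 h2 h3 h4 h5 h6 h7
  rw [h1, h4, Pi.sub_apply, h2, h3, ← integral_sub h5 h6]
  exact integral_congr_ae h7

theorem exists_enorm_density_le (hr : d < 2 * r) :
    ∃ C : ℝ≥0∞, C < ⊤ ∧ ∀ g : Lp ℂ 2 (volume : Measure (Phase d)),
      weightNorm r (g : 𝓢'(Phase d, ℂ)) < ⊤ →
      ‖density g‖ₑ ≤ C * weightNorm r (g : 𝓢'(Phase d, ℂ)) := by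
  obtain ⟨C, hC, h⟩ := exists_lintegral_velocity_sq_le hr
  obtain ⟨D, hD, hD'⟩ := exists_le_mul_of_sq_le hC
  refine ⟨D, hD, fun g hg => hD' _ _ (le_trans ?_ (h g hg))⟩
  rw [enorm_Lp_two_sq]
  refine lintegral_mono_ae ((density_ae_eq hr hg).mono fun x hx => ?_)
  rw [hx]
  gcongr
  exact enorm_integral_le_lintegral_enorm _

/-- The iterated derivative of a distribution, tested against a function. -/
theorem lineDerivOpCLM_pow_apply {E : Type} [NormedAddCommGroup E] [NormedSpace ℝ E] (w : E) (n : ℕ)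
    (u : 𝓢'(E, ℂ)) (φ : 𝓢(E, ℂ)) :
    ((LineDeriv.lineDerivOpCLM ℂ 𝓢'(E, ℂ) w ^ n : 𝓢'(E, ℂ) →L[ℂ] 𝓢'(E, ℂ)) u) φ
      = u ((fun φ : 𝓢(E, ℂ) => -(LineDeriv.lineDerivOp w φ : 𝓢(E, ℂ)))^[n] φ) := by
  induction n generalizing φ with
  | zero => rfl
  | succ n ih =>
    rw [pow_succ', Function.iterate_succ_apply, ← ih]
    rfl

theorem iterate_lineDerivOp_tensorTest (K χ : 𝓢(Space d, ℂ)) (w : Space d) (n : ℕ) :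
    (fun φ : 𝓢(Phase d, ℂ) => -(LineDeriv.lineDerivOp ((w, 0) : Phase d) φ : 𝓢(Phase d, ℂ)))^[n]
      (tensorTest K χ)
      = tensorTest ((fun φ : 𝓢(Space d, ℂ) =>
        -(LineDeriv.lineDerivOp w φ : 𝓢(Space d, ℂ)))^[n] K) χ := by
  induction n generalizing K with
  | zero => rfl
  | succ n ih =>
    rw [Function.iterate_succ_apply, Function.iterate_succ_apply, ← ih, lineDerivOp_tensorTest]
    congr 1
    ext z
    simp

/-- The density commutes with derivatives in `x`. -/
theorem density_dX_pow (hr : d < 2 * r) {g h : Lp ℂ 2 (volume : Measure (Phase d))} {l : Fin d}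
    {n : ℕ} (hh : (h : 𝓢'(Phase d, ℂ)) = (dX l ^ n) (g : 𝓢'(Phase d, ℂ)))
    (hgw : weightNorm r (g : 𝓢'(Phase d, ℂ)) < ⊤) (hhw : weightNorm r (h : 𝓢'(Phase d, ℂ)) < ⊤) :
    (density h : 𝓢'(Space d, ℂ)) = (dSpace l ^ n) (density g : 𝓢'(Space d, ℂ)) := by
  ext K
  have h1 := tendsto_integral_tensorTest hr hhw K
  have h2 := tendsto_integral_tensorTest hr hgw
    ((fun φ : 𝓢(Space d, ℂ) =>
        -(LineDeriv.lineDerivOp (EuclideanSpace.single l 1 : Space d) φ : 𝓢(Space d, ℂ)))^[n] K)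
  -- The derivative acts on K only and leaves the velocity cutoff alone, so the identity holds at
  -- each level of the cutoff, and both sides then pass to the limit.
  have e : ∀ k, ∫ z : Phase d, h z * tensorTest K (velocityCutoff d k) z
      = ∫ z : Phase d, g z * tensorTest ((fun φ : 𝓢(Space d, ℂ) =>
        -(LineDeriv.lineDerivOp (EuclideanSpace.single l 1 : Space d) φ : 𝓢(Space d, ℂ)))^[n] K)
          (velocityCutoff d k) z := fun k => by
    have e1 := congrArg (fun u : 𝓢'(Phase d, ℂ) => u (tensorTest K (velocityCutoff d k))) hh
    simp only [dX] at e1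
    rw [lineDerivOpCLM_pow_apply, iterate_lineDerivOp_tensorTest,
      Lp.toTemperedDistribution_apply, Lp.toTemperedDistribution_apply] at e1
    simpa only [smul_eq_mul, mul_comm] using e1
  simp only [e] at h1
  have e2 := tendsto_nhds_unique h1 h2
  simp only [dSpace]
  rw [lineDerivOpCLM_pow_apply, Lp.toTemperedDistribution_apply, Lp.toTemperedDistribution_apply]
  simpa only [smul_eq_mul, mul_comm] using e2

/-- The `L²` norms of `ρ` and of its pure derivatives of order `n`. -/
def spaceNorm (n : ℕ) (u : 𝓢'(Space d, ℂ)) : ℝ≥0∞ :=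
  distL2Norm u + ∑ l, distL2Norm ((dSpace l ^ n) u)

theorem exists_spaceNorm_density_le (hr : d < 2 * r) (n : ℕ) :
    ∃ C : ℝ≥0∞, C < ⊤ ∧ ∀ g : Lp ℂ 2 (volume : Measure (Phase d)),
      momentNorm r n (g : 𝓢'(Phase d, ℂ)) < ⊤ →
      spaceNorm n (density g : 𝓢'(Space d, ℂ)) ≤ C * momentNorm r n (g : 𝓢'(Phase d, ℂ)) := by
  obtain ⟨C, hC, h⟩ := exists_enorm_density_le hr
  refine ⟨C, hC, fun g hg => ?_⟩
  have hgw := (weightNorm_le_momentNorm n _).trans_lt hg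
  rw [spaceNorm, momentNorm, mul_add, Finset.mul_sum]
  refine add_le_add ?_ (Finset.sum_le_sum fun l _ => ?_)
  · rw [distL2Norm_coe]
    exact h g hgw
  · have hw := (weightNorm_dX_le_momentNorm n l _).trans_lt hg
    obtain ⟨G, hG⟩ := exists_of_distL2Norm_lt_top ((distL2Norm_le_weightNorm _).trans_lt hw)
    rw [← hG] at hw ⊢
    rw [← density_dX_pow hr hG hgw hw, distL2Norm_coe]
    exact h G hw

/-- Only the terms with β = 0 and α = 0 or α = m e_l of the norm are used. They carry no power of ε,
which makes the control of the potential uniform in ε. -/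
theorem spaceNorm_le_spaceSobolevNorm (ε : ℝ) {m : ℕ} (r : ℕ)
    (ρ : Lp ℂ 2 (volume : Measure (Space d))) :
    spaceNorm m (ρ : 𝓢'(Space d, ℂ)) ≤ (d + 1 : ℕ) * spaceSobolevNorm ε m r ρ := by
  have key : ∀ α : Fin d → ℕ, ∑ i, α i ≤ m →
      distL2Norm (opPow dSpace α (ρ : 𝓢'(Space d, ℂ))) ≤ spaceSobolevNorm ε m r ρ := by
    intro α hα
    rw [spaceSobolevNorm]
    refine le_trans ?_ (Finset.single_le_sum (fun _ _ => zero_le) (mem_multiIndices.2 hα))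
    refine le_trans (le_of_eq ?_) (Finset.single_le_sum (fun _ _ => zero_le)
      (mem_multiIndices.2 (show ∑ i, (0 : Fin d → ℕ) i ≤ r by simp)))
    rw [opPow_zero, one_mul]
  have h0 := key 0 (by simp)
  rw [opPow_zero] at h0
  have h1 : ∀ l, distL2Norm ((dSpace l ^ m) (ρ : 𝓢'(Space d, ℂ))) ≤ spaceSobolevNorm ε m r ρ :=
    fun l => by
      have h := key (Pi.single l m) (by simp)
      rwa [opPow_single] at h
  calc spaceNorm m (ρ : 𝓢'(Space d, ℂ))
      ≤ spaceSobolevNorm ε m r ρ + ∑ _l : Fin d, spaceSobolevNorm ε m r ρ :=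
        add_le_add h0 (Finset.sum_le_sum fun l _ => h1 l)
    _ = (d + 1 : ℕ) * spaceSobolevNorm ε m r ρ := by
      simp only [Finset.sum_const, Finset.card_univ, Fintype.card_fin, nsmul_eq_mul]
      push_cast; ring

/-! ### Weighted integrability of the Fourier transform -/

theorem hasTemperateGrowth_coord_pow (l : Fin d) (c : ℂ) (n : ℕ) :
    (fun ζ : Space d => (c * ((ζ l : ℝ) : ℂ)) ^ n).HasTemperateGrowth := by
  have h : (fun ζ : Space d => ((ζ l : ℝ) : ℂ)).HasTemperateGrowth :=
    (Complex.ofRealCLM ∘L (EuclideanSpace.proj l : Space d →L[ℝ] ℝ)).hasTemperateGrowth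
  exact ((Function.HasTemperateGrowth.const c).fun_mul h).fun_pow n

theorem fourier_dSpace_pow (l : Fin d) (n : ℕ) (u : 𝓢'(Space d, ℂ)) :
    𝓕 ((dSpace l ^ n) u) = TemperedDistribution.smulLeftCLM ℂ
      (fun ζ : Space d => ((2 * Real.pi * Complex.I) * ((ζ l : ℝ) : ℂ)) ^ n) (𝓕 u) := by
  induction n with
  | zero =>
    simp only [pow_zero]
    rw [TemperedDistribution.smulLeftCLM_const, one_smul]
    rfl
  | succ n ih =>
    rw [pow_succ']
    change 𝓕 (LineDeriv.lineDerivOp (EuclideanSpace.single l 1 : Space d) ((dSpace l ^ n) u)) = _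
    rw [TemperedDistribution.fourier_lineDerivOp_eq, ih]
    have e : (fun ζ : Space d => ((inner ℝ ζ (EuclideanSpace.single l (1 : ℝ)) : ℝ) : ℂ))
        = fun ζ : Space d => ((ζ l : ℝ) : ℂ) := by
      ext ζ; simp [EuclideanSpace.inner_single_right]
    have h1 := hasTemperateGrowth_coord_pow l 1 1
    simp only [pow_one, one_mul] at h1
    rw [e, TemperedDistribution.smulLeftCLM_smulLeftCLM_apply (hasTemperateGrowth_coord_pow l _ n) h1]
    have e2 := congrArg (fun L : 𝓢'(Space d, ℂ) →L[ℂ] 𝓢'(Space d, ℂ) => L (𝓕 u))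
      (TemperedDistribution.smulLeftCLM_smul (F := ℂ) ((hasTemperateGrowth_coord_pow l (2 * Real.pi * Complex.I) n).mul h1)
        (2 * Real.pi * Complex.I))
    refine e2.symm.trans ?_
    congr 2
    ext ζ
    simp only [Pi.smul_apply, Pi.mul_apply, smul_eq_mul]
    ring

/-- By Plancherel the weights ζ_l^n on the Fourier side are pure derivatives of order n, up to the
factor (2π)^n ≥ 1, and the weighted L² bound gives the weighted L¹ bound when n - q > d/2. -/
theorem exists_lintegral_fourier_le {q n : ℕ} (hq : q ≤ n) (hn : d < 2 * (n - q)) :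
    ∃ C : ℝ≥0∞, C < ⊤ ∧ ∀ ρ : Lp ℂ 2 (volume : Measure (Space d)),
      spaceNorm n (ρ : 𝓢'(Space d, ℂ)) < ⊤ →
      ∫⁻ ζ, ENNReal.ofReal ((1 + ‖ζ‖) ^ q)
        * ‖((𝓕 ρ : Lp ℂ 2 (volume : Measure (Space d))) : Space d → ℂ) ζ‖ₑ
        ≤ C * spaceNorm n (ρ : 𝓢'(Space d, ℂ)) := by
  obtain ⟨C, hC, h⟩ := exists_lintegral_weight_sq_le hq hn
  obtain ⟨D, hD, hD'⟩ := exists_le_mul_of_sq_le hC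
  refine ⟨D, hD, fun ρ hρ => hD' _ _ ((h _ (measurable_Lp _).aemeasurable).trans ?_)⟩
  gcongr
  refine le_trans (add_le_add (le_of_eq ?_) (Finset.sum_le_sum fun l _ => ?_))
    (add_sq_sum_le Finset.univ (distL2Norm (ρ : 𝓢'(Space d, ℂ)))
      fun l => distL2Norm ((dSpace l ^ n) (ρ : 𝓢'(Space d, ℂ))))
  · rw [distL2Norm_coe, ← enorm_Lp_two_sq, ← ofReal_norm, ← ofReal_norm, Lp.norm_fourier_eq]
  · have hl : distL2Norm ((dSpace l ^ n) (ρ : 𝓢'(Space d, ℂ))) < ⊤ :=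
      (ENNReal.sum_lt_top.1 (ENNReal.add_lt_top.1 hρ).2) l (Finset.mem_univ l)
    obtain ⟨G, hG⟩ := exists_of_distL2Norm_lt_top hl
    rw [← hG, distL2Norm_coe, ← ofReal_norm, ← Lp.norm_fourier_eq, ofReal_norm, enorm_Lp_two_sq]
    have e := congrArg (fun u : 𝓢'(Space d, ℂ) => 𝓕 u) hG
    simp only [fourier_dSpace_pow, Lp.fourier_toTemperedDistribution_eq] at e
    have hae := coeFn_ae_eq_of_smulLeftCLM (hasTemperateGrowth_coord_pow l _ n) e
    refine lintegral_mono_ae (hae.mono fun ζ hζ => ?_)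
    rw [hζ]
    gcongr
    rw [enorm_mul, enorm_mul]
    gcongr
    rw [mul_pow, enorm_mul]
    refine le_mul_of_one_le_left zero_le ?_
    rw [← ofReal_norm, norm_pow]
    refine ENNReal.one_le_ofReal.2 (one_le_pow₀ ?_)
    simp only [norm_mul, Complex.norm_real, Complex.norm_I, mul_one, Real.norm_eq_abs,
      abs_of_pos Real.pi_pos, Complex.norm_ofNat]
    linarith [Real.pi_gt_three]

end DensitySobolev

/-! ### Functions whose Fourier transform has a finite weighted L¹ norm -/

noncomputable section FourierField

theorem continuousOn_toReal_of_le_add {X : Type} [TopologicalSpace X] {I : Set X} {a : X → ℝ≥0∞}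
    {b : X → X → ℝ≥0∞} (ha : ∀ t ∈ I, a t < ⊤)
    (h1 : ∀ t ∈ I, ∀ τ ∈ I, a τ ≤ a t + b τ t) (h2 : ∀ t ∈ I, ∀ τ ∈ I, a t ≤ a τ + b τ t)
    (hb : ∀ t ∈ I, Tendsto (fun τ => b τ t) (𝓝[I] t) (𝓝 0)) :
    ContinuousOn (fun t => (a t).toReal) I := by
  intro t ht
  have h3 : Tendsto (fun τ => (b τ t).toReal) (𝓝[I] t) (𝓝 0) := by
    have := (ENNReal.tendsto_toReal ENNReal.zero_ne_top).comp (hb t ht)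
    rw [ENNReal.toReal_zero] at this
    exact this
  rw [ContinuousWithinAt, tendsto_iff_dist_tendsto_zero]
  refine squeeze_zero' (Eventually.of_forall fun _ => dist_nonneg) ?_ h3
  have hfin : ∀ᶠ τ in 𝓝[I] t, b τ t < ⊤ :=
    (hb t ht).eventually (gt_mem_nhds ENNReal.zero_lt_top)
  filter_upwards [hfin, self_mem_nhdsWithin] with τ hτ hτI
  have e1 := ENNReal.toReal_mono (ENNReal.add_lt_top.2 ⟨ha t ht, hτ⟩).ne (h1 t ht τ hτI)
  have e2 := ENNReal.toReal_mono (ENNReal.add_lt_top.2 ⟨ha τ hτI, hτ⟩).ne (h2 t ht τ hτI)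
  rw [ENNReal.toReal_add (ha _ ht).ne hτ.ne] at e1
  rw [ENNReal.toReal_add (ha _ hτI).ne hτ.ne] at e2
  rw [Real.dist_eq, abs_le]
  constructor <;> linarith

variable {d : ℕ}

/-- The weighted `L¹` norm `∫ (1 + |ζ|)^P |h|`. -/
def fourierWeight (P : ℕ) (h : Space d → ℂ) : ℝ≥0∞ :=
  ∫⁻ ζ, ENNReal.ofReal ((1 + ‖ζ‖) ^ P) * ‖h ζ‖ₑ

/-- The real part of the function with Fourier transform `h`. -/
def fourierField (h : Space d → ℂ) (x : Space d) : ℝ := (𝓕⁻ h x).re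

theorem fourierWeight_mono_exponent {P Q : ℕ} (hPQ : P ≤ Q) (h : Space d → ℂ) :
    fourierWeight P h ≤ fourierWeight Q h := by
  refine lintegral_mono fun ζ => ?_
  gcongr
  linarith [norm_nonneg ζ]

theorem lintegral_enorm_le_fourierWeight (P : ℕ) (h : Space d → ℂ) :
    ∫⁻ ζ, ‖h ζ‖ₑ ≤ fourierWeight P h := by
  refine (le_of_eq ?_).trans (fourierWeight_mono_exponent (Nat.zero_le P) h)
  simp [fourierWeight]

theorem fourierWeight_congr {P : ℕ} {h h' : Space d → ℂ} (e : h =ᵐ[volume] h') :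
    fourierWeight P h = fourierWeight P h' :=
  lintegral_congr_ae (e.mono fun ζ hζ => by simp only [hζ])

theorem fourierWeight_le_add {P : ℕ} {h h' : Space d → ℂ} (hm : Measurable h') :
    fourierWeight P h ≤ fourierWeight P h' + fourierWeight P (h - h') := by
  rw [fourierWeight, fourierWeight, fourierWeight, ← lintegral_add_left (by fun_prop)]
  refine lintegral_mono fun ζ => ?_
  rw [← mul_add]
  gcongr
  have := enorm_add_le (h' ζ) (h ζ - h' ζ)
  rwa [add_sub_cancel] at this

theorem fourierWeight_sub_comm {P : ℕ} (h h' : Space d → ℂ) :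
    fourierWeight P (h - h') = fourierWeight P (h' - h) := by
  simp only [fourierWeight, Pi.sub_apply]
  refine lintegral_congr fun ζ => ?_
  rw [← enorm_neg, neg_sub]

theorem fourierWeight_comp_neg (P : ℕ) (h : Space d → ℂ) :
    fourierWeight P (fun ζ => h (-ζ)) = fourierWeight P h := by
  have := lintegral_neg_eq_self (μ := (volume : Measure (Space d)))
    (fun ζ => ENNReal.ofReal ((1 + ‖ζ‖) ^ P) * ‖h ζ‖ₑ)
  simpa [fourierWeight] using this

theorem integrable_of_fourierWeight {P : ℕ} {h : Space d → ℂ} (hm : Measurable h)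
    (hf : fourierWeight P h < ⊤) : Integrable h :=
  ⟨hm.aestronglyMeasurable, (lintegral_enorm_le_fourierWeight P h).trans_lt hf⟩

theorem lintegral_pow_mul_le_fourierWeight {P n : ℕ} (hn : n ≤ P) (h : Space d → ℂ) :
    ∫⁻ ζ, ‖‖ζ‖ ^ n * ‖h ζ‖‖ₑ ≤ fourierWeight P h := by
  refine lintegral_mono fun ζ => ?_
  rw [enorm_mul, enorm_norm, Real.enorm_of_nonneg (by positivity)]
  gcongr
  calc ‖ζ‖ ^ n ≤ (1 + ‖ζ‖) ^ n := by gcongr; linarith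
    _ ≤ (1 + ‖ζ‖) ^ P := pow_le_pow_right₀ (by linarith [norm_nonneg ζ]) hn

theorem integrable_pow_mul_of_fourierWeight {P n : ℕ} (hn : n ≤ P) {h : Space d → ℂ}
    (hm : Measurable h) (hf : fourierWeight P h < ⊤) : Integrable fun ζ => ‖ζ‖ ^ n * ‖h ζ‖ :=
  ⟨by fun_prop, (lintegral_pow_mul_le_fourierWeight hn h).trans_lt hf⟩

theorem fourierField_eq (h : Space d → ℂ) :
    fourierField h = fun x => Complex.reCLM (𝓕 (fun ζ => h (-ζ)) x) := by
  ext x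
  rw [fourierField, Real.fourierInv_eq_fourier_comp_neg]
  rfl

theorem contDiff_fourierField {P : ℕ} {h : Space d → ℂ} (hm : Measurable h)
    (hf : fourierWeight P h < ⊤) : ContDiff ℝ P (fourierField h) := by
  rw [fourierField_eq]
  rw [← fourierWeight_comp_neg] at hf
  refine Complex.reCLM.contDiff.comp ?_
  exact Real.contDiff_fourier (N := P) fun n hn =>
    integrable_pow_mul_of_fourierWeight (by exact_mod_cast hn) (hm.comp measurable_neg) hf

/-- Each derivative brings down a factor of size 2π|ζ| under the integral, and the character has
modulus 1. -/
theorem enorm_iteratedFDeriv_fourierField_le {P j : ℕ} (hj : j ≤ P) {h : Space d → ℂ}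
    (hm : Measurable h) (hf : fourierWeight P h < ⊤) (x : Space d) :
    ‖iteratedFDeriv ℝ j (fourierField h) x‖ₑ
      ≤ ENNReal.ofReal ((2 * Real.pi) ^ P) * fourierWeight P h := by
  rw [fourierField_eq]
  rw [← fourierWeight_comp_neg] at hf ⊢
  set k : Space d → ℂ := fun ζ => h (-ζ) with hk
  have hkm : Measurable k := hm.comp measurable_neg
  have hint : ∀ n : ℕ, (n : ℕ∞) ≤ P → Integrable fun ζ => ‖ζ‖ ^ n * ‖k ζ‖ := fun n hn =>
    integrable_pow_mul_of_fourierWeight (by exact_mod_cast hn) hkm hf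
  have hC : ContDiff ℝ P (𝓕 k) := Real.contDiff_fourier (N := P) hint
  have e : iteratedFDeriv ℝ j (fun x => Complex.reCLM (𝓕 k x)) x
      = Complex.reCLM.compContinuousMultilinearMap (iteratedFDeriv ℝ j (𝓕 k) x) :=
    Complex.reCLM.iteratedFDeriv_comp_left hC.contDiffAt (by exact_mod_cast hj)
  have h1 : ‖iteratedFDeriv ℝ j (fun x => Complex.reCLM (𝓕 k x)) x‖ₑ
      ≤ ‖iteratedFDeriv ℝ j (𝓕 k) x‖ₑ := by
    rw [e]
    refine enorm_le_iff_norm_le.2 ?_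
    refine (ContinuousLinearMap.norm_compContinuousMultilinearMap_le _ _).trans ?_
    rw [Complex.reCLM_norm, one_mul]
  refine h1.trans ?_
  rw [Real.iteratedFDeriv_fourier (N := P) hint hkm.aestronglyMeasurable (by exact_mod_cast hj)]
  have h2 : ∀ ζ, ‖VectorFourier.fourierPowSMulRight (innerSL ℝ) k ζ j‖
      ≤ (2 * Real.pi) ^ j * (‖ζ‖ ^ j * ‖k ζ‖) := fun ζ => by
    refine (VectorFourier.norm_fourierPowSMulRight_le _ _ _ _).trans ?_
    rw [← mul_assoc]
    refine mul_le_mul_of_nonneg_right (mul_le_mul_of_nonneg_right (pow_le_pow_left₀ (by positivity)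
      (mul_le_of_le_one_right Real.two_pi_pos.le (norm_innerSL_le ℝ)) j) (by positivity))
      (norm_nonneg _)
  rw [Real.fourier_eq]
  refine (enorm_integral_le_lintegral_enorm _).trans ?_
  rw [fourierWeight, ← lintegral_const_mul' _ _ ENNReal.ofReal_ne_top]
  refine lintegral_mono fun ζ => ?_
  rw [Circle.smul_def, enorm_smul]
  have h3 : ‖((Real.fourierChar (-inner ℝ ζ x) : Circle) : ℂ)‖ₑ = 1 := by
    rw [← ofReal_norm, Circle.norm_coe, ENNReal.ofReal_one]
  rw [h3, one_mul, ← ofReal_norm, ← ofReal_norm, ← ENNReal.ofReal_mul (by positivity),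
    ← ENNReal.ofReal_mul (by positivity)]
  refine ENNReal.ofReal_le_ofReal ((h2 ζ).trans ?_)
  have hpi : 1 ≤ 2 * Real.pi := by linarith [Real.pi_gt_three]
  have h4 : ‖ζ‖ ^ j ≤ (1 + ‖ζ‖) ^ P :=
    (pow_le_pow_left₀ (norm_nonneg ζ) (by linarith) j).trans
      (pow_le_pow_right₀ (by linarith [norm_nonneg ζ]) hj)
  exact mul_le_mul (pow_le_pow_right₀ hpi hj) (mul_le_mul_of_nonneg_right h4 (norm_nonneg _))
    (by positivity) (by positivity)

theorem fourierInv_sub_of_integrable {h h' : Space d → ℂ} (hi : Integrable h) (hi' : Integrable h')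
    (x : Space d) : 𝓕⁻ (h - h') x = 𝓕⁻ h x - 𝓕⁻ h' x := by
  have e : ∀ k : Space d → ℂ, 𝓕⁻ k x = ∫ v, Complex.exp ((↑(2 * Real.pi * inner ℝ v x) * Complex.I)) • k v :=
    fun k => Real.fourierInv_eq' k x
  have hb : ∀ k : Space d → ℂ, Integrable k →
      Integrable fun v => Complex.exp ((↑(2 * Real.pi * inner ℝ v x) * Complex.I)) • k v :=
    fun k hk => by
      have hc : Continuous fun v : Space d =>
          Complex.exp ((↑(2 * Real.pi * inner ℝ v x) * Complex.I)) := by fun_prop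
      refine hk.norm.mono' (hc.aestronglyMeasurable.smul hk.1) (Eventually.of_forall fun ζ => ?_)
      rw [norm_smul, Complex.norm_exp_ofReal_mul_I, one_mul]
  simp only [Pi.sub_apply, e, smul_sub]
  exact integral_sub (hb h hi) (hb h' hi')

theorem enorm_fourierInv_le (h : Space d → ℂ) (x : Space d) :
    ‖𝓕⁻ h x‖ₑ ≤ fourierWeight 0 h := by
  rw [Real.fourierInv_eq']
  refine (enorm_integral_le_lintegral_enorm _).trans ((lintegral_mono fun ζ => ?_).trans
    (lintegral_enorm_le_fourierWeight 0 h))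
  refine enorm_le_iff_norm_le.2 (le_of_eq ?_)
  rw [norm_smul, Complex.norm_exp_ofReal_mul_I, one_mul]

theorem fourierField_sub {h h' : Space d → ℂ} (hi : Integrable h) (hi' : Integrable h') :
    fourierField (h - h') = fourierField h - fourierField h' := by
  ext x
  simp only [fourierField, Pi.sub_apply, fourierInv_sub_of_integrable hi hi', Complex.sub_re]

variable {I : Set ℝ} {P : ℕ} {h : ℝ → Space d → ℂ} (hm : ∀ t, Measurable (h t))
  (hf : ∀ t ∈ I, fourierWeight P (h t) < ⊤)
  (hc : ∀ t ∈ I, Tendsto (fun τ => fourierWeight P (h τ - h t)) (𝓝[I] t) (𝓝 0))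

include hm hf hc

theorem continuousOn_fourierWeight : ContinuousOn (fun t => (fourierWeight P (h t)).toReal) I :=
  continuousOn_toReal_of_le_add (b := fun τ t => fourierWeight P (h τ - h t)) hf
    (fun t _ τ _ => fourierWeight_le_add (hm t))
    (fun t _ τ _ => by rw [fourierWeight_sub_comm]; exact fourierWeight_le_add (hm τ)) hc

/-- The increment in time is small uniformly in x by the weighted L¹ bound; at a fixed time the
derivative is continuous in x. -/
theorem continuousOn_iteratedFDeriv_fourierField {j : ℕ} (hj : j ≤ P) :
    ContinuousOn (fun q : ℝ × Space d => iteratedFDeriv ℝ j (fourierField (h q.1)) q.2)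
      (I ×ˢ univ) := by
  rintro ⟨t, x⟩ ⟨ht, -⟩
  change t ∈ I at ht
  have hCt := contDiff_fourierField (hm t) (hf t ht)
  have hx : Continuous (iteratedFDeriv ℝ j (fourierField (h t))) :=
    hCt.continuous_iteratedFDeriv (by exact_mod_cast hj)
  have hfst : Tendsto (fun q : ℝ × Space d => q.1) (𝓝[I ×ˢ univ] (t, x)) (𝓝[I] t) :=
    tendsto_nhdsWithin_of_tendsto_nhds_of_eventually_within _
      (continuous_fst.continuousAt.tendsto.mono_left nhdsWithin_le_nhds)
      (eventually_mem_nhdsWithin.mono fun q hq => hq.1)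
  have hw := (hc t ht).comp hfst
  have hlim : Tendsto (fun q : ℝ × Space d => ENNReal.ofReal ((2 * Real.pi) ^ P)
      * fourierWeight P (h q.1 - h t)) (𝓝[I ×ˢ univ] (t, x)) (𝓝 0) := by
    have := ENNReal.Tendsto.const_mul hw (Or.inr ENNReal.ofReal_ne_top)
      (a := ENNReal.ofReal ((2 * Real.pi) ^ P))
    simpa using this
  have hdiff : Tendsto (fun q : ℝ × Space d => iteratedFDeriv ℝ j (fourierField (h q.1)) q.2
      - iteratedFDeriv ℝ j (fourierField (h t)) q.2) (𝓝[I ×ˢ univ] (t, x)) (𝓝 0) := by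
    rw [tendsto_zero_iff_enorm_tendsto_zero]
    refine tendsto_of_tendsto_of_tendsto_of_le_of_le' tendsto_const_nhds hlim
      (Eventually.of_forall fun _ => zero_le) ?_
    have hfin : ∀ᶠ q : ℝ × Space d in 𝓝[I ×ˢ univ] (t, x), fourierWeight P (h q.1 - h t) < ⊤ :=
      hw.eventually (gt_mem_nhds ENNReal.zero_lt_top)
    filter_upwards [hfin, self_mem_nhdsWithin] with q hq hqI
    have hCq := contDiff_fourierField (hm q.1) (hf q.1 hqI.1)
    have e := enorm_iteratedFDeriv_fourierField_le hj ((hm q.1).sub (hm t)) hq q.2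
    rw [fourierField_sub (integrable_of_fourierWeight (hm _) (hf _ hqI.1))
      (integrable_of_fourierWeight (hm _) (hf _ ht)),
      iteratedFDeriv_sub_apply ((hCq.of_le (by exact_mod_cast hj)).contDiffAt)
        ((hCt.of_le (by exact_mod_cast hj)).contDiffAt)] at e
    exact e
  have hfin := hdiff.add ((hx.comp continuous_snd).continuousAt.tendsto.mono_left
    (nhdsWithin_le_nhds (s := I ×ˢ (univ : Set (Space d))) (a := (t, x))))
  rw [zero_add] at hfin
  refine hfin.congr fun q => ?_
  simp

theorem continuousOn_fourierInv (x : Space d) : ContinuousOn (fun t => 𝓕⁻ (h t) x) I := by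
  intro t ht
  rw [ContinuousWithinAt, tendsto_iff_edist_tendsto_0]
  refine tendsto_of_tendsto_of_tendsto_of_le_of_le' tendsto_const_nhds (hc t ht)
    (Eventually.of_forall fun _ => zero_le) ?_
  filter_upwards [self_mem_nhdsWithin] with τ hτ
  rw [edist_eq_enorm_sub, ← fourierInv_sub_of_integrable (integrable_of_fourierWeight (hm _) (hf _ hτ))
    (integrable_of_fourierWeight (hm _) (hf _ ht))]
  exact (enorm_fourierInv_le _ x).trans (fourierWeight_mono_exponent (Nat.zero_le P) _)

end FourierField

/-! ### Passage to the limit and disappearance of the quadratic term -/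

noncomputable section WeakEquation

theorem hasDerivWithinAt_integral_Icc {F : Type} [NormedAddCommGroup F] [NormedSpace ℝ F]
    [CompleteSpace F] {A : ℝ → F} {T : ℝ} (hA : ContinuousOn A (Icc 0 T)) {t : ℝ}
    (ht : t ∈ Icc 0 T) :
    HasDerivWithinAt (fun t' => ∫ σ in 0..t', A σ) (A t) (Icc 0 T) t := by
  have h0 : (0 : ℝ) ∈ Icc 0 T := ⟨le_rfl, ht.1.trans ht.2⟩
  have h1 := hasDerivWithinAt_integral_diag (u := fun q : ℝ × ℝ => A q.2)
    (hA.comp continuousOn_snd fun q hq => hq.2) ht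
  refine (h1.const_add (∫ σ in 0..t, A σ)).congr (fun t' ht' => ?_) ?_
  · refine (intervalIntegral.integral_add_adjacent_intervals ?_ ?_).symm <;>
    exact (hA.mono (uIcc_subset_Icc (by assumption) (by assumption))).intervalIntegrable
  · simp

/-- Passage to the limit in an integrated differential equation. -/
theorem sub_eq_integral_of_tendsto {T : ℝ} {F A e : ℕ → ℝ → ℂ} {G P : ℝ → ℂ} {c M : ℝ}
    (hF : ∀ n, ∀ t ∈ Icc 0 T, HasDerivWithinAt (F n) (A n t + e n t) (Icc 0 T) t)
    (he : ∀ n, ∀ t ∈ Icc 0 T, ‖e n t‖ ≤ c / (n + 1))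
    (hAc : ∀ n, ContinuousOn (A n) (Icc 0 T)) (hAM : ∀ n, ∀ t ∈ Icc 0 T, ‖A n t‖ ≤ M)
    (hAG : ∀ t ∈ Icc 0 T, Tendsto (fun n => A n t) atTop (𝓝 (G t)))
    (hP : ∀ t ∈ Icc 0 T, Tendsto (fun n => F n t) atTop (𝓝 (P t))) {t : ℝ} (ht : t ∈ Icc 0 T) :
    P t - P 0 = ∫ τ in 0..t, G τ := by
  have h0 : (0 : ℝ) ∈ Icc 0 T := ⟨le_rfl, ht.1.trans ht.2⟩
  have hsub : uIoc 0 t ⊆ Icc 0 T := uIoc_subset_uIcc.trans (uIcc_subset_Icc h0 ht)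
  have h1 : Tendsto (fun n => ∫ τ in 0..t, A n τ) atTop (𝓝 (∫ τ in 0..t, G τ)) := by
    refine intervalIntegral.tendsto_integral_filter_of_dominated_convergence (fun _ => M)
      (Eventually.of_forall fun n => ?_) (Eventually.of_forall fun n =>
        Eventually.of_forall fun τ hτ => hAM n τ (hsub hτ)) intervalIntegrable_const
      (Eventually.of_forall fun τ hτ => hAG τ (hsub hτ))
    exact ((hAc n).mono hsub).aestronglyMeasurable measurableSet_uIoc
  have h2 : Tendsto (fun n => F n t - F n 0 - ∫ τ in 0..t, A n τ) atTop
      (𝓝 (P t - P 0 - ∫ τ in 0..t, G τ)) := ((hP t ht).sub (hP 0 h0)).sub h1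
  have h3 : Tendsto (fun n => F n t - F n 0 - ∫ τ in 0..t, A n τ) atTop (𝓝 0) := by
    have hc : Tendsto (fun n : ℕ => c * (1 / ((n : ℝ) + 1)) * ‖t - 0‖) atTop (𝓝 0) := by
      have := (tendsto_one_div_add_atTop_nhds_zero_nat (𝕜 := ℝ)).const_mul c
      simpa using this.mul_const ‖t - 0‖
    refine squeeze_zero_norm (fun n => ?_) hc
    -- Once the primitive of the main part is subtracted, only the error remains as derivative; the
    -- mean value inequality bounds the increment by c|t|/(n+1), without any measurability of the
    -- error in time.
    have := (convex_Icc 0 T).norm_image_sub_le_of_norm_hasDerivWithin_le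
      (f := fun t => F n t - ∫ τ in 0..t, A n τ) (f' := e n) (C := c / (n + 1))
      (fun τ hτ => by
        have := (hF n τ hτ).sub (hasDerivWithinAt_integral_Icc (hAc n) hτ)
        rwa [add_sub_cancel_left] at this) (he n) h0 ht
    simp only [intervalIntegral.integral_same, sub_zero] at this
    rw [sub_right_comm, mul_one_div, sub_zero]
    exact this
  exact sub_eq_zero.1 (tendsto_nhds_unique h2 h3)

variable {d : ℕ} {r : ℕ}

theorem exists_lintegral_pairing_le (hr : d < 2 * r) (K : 𝓢(Space d, ℂ)) :
    ∃ C : ℝ≥0∞, C < ⊤ ∧ ∀ g : Lp ℂ 2 (volume : Measure (Phase d)),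
      weightNorm r (g : 𝓢'(Phase d, ℂ)) < ⊤ →
      ∫⁻ z : Phase d, ‖g z * K z.1‖ₑ ≤ C * weightNorm r (g : 𝓢'(Phase d, ℂ)) := by
  obtain ⟨C, hC, h⟩ := exists_lintegral_velocity_sq_le hr
  have hK2 : ∫⁻ x : Space d, ‖K x‖ₑ ^ 2 < ⊤ := by
    have h2 := (K.memLp 2 (volume : Measure (Space d))).2
    rw [eLpNorm_lt_top_iff_lintegral_rpow_enorm_lt_top (by norm_num) (by norm_num)] at h2
    simpa using h2
  obtain ⟨D, hD, hD'⟩ := exists_le_mul_of_sq_le (ENNReal.mul_lt_top hC hK2)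
  refine ⟨D, hD, fun g hg => hD' _ _ ?_⟩
  have hgm := measurable_Lp g
  have hKm : Measurable K := K.continuous.measurable
  have e : ∫⁻ z : Phase d, ‖g z * K z.1‖ₑ
      = ∫⁻ x : Space d, (∫⁻ v : Space d, ‖g (x, v)‖ₑ) * ‖K x‖ₑ := by
    refine (lintegral_prod _ (hgm.mul (hKm.comp measurable_fst)).enorm.aemeasurable).trans ?_
    refine lintegral_congr fun x => ?_
    refine (lintegral_congr fun v => enorm_mul (g (x, v)) (K x)).trans ?_
    exact lintegral_mul_const' _ _ enorm_ne_top
  rw [e]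
  refine (lintegral_mul_sq_le hgm.enorm.lintegral_prod_right'.aemeasurable
    hKm.enorm.aemeasurable).trans ?_
  calc _ ≤ C * weightNorm r (g : 𝓢'(Phase d, ℂ)) ^ 2 * ∫⁻ x : Space d, ‖K x‖ₑ ^ 2 := by
        gcongr
        exact h g hg
    _ = _ := by ring

/-- The inverse Fourier transform of an integrable function tested against a Fourier transform. -/
theorem integral_fourierInv_mul_fourier {h : Space d → ℂ} (hh : Integrable h) (η : 𝓢(Space d, ℂ)) :
    ∫ v, 𝓕⁻ h v * (𝓕 η : 𝓢(Space d, ℂ)) v = ∫ ζ, h ζ * η ζ := by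
  have e1 : 𝓕⁻ h = fun v => 𝓕 h (-v) := by
    ext v
    exact Real.fourierInv_eq_fourier_neg h v
  have e2 : ∫ v, 𝓕 h (-v) * (𝓕 η : 𝓢(Space d, ℂ)) v
      = ∫ v, 𝓕 h v * (𝓕 η : 𝓢(Space d, ℂ)) (-v) := by
    rw [← integral_neg_eq_self]
    simp only [neg_neg]
  rw [e1, e2]
  have hi : Integrable fun v => (𝓕 η : 𝓢(Space d, ℂ)) (-v) :=
    (𝓕 η : 𝓢(Space d, ℂ)).integrable.comp_neg
  have h3 := VectorFourier.integral_bilin_fourierIntegral_eq_flip (L := innerₗ (Space d))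
    (μ := volume) (ν := volume) (ContinuousLinearMap.mul ℂ ℂ) Real.continuous_fourierChar
    continuous_inner hh hi
  simp only [ContinuousLinearMap.mul_apply', flip_innerₗ] at h3
  refine h3.trans (integral_congr_ae (Eventually.of_forall fun ζ => ?_))
  have h4 : 𝓕 (fun v => (𝓕 η : 𝓢(Space d, ℂ)) (-v)) ζ = η ζ := by
    rw [← Real.fourierInv_eq_fourier_comp_neg]
    have h5 : 𝓕⁻ (𝓕 η : 𝓢(Space d, ℂ)) = η := fourierInv_fourier_eq η
    rw [← fourierInv_coe, h5]
  change h ζ * _ = h ζ * _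
  exact congrArg (h ζ * ·) h4

theorem fourierInv_eq_zero_of_not_integrable {h : Space d → ℂ} (hh : ¬ Integrable h) (v : Space d) :
    𝓕⁻ h v = 0 := by
  rw [Real.fourierInv_eq_fourier_neg, Real.fourier_eq]
  exact integral_undef fun h' => hh ((Real.fourierIntegral_convergent_iff (-v)).1 h')

/-- Pairing with the cutoff, a Fourier transform, means integrating h against an approximate
identity supported in |ζ| ≤ 1/(n+1), where |h| ≤ c/(n+1). If h is not integrable its inverse
transform is 0 by convention and the bound is trivial. -/
theorem norm_fourierInv_pairing_le {h : Space d → ℂ} {c : ℝ} (hc : 0 ≤ c)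
    (hb : ∀ ζ, ‖h ζ‖ ≤ c * ‖ζ‖) (n : ℕ) :
    ‖∫ v, 𝓕⁻ h v * velocityCutoff d n v‖ ≤ c / (n + 1) := by
  by_cases hh : Integrable h
  · have := integral_fourierInv_mul_fourier hh (approxIdentity d n)
    rw [velocityCutoff, this]
    exact integral_norm_mul_approxIdentity_le hc hb
  · simp only [fourierInv_eq_zero_of_not_integrable hh, zero_mul, integral_zero, norm_zero]
    positivity

/-- The quadratic term does not contribute to the conservation of mass. -/
theorem enorm_integral_wignerB_mul_le (hr : d < 2 * r) {ε : ℝ} (hε : 0 < ε) {U : Space d → ℝ}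
    {L : NNReal} (hU : LipschitzWith L U) {g : Lp ℂ 2 (volume : Measure (Phase d))}
    (hg : weightNorm r (g : 𝓢'(Phase d, ℂ)) < ⊤) (K : 𝓢(Space d, ℂ)) (n : ℕ) :
    ‖∫ z : Phase d, wignerB ε U g z * tensorTest K (velocityCutoff d n) z‖ₑ
      ≤ ENNReal.ofReal (2 * Real.pi * L / (n + 1)) * ∫⁻ z : Phase d, ‖g z * K z.1‖ₑ := by
  -- Without integrability the integral is 0 by convention; otherwise Fubini applies.
  by_cases hi : Integrable fun z : Phase d => wignerB ε U g z * tensorTest K (velocityCutoff d n) z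
  swap
  · rw [integral_undef hi, enorm_zero]
    exact zero_le
  have hgm := measurable_Lp g
  have hKm : Measurable K := K.continuous.measurable
  have e : ∫⁻ z : Phase d, ‖g z * K z.1‖ₑ
      = ∫⁻ x : Space d, ∫⁻ v : Space d, ‖g (x, v) * K x‖ₑ :=
    lintegral_prod _ (hgm.mul (hKm.comp measurable_fst)).enorm.aemeasurable
  rw [e, ← lintegral_const_mul' _ _ ENNReal.ofReal_ne_top]
  have e2 := integral_prod _ hi
  refine (congrArg (fun w : ℂ => ‖w‖ₑ) e2).trans_le ?_
  refine (enorm_integral_le_lintegral_enorm _).trans (lintegral_mono_ae ?_)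
  filter_upwards [ae_integrable_velocity hr hg] with x hx
  set h : Space d → ℂ := fun ζ => ((symbolOf U x ((2 * Real.pi * ε) • ζ) : ℝ) : ℂ) *
    𝓕 (fun w : Space d => g (x, w)) ζ with hh
  -- The symbol vanishes at η = 0 and is Lipschitz there. Its argument carries a factor ε, which
  -- later compensates the 1/ε in front of B.
  have hb : ∀ ζ, ‖h ζ‖ ≤ (L * (2 * Real.pi * ε) * absDensity g x) * ‖ζ‖ := by
    intro ζ
    have h1 := abs_symbolOf_sub_le hU x ((2 * Real.pi * ε) • ζ) 0
    have h2 : symbolOf U x 0 = 0 := by simp [symbolOf]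
    rw [h2, sub_zero, sub_zero, norm_smul, Real.norm_of_nonneg (by positivity)] at h1
    have h3 : ‖𝓕 (fun w : Space d => g (x, w)) ζ‖ ≤ absDensity g x :=
      VectorFourier.norm_fourierIntegral_le_integral_norm _ _ _ _ _
    rw [hh, norm_mul, Complex.norm_real, Real.norm_eq_abs]
    calc _ ≤ (L * (2 * Real.pi * ε * ‖ζ‖)) * absDensity g x := by gcongr
      _ = _ := by ring
  have hab : 0 ≤ absDensity g x := integral_nonneg fun _ => norm_nonneg _
  have h4 := norm_fourierInv_pairing_le (by positivity) hb n
  have e3 : ∫ v : Space d, wignerB ε U g (x, v) * tensorTest K (velocityCutoff d n) (x, v)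
      = (Complex.I / ε * K x) * ∫ v, 𝓕⁻ h v * velocityCutoff d n v := by
    rw [← integral_const_mul]
    refine integral_congr_ae (Eventually.of_forall fun v => ?_)
    change (Complex.I / ε * 𝓕⁻ h v) * (K x * velocityCutoff d n v) = _
    ring
  rw [e3]
  have e4 : ∫⁻ v : Space d, ‖g (x, v) * K x‖ₑ = ENNReal.ofReal (absDensity g x * ‖K x‖) := by
    simp only [enorm_mul]
    rw [lintegral_mul_const' _ _ enorm_ne_top, absDensity,
      ENNReal.ofReal_mul (integral_nonneg fun _ => norm_nonneg _), ofReal_norm,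
      ofReal_integral_norm_eq_lintegral_enorm hx]
  rw [e4, ← ofReal_norm, ← ENNReal.ofReal_mul (by positivity)]
  refine ENNReal.ofReal_le_ofReal ?_
  rw [norm_mul, norm_mul, norm_div, Complex.norm_I, Complex.norm_real, Real.norm_of_nonneg hε.le]
  calc _ ≤ 1 / ε * ‖K x‖ * (L * (2 * Real.pi * ε) * absDensity g x / (n + 1)) := by gcongr
    _ = _ := by field_simp

end WeakEquation

/-! ### The continuity equation for the density -/

noncomputable section ContinuityEquation

variable {d : ℕ} {r : ℕ}

theorem integrable_Lp_mul_schwartz {E : Type} [NormedAddCommGroup E] [NormedSpace ℝ E]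
    [FiniteDimensional ℝ E] [MeasureSpace E] [BorelSpace E]
    [(volume : Measure E).HasTemperateGrowth]
    (g : Lp ℂ 2 (volume : Measure E)) (φ : 𝓢(E, ℂ)) : Integrable fun z => g z * φ z :=
  (Lp.memLp g).integrable_mul (φ.memLp 2 volume)

theorem coe_distribution_apply {E : Type} [NormedAddCommGroup E] [NormedSpace ℝ E]
    [FiniteDimensional ℝ E] [MeasureSpace E] [BorelSpace E]
    [(volume : Measure E).HasTemperateGrowth]
    (g : Lp ℂ 2 (volume : Measure E)) (φ : 𝓢(E, ℂ)) :
    (g : 𝓢'(E, ℂ)) φ = ∫ z, g z * φ z := by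
  rw [Lp.toTemperedDistribution_apply]
  exact integral_congr_ae (Eventually.of_forall fun z => by simp [mul_comm])

theorem continuousOn_Lp_of_weightNorm {I : Set ℝ} {f : ℝ → Lp ℂ 2 (volume : Measure (Phase d))}
    (hc : ∀ t ∈ I, Tendsto (fun τ => weightNorm r
      ((f τ - f t : Lp ℂ 2 (volume : Measure (Phase d))) : 𝓢'(Phase d, ℂ))) (𝓝[I] t) (𝓝 0)) :
    ContinuousOn f I := by
  intro t ht
  rw [ContinuousWithinAt, tendsto_iff_edist_tendsto_0]
  refine tendsto_of_tendsto_of_tendsto_of_le_of_le tendsto_const_nhds (hc t ht)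
    (fun _ => zero_le) fun τ => ?_
  change edist (f τ) (f t) ≤ _
  rw [edist_eq_enorm_sub, ← distL2Norm_coe]
  exact distL2Norm_le_weightNorm _

theorem continuousOn_weightNorm {I : Set ℝ} {f : ℝ → Lp ℂ 2 (volume : Measure (Phase d))}
    (hf : ∀ t ∈ I, weightNorm r (f t : 𝓢'(Phase d, ℂ)) < ⊤)
    (hc : ∀ t ∈ I, Tendsto (fun τ => weightNorm r
      ((f τ - f t : Lp ℂ 2 (volume : Measure (Phase d))) : 𝓢'(Phase d, ℂ))) (𝓝[I] t) (𝓝 0)) :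
    ContinuousOn (fun t => (weightNorm r (f t : 𝓢'(Phase d, ℂ))).toReal) I := by
  refine continuousOn_toReal_of_le_add (b := fun τ t => weightNorm r
    ((f τ - f t : Lp ℂ 2 (volume : Measure (Phase d))) : 𝓢'(Phase d, ℂ))) hf ?_ ?_ hc
  · intro t _ τ _
    have h := weightNorm_sub_le (r := r) (f t : 𝓢'(Phase d, ℂ))
      (0 - ((f τ - f t : Lp ℂ 2 (volume : Measure (Phase d))) : 𝓢'(Phase d, ℂ)))
    have h2 := weightNorm_sub_le (r := r) (0 : 𝓢'(Phase d, ℂ))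
      ((f τ - f t : Lp ℂ 2 (volume : Measure (Phase d))) : 𝓢'(Phase d, ℂ))
    have h0 : weightNorm r (0 : 𝓢'(Phase d, ℂ)) = 0 := by
      simp only [weightNorm, map_zero, distL2Norm_zero, Finset.sum_const_zero, add_zero]
    rw [h0, zero_add] at h2
    refine le_trans (le_of_eq ?_) (h.trans (add_le_add le_rfl h2))
    rw [coe_distribution_sub]
    congr 1
    abel
  · intro t _ τ _
    have h := weightNorm_sub_le (r := r) (f τ : 𝓢'(Phase d, ℂ))
      ((f τ - f t : Lp ℂ 2 (volume : Measure (Phase d))) : 𝓢'(Phase d, ℂ))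
    rw [coe_distribution_sub, sub_sub_cancel] at h
    rwa [coe_distribution_sub]

theorem enorm_integral_tensorTest_le (g : Lp ℂ 2 (volume : Measure (Phase d))) (K : 𝓢(Space d, ℂ))
    (n : ℕ) :
    ‖∫ z : Phase d, g z * tensorTest K (velocityCutoff d n) z‖ₑ ≤ ∫⁻ z : Phase d, ‖g z * K z.1‖ₑ := by
  refine (enorm_integral_le_lintegral_enorm _).trans (lintegral_mono fun z => ?_)
  refine enorm_le_iff_norm_le.2 ?_
  rw [tensorTest_apply, ← mul_assoc, norm_mul]
  exact mul_le_of_le_one_right (norm_nonneg _) (norm_velocityCutoff_le n z.2)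

/-- Since v·∇K = Σ v_k ∂_k K, the unbounded factor v_k goes into the momentum g_k = v_k f, which is
in L², and the test functions keep their tensor form with the same cutoff. -/
theorem integral_transport_tensorTest {f : Lp ℂ 2 (volume : Measure (Phase d))}
    {g : Fin d → Lp ℂ 2 (volume : Measure (Phase d))}
    (hg : ∀ k, (g k : 𝓢'(Phase d, ℂ)) = mulV k (f : 𝓢'(Phase d, ℂ))) (K χ : 𝓢(Space d, ℂ)) :
    ∫ z : Phase d, f z * fderiv ℝ (tensorTest K χ : Phase d → ℂ) z (z.2, 0)
      = ∑ k, ∫ z : Phase d, g k z *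
        tensorTest (LineDeriv.lineDerivOp (EuclideanSpace.single k (1 : ℝ) : Space d) K) χ z := by
  rw [← integral_finsetSum _ fun k _ => integrable_Lp_mul_schwartz (g k) _]
  have h : ∀ᵐ z : Phase d, ∀ k, g k z = ((z.2 k : ℝ) : ℂ) * f z :=
    eventually_countable_forall.2 fun k =>
      coeFn_ae_eq_of_smulLeftCLM (hasTemperateGrowth_coordV k) (hg k)
  refine integral_congr_ae (h.mono fun z hz => ?_)
  have hv : z.2 = ∑ k, z.2 k • EuclideanSpace.single k (1 : ℝ) := by
    ext i; simp [Pi.single_apply]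
  have e : fderiv ℝ K z.1 z.2 = ∑ k, ((z.2 k : ℝ) : ℂ) *
      fderiv ℝ K z.1 (EuclideanSpace.single k (1 : ℝ)) := by
    conv_lhs => rw [hv]
    rw [map_sum]
    refine Finset.sum_congr rfl fun k _ => ?_
    rw [map_smul, Complex.real_smul]
  change f z * _ = _
  rw [fderiv_tensorTest_left, e, Finset.sum_mul, Finset.mul_sum]
  refine Finset.sum_congr rfl fun k _ => ?_
  rw [hz k, tensorTest_apply, lineDerivOp_apply_eq_fderiv]
  ring

/-- The weak form of the continuity equation `∂_t ρ + div J = 0`. -/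
theorem weak_continuity_equation (hr : d < 2 * r) {ε T : ℝ} (hε : 0 < ε)
    {f : ℝ → Lp ℂ 2 (volume : Measure (Phase d))}
    {g : Fin d → ℝ → Lp ℂ 2 (volume : Measure (Phase d))} {U : ℝ → Space d → ℝ} {L : NNReal}
    (hf : ∀ t ∈ Icc 0 T, weightNorm r (f t : 𝓢'(Phase d, ℂ)) < ⊤)
    (hfc : ∀ t ∈ Icc 0 T, Tendsto (fun τ => weightNorm r
      ((f τ - f t : Lp ℂ 2 (volume : Measure (Phase d))) : 𝓢'(Phase d, ℂ))) (𝓝[Icc 0 T] t) (𝓝 0))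
    (hgf : ∀ k, ∀ t ∈ Icc 0 T, (g k t : 𝓢'(Phase d, ℂ)) = mulV k (f t : 𝓢'(Phase d, ℂ)))
    (hg : ∀ k, ∀ t ∈ Icc 0 T, weightNorm r (g k t : 𝓢'(Phase d, ℂ)) < ⊤)
    (hgc : ∀ k, ∀ t ∈ Icc 0 T, Tendsto (fun τ => weightNorm r
      ((g k τ - g k t : Lp ℂ 2 (volume : Measure (Phase d))) : 𝓢'(Phase d, ℂ)))
        (𝓝[Icc 0 T] t) (𝓝 0))
    (hU : ∀ t ∈ Icc 0 T, LipschitzWith L (U t))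
    (heq : ∀ χ : 𝓢(Phase d, ℂ), ∀ t ∈ Icc 0 T,
      HasDerivWithinAt (fun τ => ∫ z, f τ z * χ z)
        ((∫ z : Phase d, f t z * fderiv ℝ (χ : Phase d → ℂ) z (z.2, 0)) -
          ∫ z : Phase d, wignerB ε (U t) (f t) z * χ z) (Icc 0 T) t)
    (K : 𝓢(Space d, ℂ)) {t : ℝ} (ht : t ∈ Icc 0 T) :
    (∫ x, density (f t) x * K x) - ∫ x, density (f 0) x * K x
      = ∫ τ in 0..t, ∑ k, ∫ x, density (g k τ) x *
          (LineDeriv.lineDerivOp (EuclideanSpace.single k (1 : ℝ) : Space d) K : 𝓢(Space d, ℂ)) x := by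
  set D : Fin d → 𝓢(Space d, ℂ) := fun k =>
    LineDeriv.lineDerivOp (EuclideanSpace.single k (1 : ℝ) : Space d) K with hD
  obtain ⟨C, hC, hCK⟩ := exists_lintegral_pairing_le hr K
  choose B hB hBK using fun k => exists_lintegral_pairing_le hr (D k)
  obtain ⟨Mf, hMf⟩ := isCompact_Icc.exists_bound_of_continuousOn (continuousOn_weightNorm hf hfc)
  choose Mg hMg using fun k =>
    isCompact_Icc.exists_bound_of_continuousOn (continuousOn_weightNorm (hg k) (hgc k))
  -- Here A n is the transport term, bounded uniformly in n and convergent as the cutoff is removed,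
  -- and e n is the contribution of B, of size O(1/(n+1)).
  refine sub_eq_integral_of_tendsto (T := T)
    (F := fun n τ => ∫ z, f τ z * tensorTest K (velocityCutoff d n) z)
    (A := fun n τ => ∑ k, ∫ z : Phase d, g k τ z * tensorTest (D k) (velocityCutoff d n) z)
    (e := fun n τ => -∫ z : Phase d, wignerB ε (U τ) (f τ) z * tensorTest K (velocityCutoff d n) z)
    (G := fun τ => ∑ k, ∫ x, density (g k τ) x * D k x)
    (P := fun τ => ∫ x, density (f τ) x * K x)
    (c := 2 * Real.pi * L * (C.toReal * Mf)) (M := ∑ k, (B k).toReal * Mg k)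
    ?_ ?_ ?_ ?_ ?_ ?_ ht
  · intro n τ hτ
    have h := heq (tensorTest K (velocityCutoff d n)) τ hτ
    rw [integral_transport_tensorTest (fun k => hgf k τ hτ)] at h
    exact h
  · intro n τ hτ
    have h1 := enorm_integral_wignerB_mul_le hr hε (hU τ hτ) (hf τ hτ) K n
    have h2 := h1.trans (mul_le_mul_right (hCK (f τ) (hf τ hτ)) _)
    have h3 := ENNReal.toReal_mono (ENNReal.mul_lt_top ENNReal.ofReal_lt_top
      (ENNReal.mul_lt_top hC (hf τ hτ))).ne h2
    rw [ENNReal.toReal_mul, ENNReal.toReal_mul, ENNReal.toReal_ofReal (by positivity),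
      toReal_enorm] at h3
    rw [norm_neg]
    refine h3.trans ?_
    have h4 := (le_abs_self _).trans (hMf τ hτ)
    calc _ ≤ 2 * Real.pi * L / (n + 1) * (C.toReal * Mf) := by gcongr
      _ = _ := by ring
  · intro n
    refine continuousOn_finsetSum _ fun k _ => ?_
    have h1 := continuousOn_Lp_of_weightNorm (hgc k)
    have h2 : Continuous fun h : Lp ℂ 2 (volume : Measure (Phase d)) =>
        ∫ z : Phase d, h z * tensorTest (D k) (velocityCutoff d n) z := by
      simp only [← coe_distribution_apply]
      exact (PointwiseConvergenceCLM.evalCLM _ _ _).continuous.comp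
        (Lp.toTemperedDistributionCLM ℂ (volume : Measure (Phase d)) 2).continuous
    exact h2.comp_continuousOn h1
  · intro n τ hτ
    refine (norm_sum_le _ _).trans (Finset.sum_le_sum fun k _ => ?_)
    have h1 := (enorm_integral_tensorTest_le (g k τ) (D k) n).trans (hBK k _ (hg k τ hτ))
    have h3 := ENNReal.toReal_mono (ENNReal.mul_lt_top (hB k) (hg k τ hτ)).ne h1
    rw [ENNReal.toReal_mul, toReal_enorm] at h3
    have h4 := (le_abs_self _).trans (hMg k τ hτ)
    exact h3.trans (by gcongr)
  · intro τ hτ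
    exact tendsto_finsetSum _ fun k _ => tendsto_integral_tensorTest hr (hg k τ hτ) (D k)
  · intro τ hτ
    exact tendsto_integral_tensorTest hr (hf τ hτ) K

end ContinuityEquation

/-! ### Time evolution of the potential -/

noncomputable section PotentialEvolution

variable {d : ℕ}

/-- The Fourier transform of a square-integrable function, as a function. -/
def densityHat (ρ : Lp ℂ 2 (volume : Measure (Space d))) : Space d → ℂ :=
  ((𝓕 ρ : Lp ℂ 2 (volume : Measure (Space d))) : Space d → ℂ)

theorem measurable_densityHat (ρ : Lp ℂ 2 (volume : Measure (Space d))) :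
    Measurable (densityHat ρ) := measurable_Lp _

theorem densityHat_sub (ρ σ : Lp ℂ 2 (volume : Measure (Space d))) :
    densityHat (ρ - σ) =ᵐ[volume] densityHat ρ - densityHat σ := by
  have h : (𝓕 (ρ - σ) : Lp ℂ 2 (volume : Measure (Space d))) = 𝓕 ρ - 𝓕 σ :=
    map_sub (Lp.fourierTransformₗᵢ (Space d) ℂ) ρ σ
  rw [densityHat, h]
  exact Lp.coeFn_sub _ _

/-- The multiplier `V̂(2πεζ)` applied to `h`. -/
def potentialMultiplier (V : PairPotential d) (ε : ℝ) (h : Space d → ℂ) (ζ : Space d) : ℂ :=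
  ((V.hat ((2 * Real.pi * ε) • ζ) : ℝ) : ℂ) * h ζ

theorem PairPotential.exists_abs_hat_le (V : PairPotential d) : ∃ C : ℝ, 0 ≤ C ∧ ∀ ξ, |V.hat ξ| ≤ C := by
  obtain ⟨C, hC⟩ := V.bounded 0
  simp only [norm_iteratedFDeriv_zero, Real.norm_eq_abs] at hC
  exact ⟨C, (abs_nonneg _).trans (hC 0), hC⟩

theorem measurable_potentialMultiplier (V : PairPotential d) (ε : ℝ) {h : Space d → ℂ}
    (hh : Measurable h) : Measurable (potentialMultiplier V ε h) := by
  have := V.smooth.continuous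
  have h2 : Measurable fun ζ : Space d => ((V.hat ((2 * Real.pi * ε) • ζ) : ℝ) : ℂ) :=
    Continuous.measurable (by fun_prop)
  exact h2.mul hh

theorem fourierWeight_mul_le {P : ℕ} {a h : Space d → ℂ} {C : ℝ} (ha : ∀ ζ, ‖a ζ‖ ≤ C) :
    fourierWeight P (fun ζ => a ζ * h ζ) ≤ ENNReal.ofReal C * fourierWeight P h := by
  rw [fourierWeight, fourierWeight, ← lintegral_const_mul' _ _ ENNReal.ofReal_ne_top]
  refine lintegral_mono fun ζ => ?_
  rw [enorm_mul, mul_left_comm]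
  gcongr
  rw [← ofReal_norm]
  exact ENNReal.ofReal_le_ofReal (ha ζ)

theorem fourierWeight_potentialMultiplier_le {V : PairPotential d} {C : ℝ} (hC : ∀ ξ, |V.hat ξ| ≤ C)
    (ε : ℝ) (P : ℕ) (h : Space d → ℂ) :
    fourierWeight P (potentialMultiplier V ε h) ≤ ENNReal.ofReal C * fourierWeight P h :=
  fourierWeight_mul_le fun ζ => by rw [Complex.norm_real]; exact hC _

theorem potentialMultiplier_sub (V : PairPotential d) (ε : ℝ) (h h' : Space d → ℂ) :
    potentialMultiplier V ε (h - h') = potentialMultiplier V ε h - potentialMultiplier V ε h' := by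
  ext ζ
  exact mul_sub _ _ _

/-- The Fourier transform of `-div J`. -/
def divergenceSymbol (j : Fin d → Space d → ℂ) (ζ : Space d) : ℂ :=
  ∑ k, (-(2 * Real.pi * Complex.I) * ((ζ k : ℝ) : ℂ)) * j k ζ

theorem measurable_divergenceSymbol {j : Fin d → Space d → ℂ} (hj : ∀ k, Measurable (j k)) :
    Measurable (divergenceSymbol j) := by
  unfold divergenceSymbol
  refine Finset.measurable_sum _ fun k _ => Measurable.mul ?_ (hj k)
  exact Continuous.measurable (by fun_prop)

theorem divergenceSymbol_sub (j j' : Fin d → Space d → ℂ) :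
    divergenceSymbol j - divergenceSymbol j' = divergenceSymbol (j - j') := by
  ext ζ
  simp only [divergenceSymbol, Pi.sub_apply, mul_sub, Finset.sum_sub_distrib]

theorem fourierWeight_divergenceSymbol_le {j : Fin d → Space d → ℂ} (hj : ∀ k, Measurable (j k)) :
    fourierWeight 0 (divergenceSymbol j)
      ≤ ENNReal.ofReal (2 * Real.pi) * ∑ k, fourierWeight 1 (j k) := by
  have hm : ∀ k, Measurable fun ζ : Space d => ENNReal.ofReal ((1 + ‖ζ‖) ^ 1) * ‖j k ζ‖ₑ :=
    fun k => by have := hj k; fun_prop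
  simp only [fourierWeight]
  rw [← lintegral_finsetSum _ fun k _ => hm k, ← lintegral_const_mul' _ _ ENNReal.ofReal_ne_top]
  refine lintegral_mono fun ζ => ?_
  rw [pow_zero, ENNReal.ofReal_one, one_mul, Finset.mul_sum]
  refine (enorm_sum_le _ _).trans (Finset.sum_le_sum fun k _ => ?_)
  rw [enorm_mul, ← mul_assoc]
  gcongr
  rw [← ofReal_norm, ← ENNReal.ofReal_mul (by positivity)]
  refine ENNReal.ofReal_le_ofReal ?_
  rw [norm_mul, norm_neg, Complex.norm_real, norm_mul, Complex.norm_I, mul_one, pow_one]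
  have h1 : ‖(2 * Real.pi : ℂ)‖ = 2 * Real.pi := by
    rw [norm_mul, Complex.norm_real, Complex.norm_ofNat, Real.norm_of_nonneg Real.pi_pos.le]
  rw [h1]
  gcongr
  exact (PiLp.norm_apply_le ζ k).trans (by linarith)

theorem integral_mul_fourier (ρ : Lp ℂ 2 (volume : Measure (Space d))) (φ : 𝓢(Space d, ℂ)) :
    ∫ x, ρ x * (𝓕 φ : 𝓢(Space d, ℂ)) x = ∫ ζ, densityHat ρ ζ * φ ζ := by
  rw [densityHat, ← coe_distribution_apply, ← coe_distribution_apply,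
    ← Lp.fourier_toTemperedDistribution_eq]
  rfl

theorem smulLeftCLM_coord_apply (φ : 𝓢(Space d, ℂ)) (k : Fin d) (ζ : Space d) :
    (-(2 * Real.pi * Complex.I) • smulLeftCLM ℂ
      (fun y : Space d => (inner ℝ y (EuclideanSpace.single k (1 : ℝ)) : ℝ)) φ : 𝓢(Space d, ℂ)) ζ
      = -(2 * Real.pi * Complex.I) * ((ζ k : ℝ) : ℂ) * φ ζ := by
  have h : (fun y : Space d => (inner ℝ y (EuclideanSpace.single k (1 : ℝ)) : ℝ)).HasTemperateGrowth :=
    ((innerSL ℝ).flip (EuclideanSpace.single k (1 : ℝ) : Space d)).hasTemperateGrowth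
  rw [smul_apply, smulLeftCLM_apply_apply h, EuclideanSpace.inner_single_right]
  simp [mul_assoc]

theorem integral_mul_lineDerivOp_fourier (ρ : Lp ℂ 2 (volume : Measure (Space d)))
    (φ : 𝓢(Space d, ℂ)) (k : Fin d) :
    ∫ x, ρ x * (LineDeriv.lineDerivOp (EuclideanSpace.single k (1 : ℝ) : Space d)
        (𝓕 φ : 𝓢(Space d, ℂ)) : 𝓢(Space d, ℂ)) x
      = ∫ ζ, -(2 * Real.pi * Complex.I) * ((ζ k : ℝ) : ℂ) * densityHat ρ ζ * φ ζ := by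
  rw [SchwartzMap.lineDerivOp_fourier_eq, integral_mul_fourier]
  refine integral_congr_ae (Eventually.of_forall fun ζ => ?_)
  dsimp only
  rw [smulLeftCLM_coord_apply]
  ring

theorem integrable_coord_mul_densityHat_mul (ρ : Lp ℂ 2 (volume : Measure (Space d)))
    (φ : 𝓢(Space d, ℂ)) (k : Fin d) :
    Integrable fun ζ => -(2 * Real.pi * Complex.I) * ((ζ k : ℝ) : ℂ) * densityHat ρ ζ * φ ζ := by
  refine (integrable_Lp_mul_schwartz (𝓕 ρ : Lp ℂ 2 (volume : Measure (Space d)))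
    (-(2 * Real.pi * Complex.I) • smulLeftCLM ℂ
      (fun y : Space d => (inner ℝ y (EuclideanSpace.single k (1 : ℝ)) : ℝ)) φ)).congr
    (Eventually.of_forall fun ζ => ?_)
  dsimp only
  rw [smulLeftCLM_coord_apply, densityHat]
  ring

theorem continuousOn_integral_mul_of_fourierWeight {I : Set ℝ} {h : ℝ → Space d → ℂ}
    (hm : ∀ t, Measurable (h t)) (hf : ∀ t ∈ I, fourierWeight 0 (h t) < ⊤)
    (hc : ∀ t ∈ I, Tendsto (fun τ => fourierWeight 0 (h τ - h t)) (𝓝[I] t) (𝓝 0))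
    {φ : Space d → ℂ} (hφ : Continuous φ) {C : ℝ} (hC : ∀ ζ, ‖φ ζ‖ ≤ C) :
    ContinuousOn (fun t => ∫ ζ, h t ζ * φ ζ) I := by
  intro t ht
  have hi : ∀ τ ∈ I, Integrable fun ζ => h τ ζ * φ ζ := fun τ hτ =>
    (integrable_of_fourierWeight (hm τ) (hf τ hτ)).mul_bdd (c := C) hφ.aestronglyMeasurable
      (Eventually.of_forall hC)
  have h1 : Tendsto (fun τ => ENNReal.ofReal C * fourierWeight 0 (h τ - h t)) (𝓝[I] t) (𝓝 0) := by
    simpa using ENNReal.Tendsto.const_mul (hc t ht) (Or.inr ENNReal.ofReal_ne_top)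
      (a := ENNReal.ofReal C)
  rw [ContinuousWithinAt, tendsto_iff_edist_tendsto_0]
  refine tendsto_of_tendsto_of_tendsto_of_le_of_le' tendsto_const_nhds h1
    (Eventually.of_forall fun _ => zero_le) ?_
  filter_upwards [self_mem_nhdsWithin] with τ hτ
  rw [edist_eq_enorm_sub, ← integral_sub (hi τ hτ) (hi t ht)]
  refine (enorm_integral_le_lintegral_enorm _).trans ?_
  refine le_trans ?_ (fourierWeight_mul_le hC)
  refine le_trans (le_of_eq ?_) (lintegral_enorm_le_fourierWeight 0 _)
  refine lintegral_congr fun ζ => ?_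
  rw [Pi.sub_apply, ← sub_mul, mul_comm]

variable {V : PairPotential d} {ε T : ℝ} {ρ : ℝ → Lp ℂ 2 (volume : Measure (Space d))}
  {J : Fin d → ℝ → Lp ℂ 2 (volume : Measure (Space d))}

/-- The Fourier multiplier, localized and modulated, as a test function. -/
def modulatedMultiplier (V : PairPotential d) (ε : ℝ) (x : Space d) (n : ℕ) : 𝓢(Space d, ℂ) :=
  let θ : ContDiffBump (0 : Space d) := ⟨n + 1, n + 2, by positivity, by linarith⟩
  HasCompactSupport.toSchwartzMap (f := fun ζ : Space d => ((θ ζ : ℝ) : ℂ) *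
      (((V.hat ((2 * Real.pi * ε) • ζ) : ℝ) : ℂ) *
        Complex.exp (↑(2 * Real.pi * inner ℝ ζ x) * Complex.I)))
    ((θ.hasCompactSupport.comp_left (g := ((↑) : ℝ → ℂ)) Complex.ofReal_zero).mul_right) (by
      have h1 : ContDiff ℝ ∞ fun ζ : Space d => ((θ ζ : ℝ) : ℂ) := Complex.ofRealCLM.contDiff.comp θ.contDiff
      have h2 : ContDiff ℝ ∞ fun ζ : Space d => ((V.hat ((2 * Real.pi * ε) • ζ) : ℝ) : ℂ) :=
        Complex.ofRealCLM.contDiff.comp (V.smooth.comp (contDiff_id.const_smul _))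
      have h3 : ContDiff ℝ ∞ fun ζ : Space d => ((2 * Real.pi * inner ℝ ζ x : ℝ) : ℂ) :=
        Complex.ofRealCLM.contDiff.comp (contDiff_const.mul (contDiff_id.inner ℝ contDiff_const))
      exact h1.mul (h2.mul (Complex.contDiff_exp.comp (h3.mul contDiff_const))))

theorem norm_modulatedMultiplier_le {C : ℝ} (hC : ∀ ξ, |V.hat ξ| ≤ C) (x : Space d) (n : ℕ)
    (ζ : Space d) : ‖modulatedMultiplier V ε x n ζ‖ ≤ C := by
  change ‖((ContDiffBump.toFun _ _ : ℝ) : ℂ) * (_ * Complex.exp (_ * Complex.I))‖ ≤ C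
  rw [norm_mul, norm_mul, Complex.norm_exp_ofReal_mul_I, mul_one, Complex.norm_real,
    Complex.norm_real, Real.norm_eq_abs, abs_of_nonneg (ContDiffBump.nonneg _)]
  exact (mul_le_of_le_one_left (norm_nonneg _) (ContDiffBump.le_one _)).trans (hC _)

/-- The smooth multiplier V̂ times a character need not be Schwartz; the compactly supported
truncations agree with it at ζ as soon as n ≥ |ζ| and stay bounded, so dominated convergence
applies. -/
theorem tendsto_integral_mul_modulatedMultiplier (x : Space d) {h : Space d → ℂ}
    (hh : Integrable h) :
    Tendsto (fun n => ∫ ζ, h ζ * modulatedMultiplier V ε x n ζ) atTop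
      (𝓝 (𝓕⁻ (potentialMultiplier V ε h) x)) := by
  obtain ⟨C, hC0, hC⟩ := V.exists_abs_hat_le
  rw [Real.fourierInv_eq']
  refine tendsto_integral_of_dominated_convergence (fun ζ => ‖h ζ‖ * C)
    (fun n => hh.1.mul (modulatedMultiplier V ε x n).continuous.aestronglyMeasurable)
    (hh.norm.mul_const C) (fun n => Eventually.of_forall fun ζ => ?_)
    (Eventually.of_forall fun ζ => ?_)
  · rw [norm_mul]
    gcongr
    exact norm_modulatedMultiplier_le hC x n ζ
  · refine tendsto_const_nhds.congr' ?_
    filter_upwards [eventually_ge_atTop ⌈‖ζ‖⌉₊] with n hn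
    have h1 : ‖ζ‖ ≤ n + 1 := by
      have := Nat.ceil_le.1 hn
      linarith
    have h2 : modulatedMultiplier V ε x n ζ = ((V.hat ((2 * Real.pi * ε) • ζ) : ℝ) : ℂ) *
        Complex.exp (↑(2 * Real.pi * inner ℝ ζ x) * Complex.I) := by
      change ((ContDiffBump.toFun _ _ : ℝ) : ℂ) * _ = _
      rw [ContDiffBump.one_of_mem_closedBall _ (by simpa using h1), Complex.ofReal_one, one_mul]
    rw [h2, potentialMultiplier, smul_eq_mul]
    ring

theorem fourierWeight_divergenceSymbol_lt_top {j : Fin d → Space d → ℂ} (hj : ∀ k, Measurable (j k))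
    (hw : ∀ k, fourierWeight 1 (j k) < ⊤) : fourierWeight 0 (divergenceSymbol j) < ⊤ :=
  (fourierWeight_divergenceSymbol_le hj).trans_lt (ENNReal.mul_lt_top ENNReal.ofReal_lt_top
    (ENNReal.sum_lt_top.2 fun k _ => hw k))

theorem tendsto_fourierWeight_divergenceSymbol {I : Set ℝ}
    (hJc : ∀ k, ∀ t ∈ I, Tendsto
      (fun τ => fourierWeight 1 (densityHat (J k τ) - densityHat (J k t))) (𝓝[I] t) (𝓝 0))
    {t : ℝ} (ht : t ∈ I) :
    Tendsto (fun τ => fourierWeight 0 (divergenceSymbol (fun k => densityHat (J k τ))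
      - divergenceSymbol (fun k => densityHat (J k t)))) (𝓝[I] t) (𝓝 0) := by
  have h1 : Tendsto (fun τ => ENNReal.ofReal (2 * Real.pi) * ∑ k, fourierWeight 1
      (densityHat (J k τ) - densityHat (J k t))) (𝓝[I] t) (𝓝 0) := by
    have h2 := tendsto_finsetSum (s := Finset.univ) fun k _ => hJc k t ht
    simpa using ENNReal.Tendsto.const_mul h2 (Or.inr ENNReal.ofReal_ne_top)
      (a := ENNReal.ofReal (2 * Real.pi))
  refine tendsto_of_tendsto_of_tendsto_of_le_of_le tendsto_const_nhds h1 (fun _ => zero_le)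
    fun τ => ?_
  dsimp only
  rw [divergenceSymbol_sub]
  exact fourierWeight_divergenceSymbol_le fun k =>
    (measurable_densityHat _).sub (measurable_densityHat _)

theorem tendsto_fourierWeight_potentialMultiplier {I : Set ℝ} {P : ℕ} {h : ℝ → Space d → ℂ} {t : ℝ}
    (hc : Tendsto (fun τ => fourierWeight P (h τ - h t)) (𝓝[I] t) (𝓝 0)) :
    Tendsto (fun τ => fourierWeight P (potentialMultiplier V ε (h τ) - potentialMultiplier V ε (h t)))
      (𝓝[I] t) (𝓝 0) := by
  obtain ⟨C, hC0, hC⟩ := V.exists_abs_hat_le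
  have h1 : Tendsto (fun τ => ENNReal.ofReal C * fourierWeight P (h τ - h t)) (𝓝[I] t) (𝓝 0) := by
    simpa using ENNReal.Tendsto.const_mul hc (Or.inr ENNReal.ofReal_ne_top)
      (a := ENNReal.ofReal C)
  refine tendsto_of_tendsto_of_tendsto_of_le_of_le tendsto_const_nhds h1 (fun _ => zero_le)
    fun τ => ?_
  dsimp only
  rw [← potentialMultiplier_sub]
  exact fourierWeight_potentialMultiplier_le hC ε P _

/-- Time evolution of the potential generated by a solution of the continuity equation. -/
theorem potential_sub_eq_integral
    (hρ : ∀ t ∈ Icc 0 T, fourierWeight 0 (densityHat (ρ t)) < ⊤)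
    (hJ : ∀ k, ∀ t ∈ Icc 0 T, fourierWeight 1 (densityHat (J k t)) < ⊤)
    (hJc : ∀ k, ∀ t ∈ Icc 0 T, Tendsto
      (fun τ => fourierWeight 1 (densityHat (J k τ) - densityHat (J k t))) (𝓝[Icc 0 T] t) (𝓝 0))
    (heq : ∀ K : 𝓢(Space d, ℂ), ∀ t ∈ Icc 0 T, (∫ x, ρ t x * K x) - ∫ x, ρ 0 x * K x
      = ∫ τ in 0..t, ∑ k, ∫ x, J k τ x *
          (LineDeriv.lineDerivOp (EuclideanSpace.single k (1 : ℝ) : Space d) K : 𝓢(Space d, ℂ)) x)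
    {t : ℝ} (ht : t ∈ Icc 0 T) (x : Space d) :
    potential V ε (ρ t) x - potential V ε (ρ 0) x = ∫ τ in 0..t, fourierField
      (potentialMultiplier V ε (divergenceSymbol fun k => densityHat (J k τ))) x := by
  obtain ⟨C, hC0, hC⟩ := V.exists_abs_hat_le
  have h0 : (0 : ℝ) ∈ Icc 0 T := ⟨le_rfl, ht.1.trans ht.2⟩
  have hsub : uIcc 0 t ⊆ Icc 0 T := uIcc_subset_Icc h0 ht
  set w : ℝ → Space d → ℂ := fun τ => divergenceSymbol fun k => densityHat (J k τ) with hw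
  have hwm : ∀ τ, Measurable (w τ) := fun τ =>
    measurable_divergenceSymbol fun k => measurable_densityHat _
  have hwf : ∀ τ ∈ Icc 0 T, fourierWeight 0 (w τ) < ⊤ := fun τ hτ =>
    fourierWeight_divergenceSymbol_lt_top (fun k => measurable_densityHat _) fun k => hJ k τ hτ
  have hwc : ∀ τ ∈ Icc 0 T, Tendsto (fun τ' => fourierWeight 0 (w τ' - w τ)) (𝓝[Icc 0 T] τ) (𝓝 0) :=
    fun τ hτ => tendsto_fourierWeight_divergenceSymbol hJc hτ
  have hwi : ∀ τ ∈ Icc 0 T, Integrable (w τ) := fun τ hτ =>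
    integrable_of_fourierWeight (hwm τ) (hwf τ hτ)
  have hρi : ∀ τ ∈ Icc 0 T, Integrable (densityHat (ρ τ)) := fun τ hτ =>
    integrable_of_fourierWeight (measurable_densityHat _) (hρ τ hτ)

  -- The continuity equation on the Fourier side, obtained with the Fourier transform of φ as test
  -- function; the point value of the potential is then reached with truncated characters as φ.
  have hF : ∀ φ : 𝓢(Space d, ℂ), (∫ ζ, densityHat (ρ t) ζ * φ ζ) - ∫ ζ, densityHat (ρ 0) ζ * φ ζ
      = ∫ τ in 0..t, ∫ ζ, w τ ζ * φ ζ := by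
    intro φ
    have h := heq (𝓕 φ) t ht
    rw [integral_mul_fourier, integral_mul_fourier] at h
    rw [h]
    refine intervalIntegral.integral_congr fun τ hτ => ?_
    simp only [integral_mul_lineDerivOp_fourier, hw, divergenceSymbol, Finset.sum_mul]
    exact (integral_finsetSum _ fun k _ => integrable_coord_mul_densityHat_mul (J k τ) φ k).symm
  have hcont := continuousOn_fourierInv
    (fun τ => measurable_potentialMultiplier V ε (hwm τ))
    (fun τ hτ => (fourierWeight_potentialMultiplier_le hC ε 0 (w τ)).trans_lt
      (ENNReal.mul_lt_top ENNReal.ofReal_lt_top (hwf τ hτ)))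
    (fun τ hτ => tendsto_fourierWeight_potentialMultiplier (V := V) (ε := ε) (hwc τ hτ)) x
  obtain ⟨M, hM⟩ := isCompact_Icc.exists_bound_of_continuousOn (continuousOn_fourierWeight hwm hwf hwc)
  -- Domination in time: the truncated multipliers are bounded by C uniformly in n, and the L¹ norm
  -- of w(τ) is bounded on the compact time interval.
  have hR : Tendsto (fun n => ∫ τ in 0..t, ∫ ζ, w τ ζ * modulatedMultiplier V ε x n ζ) atTop
      (𝓝 (∫ τ in 0..t, 𝓕⁻ (potentialMultiplier V ε (w τ)) x)) := by
    refine intervalIntegral.tendsto_integral_filter_of_dominated_convergence (fun _ => C * M)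
      (Eventually.of_forall fun n => ?_) (Eventually.of_forall fun n =>
        Eventually.of_forall fun τ hτ => ?_) intervalIntegrable_const
      (Eventually.of_forall fun τ hτ => tendsto_integral_mul_modulatedMultiplier x
        (hwi τ (hsub (uIoc_subset_uIcc hτ))))
    · exact ((continuousOn_integral_mul_of_fourierWeight hwm hwf hwc
        (modulatedMultiplier V ε x n).continuous (norm_modulatedMultiplier_le hC x n)).mono
          (uIoc_subset_uIcc.trans hsub)).aestronglyMeasurable measurableSet_uIoc
    · have h1 : ‖∫ ζ, w τ ζ * modulatedMultiplier V ε x n ζ‖ₑ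
          ≤ ENNReal.ofReal C * fourierWeight 0 (w τ) := by
        refine (enorm_integral_le_lintegral_enorm _).trans ?_
        refine le_trans ?_ (fourierWeight_mul_le (norm_modulatedMultiplier_le (ε := ε) hC x n))
        refine le_trans (le_of_eq ?_) (lintegral_enorm_le_fourierWeight 0 _)
        simp only [mul_comm]
      have hτ' := hsub (uIoc_subset_uIcc hτ)
      have h3 := ENNReal.toReal_mono (ENNReal.mul_lt_top ENNReal.ofReal_lt_top (hwf τ hτ')).ne h1
      rw [ENNReal.toReal_mul, toReal_enorm, ENNReal.toReal_ofReal hC0] at h3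
      have h4 := (le_abs_self _).trans (hM τ hτ')
      exact h3.trans (by gcongr)
  have hL := (tendsto_integral_mul_modulatedMultiplier (V := V) (ε := ε) x (hρi t ht)).sub
    (tendsto_integral_mul_modulatedMultiplier (V := V) (ε := ε) x (hρi 0 h0))
  simp only [hF] at hL
  have h5 := tendsto_nhds_unique hL hR
  have h6 := Complex.reCLM.intervalIntegral_comp_comm
    (hcont.mono hsub).intervalIntegrable (μ := volume)
  have h7 := congrArg Complex.re h5
  rw [Complex.sub_re] at h7
  exact h7.trans h6.symm

end PotentialEvolution

/-! ### Regularity of the potential in space and time -/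

noncomputable section PotentialRegularity

variable {d : ℕ} {V : PairPotential d} {ε : ℝ} {P : ℕ} {I : Set ℝ}
  {ρ : ℝ → Lp ℂ 2 (volume : Measure (Space d))}

theorem fourierWeight_potential_lt_top {h : Space d → ℂ} (hh : fourierWeight P h < ⊤) :
    fourierWeight P (potentialMultiplier V ε h) < ⊤ := by
  obtain ⟨C, hC0, hC⟩ := V.exists_abs_hat_le
  exact (fourierWeight_potentialMultiplier_le hC ε P h).trans_lt
    (ENNReal.mul_lt_top ENNReal.ofReal_lt_top hh)

variable (V ε P ρ) in
/-- A bound for the derivatives of order at most `P` of the potential. -/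
def potentialBound (t : ℝ) : ℝ :=
  (2 * Real.pi) ^ P * (fourierWeight P (potentialMultiplier V ε (densityHat (ρ t)))).toReal

section

variable (hρ : ∀ t ∈ I, fourierWeight P (densityHat (ρ t)) < ⊤)

include hρ

theorem contDiff_potential {t : ℝ} (ht : t ∈ I) : ContDiff ℝ P (potential V ε (ρ t)) :=
  contDiff_fourierField (measurable_potentialMultiplier V ε (measurable_densityHat _))
    (fourierWeight_potential_lt_top (hρ t ht))

theorem norm_iteratedFDeriv_potential_le {j : ℕ} (hj : j ≤ P) {t : ℝ} (ht : t ∈ I) (x : Space d) :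
    ‖iteratedFDeriv ℝ j (potential V ε (ρ t)) x‖ ≤ potentialBound V ε P ρ t := by
  have hfin := fourierWeight_potential_lt_top (V := V) (ε := ε) (hρ t ht)
  have h := enorm_iteratedFDeriv_fourierField_le hj
    (measurable_potentialMultiplier V ε (measurable_densityHat (ρ t))) hfin x
  have h2 := ENNReal.toReal_mono (ENNReal.mul_lt_top ENNReal.ofReal_lt_top hfin).ne h
  rwa [toReal_enorm, ENNReal.toReal_mul, ENNReal.toReal_ofReal (by positivity)] at h2

variable (hρc : ∀ t ∈ I, Tendsto (fun τ => fourierWeight P (densityHat (ρ τ) - densityHat (ρ t)))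
  (𝓝[I] t) (𝓝 0))

include hρc

theorem continuousOn_potentialBound : ContinuousOn (potentialBound V ε P ρ) I :=
  continuousOn_const.mul (continuousOn_fourierWeight
    (h := fun t => potentialMultiplier V ε (densityHat (ρ t)))
    (fun _ => measurable_potentialMultiplier V ε (measurable_densityHat _))
    (fun t ht => fourierWeight_potential_lt_top (hρ t ht))
    fun t ht => tendsto_fourierWeight_potentialMultiplier (h := fun t => densityHat (ρ t)) (hρc t ht))

theorem continuousOn_iteratedFDeriv_potential {j : ℕ} (hj : j ≤ P) :
    ContinuousOn (fun q : ℝ × Space d => iteratedFDeriv ℝ j (potential V ε (ρ q.1)) q.2)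
      (I ×ˢ univ) :=
  continuousOn_iteratedFDeriv_fourierField
    (h := fun t => potentialMultiplier V ε (densityHat (ρ t)))
    (fun _ => measurable_potentialMultiplier V ε (measurable_densityHat _))
    (fun t ht => fourierWeight_potential_lt_top (hρ t ht))
    (fun t ht => tendsto_fourierWeight_potentialMultiplier (h := fun t => densityHat (ρ t)) (hρc t ht))
    hj

end

theorem continuousOn_of_iteratedFDeriv_zero {X : Type} [TopologicalSpace X] {s : Set X}
    {U : X → Space d → ℝ} {y : X → Space d}
    (h : ContinuousOn (fun q => iteratedFDeriv ℝ 0 (U q) (y q)) s) :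
    ContinuousOn (fun q => U q (y q)) s :=
  (ContinuousMultilinearMap.apply ℝ (fun _ : Fin 0 => Space d) ℝ 0).continuous.comp_continuousOn h

theorem continuousOn_fderiv_of_iteratedFDeriv_one {X : Type} [TopologicalSpace X] {s : Set X}
    {U : X → Space d → ℝ} {y : X → Space d}
    (h : ContinuousOn (fun q => iteratedFDeriv ℝ 1 (U q) (y q)) s) :
    ContinuousOn (fun q => fderiv ℝ (U q) (y q)) s := by
  have h1 := (continuousMultilinearCurryFin1 ℝ (Space d) ℝ).continuous.comp_continuousOn h
  refine h1.congr fun q _ => ?_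
  ext v
  simp [iteratedFDeriv_one_apply]

/-- The criterion for functions of two times is applied with a dummy second time and then restricted
to the diagonal. -/
theorem contDiffOn_one_of_time_partial {W : Type} [NormedAddCommGroup W] [NormedSpace ℝ W] {T : ℝ}
    (hT : 0 < T) {f A : ℝ → W → ℝ} (hf : ∀ t ∈ Icc 0 T, Differentiable ℝ (f t))
    (hA : ContinuousOn (fun q : ℝ × W => A q.1 q.2) (Icc 0 T ×ˢ univ))
    (hfA : ∀ t ∈ Icc 0 T, ∀ x, f t x - f 0 x = ∫ τ in 0..t, A τ x)
    (hP : ContinuousOn (fun q : ℝ × W => fderiv ℝ (f q.1) q.2) (Icc 0 T ×ˢ univ)) :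
    ContDiffOn ℝ 1 (fun q : ℝ × W => f q.1 q.2) (Icc 0 T ×ˢ univ) := by
  have hproj : ContinuousOn (fun q : ℝ × ℝ × W => (q.1, q.2.2))
      (Icc 0 T ×ˢ Icc 0 T ×ˢ univ) := by fun_prop
  have hmaps : MapsTo (fun q : ℝ × ℝ × W => (q.1, q.2.2)) (Icc 0 T ×ˢ Icc 0 T ×ˢ univ)
      (Icc 0 T ×ˢ univ) := fun q hq => ⟨hq.1, mem_univ _⟩
  have key := contDiffOn_one_of_partials hT
    (f := fun q : ℝ × ℝ × W => f q.1 q.2.2)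
    (A := fun q => A q.1 q.2.2) (B := fun _ => 0)
    (P := fun q => fderiv ℝ (f q.1) q.2.2)
    (fun q hq => by
      have hA1 : ContinuousOn (fun τ => A τ q.2.2) (Icc 0 T) :=
        hA.comp (by fun_prop : ContinuousOn (fun τ : ℝ => (τ, q.2.2)) (Icc 0 T))
          fun τ hτ => ⟨hτ, mem_univ _⟩
      have h1 := (hasDerivWithinAt_integral_Icc hA1 hq.1).const_add (f 0 q.2.2)
      refine h1.congr_of_mem (fun τ hτ => ?_) hq.1
      have h2 := hfA τ hτ q.2.2
      dsimp only
      linarith)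
    (hA.comp hproj hmaps)
    (fun q _ => hasDerivWithinAt_const q.2.1 (Icc 0 T) (f q.1 q.2.2)) continuousOn_const
    (fun q hq => (hf q.1 hq.1 q.2.2).hasFDerivAt)
    (hP.comp hproj hmaps)
  exact key.comp (f := fun q : ℝ × W => (q.1, q.1, q.2)) (by fun_prop)
    fun q hq => ⟨hq.1, hq.1, mem_univ _⟩

theorem continuousOn_current {J : Fin d → ℝ → Lp ℂ 2 (volume : Measure (Space d))}
    (hJ : ∀ k, ∀ t ∈ I, fourierWeight 1 (densityHat (J k t)) < ⊤)
    (hJc : ∀ k, ∀ t ∈ I, Tendsto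
      (fun τ => fourierWeight 1 (densityHat (J k τ) - densityHat (J k t))) (𝓝[I] t) (𝓝 0)) :
    ContinuousOn (fun q : ℝ × Space d => fourierField
      (potentialMultiplier V ε (divergenceSymbol fun k => densityHat (J k q.1))) q.2)
      (I ×ˢ univ) :=
  continuousOn_of_iteratedFDeriv_zero (continuousOn_iteratedFDeriv_fourierField (P := 0)
    (h := fun t => potentialMultiplier V ε (divergenceSymbol fun k => densityHat (J k t)))
    (fun _ => measurable_potentialMultiplier V ε
      (measurable_divergenceSymbol fun _ => measurable_densityHat _))
    (fun t ht => fourierWeight_potential_lt_top (fourierWeight_divergenceSymbol_lt_top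
      (fun _ => measurable_densityHat _) fun k => hJ k t ht))
    (fun _ ht => tendsto_fourierWeight_potentialMultiplier
      (h := fun τ => divergenceSymbol fun k => densityHat (J k τ))
      (tendsto_fourierWeight_divergenceSymbol hJc ht)) le_rfl)

/-- The potential generated by a solution of the continuity equation is of class `C¹` in time. -/
theorem contDiffOn_potential {T : ℝ} (hT : 0 < T)
    {J : Fin d → ℝ → Lp ℂ 2 (volume : Measure (Space d))}
    (hρ : ∀ t ∈ Icc 0 T, fourierWeight 1 (densityHat (ρ t)) < ⊤)
    (hρc : ∀ t ∈ Icc 0 T, Tendsto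
      (fun τ => fourierWeight 1 (densityHat (ρ τ) - densityHat (ρ t))) (𝓝[Icc 0 T] t) (𝓝 0))
    (hJ : ∀ k, ∀ t ∈ Icc 0 T, fourierWeight 1 (densityHat (J k t)) < ⊤)
    (hJc : ∀ k, ∀ t ∈ Icc 0 T, Tendsto
      (fun τ => fourierWeight 1 (densityHat (J k τ) - densityHat (J k t))) (𝓝[Icc 0 T] t) (𝓝 0))
    (heq : ∀ K : 𝓢(Space d, ℂ), ∀ t ∈ Icc 0 T, (∫ x, ρ t x * K x) - ∫ x, ρ 0 x * K x
      = ∫ τ in 0..t, ∑ k, ∫ x, J k τ x *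
          (LineDeriv.lineDerivOp (EuclideanSpace.single k (1 : ℝ) : Space d) K : 𝓢(Space d, ℂ)) x) :
    ContDiffOn ℝ 1 (fun q : ℝ × Space d => potential V ε (ρ q.1) q.2) (Icc 0 T ×ˢ univ) := by
  have h0 : ∀ t ∈ Icc 0 T, fourierWeight 0 (densityHat (ρ t)) < ⊤ := fun t ht =>
    (fourierWeight_mono_exponent zero_le_one _).trans_lt (hρ t ht)
  exact contDiffOn_one_of_time_partial hT (f := fun t => potential V ε (ρ t))
    (fun t ht => (contDiff_potential hρ ht).differentiable one_ne_zero)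
    (continuousOn_current hJ hJc)
    (fun t ht x => potential_sub_eq_integral h0 hJ hJc heq ht x)
    (continuousOn_fderiv_of_iteratedFDeriv_one
      (continuousOn_iteratedFDeriv_potential hρ hρc le_rfl))

end PotentialRegularity

/-! ### The potential generated by a solution of the Wigner equation -/

noncomputable section WignerPotential

variable {d : ℕ} {V : PairPotential d} {ε : ℝ} {m r p : ℕ} {T : ℝ}

/-- One linear estimate, for g ↦ the weighted L¹ norm of the transform of its density, is used on
u(t) for finiteness and on u(τ) - u(t) for continuity. -/
theorem fourierWeight_density_of_momentNorm (hr : d < 2 * r) {q n : ℕ} (hq : q ≤ n)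
    (hn : d < 2 * (n - q)) {I : Set ℝ} {u : ℝ → Lp ℂ 2 (volume : Measure (Phase d))}
    (hu : ∀ t ∈ I, momentNorm r n (u t : 𝓢'(Phase d, ℂ)) < ⊤)
    (huc : ∀ t ∈ I, Tendsto (fun τ => momentNorm r n
      ((u τ - u t : Lp ℂ 2 (volume : Measure (Phase d))) : 𝓢'(Phase d, ℂ))) (𝓝[I] t) (𝓝 0)) :
    (∀ t ∈ I, fourierWeight q (densityHat (density (u t))) < ⊤) ∧
    ∀ t ∈ I, Tendsto (fun τ => fourierWeight q
      (densityHat (density (u τ)) - densityHat (density (u t)))) (𝓝[I] t) (𝓝 0) := by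
  obtain ⟨C₁, hC₁, h₁⟩ := exists_spaceNorm_density_le (d := d) hr n
  obtain ⟨C₂, hC₂, h₂⟩ := exists_lintegral_fourier_le (d := d) hq hn
  have key : ∀ g : Lp ℂ 2 (volume : Measure (Phase d)), momentNorm r n (g : 𝓢'(Phase d, ℂ)) < ⊤ →
      fourierWeight q (densityHat (density g)) ≤ C₂ * (C₁ * momentNorm r n (g : 𝓢'(Phase d, ℂ))) := by
    intro g hg
    have h3 := h₁ g hg
    exact (h₂ (density g) (h3.trans_lt (ENNReal.mul_lt_top hC₁ hg))).trans (by gcongr)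
  have hw : ∀ t ∈ I, weightNorm r (u t : 𝓢'(Phase d, ℂ)) < ⊤ := fun t ht =>
    (weightNorm_le_momentNorm n _).trans_lt (hu t ht)
  refine ⟨fun t ht => (key _ (hu t ht)).trans_lt
    (ENNReal.mul_lt_top hC₂ (ENNReal.mul_lt_top hC₁ (hu t ht))), fun t ht => ?_⟩
  have hlim : Tendsto (fun τ => C₂ * (C₁ * momentNorm r n
      ((u τ - u t : Lp ℂ 2 (volume : Measure (Phase d))) : 𝓢'(Phase d, ℂ)))) (𝓝[I] t) (𝓝 0) := by
    simpa using ENNReal.Tendsto.const_mul (ENNReal.Tendsto.const_mul (huc t ht)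
      (Or.inr hC₁.ne)) (Or.inr hC₂.ne)
  refine tendsto_of_tendsto_of_tendsto_of_le_of_le' tendsto_const_nhds hlim
    (Eventually.of_forall fun _ => zero_le) ?_
  filter_upwards [self_mem_nhdsWithin, (huc t ht).eventually (gt_mem_nhds ENNReal.zero_lt_top)]
    with τ hτ hfin
  rw [← fourierWeight_congr (densityHat_sub _ _), ← density_sub hr (hw τ hτ) (hw t ht)]
  exact key _ hfin

/-- Regularity of the potential generated by a solution of the Wigner equation. -/
theorem IsWignerSolution.potential_regularity (hd : 0 < d) (hr : d < 2 * r) (hp : 2 ≤ p)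
    (hm : d / 2 + p + 2 ≤ m) (hε : 0 < ε) (hT : 0 < T)
    {f : ℝ → Lp ℂ 2 (volume : Measure (Phase d))} (h : IsWignerSolution V ε m r T f) :
    (∀ t ∈ Icc 0 T, spaceNorm m (density (f t) : 𝓢'(Space d, ℂ)) < ⊤) ∧
    (∀ t ∈ Icc 0 T, fourierWeight (p + 1) (densityHat (density (f t))) < ⊤) ∧
    (∀ t ∈ Icc 0 T, Tendsto (fun τ => fourierWeight (p + 1)
      (densityHat (density (f τ)) - densityHat (density (f t)))) (𝓝[Icc 0 T] t) (𝓝 0)) ∧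
    ContDiffOn ℝ 1 (fun q : ℝ × Space d => potential V ε (density (f q.1)) q.2)
      (Icc 0 T ×ˢ univ) := by
  obtain ⟨C, hC, hCb⟩ := exists_momentNorm_le (d := d) ε (m := m) (r := r) (by omega) (by omega)
  have hf : ∀ t ∈ Icc 0 T, momentNorm r m (f t : 𝓢'(Phase d, ℂ)) < ⊤ := fun t ht =>
    ((hCb (f t)).1).trans_lt (ENNReal.mul_lt_top hC (h.finite t ht))
  have hNc : ∀ t ∈ Icc 0 T, Tendsto (fun τ => C * phaseSobolevNorm ε m r (f τ - f t))
      (𝓝[Icc 0 T] t) (𝓝 0) := fun t ht => by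
    simpa using ENNReal.Tendsto.const_mul (h.continuous t ht) (Or.inr hC.ne)
  have hfc : ∀ t ∈ Icc 0 T, Tendsto (fun τ => momentNorm r m
      ((f τ - f t : Lp ℂ 2 (volume : Measure (Phase d))) : 𝓢'(Phase d, ℂ)))
      (𝓝[Icc 0 T] t) (𝓝 0) := fun t ht =>
    tendsto_of_tendsto_of_tendsto_of_le_of_le tendsto_const_nhds (hNc t ht) (fun _ => zero_le)
      fun τ => (hCb (f τ - f t)).1
  have hwf : ∀ t ∈ Icc 0 T, weightNorm r (f t : 𝓢'(Phase d, ℂ)) < ⊤ := fun t ht =>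
    (weightNorm_le_momentNorm m _).trans_lt (hf t ht)
  have hwfc : ∀ t ∈ Icc 0 T, Tendsto (fun τ => weightNorm r
      ((f τ - f t : Lp ℂ 2 (volume : Measure (Phase d))) : 𝓢'(Phase d, ℂ)))
      (𝓝[Icc 0 T] t) (𝓝 0) := fun t ht =>
    tendsto_of_tendsto_of_tendsto_of_le_of_le tendsto_const_nhds (hfc t ht) (fun _ => zero_le)
      fun τ => weightNorm_le_momentNorm m _
  -- the momenta
  have hex : ∀ k : Fin d, ∀ t : ℝ, ∃ G : Lp ℂ 2 (volume : Measure (Phase d)),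
      t ∈ Icc 0 T → (G : 𝓢'(Phase d, ℂ)) = mulV k (f t : 𝓢'(Phase d, ℂ)) := by
    intro k t
    by_cases ht : t ∈ Icc 0 T
    · have h1 : distL2Norm (mulV k (f t : 𝓢'(Phase d, ℂ))) < ⊤ :=
        ((distL2Norm_le_weightNorm (r := r) _).trans ((weightNorm_le_momentNorm (m - 1) _).trans
          ((hCb (f t)).2 k))).trans_lt (ENNReal.mul_lt_top hC (h.finite t ht))
      obtain ⟨G, hG⟩ := exists_of_distL2Norm_lt_top h1
      exact ⟨G, fun _ => hG⟩
    -- Outside the time interval the momentum is given the default value 0, which plays no role.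
    · exact ⟨0, fun h => absurd h ht⟩
  choose g hgf using hex
  have hg : ∀ k, ∀ t ∈ Icc 0 T, momentNorm r (m - 1) (g k t : 𝓢'(Phase d, ℂ)) < ⊤ := by
    intro k t ht
    rw [hgf k t ht]
    exact ((hCb (f t)).2 k).trans_lt (ENNReal.mul_lt_top hC (h.finite t ht))
  have hgc : ∀ k, ∀ t ∈ Icc 0 T, Tendsto (fun τ => momentNorm r (m - 1)
      ((g k τ - g k t : Lp ℂ 2 (volume : Measure (Phase d))) : 𝓢'(Phase d, ℂ)))
      (𝓝[Icc 0 T] t) (𝓝 0) := by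
    intro k t ht
    refine tendsto_of_tendsto_of_tendsto_of_le_of_le' tendsto_const_nhds (hNc t ht)
      (Eventually.of_forall fun _ => zero_le) ?_
    filter_upwards [self_mem_nhdsWithin] with τ hτ
    rw [coe_distribution_sub, hgf k τ hτ, hgf k t ht, ← map_sub, ← coe_distribution_sub]
    exact (hCb (f τ - f t)).2 k
  have hwg : ∀ k, ∀ t ∈ Icc 0 T, weightNorm r (g k t : 𝓢'(Phase d, ℂ)) < ⊤ := fun k t ht =>
    (weightNorm_le_momentNorm (m - 1) _).trans_lt (hg k t ht)
  have hwgc : ∀ k, ∀ t ∈ Icc 0 T, Tendsto (fun τ => weightNorm r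
      ((g k τ - g k t : Lp ℂ 2 (volume : Measure (Phase d))) : 𝓢'(Phase d, ℂ)))
      (𝓝[Icc 0 T] t) (𝓝 0) := fun k t ht =>
    tendsto_of_tendsto_of_tendsto_of_le_of_le tendsto_const_nhds (hgc k t ht) (fun _ => zero_le)
      fun τ => weightNorm_le_momentNorm (m - 1) _
  obtain ⟨hρ, hρc⟩ := fourierWeight_density_of_momentNorm hr (q := p + 1) (n := m) (by omega)
    (by omega) hf hfc
  obtain ⟨hρ1, hρ1c⟩ := fourierWeight_density_of_momentNorm hr (q := 1) (n := m) (by omega)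
    (by omega) hf hfc
  -- The momentum has one derivative less, and its divergence needs one more weight: the condition
  -- is m - 2 > d/2, while the density with weight p + 1 needs m - p - 1 > d/2.
  have hJ := fun k => fourierWeight_density_of_momentNorm hr (q := 1) (n := m - 1) (by omega)
    (by omega) (hg k) (hgc k)
  obtain ⟨C₁, hC₁, h₁⟩ := exists_spaceNorm_density_le (d := d) hr m
  refine ⟨fun t ht => (h₁ _ (hf t ht)).trans_lt (ENNReal.mul_lt_top hC₁ (hf t ht)), hρ, hρc, ?_⟩
  obtain ⟨L, hL⟩ := isCompact_Icc.exists_bound_of_continuousOn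
    (continuousOn_potentialBound (V := V) (ε := ε) hρ1 hρ1c)
  have hLip : ∀ t ∈ Icc 0 T, LipschitzWith L.toNNReal (potential V ε (density (f t))) := by
    intro t ht
    refine lipschitzWith_of_nnnorm_fderiv_le
      ((contDiff_potential hρ1 ht).differentiable one_ne_zero) fun x => ?_
    rw [← NNReal.coe_le_coe, coe_nnnorm, ← norm_iteratedFDeriv_one]
    exact (norm_iteratedFDeriv_potential_le hρ1 le_rfl ht x).trans
      (((le_abs_self _).trans (hL t ht)).trans (Real.le_coe_toNNReal L))
  have hw := fun (K : 𝓢(Space d, ℂ)) t ht => weak_continuity_equation hr hε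
    (U := fun t => potential V ε (density (f t))) hwf hwfc hgf hwg hwgc hLip h.equation K (t := t) ht
  exact contDiffOn_potential hT (ρ := fun t => density (f t)) (J := fun k t => density (g k t))
    hρ1 hρ1c (fun k => (hJ k).1) (fun k => (hJ k).2) hw

variable (V m p) in
/-- The derivatives of the potential are controlled by the Sobolev norm of the density, uniformly in
the semiclassical parameter. -/
theorem exists_potentialBound_le (hp : p + 1 ≤ m) (hm : d < 2 * (m - (p + 1))) :
    ∃ K : ℝ, 0 < K ∧ ∀ (ε : ℝ) (r : ℕ) (ρ : ℝ → Lp ℂ 2 (volume : Measure (Space d))) (t : ℝ),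
      spaceNorm m (ρ t : 𝓢'(Space d, ℂ)) < ⊤ →
      ENNReal.ofReal (potentialBound V ε (p + 1) ρ t)
        ≤ ENNReal.ofReal K * spaceSobolevNorm ε m r (ρ t) := by
  obtain ⟨C₂, hC₂, h₂⟩ := exists_lintegral_fourier_le (d := d) hp hm
  obtain ⟨B, hB0, hB⟩ := V.exists_abs_hat_le
  refine ⟨(2 * Real.pi) ^ (p + 1) * (B * (C₂.toReal * (d + 1))) + 1, by positivity,
    fun ε r ρ t hfin => ?_⟩
  have h1 : fourierWeight (p + 1) (densityHat (ρ t)) ≤ C₂ * spaceNorm m (ρ t : 𝓢'(Space d, ℂ)) :=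
    h₂ (ρ t) hfin
  have h3 := (fourierWeight_potentialMultiplier_le hB ε (p + 1) (densityHat (ρ t)))
  have hlt : fourierWeight (p + 1) (densityHat (ρ t)) < ⊤ :=
    h1.trans_lt (ENNReal.mul_lt_top hC₂ hfin)
  rw [potentialBound, ENNReal.ofReal_mul (by positivity),
    ENNReal.ofReal_toReal (fourierWeight_potential_lt_top hlt).ne]
  calc _ ≤ ENNReal.ofReal ((2 * Real.pi) ^ (p + 1)) * (ENNReal.ofReal B *
        (C₂ * ((d + 1 : ℕ) * spaceSobolevNorm ε m r (ρ t)))) := by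
        refine mul_le_mul_right (h3.trans (mul_le_mul_right (h1.trans ?_) _)) _
        exact mul_le_mul_right (spaceNorm_le_spaceSobolevNorm ε r (ρ t)) _
    _ = ENNReal.ofReal ((2 * Real.pi) ^ (p + 1) * (B * (C₂.toReal * (d + 1))))
        * spaceSobolevNorm ε m r (ρ t) := by
        rw [ENNReal.ofReal_mul (by positivity), ENNReal.ofReal_mul hB0,
          ENNReal.ofReal_mul (by positivity), ENNReal.ofReal_toReal hC₂.ne,
          ← ENNReal.ofReal_natCast, Nat.cast_add, Nat.cast_one]
        ring
    _ ≤ _ := by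
        gcongr
        linarith

/-- The Cauchy–Schwarz inequality in time. -/
theorem intervalIntegral_le_of_ofReal_le {S : ℝ → ℝ} {N : ℝ → ℝ≥0∞} {T T₀ K M : ℝ} (hT : 0 ≤ T)
    (hTT : T ≤ T₀) (hK : 0 ≤ K) (hM : 0 ≤ M) (hSc : ContinuousOn S (Icc 0 T₀))
    (hS0 : ∀ t ∈ Icc 0 T₀, 0 ≤ S t)
    (hSN : ∀ t ∈ Icc 0 T₀, ENNReal.ofReal (S t) ≤ ENNReal.ofReal K * N t)
    (hN : (∫⁻ t in Icc 0 T₀, N t ^ 2) ^ (1 / 2 : ℝ) ≤ ENNReal.ofReal M) :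
    ∫ σ in 0..T, S σ ≤ K * M * Real.sqrt T := by
  have hsub : Icc 0 T ⊆ Icc 0 T₀ := Icc_subset_Icc le_rfl hTT
  -- The L² bound is on the whole interval, the integral of S on [0, T]; Cauchy-Schwarz against the
  -- constant 1 produces √T.
  have hN2 : ∫⁻ t in Icc 0 T₀, N t ^ 2 ≤ ENNReal.ofReal M ^ 2 := by
    have h1 := ENNReal.rpow_le_rpow hN (zero_le_two : (0 : ℝ) ≤ 2)
    rwa [← ENNReal.rpow_mul, one_div, inv_mul_cancel₀ two_ne_zero, ENNReal.rpow_one,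
      ENNReal.rpow_two] at h1
  have hSm : AEMeasurable (fun t => ENNReal.ofReal (S t)) (volume.restrict (Icc 0 T)) :=
    ((hSc.mono hsub).aestronglyMeasurable measurableSet_Icc).aemeasurable.ennreal_ofReal
  have h2 := lintegral_mul_sq_le hSm (aemeasurable_const (b := (1 : ℝ≥0∞)))
  simp only [mul_one, one_pow, lintegral_one, Measure.restrict_apply_univ, Real.volume_Icc,
    sub_zero] at h2
  have h3 : ∫⁻ t in Icc 0 T, ENNReal.ofReal (S t) ^ 2
      ≤ ENNReal.ofReal K ^ 2 * ENNReal.ofReal M ^ 2 := by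
    refine (lintegral_mono_set hsub).trans ?_
    refine le_trans ?_ (mul_le_mul_right hN2 _)
    rw [← lintegral_const_mul' _ _ (ENNReal.pow_ne_top ENNReal.ofReal_ne_top)]
    refine setLIntegral_mono' measurableSet_Icc fun t ht => ?_
    rw [← mul_pow]
    exact pow_le_pow_left₀ zero_le (hSN t ht) 2
  have h4 : (∫⁻ t in Icc 0 T, ENNReal.ofReal (S t)) ^ 2
      ≤ ENNReal.ofReal (K * M * Real.sqrt T) ^ 2 := by
    refine (h2.trans (mul_le_mul_left h3 _)).trans (le_of_eq ?_)
    rw [ENNReal.ofReal_mul (by positivity), ENNReal.ofReal_mul hK, mul_pow, mul_pow,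
      ← ENNReal.ofReal_pow (Real.sqrt_nonneg T), Real.sq_sqrt hT]
  have h5 := (ENNReal.pow_le_pow_left_iff two_ne_zero).1 h4
  rw [intervalIntegral.integral_of_le hT, ← integral_Icc_eq_integral_Ioc,
    ← ENNReal.ofReal_le_ofReal_iff (by positivity),
    ofReal_integral_eq_lintegral_ofReal ((hSc.mono hsub).integrableOn_Icc)
      (ae_restrict_of_forall_mem measurableSet_Icc fun t ht => hS0 t (hsub ht))]
  exact h5

end WignerPotential

/-! ### The choice of T(M) and Λ, and the main theorem -/

theorem abs_intervalIntegral_le_of_mem_Icc {S : ℝ → ℝ} {T s t : ℝ} (hSc : ContinuousOn S (Icc 0 T))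
    (hS0 : ∀ σ ∈ Icc 0 T, 0 ≤ S σ) (ht : t ∈ Icc 0 T) (hs : s ∈ Icc 0 T) :
    |∫ σ in s..t, S σ| ≤ ∫ σ in 0..T, S σ := by
  have hT : 0 ≤ T := ht.1.trans ht.2
  have h1 : uIoc 0 T ⊆ Icc 0 T := by
    rw [uIoc_of_le hT]
    exact Ioc_subset_Icc_self
  have h2 : uIoc s t ⊆ uIoc 0 T := by
    rw [uIoc_of_le hT]
    exact Ioc_subset_Ioc (le_min hs.1 ht.1) (max_le hs.2 ht.2)
  have h := intervalIntegral.abs_integral_mono_interval h2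
    (ae_restrict_of_forall_mem measurableSet_uIoc fun σ hσ => hS0 σ (h1 hσ))
    ((hSc.mono (uIcc_of_le hT).subset).intervalIntegrable (μ := volume))
  rwa [abs_of_nonneg (intervalIntegral.integral_nonneg hT hS0)] at h

theorem mainTheorem7 (d : ℕ) (hd : 0 < d) (V : PairPotential d) (m r p : ℕ) (hr : d < 2 * r)
    (hp : 2 ≤ p) (hm : d / 2 + p + 2 ≤ m) :
    ∃ (Tm : ℝ → ℝ) (Λ : ℝ → ℝ → ℝ),
      (∀ M : ℝ, 0 < M → 0 < Tm M) ∧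
      Continuous (fun q : ℝ × ℝ => Λ q.1 q.2) ∧
      (∀ T T' M M' : ℝ, T ≤ T' → M ≤ M' → Λ T M ≤ Λ T' M') ∧
      ∀ (M ε T₀ : ℝ) (f : ℝ → MeasureTheory.Lp ℂ 2 (MeasureTheory.volume :
          MeasureTheory.Measure (Phase d))),
        0 < M → 0 < ε → ε ≤ 1 → 0 < T₀ →
        IsWignerSolution V ε m r T₀ f →
        bootstrapNorm ε m r T₀ f ≤ ENNReal.ofReal M →
        -- `φ t s z ξ` is the phase `φ_{t,s}(z, ξ)`
        ∃ φ : ℝ → ℝ → Phase d → Phase d → ℝ,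
          -- existence of a `C²` solution, and uniqueness for every initial time `s`
          ContDiffOn ℝ 2
            (fun q : ℝ × ℝ × Phase d × Phase d => φ q.1 q.2.1 q.2.2.1 q.2.2.2)
            (Set.Icc 0 (min (Tm M) T₀) ×ˢ Set.Icc 0 (min (Tm M) T₀) ×ˢ Set.univ) ∧
          (∀ s ∈ Set.Icc 0 (min (Tm M) T₀),
            IsEikonalSolution (fun t => potential V ε (density (f t))) (min (Tm M) T₀) s
              (fun t => φ t s) ∧
            ∀ ψ : ℝ → Phase d → Phase d → ℝ,
              IsEikonalSolution (fun t => potential V ε (density (f t))) (min (Tm M) T₀) s ψ →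
              ∀ t ∈ Set.Icc 0 (min (Tm M) T₀), ∀ z ξ : Phase d, ψ t z ξ = φ t s z ξ) ∧
          -- regularity of order `p` in `(z, ξ)`
          (∀ t ∈ Set.Icc 0 (min (Tm M) T₀), ∀ s ∈ Set.Icc 0 (min (Tm M) T₀),
            ContDiff ℝ p (fun w : Phase d × Phase d => φ t s w.1 w.2)) ∧
          -- the estimates on the maximal interval
          (∀ t ∈ Set.Icc 0 (min (Tm M) T₀), ∀ s ∈ Set.Icc 0 (min (Tm M) T₀), ∀ z ξ : Phase d,
            (∀ k ≤ p, ∀ e : Fin k → (Fin d ⊕ Fin d) ⊕ (Fin d ⊕ Fin d),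
              |iteratedFDeriv ℝ k
                (fun w : Phase d × Phase d => φ t s w.1 w.2 - freePhase t s w.1 w.2) (z, ξ)
                (fun i => fullBasis (e i))| ≤ 1) ∧
            (∀ k ≤ p, ∀ e : Fin k → Fin d ⊕ Fin d,
              |iteratedFDeriv ℝ k (fun y : Phase d => φ t s y ξ - freePhase t s y ξ) z
                (fun i => phaseBasis (e i))| ≤ ‖ξ.2‖ + 1 / 2 * |t - s| * ‖ξ.1‖) ∧
            (∀ h k : Phase d,
              |iteratedFDeriv ℝ 2 (fun w : Phase d × Phase d => φ t s w.1 w.2) (z, ξ)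
                  ![(h, 0), (0, k)] - phaseDot h k| ≤ 1 / 2 * phaseNorm h * phaseNorm k)) ∧
          -- the sharp estimates on every shorter interval
          (∀ T : ℝ, T ≤ min (Tm M) T₀ →
            ∀ t ∈ Set.Icc 0 T, ∀ s ∈ Set.Icc 0 T, ∀ z ξ : Phase d,
              (∀ k ≤ p, ∀ e : Fin k → (Fin d ⊕ Fin d) ⊕ (Fin d ⊕ Fin d),
                |iteratedFDeriv ℝ k
                  (fun w : Phase d × Phase d => φ t s w.1 w.2 - freePhase t s w.1 w.2) (z, ξ)
                  (fun i => fullBasis (e i))| ≤ Real.sqrt T * Λ T M) ∧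
              (∀ k ≤ p, ∀ e : Fin k → Fin d ⊕ Fin d,
                |iteratedFDeriv ℝ k (fun y : Phase d => φ t s y ξ - freePhase t s y ξ) z
                  (fun i => phaseBasis (e i))| ≤
                  Real.sqrt T * Λ T M * (‖ξ.2‖ + |t - s| * ‖ξ.1‖))) := by
  obtain ⟨K, hK, hKb⟩ := exists_potentialBound_le V m p (by omega) (by omega)
  set F := forceConst p with hF
  have hF0 : 0 < F := forceConst_pos p
  -- From ∫_0^T S ≤ K M √T, the second entry of the minimum gives F ∫_0^T S ≤ 1/8. With |t - s| ≤
  -- 1/4 this yields 1/4 + 2·(1/8) = 1/2 for the mixed Hessian. The same inequality gives Λ = F K M;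
  -- the positive part keeps it nonnegative for all real M.
  refine ⟨fun M => min (1 / 4) ((1 / (8 * F * K * M)) ^ 2), fun _ M => F * K * max M 0, ?_, ?_, ?_, ?_⟩
  · intro M hM
    have : 0 < 8 * F * K * M := by positivity
    exact lt_min (by norm_num) (by positivity)
  · fun_prop
  · intro _ _ M M' _ hMM
    exact mul_le_mul_of_nonneg_left (max_le_max_right 0 hMM) (by positivity)
  intro M ε T₀ f hM hε _ hT₀ hsol hboot
  obtain ⟨hfin, hρ, hρc, hUt⟩ := hsol.potential_regularity hd hr hp hm hε hT₀
  set T := min (min (1 / 4) ((1 / (8 * F * K * M)) ^ 2)) T₀ with hTdef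
  have hT : 0 < T := by
    have : 0 < 8 * F * K * M := by positivity
    exact lt_min (lt_min (by norm_num) (by positivity)) hT₀
  have hT14 : T ≤ 1 / 4 := (min_le_left _ _).trans (min_le_left _ _)
  have hTT₀ : T ≤ T₀ := min_le_right _ _
  have hsub : Icc 0 T ⊆ Icc 0 T₀ := Icc_subset_Icc le_rfl hTT₀
  set S : ℝ → ℝ := potentialBound V ε (p + 1) (fun t => density (f t)) with hS
  have hSc : ContinuousOn S (Icc 0 T₀) := continuousOn_potentialBound hρ hρc
  have hUS : ∀ j ≤ p + 1, ∀ t ∈ Icc 0 T₀, ∀ x,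
      ‖iteratedFDeriv ℝ j (potential V ε (density (f t))) x‖ ≤ S t := fun j hj t ht x =>
    norm_iteratedFDeriv_potential_le hρ hj ht x
  have hS0 : ∀ t ∈ Icc 0 T₀, 0 ≤ S t := fun t ht =>
    (norm_nonneg _).trans (hUS 0 (Nat.zero_le _) t ht 0)
  -- The integral of S is bounded through the L² in time norm of the density, the second term of
  -- `bootstrapNorm`.
  have hint : ∀ T', 0 ≤ T' → T' ≤ T₀ → ∫ σ in 0..T', S σ ≤ K * M * Real.sqrt T' :=
    fun T' h0 h1 => intervalIntegral_le_of_ofReal_le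
      (N := fun t => spaceSobolevNorm ε m r (density (f t))) h0 h1 hK.le hM.le hSc hS0
      (fun t ht => hKb ε r (fun t => density (f t)) t (hfin t ht)) (le_add_self.trans hboot)
  have hsqrt : 8 * F * K * M * Real.sqrt T ≤ 1 := by
    have h0 : 0 < 8 * F * K * M := by positivity
    have h1 : Real.sqrt T ≤ 1 / (8 * F * K * M) :=
      Real.sqrt_le_iff.2 ⟨by positivity, (min_le_left _ _).trans (min_le_right _ _)⟩
    calc _ ≤ 8 * F * K * M * (1 / (8 * F * K * M)) := by gcongr
      _ = 1 := by field_simp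
  have hκ : 8 * (F * ∫ σ in 0..T, S σ) ≤ 1 := by
    have := mul_le_mul_of_nonneg_left (hint T hT.le hTT₀) hF0.le
    linarith
  obtain ⟨φ, h1, h2, h3, h4⟩ := exists_eikonal hp hT hT14 (hSc.mono hsub)
    (fun t ht => contDiff_potential hρ (hsub ht))
    (fun j hj => (continuousOn_iteratedFDeriv_potential hρ hρc hj).mono
      (prod_mono hsub subset_rfl))
    (fun j hj t ht x => hUS j hj t (hsub ht) x) (hUt.mono (prod_mono hsub subset_rfl)) hκ
  refine ⟨φ, h1, h2, h3, fun t ht s hs z ξ => ?_, fun T' hT' t ht s hs z ξ => ?_⟩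
  · obtain ⟨a, b, c⟩ := h4 t ht s hs z ξ
    -- All the bounds on the maximal interval follow from this one: 1/8 is below the constants 1 and
    -- 1/2 claimed.
    have hβ : F * |∫ σ in s..t, S σ| ≤ 1 / 8 := by
      have := mul_le_mul_of_nonneg_left (abs_intervalIntegral_le_of_mem_Icc (hSc.mono hsub)
        (fun σ hσ => hS0 σ (hsub hσ)) ht hs) hF0.le
      linarith
    have hβ0 : 0 ≤ F * |∫ σ in s..t, S σ| := by positivity
    have hts : |t - s| ≤ 1 / 4 := (abs_le.2 ⟨by linarith [ht.1, hs.2], by linarith [ht.2, hs.1]⟩)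
    refine ⟨fun k hk e => (a k hk e).trans (by linarith), fun k hk e => (b k hk e).trans ?_,
      fun h k => (c h k).trans ?_⟩
    · have h5 : 0 ≤ ‖ξ.2‖ := norm_nonneg _
      have h6 : 0 ≤ |t - s| * ‖ξ.1‖ := by positivity
      nlinarith
    · have h5 : |t - s| + 2 * (F * |∫ σ in s..t, S σ|) ≤ 1 / 2 := by linarith
      have h6 : ∀ z : Phase d, 0 ≤ phaseNorm z := fun z => Real.sqrt_nonneg _
      exact mul_le_mul_of_nonneg_right (mul_le_mul_of_nonneg_right h5 (h6 h)) (h6 k)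
  · have hT'0 : 0 ≤ T' := ht.1.trans ht.2
    have hsub' : Icc 0 T' ⊆ Icc 0 T := Icc_subset_Icc le_rfl hT'
    obtain ⟨a, b, -⟩ := h4 t (hsub' ht) s (hsub' hs) z ξ
    have hsub₀ := hsub'.trans hsub
    -- For t and s in the shorter interval only the integral of S over [0, T'] matters, hence √T' in
    -- place of a fixed constant.
    have hβ : F * |∫ σ in s..t, S σ| ≤ Real.sqrt T' * (F * K * max M 0) := by
      have h5 := abs_intervalIntegral_le_of_mem_Icc (hSc.mono hsub₀)
        (fun σ hσ => hS0 σ (hsub₀ hσ)) ht hs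
      have h6 := mul_le_mul_of_nonneg_left (h5.trans (hint T' hT'0 (hT'.trans hTT₀))) hF0.le
      rw [max_eq_left hM.le]
      linarith
    exact ⟨fun k hk e => (a k hk e).trans hβ, fun k hk e => (b k hk e).trans
      (mul_le_mul_of_nonneg_right hβ (by positivity))⟩
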